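/- **Network and primitives.** A network has $I$ resources and $J$ job types, a $0/1$ incidence matrix $K\in\{0,1\}^{I\times J}$ ($K_{ij}=1$ iff type $j$ needs resource $i$), and a holding cost vector $h\in\mathbb R^J$, $h>0$. Every job type uses at least one resource, and for every $i$ there is a $j$ with $K_{ij}=1$ and $K_{lj}=0$ for all $l\ne i$. Vector operations and inequalities are componentwise; $|\cdot|$ on vectors is the Euclidean norm. On a probability space, for each $r\in\mathbb N=\{1,2,\dots\}$, the interarrival times $u^r_j(l)$ and job sizes $v^r_j(l)$ ($1\le j\le J$, $l\ge1$) are mutually independent, identically distributed in $l$, a.s. positive, with means $1/\alpha^r_j$, $1/\beta^r_j$ and finite standard deviations $\sigma^{u,r}_j,\sigma^{v,r}_j$. There is $\delta>0$ with $\sup_{r}E[e^{yv^r_j(1)}]<\infty$ and $\sup_rE[e^{yu^r_j(1)}]<\infty$ for all $y<\delta$ and all $j$. There are $\alpha_j,\beta_j,\bar\alpha_j,\bar\beta_j,\sigma^u_j,\sigma^v_j\in(0,\infty)$ with $r(\alpha^r_j-\alpha_j)\to\bar\alpha_j$, $r(\beta^r_j-\beta_j)\to\bar\beta_j$, $\sigma^{u,r}_j\to\sigma^u_j$,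 $\sigma^{v,r}_j\to\sigma^v_j$ as $r\to\infty$. With $\rho=\alpha/\beta$ the vector of resource capacities is $C=K\rho$, and $\theta=K\eta<0$, where $\eta=\beta^{-2}(\bar\alpha\beta-\alpha\bar\beta)$. Let $\rho^*=\min_j\rho_j$. **States and dynamics.** Let $\mathcal Y^r=(\tfrac1r\mathbb N_0)^J\times\mathbb R_+^{2J}\times\{0,1\}^J$. For an initial state $y^r=(\hat q^r,\hat\Upsilon^r,\tilde{\mathcal E}^r)\in\mathcal Y^r$, $\hat\Upsilon^r=(\hat\Upsilon^{A,r},\hat\Upsilon^{S,r})$, put $q^r=r\hat q^r$ and $\Upsilon=r\hat\Upsilon^r$ (residual arrival and service times). With $A^r_j(s)=\max\{n\ge0:\sum_{l=1}^nu^r_j(l)\le s\}$, $S^r_j(s)=\max\{n\ge0:\sum_{l=1}^nv^r_j(l)\le s\}$ and $B^r_j(t)$ the cumulative capacity given to type $j$ up to time $t$, $$Q^r_j(t)=q^r_j+A^r_j\big((t-\Upsilon^A_j)^+\big)+\mathbf 1_{\{t\ge\Upsilon^A_j>0\}}-S^r_j\big((B^r_j(t)-\Upsilon^S_j)^+\big)-\mathbf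 1_{\{B^r_j(t)\ge\Upsilon^S_j>0\}}.$$ Let $\hat Q^r(t)=Q^r(r^2t)/r$, $\hat W^r(t)=KM^r\hat Q^r(t)$ with $M^r=\mathrm{diag}(1/\beta^r_j)$, and $\hat h(w)=\inf\{h\cdot q:\ q\in\mathbb R^J_+,\ K\,\mathrm{diag}(1/\beta_j)\,q=w\}$. **Policy.** Let $\mathcal C=\{u\in\ker K:(h\beta)\cdot u=0\}$. If $\mathcal C\ne\ker K$, let $u_*$ be the unit vector in $\ker K$ orthogonal to $\mathcal C$ with $(h\beta)\cdot u_*<0$, and let $\mathcal M$ be the set of $z\in\{0,1\}^J$ for which some $v\in\ker K$ has $v\cdot u_*>0$ and $v_j\ge0$ whenever $z_j=1$; if $\mathcal C=\ker K$, let $\mathcal M=\emptyset$. For $z\in\mathcal M$ fix $v^c(z)\in\ker K$ with $v^c(z)\cdot u_*>0$, $v^c_j(z)\ge0$ whenever $z_j=1$, and $\rho-v^c(z)>\rho^*/2$. Let $\tilde\lambda=\max_{z\in\mathcal M}(h\beta)\cdot v^c(z)$. For $z\in\{0,1\}^J$ fix $v^b(z)\in\mathbb R^J$ with $|v^b(z)|\le\rho^*/4$,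 also $|v^b(z)|\le|\tilde\lambda|/(4|\beta||h|)$ if $\mathcal M\neq\emptyset$, with $(Kv^b(z))_i=0$ for every $i$ such that $K_{ij}=1$ and $z_j=0$ for some $j$, and with $v^b_j(z)>0$ whenever $z_j=1$. Fix $0<c_1<c_2$ and $0<\kappa<\frac14$, and put $\tilde c_k=c_k\min_j\beta_j$. Let $\mathcal Z^r_j(t)=\mathbf 1_{\{Q^r_j(t)<\tilde c_2r^\kappa\}}$. Let $\tau^j_1=0$ if $\tilde{\mathcal E}^r_j=1$ and $\tau^j_1=\inf\{t\ge0:Q^r_j(t)<\tilde c_1r^\kappa\}$ otherwise, and for $l\ge1$ let $\tau^j_{2l}=\inf\{t\ge\tau^j_{2l-1}:Q^r_j(t)\ge\tilde c_2r^\kappa\}$ and $\tau^j_{2l+1}=\inf\{t\ge\tau^j_{2l}:Q^r_j(t)<\tilde c_1r^\kappa\}$. Let $\mathcal E^r_j(t)=\sum_{l\ge1}\mathbf 1_{[\tau^j_{2l-1},\tau^j_{2l})}(t)$. The control $B^r$ is the measurable process that satisfies a.s., for all $t\ge0$ and all $j$, $$B^r_j(t)=\int_0^t\big(\rho_j-v^c_j(\mathcal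 Z^r(s))\mathbf 1_{\{\mathcal Z^r(s)\in\mathcal M\}}-v^b_j(\mathcal Z^r(s))\big)\mathbf 1_{\{\mathcal E^r_j(s)=0\}}\,ds .$$ $E_{y^r}$ denotes expectation when the initial state is $y^r$. Fix $\varsigma>0$. **Proposition.** For any $\epsilon\in(0,1)$ and $M<\infty$ there exist $T^*,R\in(0,\infty)$ such that for all $r\in\mathbb N$ with $r\ge R$, all $T\ge T^*$, all $t\ge0$, and all $y^r=(\hat q^r,\hat\Upsilon^r,\tilde{\mathcal E}^r)\in\mathcal Y^r$ with $\hat q^r\le M$ and $r\hat\Upsilon^r\le M$, $$E_{y^r}\Big[\frac1T\int_0^T\big|h\cdot\hat Q^r(t+s)-\hat h(\hat W^r(t+s))\big|\,ds\Big]\le\epsilon$$ and $$E_{y^r}\Big[\int_0^\infty e^{-\varsigma s}\big|h\cdot\hat Q^r(t+s)-\hat h(\hat W^r(t+s))\big|\,ds\Big]\le\epsilon .$$ -/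

import Mathlib

open MeasureTheory ProbabilityTheory Filter Topology
open scoped ENNReal Matrix

noncomputable section

namespace RSN

/-- Euclidean norm of a vector. -/
def enorm2 {d : ℕ} (x : Fin d → ℝ) : ℝ := √(∑ j, x j ^ 2)

/-- Vectors with entries `0` or `1` (`true` stands for `1`). -/
abbrev Chi (J : ℕ) : Type := Fin J → Bool

/-! ### Limiting network data -/

/-- Data of a network with `I` resources and `J` job types: the resource/job incidence matrix `K`,
the capacities `C`, the holding costs `h`, the limits `α`, `β` of the arrival and service rates and
the limits `αbar`, `βbar` of their rescaled deviations. -/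
structure Network (I J : ℕ) where
  K : Matrix (Fin I) (Fin J) ℝ
  C : Fin I → ℝ
  h : Fin J → ℝ
  α : Fin J → ℝ
  β : Fin J → ℝ
  αbar : Fin J → ℝ
  βbar : Fin J → ℝ

namespace Network

variable {I J : ℕ} (N : Network I J)

/-- Asymptotic load `ρ = α / β`. -/
def ρ (j : Fin J) : ℝ := N.α j / N.β j

/-- `ρ* = min_j ρ_j`. -/
def ρmin : ℝ := ⨅ j, N.ρ j

/-- `min_j β_j`. -/
def βmin : ℝ := ⨅ j, N.β j

/-- `η = β⁻² (ᾱ β - α β̄)`. -/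
def η (j : Fin J) : ℝ := (N.αbar j * N.β j - N.α j * N.βbar j) / N.β j ^ 2

/-- `θ = K η`. -/
def θ : Fin I → ℝ := N.K *ᵥ N.η

/-- The componentwise product `h β`. -/
def hβ (j : Fin J) : ℝ := N.h j * N.β j

/-- Standing assumptions on the topology and the cost: 0/1 incidence matrix, positive holding
costs, every job type uses some resource, and every resource has a job type that uses only it. -/
structure IsTopology : Prop where
  zero_or_one : ∀ i j, N.K i j = 0 ∨ N.K i j = 1
  h_pos : ∀ j, 0 < N.h j
  uses_resource : ∀ j, ∃ i, N.K i j = 1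
  local_traffic : ∀ i, ∃ j, N.K i j = 1 ∧ ∀ l, l ≠ i → N.K l j = 0

/-- `Λ(w)`: queue lengths `q ≥ 0` with `K M q = w`, where `M = diag(1/β)`. -/
def Lam (w : Fin I → ℝ) : Set (Fin J → ℝ) :=
  {q | (∀ j, 0 ≤ q j) ∧ N.K *ᵥ (fun j => q j / N.β j) = w}

/-- `ĥ(w)`: the least holding cost among the queue lengths with workload `w`. -/
def hhat (w : Fin I → ℝ) : ℝ := sInf ((fun q => N.h ⬝ᵥ q) '' N.Lam w)

/-- `ker K`. -/
def kerK : Set (Fin J → ℝ) := {u | N.K *ᵥ u = 0}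

/-- `𝒞_K^h`: directions in `ker K` that leave the cost unchanged. -/
def costKer : Set (Fin J → ℝ) := {u | N.K *ᵥ u = 0 ∧ N.hβ ⬝ᵥ u = 0}

/-- `u` is the unit vector of `ker K` that is orthogonal to `𝒞_K^h` and has `hβ · u < 0`.
It exists, and is then unique, exactly when `𝒞_K^h ≠ ker K`. -/
def IsCostDirection (u : Fin J → ℝ) : Prop :=
  u ∈ N.kerK ∧ u ⬝ᵥ u = 1 ∧ (∀ w ∈ N.costKer, u ⬝ᵥ w = 0) ∧ N.hβ ⬝ᵥ u < 0

/-- The set `ℳ` of configurations of empty queues from which the cost can be reduced without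
changing the workload; it is empty if `𝒞_K^h = ker K`. -/
def calM (u : Fin J → ℝ) : Set (Chi J) :=
  {z | N.costKer ≠ N.kerK ∧
    ∃ v ∈ N.kerK, (∀ j, z j = true → 0 ≤ v j) ∧ 0 < v ⬝ᵥ u}

/-- `𝒜_z`: resources used by at least one job type `j` with `z_j = 0`. -/
def calA (z : Chi J) : Set (Fin I) := {i | ∃ j, N.K i j = 1 ∧ z j = false}

end Network

/-! ### Stochastic primitives -/

/-- Interarrival times `u` and job sizes `v`, indexed by the traffic parameter `r`, the job type
and the position in the sequence. Positions are counted from `0`, so `u r j l` is the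
`(l+1)`-st interarrival time. -/
structure Primitives (J : ℕ) (Ω : Type*) where
  u : ℕ → Fin J → ℕ → Ω → ℝ
  v : ℕ → Fin J → ℕ → Ω → ℝ

namespace Primitives

variable {J : ℕ} {Ω : Type*} [MeasurableSpace Ω] (X : Primitives J Ω) (P : Measure Ω)

/-- `α^r_j`, the reciprocal of the mean interarrival time. -/
def αr (r : ℕ) (j : Fin J) : ℝ := (∫ ω, X.u r j 0 ω ∂P)⁻¹

/-- `β^r_j`, the reciprocal of the mean job size. -/
def βr (r : ℕ) (j : Fin J) : ℝ := (∫ ω, X.v r j 0 ω ∂P)⁻¹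

/-- Standard deviation of the interarrival times. -/
def σu (r : ℕ) (j : Fin J) : ℝ := √(Var[X.u r j 0; P])

/-- Standard deviation of the job sizes. -/
def σv (r : ℕ) (j : Fin J) : ℝ := √(Var[X.v r j 0; P])

/-- For each `r ≥ 1` the interarrival times and job sizes are mutually independent, identically
distributed for each job type, a.s. positive and square integrable, and their moment generating
functions are, near the origin, bounded uniformly in `r`. -/
structure IsPrimitives : Prop where
  meas_u : ∀ r ≥ 1, ∀ j l, Measurable (X.u r j l)
  meas_v : ∀ r ≥ 1, ∀ j l, Measurable (X.v r j l)
  indep : ∀ r ≥ 1, iIndepFun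
    (Sum.elim (fun p : Fin J × ℕ => X.u r p.1 p.2) (fun p : Fin J × ℕ => X.v r p.1 p.2)) P
  ident_u : ∀ r ≥ 1, ∀ j l, IdentDistrib (X.u r j l) (X.u r j 0) P P
  ident_v : ∀ r ≥ 1, ∀ j l, IdentDistrib (X.v r j l) (X.v r j 0) P P
  pos_u : ∀ r ≥ 1, ∀ j, ∀ᵐ ω ∂P, 0 < X.u r j 0 ω
  pos_v : ∀ r ≥ 1, ∀ j, ∀ᵐ ω ∂P, 0 < X.v r j 0 ω
  sq_u : ∀ r ≥ 1, ∀ j, MemLp (X.u r j 0) 2 P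
  sq_v : ∀ r ≥ 1, ∀ j, MemLp (X.v r j 0) 2 P
  mgf : ∃ δ > 0, ∀ y < δ, ∀ j,
    (∃ c : ℝ, ∀ r ≥ 1, ∫⁻ ω, ENNReal.ofReal (Real.exp (y * X.v r j 0 ω)) ∂P ≤ ENNReal.ofReal c) ∧
    (∃ c : ℝ, ∀ r ≥ 1, ∫⁻ ω, ENNReal.ofReal (Real.exp (y * X.u r j 0 ω)) ∂P ≤ ENNReal.ofReal c)

/-- The heavy traffic condition. -/
structure HeavyTraffic {I : ℕ} (N : Network I J) : Prop where
  α_pos : ∀ j, 0 < N.α j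
  β_pos : ∀ j, 0 < N.β j
  αbar_pos : ∀ j, 0 < N.αbar j
  βbar_pos : ∀ j, 0 < N.βbar j
  lim_α : ∀ j, Tendsto (fun r : ℕ => (r : ℝ) * (X.αr P r j - N.α j)) atTop (𝓝 (N.αbar j))
  lim_β : ∀ j, Tendsto (fun r : ℕ => (r : ℝ) * (X.βr P r j - N.β j)) atTop (𝓝 (N.βbar j))
  lim_σu : ∀ j, ∃ s > 0, Tendsto (fun r : ℕ => X.σu P r j) atTop (𝓝 s)
  lim_σv : ∀ j, ∃ s > 0, Tendsto (fun r : ℕ => X.σv P r j) atTop (𝓝 s)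
  capacity : N.C = N.K *ᵥ N.ρ
  θ_neg : ∀ i, N.θ i < 0

end Primitives

/-- `max {n ≥ 0 : x_1 + ⋯ + x_n ≤ s}`: the number of renewals up to time `s`. -/
def renewalCount (x : ℕ → ℝ) (s : ℝ) : ℕ := sSup {n : ℕ | ∑ l ∈ Finset.range n, x l ≤ s}

/-! ### States, queue lengths and workloads -/

/-- A (diffusion-scaled) state `(q̂, Υ̂, ℰ̃)`, with `Υ̂ = (Υ̂^A, Υ̂^S)`: queue lengths, residual
arrival and service times, and indicators of the job types that are currently not served. -/
structure State (J : ℕ) where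
  qhat : Fin J → ℝ
  ΥA : Fin J → ℝ
  ΥS : Fin J → ℝ
  E : Chi J

/-- The state space `𝒴^r = ((1/r) ℕ₀)^J × ℝ₊^{2J} × {0,1}^J`. -/
def stateSpace (J r : ℕ) : Set (State J) :=
  {y | (∀ j, ∃ n : ℕ, y.qhat j = (n : ℝ) / (r : ℝ)) ∧ (∀ j, 0 ≤ y.ΥA j) ∧ (∀ j, 0 ≤ y.ΥS j)}

/-- Queue length of one job type at time `t`: initial length `q0`, residual times `a` (arrival)
and `s` (service), interarrival times `u`, job sizes `v`, and capacity `b` used up to time `t`. -/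
def queueLength (q0 a s : ℝ) (u v : ℕ → ℝ) (t b : ℝ) : ℝ :=
  q0 + (renewalCount u (max (t - a) 0) : ℝ) + (if a ≤ t ∧ 0 < a then 1 else 0)
    - (renewalCount v (max (b - s) 0) : ℝ) - (if s ≤ b ∧ 0 < s then 1 else 0)

section Dynamics

variable {I J : ℕ} {Ω : Type*}

/-- The queue length vector `Q^r(t)` for the initial state `y` (given in diffusion scale) when
`B t ω` is the vector of capacities used up to time `t`. -/
def Q (X : Primitives J Ω) (r : ℕ) (y : State J) (B : ℝ → Ω → Fin J → ℝ)
    (ω : Ω) (t : ℝ) (j : Fin J) : ℝ :=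
  queueLength (r * y.qhat j) (r * y.ΥA j) (r * y.ΥS j)
    (fun l => X.u r j l ω) (fun l => X.v r j l ω) t (B t ω j)

/-- `Q̂^r(t) = Q^r(r² t) / r`. -/
def Qhat (X : Primitives J Ω) (r : ℕ) (y : State J) (B : ℝ → Ω → Fin J → ℝ)
    (ω : Ω) (t : ℝ) (j : Fin J) : ℝ :=
  Q X r y B ω ((r : ℝ) ^ 2 * t) j / r

/-- `Ŵ^r(t) = K M^r Q̂^r(t)`, where `M^r = diag(1/β^r)`. -/
def What [MeasurableSpace Ω] (N : Network I J) (X : Primitives J Ω) (P : Measure Ω) (r : ℕ)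
    (y : State J) (B : ℝ → Ω → Fin J → ℝ) (ω : Ω) (t : ℝ) : Fin I → ℝ :=
  N.K *ᵥ (fun j => Qhat X r y B ω t j / X.βr P r j)

/-- The cost gap `|h · Q̂^r(t) - ĥ(Ŵ^r(t))|`. -/
def costGap [MeasurableSpace Ω] (N : Network I J) (X : Primitives J Ω) (P : Measure Ω) (r : ℕ)
    (y : State J) (B : ℝ → Ω → Fin J → ℝ) (ω : Ω) (t : ℝ) : ℝ :=
  |N.h ⬝ᵥ Qhat X r y B ω t - N.hhat (What N X P r y B ω t)|

end Dynamics

/-! ### The control policy -/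

/-- `inf {t ≥ s : t ∈ S}` over times `t ≥ 0`, equal to `∞` if there is no such `t`. -/
def firstTime (s : ℝ≥0∞) (S : Set ℝ) : ℝ≥0∞ :=
  ⨅ t ∈ {t : ℝ | 0 ≤ t ∧ s ≤ ENNReal.ofReal t ∧ t ∈ S}, ENNReal.ofReal t

/-- The times `τ_1 ≤ τ_2 ≤ ⋯` at which a queue `q` goes alternately below `lo` (odd indices) and
to `hi` or above (even indices). If the job type is blocked initially (`e = true`), then
`τ_1 = 0`. The value at index `0` is only a placeholder. -/
def switchTime (lo hi : ℝ) (e : Bool) (q : ℝ → ℝ) : ℕ → ℝ≥0∞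
  | 0 => 0
  | 1 => if e = true then 0 else firstTime 0 {t | q t < lo}
  | n + 2 =>
    if Even n then firstTime (switchTime lo hi e q (n + 1)) {t | hi ≤ q t}
    else firstTime (switchTime lo hi e q (n + 1)) {t | q t < lo}

/-- `ℰ(t) = 1`: for some `l ≥ 1` the time `t` lies in `[τ_{2l-1}, τ_{2l})`. -/
def blocked (lo hi : ℝ) (e : Bool) (q : ℝ → ℝ) (t : ℝ) : Prop :=
  ∃ l : ℕ, switchTime lo hi e q (2 * l + 1) ≤ ENNReal.ofReal t ∧
    ENNReal.ofReal t < switchTime lo hi e q (2 * l + 2)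

/-- Parameters of the policy: thresholds `c₁`, `c₂`, `κ`, the cost direction `dir` and the
rate adjustments `vc` (used on `ℳ` only) and `vb`. -/
structure Policy (J : ℕ) where
  c₁ : ℝ
  c₂ : ℝ
  κ : ℝ
  dir : Fin J → ℝ
  vc : Chi J → Fin J → ℝ
  vb : Chi J → Fin J → ℝ

namespace Policy

variable {I J : ℕ} (p : Policy J) (N : Network I J)

/-- `λ̃ = max {(hβ) · v^c(z) : z ∈ ℳ}`. -/
def lamTilde : ℝ := sSup ((fun z => N.hβ ⬝ᵥ p.vc z) '' N.calM p.dir)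

/-- The requirements on the policy parameters. The bound by `λ̃` is only imposed when `ℳ` is
nonempty, as `λ̃` is not defined otherwise. -/
structure IsPolicy : Prop where
  c₁_pos : 0 < p.c₁
  c₁_lt_c₂ : p.c₁ < p.c₂
  κ_pos : 0 < p.κ
  κ_lt : p.κ < 1 / 4
  isCostDirection : N.costKer ≠ N.kerK → N.IsCostDirection p.dir
  vc_ker : ∀ z ∈ N.calM p.dir, p.vc z ∈ N.kerK
  vc_nonneg : ∀ z ∈ N.calM p.dir, ∀ j, z j = true → 0 ≤ p.vc z j
  vc_dir : ∀ z ∈ N.calM p.dir, 0 < p.vc z ⬝ᵥ p.dir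
  vc_lt : ∀ z ∈ N.calM p.dir, ∀ j, N.ρmin / 2 < N.ρ j - p.vc z j
  vb_le : ∀ z, enorm2 (p.vb z) ≤ N.ρmin / 4
  vb_le_lamTilde : (N.calM p.dir).Nonempty →
    ∀ z, enorm2 (p.vb z) ≤ |p.lamTilde N| / (4 * enorm2 N.β * enorm2 N.h)
  vb_full : ∀ z, ∀ i ∈ N.calA z, (N.K *ᵥ p.vb z) i = 0
  vb_pos : ∀ z j, z j = true → 0 < p.vb z j

open Classical in
/-- `𝒵^r`: indicators of the queues below the level `c̃₂ r^κ`, where `c̃₂ = (min_j β_j) c₂`. -/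
def Z (r : ℕ) (q : Fin J → ℝ) : Chi J :=
  fun j => decide (q j < N.βmin * p.c₂ * (r : ℝ) ^ p.κ)

open Classical in
/-- `x^r = ρ - v^c(𝒵) 1{𝒵 ∈ ℳ} - v^b(𝒵)` as a function of the current queue length. -/
def x (r : ℕ) (q : Fin J → ℝ) (j : Fin J) : ℝ :=
  N.ρ j - (if p.Z N r q ∈ N.calM p.dir then p.vc (p.Z N r q) j else 0) - p.vb (p.Z N r q) j

open Classical in
/-- The allocation rate `𝔟^r_j(t) = x^r_j(t) 1{ℰ^r_j(t) = 0}` along the queue length path `q`,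
for the initial indicators `e`. -/
def rate (r : ℕ) (e : Chi J) (q : ℝ → Fin J → ℝ) (t : ℝ) (j : Fin J) : ℝ :=
  if blocked (N.βmin * p.c₁ * (r : ℝ) ^ p.κ) (N.βmin * p.c₂ * (r : ℝ) ^ p.κ) (e j)
      (fun s => q s j) t
  then 0 else p.x N r (q t) j

/-- `B` is the control of the `r`-th system under the policy for the initial state `y`: a
stochastic evolution with, almost surely, `B(t) = ∫_0^t 𝔟^r(s) ds` for all `t ≥ 0`, where the
rate `𝔟^r` is determined by the queue lengths that `B` itself produces. -/
structure IsControl {Ω : Type*} [MeasurableSpace Ω] (X : Primitives J Ω) (P : Measure Ω)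
    (r : ℕ) (y : State J) (B : ℝ → Ω → Fin J → ℝ) : Prop where
  measurable : ∀ t ≥ 0, Measurable (B t)
  integrable : ∀ᵐ ω ∂P, ∀ t ≥ 0, ∀ j,
    IntervalIntegrable (fun s => p.rate N r y.E (Q X r y B ω) s j) volume 0 t
  eq_integral : ∀ᵐ ω ∂P, ∀ t ≥ 0, ∀ j,
    B t ω j = ∫ s in (0 : ℝ)..t, p.rate N r y.E (Q X r y B ω) s j

end Policy

end RSN

end

/-!
The system is a piecewise deterministic Markov process: its state consists of the queue lengths `q`,
the residual times `R` of the running interarrival times and jobs, and the indicators `E` of the blocked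
job types. The residual times decrease linearly between events, and at an event a process whose residual
time has expired gets a fresh renewal interval. The proof constructs a Lyapunov function `W ≥ 0` of this
process whose rate of decrease `f` dominates the unscaled cost gap. With `b = r ^ κ`,

* the mean of `W` does not increase at events (`LyapC.W_jump`);
* between events `W` has upper derivative at most `-f + C b² - (λ² / r²) W` (`LyapC.upperDeriv_W`);
* `W` is initially of order `r² b²` (`LyapC.lintegral_start_le`);
* the scaled cost gap is at most of order `f / r` (`LyapC.abs_gap_le`).

Integrating `f` with a weight `G` that grows at rate `λ² / r²` up to the unscaled time `r² t` and then
decays at rate `d / r²` (`lintegral_tsum_seg_le`) gives `E ∫ G f ≤ E W(0) + C b² ∫ G`, which is of order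
`r² b² (1 + 1 / d)`. In the time scale of the theorem the discounted cost gap after `t` is therefore of
order `b² / r = r ^ (2 κ - 1)`, uniformly in `t`, and this tends to `0` because `κ < 1/4`. An average over
`[0, T]` is a discounted integral with `d = 1 / T` up to a factor `e / T`, so that `T* = 1` suffices.

The function `W` is a sum of four parts. Exponentials of the workloads (`V₁`) decrease since the resources
are underloaded by capacities of order `1 / r`. The capacity lost while job types are blocked is paid for
by exponentials of the blocked queues (`V₂`), which decrease as these queues grow to the upper threshold;
they are matched with exponentials for the unblocked queues, which are small when the queue is long and
decrease when it is short, as short queues are served below their load. Exponentials of the residual times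
(`V₃`) decrease between events while a residual time is large, and yield a gain at each event. The last
part is the square of the positive part of the cost gap. There the gap is a concave Lipschitz function of
the queue lengths, because by linear programming `ĥ` has the convex Lipschitz extension `hext`; it
decreases at a positive rate when the empty queues form a configuration in `ℳ`, and is of order `b` otherwise
(`Network.exists_gap_le_of_notMem`, by Farkas' lemma).

The exponentials are of the form `exp (σ · q + c · R)`. With the coefficients `c = cf σ` the mean of
`exp (± σ_j + c_a u)` over a renewal interval `u` is at most `1` (`MgfBound.exp_mul_integral_le_one`), so
that they do not increase in the mean at events.
-/

noncomputable section

namespace RSN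

/-! ### Linear programming: the cost gap -/

/-- **Farkas' lemma** for finitely many linear functionals. -/
theorem farkas {E ι : Type*} [AddCommGroup E] [Module ℝ E] [DecidableEq ι] (s : Finset ι) :
    ∀ (l : ι → E →ₗ[ℝ] ℝ) (g : E →ₗ[ℝ] ℝ), (∀ v, (∀ i ∈ s, 0 ≤ l i v) → 0 ≤ g v) →
      ∃ c : ι → ℝ, (∀ i, 0 ≤ c i) ∧ ∀ v, g v = ∑ i ∈ s, c i * l i v := by
  induction s using Finset.induction_on with
  | empty =>
    intro l g h
    refine ⟨fun _ => 0, fun _ => le_rfl, fun v => ?_⟩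
    have h1 := h v (by simp)
    have h2 := h (-v) (by simp)
    simp only [map_neg] at h2
    simp only [Finset.sum_empty]
    linarith
  | insert a s ha ih =>
    intro l g h
    by_cases hg : ∀ v, (∀ i ∈ s, 0 ≤ l i v) → 0 ≤ g v
    · obtain ⟨c, hc, hcv⟩ := ih l g hg
      refine ⟨fun i => if i = a then 0 else c i, fun i => ?_, fun v => ?_⟩
      · dsimp only; split_ifs
        exacts [le_rfl, hc i]
      · rw [Finset.sum_insert ha, hcv v]
        simp only [if_true, zero_mul, zero_add]
        refine Finset.sum_congr rfl fun i hi => ?_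
        rw [if_neg (ne_of_mem_of_not_mem hi ha)]
    · push Not at hg
      obtain ⟨v₀, hv₀, hgv₀⟩ := hg
      have hneg : l a v₀ < 0 := by
        by_contra hcon
        push Not at hcon
        have := h v₀ (fun i hi => by
          rcases Finset.mem_insert.1 hi with rfl | hi
          exacts [hcon, hv₀ i hi])
        linarith
      -- the point where the direction `v₀` crosses the hyperplane `l a = 0`
      set t : ℝ := -(l a v₀)⁻¹ with ht
      have htpos : 0 < t := by
        rw [ht]; have := inv_lt_zero.2 hneg; linarith
      have hta : t * l a v₀ = -1 := by
        rw [ht, neg_mul, inv_mul_cancel₀ hneg.ne]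
      obtain ⟨c, hc, hcv⟩ := ih (fun i => l i + (t * l i v₀) • l a) (g + (t * g v₀) • l a) (by
        intro v hv
        have hv' := h (v + (t * l a v) • v₀) (fun i hi => by
          rcases Finset.mem_insert.1 hi with rfl | hi
          · simp only [map_add, map_smul, smul_eq_mul]
            have : t * l i v * l i v₀ = l i v * (t * l i v₀) := by ring
            rw [this, hta]; linarith
          · have := hv i hi
            simp only [LinearMap.add_apply, LinearMap.smul_apply, smul_eq_mul] at this
            simp only [map_add, map_smul, smul_eq_mul]
            linarith)
        simp only [map_add, map_smul, smul_eq_mul] at hv'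
        simp only [LinearMap.add_apply, LinearMap.smul_apply, smul_eq_mul]
        linarith)
      refine ⟨fun i => if i = a then ∑ j ∈ s, c j * (t * l j v₀) - t * g v₀ else c i,
        fun i => ?_, fun v => ?_⟩
      · dsimp only; split_ifs
        · have h1 : 0 ≤ ∑ j ∈ s, c j * (t * l j v₀) :=
            Finset.sum_nonneg fun j hj => mul_nonneg (hc j) (mul_nonneg htpos.le (hv₀ j hj))
          have h2 := mul_pos htpos (neg_pos.2 hgv₀)
          linarith
        · exact hc i
      · have := hcv v
        simp only [LinearMap.add_apply, LinearMap.smul_apply, smul_eq_mul] at this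
        rw [Finset.sum_insert ha]
        simp only [if_true]
        have h3 : ∑ i ∈ s, (if i = a then ∑ j ∈ s, c j * (t * l j v₀) - t * g v₀ else c i) * l i v
            = ∑ i ∈ s, c i * l i v := Finset.sum_congr rfl fun i hi => by
          rw [if_neg (ne_of_mem_of_not_mem hi ha)]
        rw [h3]
        have h4 : ∑ i ∈ s, c i * (l i v + t * l i v₀ * l a v)
            = ∑ i ∈ s, c i * l i v + (∑ j ∈ s, c j * (t * l j v₀)) * l a v := by
          rw [Finset.sum_mul, ← Finset.sum_add_distrib]
          exact Finset.sum_congr rfl fun i _ => by ring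
        rw [h4] at this
        linarith

namespace Network

variable {I J : ℕ} (N : Network I J)

/-- On `ker K` the cost functional is a multiple of the projection on the cost direction. -/
theorem hβ_dotProduct_eq {u : Fin J → ℝ} (hu : N.IsCostDirection u) {v : Fin J → ℝ}
    (hv : v ∈ N.kerK) : N.hβ ⬝ᵥ v = (v ⬝ᵥ u) * (N.hβ ⬝ᵥ u) := by
  obtain ⟨hk, hn, ho, hneg⟩ := hu
  have hmem : v - (N.hβ ⬝ᵥ v / N.hβ ⬝ᵥ u) • u ∈ N.costKer := by
    refine ⟨?_, ?_⟩
    · have h1 : N.K *ᵥ v = 0 := hv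
      have h2 : N.K *ᵥ u = 0 := hk
      rw [Matrix.mulVec_sub, Matrix.mulVec_smul, h1, h2]; simp
    · rw [dotProduct_sub, dotProduct_smul, smul_eq_mul, div_mul_cancel₀ _ hneg.ne, sub_self]
  have := ho _ hmem
  rw [dotProduct_sub, dotProduct_smul, smul_eq_mul, hn, mul_one, dotProduct_comm] at this
  have h3 : v ⬝ᵥ u = N.hβ ⬝ᵥ v / N.hβ ⬝ᵥ u := by linarith
  rw [h3, div_mul_cancel₀ _ hneg.ne]

/-- If the configuration `z` of empty queues is not in `ℳ`, no direction in `ker K` that is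
nonnegative on the empty queues lowers the cost. -/
theorem hβ_nonneg_of_notMem {u : Fin J → ℝ} (hu : N.costKer ≠ N.kerK → N.IsCostDirection u)
    {z : Chi J} (hz : z ∉ N.calM u) {v : Fin J → ℝ} (hv : v ∈ N.kerK)
    (hvz : ∀ j, z j = true → 0 ≤ v j) : 0 ≤ N.hβ ⬝ᵥ v := by
  by_cases hc : N.costKer = N.kerK
  · have : v ∈ N.costKer := hc ▸ hv
    exact this.2.ge
  · have hu' := hu hc
    rw [N.hβ_dotProduct_eq hu' hv]
    by_cases hpos : 0 < v ⬝ᵥ u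
    · exact absurd ⟨hc, v, hv, hvz, hpos⟩ hz
    · exact mul_nonneg_of_nonpos_of_nonpos (not_lt.1 hpos) hu'.2.2.2.le

/-- Quantitative form of `hβ_nonneg_of_notMem`, by Farkas' lemma. -/
theorem exists_hβ_ge {u : Fin J → ℝ} (hu : N.costKer ≠ N.kerK → N.IsCostDirection u) :
    ∃ C : ℝ, 0 ≤ C ∧ ∀ z ∉ N.calM u, ∀ v ∈ N.kerK, ∀ t : ℝ, 0 ≤ t →
      (∀ j, z j = true → -t ≤ v j) → -(C * t) ≤ N.hβ ⬝ᵥ v := by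
  have key : ∀ z : Chi J, ∃ C : ℝ, 0 ≤ C ∧ (z ∉ N.calM u → ∀ v ∈ N.kerK, ∀ t : ℝ, 0 ≤ t →
      (∀ j, z j = true → -t ≤ v j) → -(C * t) ≤ N.hβ ⬝ᵥ v) := by
    intro z
    by_cases hz : z ∈ N.calM u
    · exact ⟨0, le_rfl, fun h => absurd hz h⟩
    let U : Submodule ℝ (Fin J → ℝ) := LinearMap.ker (Matrix.mulVecLin N.K)
    have hU : ∀ v, v ∈ U ↔ v ∈ N.kerK := fun v => by
      simp [U, kerK, LinearMap.mem_ker]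
    obtain ⟨c, hc, hcv⟩ := farkas (E := U) (Finset.univ.filter fun j => z j = true)
      (fun j => (LinearMap.proj j).comp U.subtype)
      ((dotProductBilin ℝ ℝ N.hβ).comp U.subtype) (fun v hv => by
        have := N.hβ_nonneg_of_notMem hu hz ((hU v).1 v.2) (fun j hj => by
          simpa using hv j (by simp [hj]))
        simpa [dotProductBilin] using this)
    refine ⟨∑ j, c j, Finset.sum_nonneg fun j _ => hc j, fun _ v hv t ht hvt => ?_⟩
    have h1 := hcv ⟨v, (hU v).2 hv⟩
    have h2 : N.hβ ⬝ᵥ v = ∑ j ∈ Finset.univ.filter (fun j => z j = true), c j * v j := by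
      simpa [dotProductBilin] using h1
    rw [h2]
    have h3 : ∑ j ∈ Finset.univ.filter (fun j => z j = true), c j * (-t) ≤
        ∑ j ∈ Finset.univ.filter (fun j => z j = true), c j * v j :=
      Finset.sum_le_sum fun j hj =>
        mul_le_mul_of_nonneg_left (hvt j (Finset.mem_filter.1 hj).2) (hc j)
    have h4 : ∑ j ∈ Finset.univ.filter (fun j => z j = true), c j ≤ ∑ j, c j :=
      Finset.sum_le_sum_of_subset_of_nonneg (Finset.filter_subset _ _) fun j _ _ => hc j
    rw [← Finset.sum_mul] at h3
    nlinarith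
  choose C hC0 hC using key
  refine ⟨∑ z, C z, Finset.sum_nonneg fun z _ => hC0 z, fun z hz v hv t ht hvt => ?_⟩
  have h1 := hC z hz v hv t ht hvt
  have h2 : C z ≤ ∑ z, C z := Finset.single_le_sum (fun z _ => hC0 z) (Finset.mem_univ z)
  nlinarith

/-- Workload `K diag(1/β) q` of the queue length vector `q`. -/
def wl (q : Fin J → ℝ) : Fin I → ℝ := N.K *ᵥ (fun j => q j / N.β j)

theorem wl_apply (q : Fin J → ℝ) (i : Fin I) : N.wl q i = ∑ j, N.K i j * (q j / N.β j) := rfl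

theorem wl_add (q q' : Fin J → ℝ) : N.wl (q + q') = N.wl q + N.wl q' := by
  ext i
  simp only [wl_apply, Pi.add_apply, ← Finset.sum_add_distrib]
  exact Finset.sum_congr rfl fun j _ => by ring

theorem wl_smul (c : ℝ) (q : Fin J → ℝ) : N.wl (c • q) = c • N.wl q := by
  ext i
  simp only [wl_apply, Pi.smul_apply, smul_eq_mul, Finset.mul_sum]
  exact Finset.sum_congr rfl fun j _ => by ring

/-- Cost of `q` plus a penalty for missing the workload `w`. -/
def relaxedCost (Cp : ℝ) (w : Fin I → ℝ) (q : Fin J → ℝ) : ℝ :=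
  N.h ⬝ᵥ q + Cp * ∑ i, |w i - N.wl q i|

/-- Convex Lipschitz extension of `ĥ` to all of `ℝ^I`: the constraint `K M q = w` is replaced by a
penalty proportional to the `ℓ¹` distance. -/
def hext (Cp : ℝ) (w : Fin I → ℝ) : ℝ :=
  ⨅ q : {q : Fin J → ℝ // ∀ j, 0 ≤ q j}, N.relaxedCost Cp w q

/-- The cost gap `h · q - ĥ(K M q)` of the queue length vector `q`, extended to `ℝ^J`. -/
def gap (Cp : ℝ) (q : Fin J → ℝ) : ℝ := N.h ⬝ᵥ q - N.hext Cp (N.wl q)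

variable {N}

instance : Nonempty {q : Fin J → ℝ // ∀ j, 0 ≤ q j} := ⟨⟨0, fun _ => le_rfl⟩⟩

theorem h_dot_nonneg (hN : N.IsTopology) {q : Fin J → ℝ} (hq : ∀ j, 0 ≤ q j) : 0 ≤ N.h ⬝ᵥ q :=
  Finset.sum_nonneg fun j _ => mul_nonneg (hN.h_pos j).le (hq j)

theorem relaxedCost_nonneg (hN : N.IsTopology) {Cp : ℝ} (hCp : 0 ≤ Cp) (w : Fin I → ℝ)
    {q : Fin J → ℝ} (hq : ∀ j, 0 ≤ q j) : 0 ≤ N.relaxedCost Cp w q :=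
  add_nonneg (h_dot_nonneg hN hq) (mul_nonneg hCp (Finset.sum_nonneg fun _ _ => abs_nonneg _))

theorem hext_le (hN : N.IsTopology) {Cp : ℝ} (hCp : 0 ≤ Cp) (w : Fin I → ℝ)
    {q : Fin J → ℝ} (hq : ∀ j, 0 ≤ q j) : N.hext Cp w ≤ N.relaxedCost Cp w q :=
  ciInf_le (f := fun q : {q : Fin J → ℝ // ∀ j, 0 ≤ q j} => N.relaxedCost Cp w q)
    ⟨0, by rintro _ ⟨q, rfl⟩; exact relaxedCost_nonneg hN hCp w q.2⟩ ⟨q, hq⟩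

theorem le_hext {Cp : ℝ} {w : Fin I → ℝ} {c : ℝ}
    (h : ∀ q : Fin J → ℝ, (∀ j, 0 ≤ q j) → c ≤ N.relaxedCost Cp w q) : c ≤ N.hext Cp w :=
  le_ciInf fun q => h q.1 q.2

theorem hext_nonneg (hN : N.IsTopology) {Cp : ℝ} (hCp : 0 ≤ Cp) (w : Fin I → ℝ) :
    0 ≤ N.hext Cp w := le_hext fun _ hq => relaxedCost_nonneg hN hCp w hq

theorem hext_lipschitz (hN : N.IsTopology) {Cp : ℝ} (hCp : 0 ≤ Cp) (w w' : Fin I → ℝ) :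
    N.hext Cp w ≤ N.hext Cp w' + Cp * ∑ i, |w i - w' i| := by
  rw [← sub_le_iff_le_add]
  refine le_hext fun q hq => ?_
  have h1 := hext_le hN hCp w hq
  have h2 : ∑ i, |w i - N.wl q i| ≤ ∑ i, |w i - w' i| + ∑ i, |w' i - N.wl q i| := by
    rw [← Finset.sum_add_distrib]
    exact Finset.sum_le_sum fun i _ => abs_sub_le (w i) (w' i) (N.wl q i)
  have h3 := mul_le_mul_of_nonneg_left h2 hCp
  unfold relaxedCost at h1 ⊢
  linarith

theorem hext_smul_le (hN : N.IsTopology) {Cp : ℝ} (hCp : 0 ≤ Cp) (w : Fin I → ℝ) {c : ℝ}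
    (hc : 0 < c) : N.hext Cp (c • w) ≤ c * N.hext Cp w := by
  rw [← div_le_iff₀' hc]
  refine le_hext fun q hq => ?_
  rw [div_le_iff₀' hc]
  refine (hext_le hN hCp (c • w) (q := c • q) fun j => mul_nonneg hc.le (hq j)).trans_eq ?_
  unfold relaxedCost
  have h1 : ∑ i, |(c • w) i - N.wl (c • q) i| = c * ∑ i, |w i - N.wl q i| := by
    rw [Finset.mul_sum, wl_smul]
    refine Finset.sum_congr rfl fun i _ => ?_
    simp only [Pi.smul_apply, smul_eq_mul]
    rw [← mul_sub, abs_mul, abs_of_pos hc]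
  rw [h1, dotProduct_smul, smul_eq_mul]
  ring

theorem hext_convex (hN : N.IsTopology) {Cp : ℝ} (hCp : 0 ≤ Cp) :
    ConvexOn ℝ Set.univ (N.hext Cp) := by
  refine ⟨convex_univ, fun w _ w' _ a b ha hb hab => ?_⟩
  simp only [smul_eq_mul]
  -- near-minimizers for `w` and `w'` are combined
  refine le_of_forall_pos_le_add fun ε hε => ?_
  obtain ⟨q, hq⟩ := exists_lt_of_ciInf_lt (f := fun q : {q : Fin J → ℝ // ∀ j, 0 ≤ q j} =>
    N.relaxedCost Cp w q) (lt_add_of_pos_right _ hε)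
  obtain ⟨q', hq'⟩ := exists_lt_of_ciInf_lt (f := fun q : {q : Fin J → ℝ // ∀ j, 0 ≤ q j} =>
    N.relaxedCost Cp w' q) (lt_add_of_pos_right _ hε)
  have h1 := hext_le hN hCp (a • w + b • w') (q := a • q.1 + b • q'.1) fun j =>
    add_nonneg (mul_nonneg ha (q.2 j)) (mul_nonneg hb (q'.2 j))
  have h2 : N.relaxedCost Cp (a • w + b • w') (a • q.1 + b • q'.1) ≤
      a * N.relaxedCost Cp w q + b * N.relaxedCost Cp w' q' := by
    have h3 : ∑ i, |(a • w + b • w') i - N.wl (a • q.1 + b • q'.1) i| ≤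
        a * ∑ i, |w i - N.wl q i| + b * ∑ i, |w' i - N.wl q' i| := by
      rw [Finset.mul_sum, Finset.mul_sum, ← Finset.sum_add_distrib]
      refine Finset.sum_le_sum fun i _ => ?_
      rw [wl_add, wl_smul, wl_smul]
      simp only [Pi.add_apply, Pi.smul_apply, smul_eq_mul]
      calc |a * w i + b * w' i - (a * N.wl q i + b * N.wl q' i)|
          = |a * (w i - N.wl q i) + b * (w' i - N.wl q' i)| := by congr 1; ring
        _ ≤ _ := (abs_add_le _ _).trans (by rw [abs_mul, abs_mul, abs_of_nonneg ha, abs_of_nonneg hb])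
    unfold relaxedCost
    rw [dotProduct_add, dotProduct_smul, dotProduct_smul, smul_eq_mul, smul_eq_mul]
    have := mul_le_mul_of_nonneg_left h3 hCp
    linarith
  have h4 : a * N.relaxedCost Cp w q ≤ a * (N.hext Cp w + ε) :=
    mul_le_mul_of_nonneg_left hq.le ha
  have h5 : b * N.relaxedCost Cp w' q' ≤ b * (N.hext Cp w' + ε) :=
    mul_le_mul_of_nonneg_left hq'.le hb
  nlinarith

theorem K_nonneg (hN : N.IsTopology) (i : Fin I) (j : Fin J) : 0 ≤ N.K i j := by
  rcases hN.zero_or_one i j with h | h <;> simp [h]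

theorem K_le_one (hN : N.IsTopology) (i : Fin I) (j : Fin J) : N.K i j ≤ 1 := by
  rcases hN.zero_or_one i j with h | h <;> simp [h]

theorem bddBelow_cost (hN : N.IsTopology) (w : Fin I → ℝ) :
    BddBelow ((fun q => N.h ⬝ᵥ q) '' N.Lam w) :=
  ⟨0, by rintro _ ⟨q, hq, rfl⟩; exact h_dot_nonneg hN hq.1⟩

/-- Repair of a workload: from `p ≥ 0` one gets some `p' ≥ 0` of workload `w ≥ 0` by lowering each
job type by the excesses of the resources it uses and then filling up with single-resource jobs. -/
theorem exists_workload_repair (hN : N.IsTopology) (p : Fin J → ℝ) (hp : ∀ j, 0 ≤ p j)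
    (w : Fin I → ℝ) (hw : ∀ i, 0 ≤ w i) :
    ∃ p' : Fin J → ℝ, (∀ j, 0 ≤ p' j) ∧ N.K *ᵥ p' = w ∧
      ∀ j, p' j ≤ p j + I * (J + 1) * ∑ i, |w i - (N.K *ᵥ p) i| := by
  choose l hl using hN.local_traffic
  set S : ℝ := ∑ i, |w i - (N.K *ᵥ p) i| with hS
  set e : Fin I → ℝ := fun i => max ((N.K *ᵥ p) i - w i) 0 with he
  have he0 : ∀ i, 0 ≤ e i := fun i => le_max_right _ _
  have heS : ∑ i, e i ≤ S := Finset.sum_le_sum fun i _ =>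
    max_le ((le_abs_self _).trans_eq (abs_sub_comm _ _)) (abs_nonneg _)
  set p1 : Fin J → ℝ := fun j => max (p j - ∑ i, N.K i j * e i) 0 with hp1
  have hp10 : ∀ j, 0 ≤ p1 j := fun j => le_max_right _ _
  have hKe : ∀ j, 0 ≤ ∑ i, N.K i j * e i := fun j =>
    Finset.sum_nonneg fun i _ => mul_nonneg (K_nonneg hN i j) (he0 i)
  have hp1p : ∀ j, p1 j ≤ p j := fun j => max_le (by linarith [hKe j]) (hp j)
  have hKeS : ∀ j, ∑ i, N.K i j * e i ≤ S := fun j => le_trans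
    (Finset.sum_le_sum fun i _ => mul_le_of_le_one_left (he0 i) (K_le_one hN i j)) heS
  have hpp1 : ∀ j, p j - p1 j ≤ S := fun j => by
    have : p j - ∑ i, N.K i j * e i ≤ p1 j := le_max_left _ _
    linarith [hKeS j]
  have hmv : ∀ (v : Fin J → ℝ) i, (N.K *ᵥ v) i = ∑ j, N.K i j * v j := fun v i => rfl
  have hle : ∀ i, (N.K *ᵥ p1) i ≤ w i := by
    intro i
    by_cases hex : ∃ j, N.K i j = 1 ∧ e i ≤ p j
    · obtain ⟨j0, hj0, hej⟩ := hex
      have h1 : (N.K *ᵥ p1) i ≤ (N.K *ᵥ p) i - e i := by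
        rw [hmv, hmv, le_sub_iff_add_le, ← Finset.add_sum_erase _ _ (Finset.mem_univ j0),
          ← Finset.add_sum_erase _ (fun j => N.K i j * p j) (Finset.mem_univ j0)]
        have h2 : ∑ j ∈ Finset.univ.erase j0, N.K i j * p1 j ≤
            ∑ j ∈ Finset.univ.erase j0, N.K i j * p j :=
          Finset.sum_le_sum fun j _ => mul_le_mul_of_nonneg_left (hp1p j) (K_nonneg hN i j)
        have h3 : p1 j0 ≤ p j0 - e i := by
          refine max_le ?_ (by linarith)
          have : N.K i j0 * e i ≤ ∑ i, N.K i j0 * e i :=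
            Finset.single_le_sum (f := fun i => N.K i j0 * e i)
              (fun i _ => mul_nonneg (K_nonneg hN i j0) (he0 i)) (Finset.mem_univ i)
          rw [hj0, one_mul] at this
          linarith
        rw [hj0]
        linarith
      have h4 : (N.K *ᵥ p) i - w i ≤ e i := le_max_left _ _
      linarith
    · push Not at hex
      have : (N.K *ᵥ p1) i = 0 := by
        rw [hmv]
        refine Finset.sum_eq_zero fun j _ => ?_
        rcases hN.zero_or_one i j with h | h
        · rw [h, zero_mul]
        · have h1 := hex j h
          have h2 : N.K i j * e i ≤ ∑ i, N.K i j * e i :=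
            Finset.single_le_sum (f := fun i => N.K i j * e i)
              (fun i _ => mul_nonneg (K_nonneg hN i j) (he0 i)) (Finset.mem_univ i)
          rw [h, one_mul] at h2
          have : p1 j = 0 := max_eq_right (by linarith)
          rw [this, mul_zero]
      rw [this]; exact hw i
  set d : Fin I → ℝ := fun i => w i - (N.K *ᵥ p1) i with hd
  have hd0 : ∀ i, 0 ≤ d i := fun i => sub_nonneg.2 (hle i)
  have hdS : ∀ i, d i ≤ (J + 1) * S := by
    intro i
    have h1 : w i - (N.K *ᵥ p) i ≤ S := (le_abs_self _).trans
      (Finset.single_le_sum (f := fun i => |w i - (N.K *ᵥ p) i|) (fun _ _ => abs_nonneg _)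
        (Finset.mem_univ i))
    have h2 : (N.K *ᵥ p) i - (N.K *ᵥ p1) i ≤ J * S := by
      rw [hmv, hmv, ← Finset.sum_sub_distrib]
      calc ∑ j, (N.K i j * p j - N.K i j * p1 j) ≤ ∑ _j : Fin J, S := by
            refine Finset.sum_le_sum fun j _ => ?_
            rw [← mul_sub]
            exact (mul_le_of_le_one_left (sub_nonneg.2 (hp1p j)) (K_le_one hN i j)).trans (hpp1 j)
        _ = J * S := by simp
    simp only [hd]; linarith
  refine ⟨fun j => p1 j + ∑ i, if l i = j then d i else 0, fun j => ?_, ?_, fun j => ?_⟩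
  · refine add_nonneg (hp10 j) (Finset.sum_nonneg fun i _ => ?_)
    split_ifs
    exacts [hd0 i, le_rfl]
  · ext i
    rw [hmv]
    simp only [mul_add, Finset.sum_add_distrib, Finset.mul_sum]
    rw [Finset.sum_comm]
    have h1 : ∀ i', ∑ j, N.K i j * (if l i' = j then d i' else 0) = if i' = i then d i else 0 := by
      intro i'
      rw [Finset.sum_eq_single (l i') (fun j _ hj => by rw [if_neg hj.symm, mul_zero])
        (fun h => absurd (Finset.mem_univ _) h), if_pos rfl]
      split_ifs with hi
      · subst hi; rw [(hl i').1, one_mul]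
      · rw [(hl i').2 i (Ne.symm hi), zero_mul]
    simp only [h1, Finset.sum_ite_eq', Finset.mem_univ, if_true]
    rw [← hmv]; simp only [hd]; ring
  · have h1 : ∑ i, (if l i = j then d i else 0) ≤ ∑ _i : Fin I, (J + 1) * S :=
      Finset.sum_le_sum fun i _ => by
        split_ifs
        exacts [hdS i, by positivity]
    rw [Finset.sum_const, Finset.card_univ, Fintype.card_fin, nsmul_eq_mul] at h1
    have := hp1p j
    simp only
    linarith

/-- For a large penalty the relaxed problem has the value `ĥ` on the orthant. -/
theorem exists_hhat_eq_hext (hN : N.IsTopology) (hβ : ∀ j, 0 < N.β j) :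
    ∃ Cp : ℝ, 0 ≤ Cp ∧ ∀ w : Fin I → ℝ, (∀ i, 0 ≤ w i) → N.hhat w = N.hext Cp w := by
  set Cp : ℝ := (∑ j, N.h j * N.β j) * (I * (J + 1)) with hCpdef
  have hCp : 0 ≤ Cp := mul_nonneg
    (Finset.sum_nonneg fun j _ => mul_nonneg (hN.h_pos j).le (hβ j).le) (by positivity)
  refine ⟨Cp, hCp, fun w hw => le_antisymm ?_ ?_⟩
  · refine le_hext fun q hq => ?_
    obtain ⟨p', hp', hK, hle⟩ := exists_workload_repair hN (fun j => q j / N.β j)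
      (fun j => div_nonneg (hq j) (hβ j).le) w hw
    have hmem : (fun j => N.β j * p' j) ∈ N.Lam w := by
      refine ⟨fun j => mul_nonneg (hβ j).le (hp' j), ?_⟩
      rw [← hK]; congr 1; ext j
      rw [mul_div_cancel_left₀ _ (hβ j).ne']
    refine (csInf_le (bddBelow_cost hN w) ⟨_, hmem, rfl⟩).trans ?_
    unfold relaxedCost
    rw [hCpdef, mul_assoc, Finset.sum_mul]
    simp only [dotProduct]
    rw [← Finset.sum_add_distrib]
    refine Finset.sum_le_sum fun j _ => ?_
    have h1 := mul_le_mul_of_nonneg_left (hle j) (mul_nonneg (hN.h_pos j).le (hβ j).le)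
    have h2 : N.h j * N.β j * (q j / N.β j) = N.h j * q j := by
      have := (hβ j).ne'; field_simp
    rw [mul_add, h2] at h1
    calc N.h j * (N.β j * p' j) = N.h j * N.β j * p' j := by ring
      _ ≤ _ := h1
  · obtain ⟨p', hp', hK, -⟩ := exists_workload_repair hN 0 (fun _ => le_rfl) w hw
    have hne : ((fun q => N.h ⬝ᵥ q) '' N.Lam w).Nonempty := by
      refine ⟨_, fun j => N.β j * p' j, ⟨fun j => mul_nonneg (hβ j).le (hp' j), ?_⟩, rfl⟩
      rw [← hK]; congr 1; ext j
      rw [mul_div_cancel_left₀ _ (hβ j).ne']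
    refine le_csInf hne ?_
    rintro _ ⟨q, ⟨hq, hqw⟩, rfl⟩
    refine (hext_le hN hCp w hq).trans_eq ?_
    unfold relaxedCost wl
    rw [hqw]; simp

theorem wl_nonneg (hN : N.IsTopology) (hβ : ∀ j, 0 < N.β j) {q : Fin J → ℝ} (hq : ∀ j, 0 ≤ q j)
    (i : Fin I) : 0 ≤ N.wl q i := by
  rw [wl_apply]
  exact Finset.sum_nonneg fun j _ => mul_nonneg (K_nonneg hN i j) (div_nonneg (hq j) (hβ j).le)

theorem abs_wl_sub_le (hN : N.IsTopology) (hβ : ∀ j, 0 < N.β j) (q q' : Fin J → ℝ) (i : Fin I) :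
    |N.wl q i - N.wl q' i| ≤ ∑ j, |q j - q' j| / N.β j := by
  rw [wl_apply, wl_apply, ← Finset.sum_sub_distrib]
  refine (Finset.abs_sum_le_sum_abs _ _).trans (Finset.sum_le_sum fun j _ => ?_)
  rw [← mul_sub, ← sub_div, abs_mul, abs_div, abs_of_pos (hβ j), abs_of_nonneg (K_nonneg hN i j)]
  exact mul_le_of_le_one_left (div_nonneg (abs_nonneg _) (hβ j).le) (K_le_one hN i j)

/-- The gap is Lipschitz for the `ℓ¹` norm. -/
theorem exists_gap_lipschitz (hN : N.IsTopology) (hβ : ∀ j, 0 < N.β j) {Cp : ℝ} (hCp : 0 ≤ Cp) :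
    ∃ L : ℝ, 0 ≤ L ∧ ∀ q q' : Fin J → ℝ, N.gap Cp q ≤ N.gap Cp q' + L * ∑ j, |q j - q' j| := by
  have hβ0 : 0 ≤ ∑ j, (N.β j)⁻¹ := Finset.sum_nonneg fun j _ => (inv_pos.2 (hβ j)).le
  have hh0 : 0 ≤ ∑ j, N.h j := Finset.sum_nonneg fun j _ => (hN.h_pos j).le
  refine ⟨∑ j, N.h j + Cp * (I * ∑ j, (N.β j)⁻¹), by positivity, fun q q' => ?_⟩
  have h1 := hext_lipschitz hN hCp (N.wl q') (N.wl q)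
  have h2 : N.h ⬝ᵥ q - N.h ⬝ᵥ q' ≤ (∑ j, N.h j) * ∑ j, |q j - q' j| := by
    rw [← dotProduct_sub, Finset.sum_mul]
    refine Finset.sum_le_sum fun j _ => mul_le_mul_of_nonneg_left ?_ (hN.h_pos j).le
    exact (le_abs_self _).trans (Finset.single_le_sum (f := fun j => |q j - q' j|)
      (fun _ _ => abs_nonneg _) (Finset.mem_univ j))
  have h3 : ∑ i, |N.wl q' i - N.wl q i| ≤ (I * ∑ j, (N.β j)⁻¹) * ∑ j, |q j - q' j| := by
    have : ∀ i, |N.wl q' i - N.wl q i| ≤ (∑ j, (N.β j)⁻¹) * ∑ j, |q j - q' j| := fun i => by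
      refine (abs_wl_sub_le hN hβ q' q i).trans ?_
      rw [Finset.sum_mul]
      refine Finset.sum_le_sum fun j _ => ?_
      rw [div_eq_inv_mul, abs_sub_comm]
      exact mul_le_mul_of_nonneg_left (Finset.single_le_sum (f := fun j => |q j - q' j|)
        (fun _ _ => abs_nonneg _) (Finset.mem_univ j)) (inv_pos.2 (hβ j)).le
    refine (Finset.sum_le_sum fun i _ => this i).trans_eq ?_
    rw [Finset.sum_const, Finset.card_univ, Fintype.card_fin, nsmul_eq_mul, mul_assoc]
  have h4 := mul_le_mul_of_nonneg_left h3 hCp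
  unfold gap
  linarith

theorem gap_concave (hN : N.IsTopology) {Cp : ℝ} (hCp : 0 ≤ Cp) :
    ConcaveOn ℝ Set.univ (N.gap Cp) := by
  refine ⟨convex_univ, fun q _ q' _ a b ha hb hab => ?_⟩
  have h := (hext_convex hN hCp).2 (Set.mem_univ (N.wl q)) (Set.mem_univ (N.wl q')) ha hb hab
  unfold gap
  rw [wl_add, wl_smul, wl_smul, dotProduct_add, dotProduct_smul, dotProduct_smul]
  simp only [smul_eq_mul] at h ⊢
  linarith

theorem hext_wl_le (hN : N.IsTopology) {Cp : ℝ} (hCp : 0 ≤ Cp) {q : Fin J → ℝ}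
    (hq : ∀ j, 0 ≤ q j) : N.hext Cp (N.wl q) ≤ N.h ⬝ᵥ q := by
  refine (hext_le hN hCp _ hq).trans_eq ?_
  simp [relaxedCost]

theorem gap_nonneg (hN : N.IsTopology) {Cp : ℝ} (hCp : 0 ≤ Cp) {q : Fin J → ℝ}
    (hq : ∀ j, 0 ≤ q j) : 0 ≤ N.gap Cp q := sub_nonneg.2 (hext_wl_le hN hCp hq)

theorem gap_smul_le (hN : N.IsTopology) {Cp : ℝ} (hCp : 0 ≤ Cp) (q : Fin J → ℝ) {c : ℝ}
    (hc : 0 < c) : N.gap Cp (c • q) ≤ c * N.gap Cp q := by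
  have h := hext_smul_le hN hCp (N.wl (c • q)) (inv_pos.2 hc)
  rw [wl_smul, inv_smul_smul₀ hc.ne', ← wl_smul, ← div_eq_inv_mul, le_div_iff₀' hc] at h
  unfold gap
  rw [dotProduct_smul, smul_eq_mul, mul_sub]
  linarith

/-- If the queues below the level `t` form a configuration outside `ℳ`, the gap is of order `t`. -/
theorem exists_gap_le_of_notMem (hN : N.IsTopology) (hβ : ∀ j, 0 < N.β j) {u : Fin J → ℝ}
    (hu : N.costKer ≠ N.kerK → N.IsCostDirection u) {Cp : ℝ}
    (hCp : ∀ w : Fin I → ℝ, (∀ i, 0 ≤ w i) → N.hhat w = N.hext Cp w) :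
    ∃ C : ℝ, 0 ≤ C ∧ ∀ z ∉ N.calM u, ∀ q : Fin J → ℝ, (∀ j, 0 ≤ q j) → ∀ t : ℝ, 0 ≤ t →
      (∀ j, z j = true → q j ≤ t) → N.gap Cp q ≤ C * t := by
  obtain ⟨C, hC0, hC⟩ := N.exists_hβ_ge hu
  have hβ0 : 0 ≤ ∑ j, (N.β j)⁻¹ := Finset.sum_nonneg fun j _ => (inv_pos.2 (hβ j)).le
  refine ⟨C * ∑ j, (N.β j)⁻¹, by positivity, fun z hz q hq t ht hqt => ?_⟩
  unfold gap
  rw [sub_le_comm, ← hCp _ (wl_nonneg hN hβ hq)]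
  refine le_csInf ⟨_, q, ⟨hq, rfl⟩, rfl⟩ ?_
  rintro _ ⟨q', ⟨hq', hw⟩, rfl⟩
  have hv := hC z hz (fun j => q' j / N.β j - q j / N.β j) (by
      change N.K *ᵥ ((fun j => q' j / N.β j) - fun j => q j / N.β j) = 0
      rw [Matrix.mulVec_sub, hw]; exact sub_self _) (t * ∑ j, (N.β j)⁻¹) (by positivity) (by
      intro j hj
      have h1 : q j / N.β j ≤ t * ∑ j, (N.β j)⁻¹ := by
        rw [div_eq_mul_inv]
        exact mul_le_mul (hqt j hj) (Finset.single_le_sum (f := fun j => (N.β j)⁻¹)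
          (fun j _ => (inv_pos.2 (hβ j)).le) (Finset.mem_univ j)) (inv_pos.2 (hβ j)).le ht
      have h2 : 0 ≤ q' j / N.β j := div_nonneg (hq' j) (hβ j).le
      linarith)
  have h3 : (N.hβ ⬝ᵥ fun j => q' j / N.β j - q j / N.β j) = N.h ⬝ᵥ q' - N.h ⬝ᵥ q := by
    rw [← dotProduct_sub]
    refine Finset.sum_congr rfl fun j _ => ?_
    have := (hβ j).ne'
    simp only [Network.hβ, Pi.sub_apply]
    field_simp
  rw [h3] at hv
  simp only
  linarith

end Network
end RSN
end

noncomputable section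

namespace RSN

/-! ### Exponential moments of the primitives -/

/-- A law on the positive half-line of mean `1/γ` with an exponential moment of order `δ` that is at
most `K`. -/
structure MgfBound (δ K γ : ℝ) (μ : Measure ℝ) : Prop where
  prob : IsProbabilityMeasure μ
  pos : ∀ᵐ u ∂μ, 0 < u
  int_id : Integrable (fun u : ℝ => u) μ
  mean : ∫ u, u ∂μ = γ⁻¹
  int_exp : Integrable (fun u : ℝ => Real.exp (δ * u)) μ
  exp_le : ∫ u, Real.exp (δ * u) ∂μ ≤ K

theorem exp_le_quadratic (x : ℝ) : Real.exp x ≤ 1 + x + x ^ 2 * Real.exp |x| := by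
  have h := Complex.norm_exp_sub_sum_le_norm_mul_exp (x : ℂ) 2
  rw [← Complex.ofReal_exp] at h
  simp only [Finset.sum_range_succ, Finset.sum_range_zero, pow_zero, Nat.factorial, pow_one,
    Nat.cast_one, div_one, zero_add, mul_one, Complex.norm_real, Real.norm_eq_abs, sq_abs] at h
  have h2 : ((Real.exp x : ℂ) - (1 + x)) = ((Real.exp x - (1 + x) : ℝ) : ℂ) := by push_cast; ring
  rw [h2, Complex.norm_real, Real.norm_eq_abs] at h
  linarith [le_abs_self (Real.exp x - (1 + x))]

theorem sq_le_exp {c u : ℝ} (hc : 0 < c) (hu : 0 ≤ u) :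
    u ^ 2 ≤ 2 / c ^ 2 * Real.exp (c * u) := by
  have h := Real.quadratic_le_exp_of_nonneg (mul_nonneg hc.le hu)
  rw [div_mul_eq_mul_div, le_div_iff₀ (by positivity)]
  nlinarith [mul_nonneg hc.le hu]

namespace MgfBound

variable {δ K γ : ℝ} {μ : Measure ℝ}

theorem integrable_exp (h : MgfBound δ K γ μ) {a : ℝ} (ha : a ≤ δ) :
    Integrable (fun u : ℝ => Real.exp (a * u)) μ := by
  refine h.int_exp.mono' (by fun_prop) ?_
  filter_upwards [h.pos] with u hu
  rw [Real.norm_eq_abs, Real.abs_exp]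
  exact Real.exp_le_exp.2 (mul_le_mul_of_nonneg_right ha hu.le)

theorem integral_exp_le (h : MgfBound δ K γ μ) {a : ℝ} (ha : a ≤ δ) :
    ∫ u, Real.exp (a * u) ∂μ ≤ K := by
  refine (integral_mono_ae (h.integrable_exp ha) h.int_exp ?_).trans h.exp_le
  filter_upwards [h.pos] with u hu
  exact Real.exp_le_exp.2 (mul_le_mul_of_nonneg_right ha hu.le)

theorem integrable_sq (h : MgfBound δ K γ μ) (hδ : 0 < δ) :
    Integrable (fun u : ℝ => u ^ 2) μ := by
  refine (h.int_exp.const_mul (2 / δ ^ 2)).mono' (by fun_prop) ?_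
  filter_upwards [h.pos] with u hu
  rw [Real.norm_eq_abs, abs_of_nonneg (sq_nonneg u)]
  exact sq_le_exp hδ hu.le

theorem integral_sq_le (h : MgfBound δ K γ μ) (hδ : 0 < δ) :
    ∫ u, u ^ 2 ∂μ ≤ 2 / δ ^ 2 * K := by
  calc ∫ u, u ^ 2 ∂μ ≤ ∫ u, 2 / δ ^ 2 * Real.exp (δ * u) ∂μ := by
        refine integral_mono_ae (h.integrable_sq hδ) (h.int_exp.const_mul _) ?_
        filter_upwards [h.pos] with u hu
        exact sq_le_exp hδ hu.le
    _ ≤ _ := by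
        rw [integral_const_mul]
        exact mul_le_mul_of_nonneg_left h.exp_le (by positivity)

theorem K_nonneg (h : MgfBound δ K γ μ) : 0 ≤ K :=
  le_trans (integral_nonneg fun _ => (Real.exp_pos _).le) h.exp_le

/-- Second order expansion of the moment generating function at the origin. -/
theorem integral_exp_le_exp (h : MgfBound δ K γ μ) (hδ : 0 < δ) {a : ℝ} (ha : |a| ≤ δ / 2) :
    ∫ u, Real.exp (a * u) ∂μ ≤ Real.exp (a / γ + 8 / δ ^ 2 * K * a ^ 2) := by
  have := h.prob
  have haδ : a ≤ δ := by linarith [le_abs_self a]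
  have h1 : ∫ u, Real.exp (a * u) ∂μ ≤
      ∫ u, (1 + a * u + a ^ 2 * (8 / δ ^ 2) * Real.exp (δ * u)) ∂μ := by
    refine integral_mono_ae (h.integrable_exp haδ)
      (((integrable_const _).add (h.int_id.const_mul a)).add (h.int_exp.const_mul _)) ?_
    filter_upwards [h.pos] with u hu
    refine (exp_le_quadratic _).trans ?_
    have h2 : u ^ 2 ≤ 8 / δ ^ 2 * Real.exp (δ / 2 * u) := by
      have := sq_le_exp (half_pos hδ) hu.le
      rw [show 2 / (δ / 2) ^ 2 = 8 / δ ^ 2 by field_simp; norm_num] at this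
      exact this
    have h3 : Real.exp |a * u| ≤ Real.exp (δ / 2 * u) := by
      rw [abs_mul, abs_of_pos hu]
      exact Real.exp_le_exp.2 (mul_le_mul_of_nonneg_right ha hu.le)
    have h4 : (a * u) ^ 2 * Real.exp |a * u| ≤ a ^ 2 * (8 / δ ^ 2) * Real.exp (δ * u) := by
      calc (a * u) ^ 2 * Real.exp |a * u| = a ^ 2 * (u ^ 2 * Real.exp |a * u|) := by ring
        _ ≤ a ^ 2 * (8 / δ ^ 2 * Real.exp (δ / 2 * u) * Real.exp (δ / 2 * u)) := by gcongr
        _ = _ := by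
          rw [mul_assoc (8 / δ ^ 2), ← Real.exp_add]
          ring_nf
    linarith
  have i1 : Integrable (fun u : ℝ => 1 + a * u) μ := (integrable_const _).add (h.int_id.const_mul a)
  have i2 : Integrable (fun u : ℝ => a ^ 2 * (8 / δ ^ 2) * Real.exp (δ * u)) μ :=
    h.int_exp.const_mul _
  rw [integral_add i1 i2, integral_add (integrable_const _) (h.int_id.const_mul a),
    integral_const_mul, integral_const_mul, h.mean] at h1
  simp only [integral_const, probReal_univ, smul_eq_mul, one_mul] at h1
  have h5 : a ^ 2 * (8 / δ ^ 2) * ∫ u, Real.exp (δ * u) ∂μ ≤ a ^ 2 * (8 / δ ^ 2) * K :=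
    mul_le_mul_of_nonneg_left h.exp_le (by positivity)
  have h6 := Real.add_one_le_exp (a / γ + 8 / δ ^ 2 * K * a ^ 2)
  rw [div_eq_mul_inv] at h6 ⊢
  linarith

/-- With the quadratic correction `Λ s²`, jumps do not increase exponentials in the mean. -/
theorem exp_mul_integral_le_one (h : MgfBound δ K γ μ) (hδ : 0 < δ) {γhi Λ s : ℝ} (hγ : 0 < γ)
    (hγhi : γ ≤ γhi) (hΛ : 32 / δ ^ 2 * K * γhi ^ 2 ≤ Λ) (hs1 : Λ * |s| ≤ 1)
    (hs2 : 4 * γhi * |s| ≤ δ) :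
    Real.exp s * ∫ u, Real.exp (-γ * (s + Λ * s ^ 2) * u) ∂μ ≤ 1 := by
  have hK := h.K_nonneg
  have hΛ0 : 0 ≤ Λ := le_trans (by positivity) hΛ
  have h1 : |s + Λ * s ^ 2| ≤ 2 * |s| := by
    refine (abs_add_le _ _).trans ?_
    rw [abs_mul, abs_pow, abs_of_nonneg hΛ0]
    nlinarith [abs_nonneg s]
  have h2 : |-γ * (s + Λ * s ^ 2)| ≤ 2 * γhi * |s| := by
    rw [abs_mul, abs_neg, abs_of_pos hγ]
    nlinarith [abs_nonneg s, abs_nonneg (s + Λ * s ^ 2)]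
  have h3 := h.integral_exp_le_exp hδ (a := -γ * (s + Λ * s ^ 2)) (by linarith)
  have h4 : 8 / δ ^ 2 * K * (-γ * (s + Λ * s ^ 2)) ^ 2 ≤ Λ * s ^ 2 := by
    have h5 : (-γ * (s + Λ * s ^ 2)) ^ 2 ≤ (2 * γhi * |s|) ^ 2 := by
      rw [← sq_abs (-γ * _)]; gcongr
    calc 8 / δ ^ 2 * K * (-γ * (s + Λ * s ^ 2)) ^ 2 ≤ 8 / δ ^ 2 * K * (2 * γhi * |s|) ^ 2 := by
          gcongr
      _ = 32 / δ ^ 2 * K * γhi ^ 2 * s ^ 2 := by rw [mul_pow, sq_abs]; ring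
      _ ≤ _ := by gcongr
  have h6 : -γ * (s + Λ * s ^ 2) / γ = -(s + Λ * s ^ 2) := by field_simp
  rw [h6] at h3
  calc _ ≤ Real.exp s * Real.exp (-s) := by
        refine mul_le_mul_of_nonneg_left (h3.trans (Real.exp_le_exp.2 (by linarith)))
          (Real.exp_pos _).le
    _ = 1 := by rw [← Real.exp_add]; simp

theorem exp_mul_integral_le_exp_neg (h : MgfBound δ K γ μ) (hδ : 0 < δ) {γhi Λ s y : ℝ}
    (hγ : 0 < γ) (hγhi : γ ≤ γhi) (hΛ : 0 ≤ Λ) (hy : 0 < y)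
    (hs1 : Λ * |s| ≤ 1) (hs2 : 2 * γhi * |s| ≤ y) (hy1 : 4 * y ≤ δ)
    (hy2 : 64 / δ ^ 2 * K * γhi * y ≤ 1) :
    Real.exp s * ∫ u, Real.exp ((-γ * (s + Λ * s ^ 2) - y) * u) ∂μ ≤ Real.exp (-(y / (2 * γhi))) := by
  have hK := h.K_nonneg
  have hγhi0 : 0 < γhi := hγ.trans_le hγhi
  have h1 : |s + Λ * s ^ 2| ≤ 2 * |s| := by
    refine (abs_add_le _ _).trans ?_
    rw [abs_mul, abs_pow, abs_of_nonneg hΛ]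
    nlinarith [abs_nonneg s]
  have h2 : |-γ * (s + Λ * s ^ 2)| ≤ y := by
    rw [abs_mul, abs_neg, abs_of_pos hγ]
    nlinarith [abs_nonneg s, abs_nonneg (s + Λ * s ^ 2)]
  have h2' : |-γ * (s + Λ * s ^ 2) - y| ≤ 2 * y := by
    refine (abs_sub _ _).trans ?_
    rw [abs_of_pos hy]; linarith
  have h3 := h.integral_exp_le_exp hδ (a := -γ * (s + Λ * s ^ 2) - y) (by linarith)
  have h4 : 8 / δ ^ 2 * K * (-γ * (s + Λ * s ^ 2) - y) ^ 2 ≤ y / (2 * γhi) := by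
    have h5 : (-γ * (s + Λ * s ^ 2) - y) ^ 2 ≤ (2 * y) ^ 2 := by
      rw [← sq_abs (-γ * _ - y)]; gcongr
    calc _ ≤ 8 / δ ^ 2 * K * (2 * y) ^ 2 := by gcongr
      _ = (64 / δ ^ 2 * K * γhi * y) * (y / (2 * γhi)) := by field_simp; ring
      _ ≤ 1 * (y / (2 * γhi)) := by gcongr
      _ = _ := one_mul _
  have h6 : (-γ * (s + Λ * s ^ 2) - y) / γ = -(s + Λ * s ^ 2) - y / γ := by field_simp
  have h7 : y / γhi ≤ y / γ := by gcongr
  have h8 : y / γhi = y / (2 * γhi) + y / (2 * γhi) := by field_simp; norm_num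
  have h9 : 0 ≤ Λ * s ^ 2 := by positivity
  rw [h6] at h3
  refine (mul_le_mul_of_nonneg_left h3 (Real.exp_pos _).le).trans ?_
  rw [← Real.exp_add]
  exact Real.exp_le_exp.2 (by linarith)

end MgfBound
end RSN
end

noncomputable section

namespace RSN

/-! ### The piecewise deterministic process -/

/-- Index set of the renewal processes: `inl j` stands for the arrivals and `inr j` for the
services of job type `j`. -/
abbrev Idx (J : ℕ) : Type := Fin J ⊕ Fin J

/-- State `(q, R, E)` of the Markov process: queue lengths, residual times of the running
interarrival times and jobs, and indicators of the blocked job types. -/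
abbrev Config (J : ℕ) : Type := (Fin J → ℝ) × (Idx J → ℝ) × Chi J

/-- Signed change `± σ_j` of `σ · q` when the renewal process `a` has an event. -/
def sg {J : ℕ} (σ : Fin J → ℝ) : Idx J → ℝ := Sum.elim σ (fun j => -σ j)

section Dynamics

variable {I J : ℕ} (p : Policy J) (N : Network I J) (r : ℕ) (lo hi : ℝ)

/-- Speed at which the residual times decrease: `1` for arrivals, the allocation rate for jobs. -/
def speed (x : Config J) : Idx J → ℝ :=
  Sum.elim (fun _ => 1) (fun j => if x.2.2 j = true then 0 else p.x N r x.1 j)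

/-- Deterministic motion between events. -/
def flow (x : Config J) (s : ℝ) : Config J :=
  (x.1, fun a => x.2.1 a - s * speed p N r x a, x.2.2)

/-- Hysteresis rule for the indicator of a blocked job type with new queue length `q`. -/
def updE (e : Bool) (q : ℝ) : Bool :=
  if e = true then decide (q < hi) else decide (q < lo)

/-- Queue lengths after the events of all processes with expired residual time. -/
def jumpQ (x : Config J) (j : Fin J) : ℝ :=
  x.1 j + (if x.2.1 (Sum.inl j) ≤ 0 then 1 else 0) - (if x.2.1 (Sum.inr j) ≤ 0 then 1 else 0)

/-- Transition at an event: all processes with expired residual time fire simultaneously and get the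
fresh residual times `y`. -/
def jump (x : Config J) (y : Idx J → ℝ) : Config J :=
  (jumpQ x, fun a => if x.2.1 a ≤ 0 then y a else x.2.1 a,
    fun j => updE lo hi (x.2.2 j) (jumpQ x j))

/-- Number of processes that fire. -/
def numFire (x : Config J) : ℝ := ∑ a : Idx J, if x.2.1 a ≤ 0 then (1 : ℝ) else 0

end Dynamics

section Exponentials

variable {J : ℕ}

/-- Exponential of a linear function of the queue lengths and the residual times. -/
def expo (σ : Fin J → ℝ) (c : Idx J → ℝ) (x : Config J) : ℝ :=
  Real.exp (∑ j, σ j * x.1 j + ∑ a, c a * x.2.1 a)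

/-- The coefficients of the residual times that make `exp (σ · q + c · R)` a supermartingale at
jumps. -/
def cf (Λ : ℝ) (γ : Idx J → ℝ) (σ : Fin J → ℝ) (a : Idx J) : ℝ :=
  -γ a * (sg σ a + Λ * sg σ a ^ 2)

theorem expo_pos (σ : Fin J → ℝ) (c : Idx J → ℝ) (x : Config J) : 0 < expo σ c x :=
  Real.exp_pos _

theorem sum_sg (σ : Fin J → ℝ) (f : Idx J → ℝ) :
    ∑ a, f a * sg σ a = ∑ j, σ j * (f (Sum.inl j) - f (Sum.inr j)) := by
  rw [Fintype.sum_sum_type, ← Finset.sum_add_distrib]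
  exact Finset.sum_congr rfl fun j _ => by simp only [sg, Sum.elim_inl, Sum.elim_inr]; ring

theorem expo_jump (lo hi : ℝ) (σ : Fin J → ℝ) (c : Idx J → ℝ) (x : Config J) (y : Idx J → ℝ) :
    expo σ c (jump lo hi x y) = Real.exp (∑ j, σ j * x.1 j) *
      ∏ a, (if x.2.1 a ≤ 0 then Real.exp (sg σ a) * Real.exp (c a * y a)
        else Real.exp (c a * x.2.1 a)) := by
  have h1 : ∑ j, σ j * jumpQ x j = ∑ j, σ j * x.1 j +
      ∑ a, (if x.2.1 a ≤ 0 then (1 : ℝ) else 0) * sg σ a := by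
    rw [sum_sg, ← Finset.sum_add_distrib]
    exact Finset.sum_congr rfl fun j _ => by simp only [jumpQ]; ring
  unfold expo jump
  simp only
  rw [h1, add_assoc, Real.exp_add, ← Finset.sum_add_distrib]
  congr 1
  rw [Real.exp_sum]
  refine Finset.prod_congr rfl fun a _ => ?_
  split_ifs
  · rw [← Real.exp_add, one_mul]
  · rw [zero_mul, zero_add]

theorem expo_eq_prod (σ : Fin J → ℝ) (c : Idx J → ℝ) (x : Config J) :
    expo σ c x = Real.exp (∑ j, σ j * x.1 j) * ∏ a, Real.exp (c a * x.2.1 a) := by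
  unfold expo
  rw [Real.exp_add, ← Real.exp_sum]

variable {m : Idx J → Measure ℝ} [∀ a, IsProbabilityMeasure (m a)]

theorem integrable_expo_jump (lo hi : ℝ) (σ : Fin J → ℝ) (c : Idx J → ℝ) (x : Config J)
    (hint : ∀ a, x.2.1 a ≤ 0 → Integrable (fun u => Real.exp (c a * u)) (m a)) :
    Integrable (fun y => expo σ c (jump lo hi x y)) (Measure.pi m) := by
  simp only [expo_jump]
  refine Integrable.const_mul (Integrable.fintype_prod (f := fun a u =>
    if x.2.1 a ≤ 0 then Real.exp (sg σ a) * Real.exp (c a * u)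
        else Real.exp (c a * x.2.1 a)) fun a => ?_) _
  by_cases h : x.2.1 a ≤ 0
  · simp only [h, if_true]; exact (hint a h).const_mul _
  · simp only [h, if_false]; exact integrable_const _

/-- Mean of an exponential after a jump, if at most the factor of `a₀` can increase. -/
theorem integral_expo_jump_le (lo hi : ℝ) (σ : Fin J → ℝ) (c : Idx J → ℝ) (x : Config J)
    (hR : ∀ a, 0 ≤ x.2.1 a) (a₀ : Idx J) (κ : ℝ)
    (h1 : ∀ a ≠ a₀, x.2.1 a ≤ 0 → Real.exp (sg σ a) * ∫ u, Real.exp (c a * u) ∂m a ≤ 1)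
    (h0 : x.2.1 a₀ ≤ 0 → Real.exp (sg σ a₀) * ∫ u, Real.exp (c a₀ * u) ∂m a₀ ≤ κ) :
    ∫ y, expo σ c (jump lo hi x y) ∂Measure.pi m ≤
      (if x.2.1 a₀ ≤ 0 then κ else 1) * expo σ c x := by
  simp only [expo_jump]
  rw [integral_const_mul, integral_fintype_prod_eq_prod (f := fun a u =>
    if x.2.1 a ≤ 0 then Real.exp (sg σ a) * Real.exp (c a * u)
        else Real.exp (c a * x.2.1 a)), expo_eq_prod, mul_left_comm]
  refine mul_le_mul_of_nonneg_left ?_ (Real.exp_pos _).le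
  have hpi : (if x.2.1 a₀ ≤ 0 then κ else 1) =
      ∏ a, if a = a₀ then (if x.2.1 a₀ ≤ 0 then κ else 1) else 1 := by
    rw [Finset.prod_ite_eq' Finset.univ a₀ (fun _ => if x.2.1 a₀ ≤ 0 then κ else 1)]; simp
  rw [hpi, ← Finset.prod_mul_distrib]
  refine Finset.prod_le_prod (fun a _ => integral_nonneg fun u => ?_) fun a _ => ?_
  · dsimp only; split_ifs <;> positivity
  · by_cases h : x.2.1 a ≤ 0
    · have hRa : x.2.1 a = 0 := le_antisymm h (hR a)
      simp only [h, if_true]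
      rw [integral_const_mul, hRa, mul_zero, Real.exp_zero, mul_one]
      by_cases ha : a = a₀
      · subst ha; rw [if_pos rfl, if_pos h]; exact h0 h
      · rw [if_neg ha]; exact h1 a ha h
    · simp only [h, if_false]
      rw [integral_const, probReal_univ, one_smul]
      by_cases ha : a = a₀
      · subst ha; rw [if_pos rfl, if_neg h, one_mul]
      · rw [if_neg ha, one_mul]

theorem integral_expo_jump_le_self (lo hi : ℝ) (σ : Fin J → ℝ) (c : Idx J → ℝ) (x : Config J)
    (hR : ∀ a, 0 ≤ x.2.1 a)
    (h1 : ∀ a, x.2.1 a ≤ 0 → Real.exp (sg σ a) * ∫ u, Real.exp (c a * u) ∂m a ≤ 1) :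
    ∫ y, expo σ c (jump lo hi x y) ∂Measure.pi m ≤ expo σ c x := by
  rcases isEmpty_or_nonempty (Idx J) with he | ⟨⟨a₀⟩⟩
  · have : ∀ y, expo σ c (jump lo hi x y) = expo σ c x := fun y => by
      rw [expo_jump, expo_eq_prod]; simp
    simp [this]
  · refine (integral_expo_jump_le lo hi σ c x hR a₀ 1 (fun a _ => h1 a) (h1 a₀)).trans_eq ?_
    rw [ite_self, one_mul]

end Exponentials

/-- What is used of the laws `m` of the primitives: moment conditions, the mean-zero property of
`1 - γ u`, and the inequalities on exponentials that make jumps harmless. -/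
structure JumpLaw {J : ℕ} (γ : Idx J → ℝ) (Λ s₀ s₁ y K η : ℝ) (m : Idx J → Measure ℝ) : Prop where
  prob : ∀ a, IsProbabilityMeasure (m a)
  pos : ∀ a, ∀ᵐ u ∂m a, 0 < u
  int_id : ∀ a, Integrable (fun u : ℝ => u) (m a)
  int_sq : ∀ a, Integrable (fun u : ℝ => u ^ 2) (m a)
  mean : ∀ a, ∫ u, (1 - γ a * u) ∂m a = 0
  sq_le : ∀ a, ∫ u, (1 - γ a * u) ^ 2 ∂m a ≤ K
  int_exp : ∀ a, ∀ c ≤ 4 * y, Integrable (fun u => Real.exp (c * u)) (m a)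
  one : ∀ a s, |s| ≤ s₀ → Real.exp s * ∫ u, Real.exp (-γ a * (s + Λ * s ^ 2) * u) ∂m a ≤ 1
  up : ∀ a s, |s| ≤ s₀ → ∀ c ≤ 4 * y, Real.exp s * ∫ u, Real.exp (c * u) ∂m a ≤ K
  down : ∀ a s, |s| ≤ s₁ →
    Real.exp s * ∫ u, Real.exp ((-γ a * (s + Λ * s ^ 2) - y) * u) ∂m a ≤ 1 - η

section Lyapunov

variable {I J : ℕ} (N : Network I J)

/-- Weights of the queue lengths in the `k`-th exponential: `λ` times the diffusion-scaled workload
of resource `i` for `k = some i`, and `0` for `k = none`. -/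
def wt (γ : Idx J → ℝ) (lam : ℝ) (r : ℕ) : Option (Fin I) → Fin J → ℝ
  | none => 0
  | some i => fun j => lam * N.K i j / (r * γ (Sum.inr j))

/-- Exponentials `e^{±λ w_i / r}` of the workloads. -/
def V₁ (γ : Idx J → ℝ) (Λ lam : ℝ) (r : ℕ) (x : Config J) : ℝ :=
  ∑ i : Fin I, (expo (wt N γ lam r (some i)) (cf Λ γ (wt N γ lam r (some i))) x +
    expo (-wt N γ lam r (some i)) (cf Λ γ (-wt N γ lam r (some i))) x)

/-- Exponentials of the residual times, weighted with those of the workloads. -/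
def V₃ (γ : Idx J → ℝ) (Λ lam y G : ℝ) (r : ℕ) (x : Config J) : ℝ :=
  ∑ k : Option (Fin I), ∑ a : Idx J,
    (expo (wt N γ lam r k) (cf Λ γ (wt N γ lam r k) + Pi.single a y) x +
      G * expo (wt N γ lam r k) (cf Λ γ (wt N γ lam r k) - Pi.single a y) x)

/-- The exponential used while job type `j` is blocked; it decreases at rate of order `1/b`. -/
def expoB (γ : Idx J → ℝ) (Λ lam y b : ℝ) (r : ℕ) (k : Option (Fin I)) (j : Fin J)
    (x : Config J) : ℝ :=
  expo (wt N γ lam r k - Pi.single j b⁻¹)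
    (Function.update (cf Λ γ (wt N γ lam r k - Pi.single j b⁻¹)) (Sum.inr j) (2 * y)) x

/-- The exponential used while job type `j` is not blocked; it is small for long queues. -/
def expoU (γ : Idx J → ℝ) (Λ lam θ : ℝ) (r : ℕ) (k : Option (Fin I)) (j : Fin J)
    (x : Config J) : ℝ :=
  expo (wt N γ lam r k - Pi.single j θ) (cf Λ γ (wt N γ lam r k - Pi.single j θ)) x

/-- Penalty for blocked job types. -/
def V₂ (γ : Idx J → ℝ) (Λ lam y θ b B₁ lo hi : ℝ) (r : ℕ) (x : Config J) : ℝ :=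
  ∑ k : Option (Fin I), ∑ j : Fin J,
    if x.2.2 j = true then Real.exp (hi * b⁻¹) * expoB N γ Λ lam y b r k j x
    else B₁ * Real.exp (θ * lo) * expoU N γ Λ lam θ r k j x

variable {N} {γ : Idx J → ℝ} {Λ s₀ s₁ y K η : ℝ} {m : Idx J → Measure ℝ}

theorem V₁_jump (hm : JumpLaw γ Λ s₀ s₁ y K η m) {lam : ℝ} {r : ℕ} (hy : 0 ≤ y)
    (hwt : ∀ k a, |sg (wt N γ lam r k) a| ≤ s₀)
    (hcf : ∀ k a, |cf Λ γ (wt N γ lam r k) a| ≤ y ∧ |cf Λ γ (-wt N γ lam r k) a| ≤ y)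
    (lo hi : ℝ) {x : Config J} (hR : ∀ a, 0 ≤ x.2.1 a) :
    Integrable (fun y => V₁ N γ Λ lam r (jump lo hi x y)) (Measure.pi m) ∧
      ∫ y, V₁ N γ Λ lam r (jump lo hi x y) ∂Measure.pi m ≤ V₁ N γ Λ lam r x := by
  have := hm.prob
  have i1 : ∀ i : Fin I, Integrable (fun y => expo (wt N γ lam r (some i))
      (cf Λ γ (wt N γ lam r (some i))) (jump lo hi x y)) (Measure.pi m) := fun i =>
    integrable_expo_jump lo hi _ _ x fun a _ => hm.int_exp a _ (by
      linarith [(hcf (some i) a).1, le_abs_self (cf Λ γ (wt N γ lam r (some i)) a)])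
  have i2 : ∀ i : Fin I, Integrable (fun y => expo (-wt N γ lam r (some i))
      (cf Λ γ (-wt N γ lam r (some i))) (jump lo hi x y)) (Measure.pi m) := fun i =>
    integrable_expo_jump lo hi _ _ x fun a _ => hm.int_exp a _ (by
      linarith [(hcf (some i) a).2, le_abs_self (cf Λ γ (-wt N γ lam r (some i)) a)])
  have i3 : ∀ i : Fin I, Integrable (fun y => expo (wt N γ lam r (some i))
      (cf Λ γ (wt N γ lam r (some i))) (jump lo hi x y) + expo (-wt N γ lam r (some i))
      (cf Λ γ (-wt N γ lam r (some i))) (jump lo hi x y)) (Measure.pi m) := fun i =>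
    (i1 i).add (i2 i)
  refine ⟨integrable_finsetSum _ fun i _ => i3 i, ?_⟩
  unfold V₁
  rw [integral_finsetSum _ fun i _ => i3 i]
  refine Finset.sum_le_sum fun i _ => ?_
  rw [integral_add (i1 i) (i2 i)]
  refine add_le_add (integral_expo_jump_le_self lo hi _ _ x hR fun a _ =>
    hm.one a _ (hwt _ _)) (integral_expo_jump_le_self lo hi _ _ x hR fun a _ => hm.one a _ ?_)
  have : sg (-wt N γ lam r (some i)) a = -sg (wt N γ lam r (some i)) a := by
    rcases a with j | j <;> simp [sg]
  rw [this, abs_neg]; exact hwt _ _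

theorem numFire_nonneg (x : Config J) : 0 ≤ numFire x :=
  Finset.sum_nonneg fun a _ => by split_ifs <;> norm_num

/-- At a jump `V₃` decreases in the mean at least by the number of processes that fire. -/
theorem V₃_jump (hm : JumpLaw γ Λ s₀ s₁ y K η m) {lam : ℝ} {r : ℕ} (hy : 0 ≤ y) (hη : 0 < η)
    (hwt : ∀ k a, |sg (wt N γ lam r k) a| ≤ s₀) (hwt1 : ∀ k a, |sg (wt N γ lam r k) a| ≤ s₁)
    (hcf : ∀ k a, |cf Λ γ (wt N γ lam r k) a| ≤ y)
    (lo hi : ℝ) {x : Config J} (hR : ∀ a, 0 ≤ x.2.1 a) (hK : 0 ≤ K) :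
    Integrable (fun z => V₃ N γ Λ lam y (K / η) r (jump lo hi x z)) (Measure.pi m) ∧
      ∫ z, V₃ N γ Λ lam y (K / η) r (jump lo hi x z) ∂Measure.pi m ≤
        V₃ N γ Λ lam y (K / η) r x - numFire x := by
  have := hm.prob
  have hG : 0 ≤ K / η := by positivity
  have i1 : ∀ k a, Integrable (fun z => expo (wt N γ lam r k)
      (cf Λ γ (wt N γ lam r k) + Pi.single a y) (jump lo hi x z)) (Measure.pi m) := fun k a =>
    integrable_expo_jump lo hi _ _ x fun a' _ => hm.int_exp a' _ (by
      have h1 := le_abs_self (cf Λ γ (wt N γ lam r k) a')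
      have h2 : (Pi.single a y : Idx J → ℝ) a' ≤ y := by
        rw [Pi.single_apply]; split_ifs <;> linarith
      rw [Pi.add_apply]
      linarith [hcf k a'])
  have i2 : ∀ k a, Integrable (fun z => expo (wt N γ lam r k)
      (cf Λ γ (wt N γ lam r k) - Pi.single a y) (jump lo hi x z)) (Measure.pi m) := fun k a =>
    integrable_expo_jump lo hi _ _ x fun a' _ => hm.int_exp a' _ (by
      have h1 := le_abs_self (cf Λ γ (wt N γ lam r k) a')
      have h2 : 0 ≤ (Pi.single a y : Idx J → ℝ) a' := by
        rw [Pi.single_apply]; split_ifs <;> linarith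
      rw [Pi.sub_apply]
      linarith [hcf k a'])
  have i3 : ∀ k a, Integrable (fun z => expo (wt N γ lam r k) (cf Λ γ (wt N γ lam r k) +
      Pi.single a y) (jump lo hi x z) + K / η * expo (wt N γ lam r k)
      (cf Λ γ (wt N γ lam r k) - Pi.single a y) (jump lo hi x z)) (Measure.pi m) := fun k a =>
    (i1 k a).add ((i2 k a).const_mul (K / η))
  have i4 : ∀ k, Integrable (fun z => ∑ a, (expo (wt N γ lam r k) (cf Λ γ (wt N γ lam r k) +
      Pi.single a y) (jump lo hi x z) + K / η * expo (wt N γ lam r k)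
      (cf Λ γ (wt N γ lam r k) - Pi.single a y) (jump lo hi x z))) (Measure.pi m) := fun k =>
    integrable_finsetSum _ fun a _ => i3 k a
  refine ⟨integrable_finsetSum _ fun k _ => i4 k, ?_⟩
  unfold V₃
  rw [integral_finsetSum _ fun k _ => i4 k]
  -- each fired process gains at least its own exponential
  have key : ∀ k a, ∫ z, (expo (wt N γ lam r k) (cf Λ γ (wt N γ lam r k) + Pi.single a y)
        (jump lo hi x z) + K / η * expo (wt N γ lam r k)
        (cf Λ γ (wt N γ lam r k) - Pi.single a y) (jump lo hi x z)) ∂Measure.pi m ≤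
      expo (wt N γ lam r k) (cf Λ γ (wt N γ lam r k) + Pi.single a y) x +
      K / η * expo (wt N γ lam r k) (cf Λ γ (wt N γ lam r k) - Pi.single a y) x -
      (if x.2.1 a ≤ 0 then expo (wt N γ lam r k) (cf Λ γ (wt N γ lam r k)) x else 0) := by
    intro k a
    rw [integral_add (i1 k a) ((i2 k a).const_mul _), integral_const_mul]
    have e1 := integral_expo_jump_le (m := m) lo hi (wt N γ lam r k)
      (cf Λ γ (wt N γ lam r k) + Pi.single a y) x hR a K
      (fun a' ha' _ => by
        rw [Pi.add_apply, Pi.single_eq_of_ne ha', add_zero]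
        exact hm.one a' _ (hwt k a'))
      (fun _ => hm.up a _ (hwt k a) _ (by
        rw [Pi.add_apply, Pi.single_eq_same]
        linarith [hcf k a, le_abs_self (cf Λ γ (wt N γ lam r k) a)]))
    have e2 := integral_expo_jump_le (m := m) lo hi (wt N γ lam r k)
      (cf Λ γ (wt N γ lam r k) - Pi.single a y) x hR a (1 - η)
      (fun a' ha' _ => by
        rw [Pi.sub_apply, Pi.single_eq_of_ne ha', sub_zero]
        exact hm.one a' _ (hwt k a'))
      (fun _ => by
        rw [Pi.sub_apply, Pi.single_eq_same]
        exact hm.down a _ (hwt1 k a))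
    by_cases h : x.2.1 a ≤ 0
    · have hRa : x.2.1 a = 0 := le_antisymm h (hR a)
      have hs : ∑ a', (Pi.single a y : Idx J → ℝ) a' * x.2.1 a' = 0 := by
        rw [Finset.sum_eq_single a (fun a' _ ha' => by rw [Pi.single_eq_of_ne ha', zero_mul])
          (fun h => absurd (Finset.mem_univ _) h), hRa, mul_zero]
      have f1 : expo (wt N γ lam r k) (cf Λ γ (wt N γ lam r k) + Pi.single a y) x =
          expo (wt N γ lam r k) (cf Λ γ (wt N γ lam r k)) x := by
        simp only [expo, Pi.add_apply, add_mul, Finset.sum_add_distrib, hs, add_zero]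
      have f2 : expo (wt N γ lam r k) (cf Λ γ (wt N γ lam r k) - Pi.single a y) x =
          expo (wt N γ lam r k) (cf Λ γ (wt N γ lam r k)) x := by
        simp only [expo, Pi.sub_apply, sub_mul, Finset.sum_sub_distrib, hs, sub_zero]
      rw [if_pos h, f1] at e1
      rw [if_pos h, f2] at e2
      rw [if_pos h, f1, f2]
      have e3 := mul_le_mul_of_nonneg_left e2 hG
      have e4 : K / η * ((1 - η) * expo (wt N γ lam r k) (cf Λ γ (wt N γ lam r k)) x) =
          K / η * expo (wt N γ lam r k) (cf Λ γ (wt N γ lam r k)) x -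
          K * expo (wt N γ lam r k) (cf Λ γ (wt N γ lam r k)) x := by
        field_simp
      linarith
    · rw [if_neg h, one_mul] at e1 e2
      rw [if_neg h, sub_zero]
      exact add_le_add e1 (mul_le_mul_of_nonneg_left e2 hG)
  have h1 : ∀ k, ∫ z, ∑ a, (expo (wt N γ lam r k) (cf Λ γ (wt N γ lam r k) + Pi.single a y)
        (jump lo hi x z) + K / η * expo (wt N γ lam r k)
        (cf Λ γ (wt N γ lam r k) - Pi.single a y) (jump lo hi x z)) ∂Measure.pi m ≤
      ∑ a, (expo (wt N γ lam r k) (cf Λ γ (wt N γ lam r k) + Pi.single a y) x +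
      K / η * expo (wt N γ lam r k) (cf Λ γ (wt N γ lam r k) - Pi.single a y) x) -
      ∑ a, (if x.2.1 a ≤ 0 then expo (wt N γ lam r k) (cf Λ γ (wt N γ lam r k)) x else 0) := by
    intro k
    rw [integral_finsetSum _ fun a _ => i3 k a, ← Finset.sum_sub_distrib]
    exact Finset.sum_le_sum fun a _ => key k a
  refine (Finset.sum_le_sum fun k _ => h1 k).trans ?_
  rw [Finset.sum_sub_distrib]
  refine sub_le_sub_left ?_ _
  have h2 : numFire x = ∑ a, (if x.2.1 a ≤ 0 then
      expo (wt N γ lam r none) (cf Λ γ (wt N γ lam r none)) x else 0) := by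
    refine Finset.sum_congr rfl fun a _ => ?_
    have : expo (wt N γ lam r none) (cf Λ γ (wt N γ lam r none)) x = 1 := by
      have h3 : ∀ a, sg (0 : Fin J → ℝ) a = 0 := fun a => by rcases a with j | j <;> simp [sg]
      simp [expo, wt, cf, h3]
    rw [this]
  rw [h2]
  exact Finset.single_le_sum (f := fun k => ∑ a, (if x.2.1 a ≤ 0 then
      expo (wt N γ lam r k) (cf Λ γ (wt N γ lam r k)) x else 0)) (fun k _ =>
    Finset.sum_nonneg fun a _ => by split_ifs; exacts [(expo_pos _ _ _).le, le_rfl])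
    (Finset.mem_univ none)

end Lyapunov
end RSN
end

noncomputable section

namespace RSN

/-! ### The penalty for blocked job types at jumps -/

/-- States that the process visits. -/
structure Valid {J : ℕ} (lo hi : ℝ) (x : Config J) : Prop where
  q_nonneg : ∀ j, 0 ≤ x.1 j
  R_nonneg : ∀ a, 0 ≤ x.2.1 a
  lo_le : ∀ j, x.2.2 j = false → lo ≤ x.1 j
  lt_hi : ∀ j, x.2.2 j = true → x.1 j < hi
  R_pos : ∀ j, x.2.2 j = true → 0 < x.2.1 (Sum.inr j)

section Blocking

variable {I J : ℕ} {N : Network I J} {γ : Idx J → ℝ} {Λ s₀ s₁ y K η : ℝ} {m : Idx J → Measure ℝ}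

theorem sg_sub (σ σ' : Fin J → ℝ) (a : Idx J) : sg (σ - σ') a = sg σ a - sg σ' a := by
  rcases a with j | j
  · simp [sg]
  · simp only [sg, Sum.elim_inr, Pi.sub_apply]; ring

theorem sg_single_eq_zero {j : Fin J} {t : ℝ} {a : Idx J} (h1 : a ≠ Sum.inl j)
    (h2 : a ≠ Sum.inr j) : sg (Pi.single j t) a = 0 := by
  rcases a with i | i
  · have : i ≠ j := fun h => h1 (by rw [h])
    simp [sg, this]
  · have : i ≠ j := fun h => h2 (by rw [h])
    simp [sg, this]

theorem cf_sub_single {σ : Fin J → ℝ} {j : Fin J} {t : ℝ} {a : Idx J} (h1 : a ≠ Sum.inl j)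
    (h2 : a ≠ Sum.inr j) : cf Λ γ (σ - Pi.single j t) a = cf Λ γ σ a := by
  rw [cf, sg_sub, sg_single_eq_zero h1 h2, sub_zero, cf]

/-- Sums over the renewal processes of two coefficient vectors that differ only at job type `j`. -/
theorem sum_mul_sub_sum_mul {c c' R : Idx J → ℝ} (j : Fin J)
    (h : ∀ a, a ≠ Sum.inl j → a ≠ Sum.inr j → c a = c' a) :
    ∑ a, c a * R a - ∑ a, c' a * R a = (c (Sum.inl j) - c' (Sum.inl j)) * R (Sum.inl j) +
      (c (Sum.inr j) - c' (Sum.inr j)) * R (Sum.inr j) := by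
  rw [← Finset.sum_sub_distrib, Fintype.sum_sum_type,
    Finset.sum_eq_single j (fun i _ hi => by
      rw [h (Sum.inl i) (by simpa using hi) (by simp), sub_self]) (by simp),
    Finset.sum_eq_single j (fun i _ hi => by
      rw [h (Sum.inr i) (by simp) (by simpa using hi), sub_self]) (by simp)]
  ring

theorem sum_sub_single_mul (σ q : Fin J → ℝ) (j : Fin J) (t : ℝ) :
    ∑ i, (σ - Pi.single j t : Fin J → ℝ) i * q i = ∑ i, σ i * q i - t * q j := by
  simp only [Pi.sub_apply, sub_mul, Finset.sum_sub_distrib]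
  congr 1
  rw [Finset.sum_eq_single j (fun i _ hi => by rw [Pi.single_eq_of_ne hi, zero_mul]) (by simp),
    Pi.single_eq_same]

/-- `cf` is monotone in the weight near the origin. -/
theorem cf_le_cf {σ σ' : Fin J → ℝ} {a : Idx J} (hγ : 0 ≤ γ a) (hΛ : 0 ≤ Λ)
    (h1 : 2 * Λ * |sg σ a| ≤ 1) (h2 : 2 * Λ * |sg σ' a| ≤ 1) (h : sg σ' a ≤ sg σ a) :
    cf Λ γ σ a ≤ cf Λ γ σ' a := by
  unfold cf
  have h4 := abs_le.1 (le_refl |sg σ' a|)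
  have h5 : 0 ≤ 1 + Λ * (sg σ a + sg σ' a) := by nlinarith
  have h6 : sg σ' a + Λ * sg σ' a ^ 2 ≤ sg σ a + Λ * sg σ a ^ 2 := by
    nlinarith [mul_nonneg (sub_nonneg.2 h) h5]
  nlinarith

/-- At a jump the mean of a summand of `V₂` does not increase. If the indicator of `j` switches, then
the exponentials `expoB` and `expoU` are compared at the threshold that is crossed: the two
conditions on `B₁` say that the jump in either direction is downward. -/
theorem V₂_term_jump (hm : JumpLaw γ Λ s₀ s₁ y K η m) {lam θ b B₁ lo hi : ℝ} {r : ℕ}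
    (hγ : ∀ a, 0 < γ a) (hΛ : 0 ≤ Λ) (hs₀ : 2 * Λ * s₀ ≤ 1) (hy : 0 ≤ y) (hb : 0 < b)
    (hθ : b⁻¹ ≤ θ) (hlo : 0 ≤ lo)
    (hsB : ∀ k j a, |sg (wt N γ lam r k - Pi.single j b⁻¹) a| ≤ s₀)
    (hsU : ∀ k j a, |sg (wt N γ lam r k - Pi.single j θ) a| ≤ s₀)
    (hcB : ∀ k j a, |cf Λ γ (wt N γ lam r k - Pi.single j b⁻¹) a| ≤ 2 * y)
    (hcU : ∀ k j a, |cf Λ γ (wt N γ lam r k - Pi.single j θ) a| ≤ 2 * y)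
    (hB1 : K * Real.exp (θ + hi * b⁻¹) ≤ B₁) (hB2 : B₁ ≤ Real.exp (θ * (hi - lo) - θ))
    {x : Config J} (hx : Valid lo hi x) (k : Option (Fin I)) (j : Fin J) :
    Integrable (fun z => if (jump lo hi x z).2.2 j = true then
        Real.exp (hi * b⁻¹) * expoB N γ Λ lam y b r k j (jump lo hi x z)
        else B₁ * Real.exp (θ * lo) * expoU N γ Λ lam θ r k j (jump lo hi x z)) (Measure.pi m) ∧
      ∫ z, (if (jump lo hi x z).2.2 j = true then
        Real.exp (hi * b⁻¹) * expoB N γ Λ lam y b r k j (jump lo hi x z)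
        else B₁ * Real.exp (θ * lo) * expoU N γ Λ lam θ r k j (jump lo hi x z)) ∂Measure.pi m ≤
      if x.2.2 j = true then Real.exp (hi * b⁻¹) * expoB N γ Λ lam y b r k j x
        else B₁ * Real.exp (θ * lo) * expoU N γ Λ lam θ r k j x := by
  have := hm.prob
  have hK : 0 ≤ K := le_trans (integral_nonneg fun u => sq_nonneg _) (hm.sq_le (Sum.inl j))
  have hB₁ : 0 ≤ B₁ := le_trans (by positivity) hB1
  have iB : Integrable (fun z => expoB N γ Λ lam y b r k j (jump lo hi x z)) (Measure.pi m) :=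
    integrable_expo_jump lo hi _ _ x fun a _ => hm.int_exp a _ (by
      by_cases ha : a = Sum.inr j
      · subst ha; rw [Function.update_self]; linarith
      · rw [Function.update_of_ne ha]
        linarith [le_abs_self (cf Λ γ (wt N γ lam r k - Pi.single j b⁻¹) a), hcB k j a])
  have iU : Integrable (fun z => expoU N γ Λ lam θ r k j (jump lo hi x z)) (Measure.pi m) :=
    integrable_expo_jump lo hi _ _ x fun a _ => hm.int_exp a _ (by
      linarith [le_abs_self (cf Λ γ (wt N γ lam r k - Pi.single j θ) a), hcU k j a])
  -- the coefficients of the two exponentials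
  have hcl : cf Λ γ (wt N γ lam r k - Pi.single j b⁻¹) (Sum.inl j) ≤
      cf Λ γ (wt N γ lam r k - Pi.single j θ) (Sum.inl j) := by
    refine cf_le_cf (hγ _).le hΛ ?_ ?_ ?_
    · nlinarith [hsB k j (Sum.inl j)]
    · nlinarith [hsU k j (Sum.inl j)]
    · simp only [sg, Sum.elim_inl, Pi.sub_apply, Pi.single_eq_same]; linarith
  have hdiff := sum_mul_sub_sum_mul (R := x.2.1) (c := cf Λ γ (wt N γ lam r k - Pi.single j θ))
    (c' := Function.update (cf Λ γ (wt N γ lam r k - Pi.single j b⁻¹)) (Sum.inr j) (2 * y)) j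
    (fun a h1 h2 => by
      rw [Function.update_of_ne h2, cf_sub_single h1 h2, cf_sub_single h1 h2])
  rw [Function.update_self, Function.update_of_ne (by simp)] at hdiff
  have hU : ∫ z, expoU N γ Λ lam θ r k j (jump lo hi x z) ∂Measure.pi m ≤
      expoU N γ Λ lam θ r k j x :=
    integral_expo_jump_le_self lo hi _ _ x hx.R_nonneg fun a _ => hm.one a _ (hsU k j a)
  have hE' : ∀ z, (jump lo hi x z).2.2 j = updE lo hi (x.2.2 j) (jumpQ x j) := fun _ => rfl
  simp only [hE']
  rcases hE : x.2.2 j with _ | _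
  · by_cases hq : jumpQ x j < lo
    -- `j` becomes blocked; its service has just ended, and its queue length is at most `lo + 1`
    · have h1 : updE lo hi false (jumpQ x j) = true := by simp [updE, hq]
      simp only [h1, if_true, Bool.false_eq_true, if_false]
      refine ⟨iB.const_mul _, ?_⟩
      rw [integral_const_mul]
      have hlo' := hx.lo_le j hE
      have hfire : x.2.1 (Sum.inr j) ≤ 0 := by
        by_contra hcon
        unfold jumpQ at hq
        rw [if_neg hcon] at hq
        split_ifs at hq <;> linarith
      have hR0 : x.2.1 (Sum.inr j) = 0 := le_antisymm hfire (hx.R_nonneg _)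
      have hq1 : x.1 j ≤ lo + 1 := by
        unfold jumpQ at hq
        split_ifs at hq <;> linarith
      have h2 := integral_expo_jump_le (m := m) lo hi (wt N γ lam r k - Pi.single j b⁻¹)
        (Function.update (cf Λ γ (wt N γ lam r k - Pi.single j b⁻¹)) (Sum.inr j) (2 * y)) x
        hx.R_nonneg (Sum.inr j) K
        (fun a ha _ => by rw [Function.update_of_ne ha]; exact hm.one a _ (hsB k j a))
        (fun _ => by
          rw [Function.update_self]
          exact hm.up _ _ (hsB k j _) _ (by linarith))
      rw [if_pos hfire] at h2
      have h3 : Real.exp (hi * b⁻¹) * expoB N γ Λ lam y b r k j x ≤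
          Real.exp (θ + hi * b⁻¹) * (Real.exp (θ * lo) * expoU N γ Λ lam θ r k j x) := by
        unfold expoB expoU expo
        rw [← Real.exp_add, ← Real.exp_add, ← Real.exp_add, sum_sub_single_mul,
          sum_sub_single_mul]
        refine Real.exp_le_exp.2 ?_
        rw [hR0, mul_zero, add_zero] at hdiff
        have h4 := mul_nonneg (sub_nonneg.2 hcl) (hx.R_nonneg (Sum.inl j))
        have h5 := mul_le_mul_of_nonneg_left hq1 (sub_nonneg.2 hθ)
        have h6 : 0 ≤ b⁻¹ * (lo + 1) := by positivity
        nlinarith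
      calc Real.exp (hi * b⁻¹) * ∫ z, expoB N γ Λ lam y b r k j (jump lo hi x z) ∂Measure.pi m
          ≤ Real.exp (hi * b⁻¹) * (K * expoB N γ Λ lam y b r k j x) :=
            mul_le_mul_of_nonneg_left h2 (Real.exp_pos _).le
        _ = K * (Real.exp (hi * b⁻¹) * expoB N γ Λ lam y b r k j x) := by ring
        _ ≤ K * (Real.exp (θ + hi * b⁻¹) * (Real.exp (θ * lo) * expoU N γ Λ lam θ r k j x)) :=
            mul_le_mul_of_nonneg_left h3 hK
        _ = K * Real.exp (θ + hi * b⁻¹) * (Real.exp (θ * lo) * expoU N γ Λ lam θ r k j x) := by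
            ring
        _ ≤ B₁ * (Real.exp (θ * lo) * expoU N γ Λ lam θ r k j x) :=
            mul_le_mul_of_nonneg_right hB1 (mul_pos (Real.exp_pos _) (expo_pos _ _ _)).le
        _ = _ := by ring
    · have h1 : updE lo hi false (jumpQ x j) = false := by simp [updE]; linarith
      simp only [h1, Bool.false_eq_true, if_false]
      refine ⟨iU.const_mul _, ?_⟩
      rw [integral_const_mul]
      exact mul_le_mul_of_nonneg_left hU (mul_nonneg hB₁ (Real.exp_pos _).le)
  · have hRp := hx.R_pos j hE
    have hqh := hx.lt_hi j hE
    by_cases hq : jumpQ x j < hi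
    · have h1 : updE lo hi true (jumpQ x j) = true := by simp [updE, hq]
      simp only [h1, if_true]
      refine ⟨iB.const_mul _, ?_⟩
      rw [integral_const_mul]
      refine mul_le_mul_of_nonneg_left ?_ (Real.exp_pos _).le
      refine integral_expo_jump_le_self lo hi _ _ x hx.R_nonneg fun a ha => ?_
      have hne : a ≠ Sum.inr j := by rintro rfl; linarith
      rw [Function.update_of_ne hne]
      exact hm.one a _ (hsB k j a)
    -- service of `j` resumes; there was an arrival, and the queue length is at least `hi - 1`
    · have h1 : updE lo hi true (jumpQ x j) = false := by simp [updE]; linarith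
      simp only [h1, if_true, Bool.false_eq_true, if_false]
      refine ⟨iU.const_mul _, ?_⟩
      rw [integral_const_mul]
      have hnf : ¬ x.2.1 (Sum.inr j) ≤ 0 := not_le.2 hRp
      have hfire : x.2.1 (Sum.inl j) ≤ 0 := by
        by_contra hcon
        unfold jumpQ at hq
        rw [if_neg hcon, if_neg hnf] at hq
        linarith
      have hR0 : x.2.1 (Sum.inl j) = 0 := le_antisymm hfire (hx.R_nonneg _)
      have hq1 : hi - 1 ≤ x.1 j := by
        unfold jumpQ at hq
        rw [if_pos hfire, if_neg hnf] at hq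
        linarith
      have h3 : Real.exp (θ * (hi - lo) - θ) * (Real.exp (θ * lo) * expoU N γ Λ lam θ r k j x) ≤
          Real.exp (hi * b⁻¹) * expoB N γ Λ lam y b r k j x := by
        unfold expoB expoU expo
        rw [← Real.exp_add, ← Real.exp_add, ← Real.exp_add, sum_sub_single_mul,
          sum_sub_single_mul]
        refine Real.exp_le_exp.2 ?_
        rw [hR0, mul_zero, zero_add] at hdiff
        have h4 : (cf Λ γ (wt N γ lam r k - Pi.single j θ) (Sum.inr j) - 2 * y) *
            x.2.1 (Sum.inr j) ≤ 0 := mul_nonpos_of_nonpos_of_nonneg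
          (by linarith [le_abs_self (cf Λ γ (wt N γ lam r k - Pi.single j θ) (Sum.inr j)),
            hcU k j (Sum.inr j)]) hRp.le
        have h5 := mul_le_mul_of_nonneg_left hq1 (sub_nonneg.2 hθ)
        have h6 : 0 ≤ b⁻¹ := by positivity
        nlinarith
      calc _ ≤ B₁ * Real.exp (θ * lo) * expoU N γ Λ lam θ r k j x :=
            mul_le_mul_of_nonneg_left hU (mul_nonneg hB₁ (Real.exp_pos _).le)
        _ = B₁ * (Real.exp (θ * lo) * expoU N γ Λ lam θ r k j x) := by ring
        _ ≤ _ := (mul_le_mul_of_nonneg_right hB2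
            (mul_pos (Real.exp_pos _) (expo_pos _ _ _)).le).trans h3

theorem V₂_jump (hm : JumpLaw γ Λ s₀ s₁ y K η m) {lam θ b B₁ lo hi : ℝ} {r : ℕ}
    (hγ : ∀ a, 0 < γ a) (hΛ : 0 ≤ Λ) (hs₀ : 2 * Λ * s₀ ≤ 1) (hy : 0 ≤ y) (hb : 0 < b)
    (hθ : b⁻¹ ≤ θ) (hlo : 0 ≤ lo)
    (hsB : ∀ k j a, |sg (wt N γ lam r k - Pi.single j b⁻¹) a| ≤ s₀)
    (hsU : ∀ k j a, |sg (wt N γ lam r k - Pi.single j θ) a| ≤ s₀)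
    (hcB : ∀ k j a, |cf Λ γ (wt N γ lam r k - Pi.single j b⁻¹) a| ≤ 2 * y)
    (hcU : ∀ k j a, |cf Λ γ (wt N γ lam r k - Pi.single j θ) a| ≤ 2 * y)
    (hB1 : K * Real.exp (θ + hi * b⁻¹) ≤ B₁) (hB2 : B₁ ≤ Real.exp (θ * (hi - lo) - θ))
    {x : Config J} (hx : Valid lo hi x) :
    Integrable (fun z => V₂ N γ Λ lam y θ b B₁ lo hi r (jump lo hi x z)) (Measure.pi m) ∧
      ∫ z, V₂ N γ Λ lam y θ b B₁ lo hi r (jump lo hi x z) ∂Measure.pi m ≤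
        V₂ N γ Λ lam y θ b B₁ lo hi r x := by
  have key := V₂_term_jump (N := N) hm hγ hΛ hs₀ hy hb hθ hlo hsB hsU hcB hcU hB1 hB2 hx
  refine ⟨integrable_finsetSum _ fun k _ => integrable_finsetSum _ fun j _ => (key k j).1, ?_⟩
  unfold V₂
  rw [integral_finsetSum _ fun k _ => integrable_finsetSum _ fun j _ => (key k j).1]
  refine Finset.sum_le_sum fun k _ => ?_
  rw [integral_finsetSum _ fun j _ => (key k j).1]
  exact Finset.sum_le_sum fun j _ => (key k j).2

end Blocking
end RSN
end

noncomputable section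

namespace RSN

/-! ### The corrected cost gap at jumps -/

section GapPart

variable {I J : ℕ}

/-- Queue lengths corrected by the residual times: the correction turns the queue lengths into a
martingale plus a continuous drift. -/
def qt (γ : Idx J → ℝ) (x : Config J) (j : Fin J) : ℝ :=
  x.1 j - γ (Sum.inl j) * x.2.1 (Sum.inl j) + γ (Sum.inr j) * x.2.1 (Sum.inr j)

/-- A smooth convex function with slope between `-2` and `0`, close to `0` for large arguments and at
most `-1/4` for arguments up to `ℓ`. -/
def phi (ℓ w : ℝ) : ℝ := √(ℓ ^ 2 + w ^ 2) - w

/-- The corrected cost gap. The terms with `phi` compensate the growth of empty resources' workload,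
those with the residual times the curvature of `phi`. -/
def Y (N : Network I J) (γ : Idx J → ℝ) (Cp Cφ Gχ ℓ y : ℝ) (x : Config J) : ℝ :=
  N.gap Cp (qt γ x) + Cφ * ∑ i, phi ℓ (N.wl (qt γ x) i) + Gχ * ∑ a, Real.exp (-y * x.2.1 a)

theorem phi_nonneg (ℓ w : ℝ) : 0 ≤ phi ℓ w := by
  unfold phi
  have : |w| ≤ √(ℓ ^ 2 + w ^ 2) := Real.abs_le_sqrt (by nlinarith [sq_nonneg ℓ])
  linarith [le_abs_self w]

/-- Second order bound for `phi`. -/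
theorem phi_add_le {ℓ : ℝ} (hℓ : 0 < ℓ) (w d : ℝ) :
    phi ℓ (w + d) ≤ phi ℓ w + (w / √(ℓ ^ 2 + w ^ 2) - 1) * d + d ^ 2 / (2 * ℓ) := by
  unfold phi
  set s := √(ℓ ^ 2 + w ^ 2) with hs
  have hs2 : s ^ 2 = ℓ ^ 2 + w ^ 2 := Real.sq_sqrt (by positivity)
  have hsℓ : ℓ ≤ s := Real.le_sqrt_of_sq_le (by nlinarith [sq_nonneg w])
  have hs0 : 0 < s := hℓ.trans_le hsℓ
  have h1 : √(ℓ ^ 2 + (w + d) ^ 2) ≤ s + w * d / s + d ^ 2 / (2 * s) := by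
    have h2 : s + w * d / s + d ^ 2 / (2 * s) = s + (2 * w * d + d ^ 2) / (2 * s) := by
      field_simp; ring
    rw [h2]
    have h3 : ℓ ^ 2 + (w + d) ^ 2 ≤ (s + (2 * w * d + d ^ 2) / (2 * s)) ^ 2 := by
      have h4 : (s + (2 * w * d + d ^ 2) / (2 * s)) ^ 2 =
          s ^ 2 + (2 * w * d + d ^ 2) + ((2 * w * d + d ^ 2) / (2 * s)) ^ 2 := by
        field_simp; ring
      rw [h4, hs2]
      nlinarith [sq_nonneg ((2 * w * d + d ^ 2) / (2 * s))]
    refine Real.sqrt_le_iff.2 ⟨?_, h3⟩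
    have h5 : s + (2 * w * d + d ^ 2) / (2 * s) = (2 * s ^ 2 + (2 * w * d + d ^ 2)) / (2 * s) := by
      field_simp
    rw [h5]
    refine div_nonneg ?_ (by positivity)
    rw [hs2]; nlinarith [sq_nonneg (w + d), sq_nonneg ℓ, sq_nonneg w]
  have h6 : d ^ 2 / (2 * s) ≤ d ^ 2 / (2 * ℓ) := by gcongr
  have h7 : w / s * d = w * d / s := by ring
  rw [sub_mul, h7]
  linarith

theorem phi_lipschitz (ℓ w d : ℝ) : phi ℓ (w + d) ≤ phi ℓ w + 2 * |d| := by
  unfold phi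
  have h1 : √(ℓ ^ 2 + (w + d) ^ 2) ≤ √(ℓ ^ 2 + w ^ 2) + |d| := by
    refine Real.sqrt_le_iff.2 ⟨by positivity, ?_⟩
    have h2 : |w| ≤ √(ℓ ^ 2 + w ^ 2) := Real.abs_le_sqrt (by nlinarith [sq_nonneg ℓ])
    have h3 : √(ℓ ^ 2 + w ^ 2) ^ 2 = ℓ ^ 2 + w ^ 2 := Real.sq_sqrt (by positivity)
    have h4 : w * d ≤ |w| * |d| := by rw [← abs_mul]; exact le_abs_self _
    have h5 := mul_le_mul_of_nonneg_right h2 (abs_nonneg d)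
    nlinarith [sq_abs d]
  linarith [neg_abs_le d]

theorem phi_le_of_nonneg {ℓ w : ℝ} (hℓ : 0 ≤ ℓ) (hw : 0 ≤ w) : phi ℓ w ≤ ℓ := by
  unfold phi
  have : √(ℓ ^ 2 + w ^ 2) ≤ ℓ + w := Real.sqrt_le_iff.2 ⟨by positivity, by nlinarith⟩
  linarith

theorem phi_slope_le {ℓ w : ℝ} (hℓ : 0 < ℓ) (hw : w ≤ ℓ) :
    w / √(ℓ ^ 2 + w ^ 2) - 1 ≤ -(1 / 4) := by
  have hs0 : 0 < √(ℓ ^ 2 + w ^ 2) := Real.sqrt_pos.2 (by positivity)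
  have h1 : w ≤ 3 / 4 * √(ℓ ^ 2 + w ^ 2) := by
    rcases le_or_gt w 0 with h | h
    · linarith
    · have : w * (4 / 3) ≤ √(ℓ ^ 2 + w ^ 2) := Real.le_sqrt_of_sq_le (by nlinarith)
      linarith
  rw [sub_le_iff_le_add, div_le_iff₀ hs0]
  linarith

theorem phi_slope_abs_le {ℓ : ℝ} (hℓ : 0 < ℓ) (w : ℝ) : |w / √(ℓ ^ 2 + w ^ 2) - 1| ≤ 2 := by
  have hs0 : 0 < √(ℓ ^ 2 + w ^ 2) := Real.sqrt_pos.2 (by positivity)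
  have h2 : |w| ≤ √(ℓ ^ 2 + w ^ 2) := Real.abs_le_sqrt (by nlinarith [sq_nonneg ℓ])
  have h3 : |w / √(ℓ ^ 2 + w ^ 2)| ≤ 1 := by
    rw [abs_div, abs_of_pos hs0]; exact div_le_one_of_le₀ h2 hs0.le
  refine (abs_sub _ _).trans ?_
  rw [abs_one]; linarith

/-- Increment of the corrected queue lengths caused by the event of process `a`. -/
def dinc (γ : Idx J → ℝ) (x : Config J) (z : Idx J → ℝ) (a : Idx J) : ℝ :=
  if x.2.1 a ≤ 0 then 1 - γ a * z a else 0

/-- Increment of the corrected queue lengths at a jump. -/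
def dq (γ : Idx J → ℝ) (x : Config J) (z : Idx J → ℝ) (j : Fin J) : ℝ :=
  dinc γ x z (Sum.inl j) - dinc γ x z (Sum.inr j)

theorem qt_jump (γ : Idx J → ℝ) {x : Config J} (hR : ∀ a, 0 ≤ x.2.1 a) (lo hi : ℝ)
    (z : Idx J → ℝ) : qt γ (jump lo hi x z) = qt γ x + dq γ x z := by
  ext j
  have h : ∀ a, γ a * (if x.2.1 a ≤ 0 then z a else x.2.1 a) =
      (if x.2.1 a ≤ 0 then 1 else 0) + γ a * x.2.1 a - dinc γ x z a := by
    intro a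
    unfold dinc
    split_ifs with h
    · rw [le_antisymm h (hR a)]; ring
    · ring
  simp only [qt, jump, jumpQ, h, Pi.add_apply, dq]
  ring

theorem sum_abs_dq_le (γ : Idx J → ℝ) (x : Config J) (z : Idx J → ℝ) :
    ∑ j, |dq γ x z j| ≤ ∑ a, |dinc γ x z a| := by
  rw [Fintype.sum_sum_type, ← Finset.sum_add_distrib]
  exact Finset.sum_le_sum fun j _ => abs_sub _ _

variable {γ : Idx J → ℝ} {Λ s₀ s₁ y K η : ℝ} {m : Idx J → Measure ℝ}

theorem JumpLaw.integrable_eval (hm : JumpLaw γ Λ s₀ s₁ y K η m) (a : Idx J) {f : ℝ → ℝ}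
    (hf : Integrable f (m a)) : Integrable (fun z => f (z a)) (Measure.pi m) := by
  have := hm.prob
  exact integrable_comp_eval hf

theorem JumpLaw.integral_eval (hm : JumpLaw γ Λ s₀ s₁ y K η m) (a : Idx J) {f : ℝ → ℝ}
    (hf : Integrable f (m a)) : ∫ z, f (z a) ∂(Measure.pi m) = ∫ u, f u ∂m a := by
  have := hm.prob
  exact integral_comp_eval hf.aestronglyMeasurable

theorem JumpLaw.dinc_facts (hm : JumpLaw γ Λ s₀ s₁ y K η m) (x : Config J) (a : Idx J) :
    Integrable (fun z => dinc γ x z a) (Measure.pi m) ∧ ∫ z, dinc γ x z a ∂Measure.pi m = 0 ∧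
    Integrable (fun z => dinc γ x z a ^ 2) (Measure.pi m) ∧
    ∫ z, dinc γ x z a ^ 2 ∂Measure.pi m ≤ K * (if x.2.1 a ≤ 0 then 1 else 0) := by
  have := hm.prob
  unfold dinc
  by_cases h : x.2.1 a ≤ 0
  · simp only [h, if_true, mul_one]
    have h1 : Integrable (fun u : ℝ => 1 - γ a * u) (m a) :=
      (integrable_const _).sub ((hm.int_id a).const_mul _)
    have h2 : Integrable (fun u : ℝ => (1 - γ a * u) ^ 2) (m a) := by
      have : (fun u : ℝ => (1 - γ a * u) ^ 2) =
          fun u => 1 + (-2 * γ a) * u + γ a ^ 2 * u ^ 2 := by ext u; ring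
      rw [this]
      exact ((integrable_const _).add ((hm.int_id a).const_mul _)).add ((hm.int_sq a).const_mul _)
    refine ⟨hm.integrable_eval a h1, ?_, hm.integrable_eval a h2, ?_⟩
    · rw [hm.integral_eval a h1, hm.mean a]
    · rw [hm.integral_eval a h2]; exact hm.sq_le a
  · simp [h]

/-- Bounds used for the cost gap and the workload. -/
structure GapBound (N : Network I J) (Cp L Cb : ℝ) : Prop where
  L_nonneg : 0 ≤ L
  Cb_nonneg : 0 ≤ Cb
  concave : ConcaveOn ℝ Set.univ (N.gap Cp)
  lip : ∀ q q' : Fin J → ℝ, N.gap Cp q ≤ N.gap Cp q' + L * ∑ j, |q j - q' j|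
  wl_lip : ∀ (q q' : Fin J → ℝ) i, |N.wl q i - N.wl q' i| ≤ Cb * ∑ j, |q j - q' j|

theorem GapBound.abs_gap_sub_le {N : Network I J} {Cp L Cb : ℝ} (h : GapBound N Cp L Cb)
    (q q' : Fin J → ℝ) : |N.gap Cp q - N.gap Cp q'| ≤ L * ∑ j, |q j - q' j| := by
  rw [abs_le]
  have h1 := h.lip q q'
  have h2 := h.lip q' q
  simp only [abs_sub_comm (q' _)] at h2
  constructor <;> linarith

theorem GapBound.continuous_gap {N : Network I J} {Cp L Cb : ℝ} (h : GapBound N Cp L Cb) :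
    Continuous (N.gap Cp) := by
  rw [← continuousOn_univ]
  exact h.concave.continuousOn isOpen_univ

theorem continuous_wl (N : Network I J) : Continuous N.wl := by
  refine continuous_pi fun i => ?_
  simp only [Network.wl_apply]
  fun_prop

theorem continuous_phi (ℓ : ℝ) : Continuous (phi ℓ) := by
  unfold phi; fun_prop

theorem abs_phi_sub_le (ℓ w d : ℝ) : |phi ℓ (w + d) - phi ℓ w| ≤ 2 * |d| := by
  have h1 := phi_lipschitz ℓ w d
  have h2 := phi_lipschitz ℓ (w + d) (-d)
  rw [add_neg_cancel_right, abs_neg] at h2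
  rw [abs_le]; constructor <;> linarith

theorem sq_posPart_add_le (a X : ℝ) : max (a + X) 0 ^ 2 ≤ max a 0 ^ 2 + 2 * max a 0 * X + X ^ 2 := by
  have h : max a 0 ^ 2 + 2 * max a 0 * X + X ^ 2 = (max a 0 + X) ^ 2 := by ring
  rw [h]
  rcases le_total (a + X) 0 with h1 | h1
  · rw [max_eq_right h1]; nlinarith [sq_nonneg (max a 0 + X)]
  · rw [max_eq_left h1]
    exact pow_le_pow_left₀ h1 (by linarith [le_max_left a 0]) 2

/-- At a jump the mean of `Y` does not increase, and that of the square of its positive part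
increases at most by a multiple of the number of processes that fire. -/
theorem Y_sq_jump (hm : JumpLaw γ Λ s₀ s₁ y K η m) {N : Network I J} {Cp L Cb Cφ Gχ ℓ : ℝ}
    (hg : GapBound N Cp L Cb) (hCφ : 0 ≤ Cφ) (hG0 : 0 ≤ Gχ) (hG1 : Gχ ≤ 1) (hℓ : 0 < ℓ)
    (hy : 0 ≤ y) (hs₁ : 0 ≤ s₁)
    (hG : Cφ * I * Cb ^ 2 * Fintype.card (Idx J) * K ≤ 2 * ℓ * (η * Gχ))
    (lo hi : ℝ) {x : Config J} (hR : ∀ a, 0 ≤ x.2.1 a) :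
    Integrable (fun z => max (Y N γ Cp Cφ Gχ ℓ y (jump lo hi x z)) 0 ^ 2) (Measure.pi m) ∧
      ∫ z, max (Y N γ Cp Cφ Gχ ℓ y (jump lo hi x z)) 0 ^ 2 ∂Measure.pi m ≤
        max (Y N γ Cp Cφ Gχ ℓ y x) 0 ^ 2 +
        (2 * (L + 2 * Cφ * I * Cb) ^ 2 * Fintype.card (Idx J) * K + 2 * Fintype.card (Idx J)) *
          numFire x := by
  have := hm.prob
  set n : ℝ := (Fintype.card (Idx J) : ℝ) with hn
  set D : (Idx J → ℝ) → ℝ := fun z => ∑ a, |dinc γ x z a| with hD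
  have hL := hg.L_nonneg
  have hCb := hg.Cb_nonneg
  -- facts on the increments
  have hDsq : ∀ z, D z ^ 2 ≤ n * ∑ a, dinc γ x z a ^ 2 := fun z => by
    have := sq_sum_le_card_mul_sum_sq (s := Finset.univ) (f := fun a => |dinc γ x z a|)
    simpa only [sq_abs, Finset.card_univ] using this
  have iS : Integrable (fun z => ∑ a, dinc γ x z a ^ 2) (Measure.pi m) :=
    integrable_finsetSum _ fun a _ => (hm.dinc_facts x a).2.2.1
  have hS : ∫ z, ∑ a, dinc γ x z a ^ 2 ∂Measure.pi m ≤ K * numFire x := by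
    rw [integral_finsetSum _ fun a _ => (hm.dinc_facts x a).2.2.1, numFire, Finset.mul_sum]
    exact Finset.sum_le_sum fun a _ => (hm.dinc_facts x a).2.2.2
  have iD : Integrable D (Measure.pi m) :=
    integrable_finsetSum _ fun a _ => (hm.dinc_facts x a).1.abs
  have hq := qt_jump γ hR lo hi
  have hdq : ∀ z, ∑ j, |(qt γ x + dq γ x z) j - qt γ x j| ≤ D z := fun z => by
    simp only [Pi.add_apply, add_sub_cancel_left]; exact sum_abs_dq_le γ x z
  have hwd : ∀ z i, |N.wl (dq γ x z) i| ≤ Cb * D z := fun z i => by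
    have h1 := hg.wl_lip (dq γ x z) 0 i
    have h0 : N.wl (0 : Fin J → ℝ) i = 0 := by rw [Network.wl_apply]; simp
    rw [h0, sub_zero] at h1
    refine h1.trans (mul_le_mul_of_nonneg_left ?_ hCb)
    simp only [Pi.zero_apply, sub_zero]
    exact sum_abs_dq_le γ x z
  have mdq : Measurable (fun z => dq γ x z) := by
    refine measurable_pi_lambda _ fun j => ?_
    unfold dq dinc
    refine Measurable.sub ?_ ?_ <;> split_ifs <;> fun_prop
  -- the three parts of the increment of `Y`
  set X₁ : (Idx J → ℝ) → ℝ := fun z => N.gap Cp (qt γ x + dq γ x z) - N.gap Cp (qt γ x) with hX₁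
  set X₂ : (Idx J → ℝ) → ℝ := fun z => ∑ i, (phi ℓ (N.wl (qt γ x) i + N.wl (dq γ x z) i) -
    phi ℓ (N.wl (qt γ x) i)) with hX₂
  set X₃ : (Idx J → ℝ) → ℝ := fun z =>
    ∑ a, if x.2.1 a ≤ 0 then Real.exp (-y * z a) - 1 else 0 with hX₃
  have hYX : ∀ z, Y N γ Cp Cφ Gχ ℓ y (jump lo hi x z) =
      Y N γ Cp Cφ Gχ ℓ y x + (X₁ z + Cφ * X₂ z + Gχ * X₃ z) := by
    intro z
    have h3 : ∑ a, Real.exp (-y * (jump lo hi x z).2.1 a) =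
        ∑ a, Real.exp (-y * x.2.1 a) + X₃ z := by
      rw [hX₃, ← Finset.sum_add_distrib]
      refine Finset.sum_congr rfl fun a _ => ?_
      simp only [jump]
      split_ifs with h
      · rw [le_antisymm h (hR a)]; simp
      · ring
    unfold Y
    rw [h3, hq z, N.wl_add]
    simp only [hX₁, hX₂, Finset.sum_sub_distrib, Pi.add_apply]
    ring
  have b1 : ∀ z, |X₁ z| ≤ L * D z := fun z =>
    (hg.abs_gap_sub_le _ _).trans (mul_le_mul_of_nonneg_left (hdq z) hL)
  have b2 : ∀ z, |X₂ z| ≤ 2 * I * Cb * D z := fun z => by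
    refine (Finset.abs_sum_le_sum_abs _ _).trans ?_
    calc _ ≤ ∑ _i : Fin I, 2 * (Cb * D z) := Finset.sum_le_sum fun i _ =>
          (abs_phi_sub_le ℓ _ _).trans (mul_le_mul_of_nonneg_left (hwd z i) zero_le_two)
      _ = _ := by simp; ring
  have hpos : ∀ᵐ z ∂Measure.pi m, ∀ a, 0 < z a := by
    rw [ae_all_iff]
    intro a
    exact (Measure.tendsto_eval_ae_ae (i := a)).eventually (hm.pos a)
  have b3 : ∀ᵐ z ∂Measure.pi m, |X₃ z| ≤ numFire x := by
    filter_upwards [hpos] with z hz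
    refine (Finset.abs_sum_le_sum_abs _ _).trans (Finset.sum_le_sum fun a _ => ?_)
    split_ifs
    · have h1 : Real.exp (-y * z a) ≤ 1 := Real.exp_le_one_iff.2 (by nlinarith [hz a])
      have h2 := Real.exp_pos (-y * z a)
      rw [abs_le]; constructor <;> linarith
    · simp
  have m1 : Measurable X₁ :=
    (hg.continuous_gap.measurable.comp (mdq.const_add _)).sub_const _
  have m2 : Measurable X₂ := by
    refine Finset.measurable_fun_sum _ fun i _ => ?_
    exact (((continuous_phi ℓ).measurable.comp ((((measurable_pi_apply i).comp
      ((continuous_wl N).measurable.comp mdq))).const_add _))).sub_const _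
  have m3 : Measurable X₃ := by
    refine Finset.measurable_fun_sum _ fun a _ => ?_
    split_ifs <;> fun_prop
  have i1 : Integrable X₁ (Measure.pi m) :=
    (iD.const_mul L).mono' m1.aestronglyMeasurable (Eventually.of_forall b1)
  have i2 : Integrable X₂ (Measure.pi m) :=
    (iD.const_mul (2 * I * Cb)).mono' m2.aestronglyMeasurable (Eventually.of_forall b2)
  have i3 : Integrable X₃ (Measure.pi m) :=
    (integrable_const (numFire x)).mono' m3.aestronglyMeasurable b3
  -- the mean increment is not positive
  have e1 : ∫ z, X₁ z ∂Measure.pi m ≤ 0 := by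
    have idq : Integrable (fun z => dq γ x z) (Measure.pi m) := by
      refine Integrable.of_eval fun j => ?_
      exact (hm.dinc_facts x _).1.sub (hm.dinc_facts x _).1
    have iqd : Integrable (fun z => qt γ x + dq γ x z) (Measure.pi m) :=
      (integrable_const _).add idq
    have igap : Integrable (fun z => N.gap Cp (qt γ x + dq γ x z)) (Measure.pi m) := by
      have h1 := i1.add (integrable_const (N.gap Cp (qt γ x)))
      refine h1.congr (Eventually.of_forall fun z => ?_)
      simp [hX₁]
    have hmean : ∫ z, (qt γ x + dq γ x z) ∂Measure.pi m = qt γ x := by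
      rw [integral_add (integrable_const _) idq]
      have : ∫ z, dq γ x z ∂Measure.pi m = 0 := by
        ext j
        rw [eval_integral fun j => (idq.eval j)]
        simp only [dq]
        rw [integral_sub (hm.dinc_facts x _).1 (hm.dinc_facts x _).1,
          (hm.dinc_facts x _).2.1, (hm.dinc_facts x _).2.1]
        simp
      rw [this]; simp
    have hJ := hg.concave.le_map_integral hg.continuous_gap.continuousOn isClosed_univ
      (Eventually.of_forall fun _ => Set.mem_univ _) iqd igap
    rw [hmean] at hJ
    rw [hX₁, integral_sub igap (integrable_const _)]
    simpa using hJ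
  have e2 : ∫ z, X₂ z ∂Measure.pi m ≤ I * Cb ^ 2 * n * K * numFire x / (2 * ℓ) := by
    have h0 : ∀ i, Integrable (fun z => N.wl (dq γ x z) i) (Measure.pi m) ∧
        ∫ z, N.wl (dq γ x z) i ∂Measure.pi m = 0 := by
      intro i
      simp only [Network.wl_apply]
      have hj : ∀ j, Integrable (fun z => N.K i j * (dq γ x z j / N.β j)) (Measure.pi m) :=
        fun j => (((hm.dinc_facts x _).1.sub (hm.dinc_facts x _).1).div_const _).const_mul _
      refine ⟨integrable_finsetSum _ fun j _ => hj j, ?_⟩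
      rw [integral_finsetSum _ fun j _ => hj j]
      refine Finset.sum_eq_zero fun j _ => ?_
      rw [integral_const_mul, integral_div]
      simp only [dq]
      rw [integral_sub (hm.dinc_facts x _).1 (hm.dinc_facts x _).1,
        (hm.dinc_facts x _).2.1, (hm.dinc_facts x _).2.1]
      simp
    have hle : ∀ z, X₂ z ≤ ∑ i, ((N.wl (qt γ x) i / √(ℓ ^ 2 + N.wl (qt γ x) i ^ 2) - 1) *
        N.wl (dq γ x z) i) + I * Cb ^ 2 * n / (2 * ℓ) * ∑ a, dinc γ x z a ^ 2 := by
      intro z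
      have h1 : I * Cb ^ 2 * n / (2 * ℓ) * ∑ a, dinc γ x z a ^ 2 =
          ∑ _i : Fin I, Cb ^ 2 * (n * ∑ a, dinc γ x z a ^ 2) / (2 * ℓ) := by simp; ring
      rw [h1, ← Finset.sum_add_distrib]
      refine Finset.sum_le_sum fun i _ => ?_
      have h2 := phi_add_le hℓ (N.wl (qt γ x) i) (N.wl (dq γ x z) i)
      have h3 : N.wl (dq γ x z) i ^ 2 ≤ Cb ^ 2 * (n * ∑ a, dinc γ x z a ^ 2) := by
        calc N.wl (dq γ x z) i ^ 2 ≤ (Cb * D z) ^ 2 := by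
              rw [← sq_abs]; exact pow_le_pow_left₀ (abs_nonneg _) (hwd z i) 2
          _ = Cb ^ 2 * D z ^ 2 := by ring
          _ ≤ _ := mul_le_mul_of_nonneg_left (hDsq z) (sq_nonneg _)
      have h4 : N.wl (dq γ x z) i ^ 2 / (2 * ℓ) ≤
          Cb ^ 2 * (n * ∑ a, dinc γ x z a ^ 2) / (2 * ℓ) := by gcongr
      linarith
    have il : Integrable (fun z => ∑ i, ((N.wl (qt γ x) i / √(ℓ ^ 2 + N.wl (qt γ x) i ^ 2) - 1) *
        N.wl (dq γ x z) i)) (Measure.pi m) :=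
      integrable_finsetSum _ fun i _ => (h0 i).1.const_mul _
    refine (integral_mono i2 (il.add (iS.const_mul _)) hle).trans ?_
    simp only [Pi.add_apply]
    rw [integral_add il (iS.const_mul _), integral_const_mul,
      integral_finsetSum _ fun i _ => (h0 i).1.const_mul _]
    have h5 : ∑ i, ∫ z, (N.wl (qt γ x) i / √(ℓ ^ 2 + N.wl (qt γ x) i ^ 2) - 1) *
        N.wl (dq γ x z) i ∂Measure.pi m = 0 :=
      Finset.sum_eq_zero fun i _ => by rw [integral_const_mul, (h0 i).2, mul_zero]
    rw [h5, zero_add]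
    refine (mul_le_mul_of_nonneg_left hS (by positivity)).trans_eq ?_
    ring
  have e3 : ∫ z, X₃ z ∂Measure.pi m ≤ -η * numFire x := by
    have hint : ∀ a, Integrable (fun u => Real.exp (-y * u)) (m a) := fun a =>
      hm.int_exp a _ (by linarith)
    have ia : ∀ a, Integrable (fun z : Idx J → ℝ =>
        if x.2.1 a ≤ 0 then Real.exp (-y * z a) - 1 else 0) (Measure.pi m) := by
      intro a
      split_ifs
      · exact (hm.integrable_eval a (hint a)).sub (integrable_const _)
      · exact integrable_const _
    rw [hX₃, integral_finsetSum _ fun a _ => ia a, numFire, Finset.mul_sum]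
    refine Finset.sum_le_sum fun a _ => ?_
    split_ifs
    · rw [integral_sub (hm.integrable_eval a (hint a)) (integrable_const _),
        hm.integral_eval a (hint a)]
      have := hm.down a 0 (by simpa using hs₁)
      simp only [Real.exp_zero, one_mul, ne_eq, OfNat.ofNat_ne_zero, not_false_eq_true, zero_pow,
        mul_zero, add_zero, zero_sub] at this
      simp only [integral_const, probReal_univ, smul_eq_mul, mul_one]
      linarith
    · simp
  set X : (Idx J → ℝ) → ℝ := fun z => X₁ z + Cφ * X₂ z + Gχ * X₃ z with hX
  have iX : Integrable X (Measure.pi m) := (i1.add (i2.const_mul _)).add (i3.const_mul _)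
  have hnF := numFire_nonneg x
  have eX : ∫ z, X z ∂Measure.pi m ≤ 0 := by
    have h1 : ∫ z, X z ∂Measure.pi m = ∫ z, X₁ z ∂Measure.pi m + Cφ * ∫ z, X₂ z ∂Measure.pi m +
        Gχ * ∫ z, X₃ z ∂Measure.pi m := by
      have i12 : Integrable (fun z => X₁ z + Cφ * X₂ z) (Measure.pi m) := i1.add (i2.const_mul _)
      change ∫ z, (X₁ z + Cφ * X₂ z + Gχ * X₃ z) ∂Measure.pi m = _
      rw [integral_add i12 (i3.const_mul _), integral_add i1 (i2.const_mul _),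
        integral_const_mul, integral_const_mul]
    rw [h1]
    have h2 := mul_le_mul_of_nonneg_left e2 hCφ
    have h3 := mul_le_mul_of_nonneg_left e3 hG0
    have h4 : Cφ * (I * Cb ^ 2 * n * K * numFire x / (2 * ℓ)) ≤ η * Gχ * numFire x := by
      have : Cφ * (I * Cb ^ 2 * n * K * numFire x / (2 * ℓ)) =
          (Cφ * I * Cb ^ 2 * n * K) * numFire x / (2 * ℓ) := by ring
      rw [this, div_le_iff₀ (by positivity)]
      calc _ ≤ 2 * ℓ * (η * Gχ) * numFire x := mul_le_mul_of_nonneg_right hG hnF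
        _ = _ := by ring
    linarith
  have hnFn : numFire x ≤ n := by
    unfold numFire
    calc _ ≤ ∑ _a : Idx J, (1 : ℝ) := Finset.sum_le_sum fun a _ => by split_ifs <;> norm_num
      _ = n := by simp [hn]
  have bX : ∀ᵐ z ∂Measure.pi m, X z ^ 2 ≤
      2 * (L + 2 * Cφ * I * Cb) ^ 2 * n * ∑ a, dinc γ x z a ^ 2 + 2 * n * numFire x := by
    filter_upwards [b3] with z hz
    have h1 : |X z| ≤ (L + 2 * Cφ * I * Cb) * D z + numFire x := by
      have h2 : |X z| ≤ |X₁ z| + Cφ * |X₂ z| + Gχ * |X₃ z| := by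
        refine (abs_add_le _ _).trans ?_
        rw [abs_mul, abs_of_nonneg hG0]
        refine add_le_add_left ((abs_add_le _ _).trans ?_) _
        rw [abs_mul, abs_of_nonneg hCφ]
      have h3 := mul_le_mul_of_nonneg_left (b2 z) hCφ
      have h4 := mul_le_mul hG1 hz (abs_nonneg _) zero_le_one
      linarith [b1 z]
    have h5 : X z ^ 2 ≤ ((L + 2 * Cφ * I * Cb) * D z + numFire x) ^ 2 := by
      rw [← sq_abs]; exact pow_le_pow_left₀ (abs_nonneg _) h1 2
    have h6 : ((L + 2 * Cφ * I * Cb) * D z + numFire x) ^ 2 ≤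
        2 * (L + 2 * Cφ * I * Cb) ^ 2 * D z ^ 2 + 2 * numFire x ^ 2 := by
      nlinarith [sq_nonneg ((L + 2 * Cφ * I * Cb) * D z - numFire x)]
    have h7 : 2 * (L + 2 * Cφ * I * Cb) ^ 2 * D z ^ 2 ≤
        2 * (L + 2 * Cφ * I * Cb) ^ 2 * (n * ∑ a, dinc γ x z a ^ 2) :=
      mul_le_mul_of_nonneg_left (hDsq z) (by positivity)
    have h8 : numFire x ^ 2 ≤ n * numFire x := by nlinarith
    linarith
  have mX : Measurable X := (m1.add (m2.const_mul _)).add (m3.const_mul _)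
  have iB := (iS.const_mul (2 * (L + 2 * Cφ * I * Cb) ^ 2 * n)).add
    (integrable_const (μ := Measure.pi m) (2 * n * numFire x))
  have iX2 : Integrable (fun z => X z ^ 2) (Measure.pi m) := by
    refine iB.mono' (mX.pow_const 2).aestronglyMeasurable ?_
    filter_upwards [bX] with z hz
    rw [Real.norm_eq_abs, abs_of_nonneg (sq_nonneg _)]
    exact hz
  set a := Y N γ Cp Cφ Gχ ℓ y x with ha
  have iU : Integrable (fun z => max a 0 ^ 2 + 2 * max a 0 * X z + X z ^ 2) (Measure.pi m) :=
    ((integrable_const _).add (iX.const_mul _)).add iX2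
  simp only [hYX]
  have iF : Integrable (fun z => max (a + X z) 0 ^ 2) (Measure.pi m) := by
    refine iU.mono' ?_ (Eventually.of_forall fun z => ?_)
    · exact (((mX.const_add a).max measurable_const).pow_const 2).aestronglyMeasurable
    · rw [Real.norm_eq_abs, abs_of_nonneg (sq_nonneg _)]
      exact sq_posPart_add_le a (X z)
  refine ⟨iF, (integral_mono iF iU fun z => sq_posPart_add_le a (X z)).trans ?_⟩
  have iL : Integrable (fun z => max a 0 ^ 2 + 2 * max a 0 * X z) (Measure.pi m) :=
    (integrable_const _).add (iX.const_mul _)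
  rw [integral_add iL iX2, integral_add (integrable_const _) (iX.const_mul _), integral_const_mul]
  simp only [integral_const, probReal_univ, smul_eq_mul, one_mul]
  have h1 : 2 * max a 0 * ∫ z, X z ∂Measure.pi m ≤ 0 :=
    mul_nonpos_of_nonneg_of_nonpos (by positivity) eX
  have h2 : ∫ z, X z ^ 2 ∂Measure.pi m ≤
      2 * (L + 2 * Cφ * I * Cb) ^ 2 * n * (K * numFire x) + 2 * n * numFire x := by
    refine (integral_mono_ae iX2 iB bX).trans ?_
    simp only [Pi.add_apply]
    rw [integral_add (iS.const_mul _) (integrable_const _), integral_const_mul]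
    simp only [integral_const, probReal_univ, smul_eq_mul, one_mul]
    have := mul_le_mul_of_nonneg_left hS
      (show 0 ≤ 2 * (L + 2 * Cφ * I * Cb) ^ 2 * n by positivity)
    linarith
  linarith

end GapPart
end RSN
end

noncomputable section

namespace RSN

/-! ### Upper derivatives and exponentials along the deterministic motion -/

section UpperDeriv

/-- `d` bounds the right derivative of `f` at `0` from above: `f` lies below a function that is
differentiable at `0` with derivative `d` and has the same value there. -/
def UpperDeriv (f : ℝ → ℝ) (d : ℝ) : Prop :=
  ∃ g : ℝ → ℝ, HasDerivAt g d 0 ∧ g 0 = f 0 ∧ ∀ u, 0 ≤ u → f u ≤ g u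

theorem UpperDeriv.add {f₁ f₂ : ℝ → ℝ} {d₁ d₂ : ℝ} (h₁ : UpperDeriv f₁ d₁)
    (h₂ : UpperDeriv f₂ d₂) : UpperDeriv (fun u => f₁ u + f₂ u) (d₁ + d₂) := by
  obtain ⟨g₁, a₁, b₁, c₁⟩ := h₁
  obtain ⟨g₂, a₂, b₂, c₂⟩ := h₂
  exact ⟨fun u => g₁ u + g₂ u, a₁.add a₂, by simp only [b₁, b₂],
    fun u hu => add_le_add (c₁ u hu) (c₂ u hu)⟩

theorem UpperDeriv.const_mul {f : ℝ → ℝ} {d : ℝ} (h : UpperDeriv f d) {c : ℝ} (hc : 0 ≤ c) :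
    UpperDeriv (fun u => c * f u) (c * d) := by
  obtain ⟨g, a, b, e⟩ := h
  exact ⟨fun u => c * g u, a.const_mul c, by simp only [b],
    fun u hu => mul_le_mul_of_nonneg_left (e u hu) hc⟩

theorem UpperDeriv.sum {ι : Type*} (s : Finset ι) {f : ι → ℝ → ℝ} {d : ι → ℝ}
    (h : ∀ i ∈ s, UpperDeriv (f i) (d i)) :
    UpperDeriv (fun u => ∑ i ∈ s, f i u) (∑ i ∈ s, d i) := by
  classical
  choose! g a b e using h
  refine ⟨fun u => ∑ i ∈ s, g i u, HasDerivAt.fun_sum a,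
    Finset.sum_congr rfl b, fun u hu => Finset.sum_le_sum fun i hi => e i hi u hu⟩

theorem UpperDeriv.mono {f : ℝ → ℝ} {d d' : ℝ} (h : UpperDeriv f d) (hd : d ≤ d') :
    UpperDeriv f d' := by
  obtain ⟨g, a, b, e⟩ := h
  refine ⟨fun u => g u + (d' - d) * u, ?_, by simp [b], fun u hu => ?_⟩
  · have := a.fun_add ((hasDerivAt_id' (0 : ℝ)).const_mul (d' - d))
    simpa using this
  · have := mul_nonneg (sub_nonneg.2 hd) hu
    linarith [e u hu]

/-- Square of the positive part of a function with a quadratic upper bound. -/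
theorem upperDeriv_sq_posPart {f : ℝ → ℝ} {d : ℝ} (h : UpperDeriv f d) :
    UpperDeriv (fun u => max (f u) 0 ^ 2) (2 * max (f 0) 0 * d) := by
  obtain ⟨g, a, b, e⟩ := h
  refine ⟨fun u => max (f 0) 0 ^ 2 + 2 * max (f 0) 0 * (g u - g 0) + (g u - g 0) ^ 2, ?_, by simp,
    fun u hu => ?_⟩
  · have h1 := a.sub_const (g 0)
    have h2 := ((h1.const_mul (2 * max (f 0) 0)).const_add (max (f 0) 0 ^ 2)).fun_add (h1.fun_pow 2)
    simpa using h2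
  · refine le_trans ?_ (sq_posPart_add_le (f 0) (g u - g 0))
    refine pow_le_pow_left₀ (le_max_right _ _) (max_le_max_right 0 ?_) 2
    linarith [e u hu]

end UpperDeriv

section Rates

variable {I J : ℕ}

/-- Velocity of the residual times for the indicators `E` of blocked job types and the allocation
rates `ξ`. -/
def vel (E : Chi J) (ξ : Fin J → ℝ) : Idx J → ℝ :=
  Sum.elim (fun _ => 1) (fun j => if E j = true then 0 else ξ j)

/-- Logarithmic derivative of `exp (σ · q + c · R)` along the deterministic motion. -/
def rate (c v : Idx J → ℝ) : ℝ := -∑ a, c a * v a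

theorem expo_flow (p : Policy J) (N : Network I J) (r : ℕ) (σ : Fin J → ℝ) (c : Idx J → ℝ)
    (x : Config J) (u : ℝ) :
    expo σ c (flow p N r x u) = expo σ c x * Real.exp (u * rate c (speed p N r x)) := by
  unfold expo flow rate
  rw [← Real.exp_add]
  congr 1
  simp only [mul_sub, Finset.sum_sub_distrib]
  have : ∑ a, c a * (u * speed p N r x a) = u * ∑ a, c a * speed p N r x a := by
    rw [Finset.mul_sum]; exact Finset.sum_congr rfl fun a _ => by ring
  rw [this]; ring

theorem upperDeriv_expo_flow (p : Policy J) (N : Network I J) (r : ℕ) (σ : Fin J → ℝ)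
    (c : Idx J → ℝ) (x : Config J) :
    UpperDeriv (fun u => expo σ c (flow p N r x u))
      (expo σ c x * rate c (speed p N r x)) := by
  refine ⟨_, ?_, rfl, fun u _ => le_rfl⟩
  simp only [expo_flow]
  have h1 : HasDerivAt (fun u : ℝ => u * rate c (speed p N r x)) (rate c (speed p N r x)) 0 := by
    simpa using (hasDerivAt_id (0 : ℝ)).mul_const (rate c (speed p N r x))
  have h2 := (h1.exp.const_mul (expo σ c x))
  simpa using h2

theorem rate_cf (Λ : ℝ) (γ : Idx J → ℝ) (σ : Fin J → ℝ) (v : Idx J → ℝ) :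
    rate (cf Λ γ σ) v =
      ∑ j, σ j * (γ (Sum.inl j) * v (Sum.inl j) - γ (Sum.inr j) * v (Sum.inr j)) +
      Λ * ∑ j, σ j ^ 2 * (γ (Sum.inl j) * v (Sum.inl j) + γ (Sum.inr j) * v (Sum.inr j)) := by
  unfold rate
  rw [Fintype.sum_sum_type, ← Finset.sum_add_distrib, ← Finset.sum_neg_distrib, Finset.mul_sum,
    ← Finset.sum_add_distrib]
  refine Finset.sum_congr rfl fun j _ => ?_
  simp only [cf, sg, Sum.elim_inl, Sum.elim_inr]
  ring

theorem rate_add (c c' v : Idx J → ℝ) : rate (c + c') v = rate c v + rate c' v := by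
  simp only [rate, Pi.add_apply, add_mul, Finset.sum_add_distrib]; ring

theorem rate_sub (c c' v : Idx J → ℝ) : rate (c - c') v = rate c v - rate c' v := by
  simp only [rate, Pi.sub_apply, sub_mul, Finset.sum_sub_distrib]; ring

theorem rate_single (a : Idx J) (t : ℝ) (v : Idx J → ℝ) : rate (Pi.single a t) v = -(t * v a) := by
  unfold rate
  rw [Finset.sum_eq_single a (fun b _ hb => by rw [Pi.single_eq_of_ne hb, zero_mul]) (by simp),
    Pi.single_eq_same]

theorem expo_add_single (σ : Fin J → ℝ) (c : Idx J → ℝ) (a : Idx J) (t : ℝ) (x : Config J) :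
    expo σ (c + Pi.single a t) x = expo σ c x * Real.exp (t * x.2.1 a) := by
  unfold expo
  rw [← Real.exp_add]
  congr 1
  have : ∑ b, (Pi.single a t : Idx J → ℝ) b * x.2.1 b = t * x.2.1 a := by
    rw [Finset.sum_eq_single a (fun b _ hb => by rw [Pi.single_eq_of_ne hb, zero_mul]) (by simp),
      Pi.single_eq_same]
  simp only [Pi.add_apply, add_mul, Finset.sum_add_distrib, this]
  ring

theorem expo_sub_single (σ : Fin J → ℝ) (c : Idx J → ℝ) (a : Idx J) (t : ℝ) (x : Config J) :
    expo σ (c - Pi.single a t) x = expo σ c x * Real.exp (-t * x.2.1 a) := by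
  rw [← expo_add_single]
  congr 1
  rw [sub_eq_add_neg]
  congr 1
  rw [Pi.single_neg]

end Rates

/-- Constants that bound the rates of the system: `g₀ ≤ γ ≤ g₁` for the arrival and service rates,
`c₀ / r` and `C₀ / r` for the negative drift and the deviations from the limit, `smin` and `smax` for
the allocation rates, `vmin` for the reduction of the rate of small queues, `cM` for the rate of
decrease of the cost when it can be reduced, `Cp` for the penalty in the extended cost and `Cg` for
the gap when it cannot be reduced. -/
structure Consts where
  g₀ : ℝ
  g₁ : ℝ
  c₀ : ℝ
  C₀ : ℝ
  smin : ℝ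
  smax : ℝ
  vmin : ℝ
  cM : ℝ
  Cp : ℝ
  Cg : ℝ
  g₀_pos : 0 < g₀
  g₁_pos : 0 < g₁
  c₀_pos : 0 < c₀
  C₀_pos : 0 < C₀
  smin_pos : 0 < smin
  smin_le_one : smin ≤ 1
  one_le_smax : 1 ≤ smax
  vmin_pos : 0 < vmin
  cM_pos : 0 < cM
  Cp_nonneg : 0 ≤ Cp
  Cg_nonneg : 0 ≤ Cg

section Drift

variable {I J : ℕ}

/-- The arrival and service rates `γ` are within order `1/r` of their limits, and every resource is
underloaded by a capacity of order `1/r`. -/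
structure Near (N : Network I J) (k : Consts) (r : ℕ) (γ : Idx J → ℝ) : Prop where
  one_le : 1 ≤ r
  g₀_le : ∀ a, k.g₀ ≤ γ a
  le_g₁ : ∀ a, γ a ≤ k.g₁
  g₀_le_β : ∀ j, k.g₀ ≤ N.β j
  dev : ∀ j, |γ (Sum.inl j) - γ (Sum.inr j) * N.ρ j| ≤ k.C₀ / r
  devβ : ∀ j, |γ (Sum.inr j) - N.β j| ≤ k.C₀ / r
  drift : ∀ i, ∑ j, N.K i j * (γ (Sum.inl j) / γ (Sum.inr j) - N.ρ j) ≤ -k.c₀ / r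

/-- The properties of the allocation rates `ξ` for queue lengths `q` with threshold `hi`. -/
structure Rates (N : Network I J) (k : Consts) (hi : ℝ) (q ξ : Fin J → ℝ) : Prop where
  lower : ∀ j, k.smin ≤ ξ j
  upper : ∀ j, ξ j ≤ k.smax
  abs_le : ∀ j, |N.ρ j - ξ j| ≤ k.smax
  nonneg : ∀ i, 0 ≤ ∑ j, N.K i j * (N.ρ j - ξ j)
  full : ∀ i, (∃ j, N.K i j = 1 ∧ hi ≤ q j) → ∑ j, N.K i j * (N.ρ j - ξ j) = 0
  small : ∀ j, q j < hi → k.vmin ≤ N.ρ j - ξ j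
  cost : ∑ j, N.h j * N.β j * (N.ρ j - ξ j) ≤ -k.cM ∨ N.gap k.Cp q ≤ k.Cg * hi

theorem Near.r_pos {N : Network I J} {k : Consts} {r : ℕ} {γ : Idx J → ℝ} (h : Near N k r γ) :
    (1 : ℝ) ≤ r := by exact_mod_cast h.one_le

theorem Near.γ_pos {N : Network I J} {k : Consts} {r : ℕ} {γ : Idx J → ℝ} (h : Near N k r γ)
    (a : Idx J) : 0 < γ a := k.g₀_pos.trans_le (h.g₀_le a)

theorem vel_nonneg {N : Network I J} {k : Consts} {hi : ℝ} {q ξ : Fin J → ℝ}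
    (h : Rates N k hi q ξ) (E : Chi J) (a : Idx J) : 0 ≤ vel E ξ a := by
  rcases a with j | j
  · simp [vel]
  · simp only [vel, Sum.elim_inr]
    split_ifs
    exacts [le_rfl, k.smin_pos.le.trans (h.lower j)]

theorem vel_le {N : Network I J} {k : Consts} {hi : ℝ} {q ξ : Fin J → ℝ}
    (h : Rates N k hi q ξ) (E : Chi J) (a : Idx J) : vel E ξ a ≤ k.smax := by
  rcases a with j | j
  · simpa [vel] using k.one_le_smax
  · simp only [vel, Sum.elim_inr]
    split_ifs
    exacts [zero_le_one.trans k.one_le_smax, h.upper j]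

theorem wt_nonneg {N : Network I J} (hN : N.IsTopology) {γ : Idx J → ℝ} (hγ : ∀ a, 0 < γ a)
    {lam : ℝ} (hlam : 0 ≤ lam) (r : ℕ) (o : Option (Fin I)) (j : Fin J) :
    0 ≤ wt N γ lam r o j := by
  rcases o with _ | i
  · simp [wt]
  · have := N.K_nonneg hN i j
    have := hγ (Sum.inr j)
    simp only [wt]; positivity

theorem wt_le {N : Network I J} (hN : N.IsTopology) {k : Consts} {r : ℕ} {γ : Idx J → ℝ}
    (h : Near N k r γ) {lam : ℝ} (hlam : 0 ≤ lam) (o : Option (Fin I)) (j : Fin J) :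
    wt N γ lam r o j ≤ lam / k.g₀ / r := by
  have hr := h.r_pos
  have hg := k.g₀_pos
  rcases o with _ | i
  · simp only [wt, Pi.zero_apply]; positivity
  · have h1 := N.K_le_one hN i j
    have h2 := h.g₀_le (Sum.inr j)
    simp only [wt]
    rw [div_div, mul_comm k.g₀]
    exact div_le_div₀ hlam (mul_le_of_le_one_right hlam h1) (by positivity)
      (mul_le_mul_of_nonneg_left h2 (by positivity))

theorem abs_sg_wt_le {N : Network I J} (hN : N.IsTopology) {k : Consts} {r : ℕ} {γ : Idx J → ℝ}
    (h : Near N k r γ) {lam : ℝ} (hlam : 0 ≤ lam) (o : Option (Fin I)) (a : Idx J) :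
    |sg (wt N γ lam r o) a| ≤ lam / k.g₀ / r := by
  rcases a with j | j
  · simp only [sg, Sum.elim_inl]
    rw [abs_of_nonneg (wt_nonneg hN h.γ_pos hlam r o j)]; exact wt_le hN h hlam o j
  · simp only [sg, Sum.elim_inr]
    rw [abs_neg, abs_of_nonneg (wt_nonneg hN h.γ_pos hlam r o j)]; exact wt_le hN h hlam o j

theorem abs_cf_le {Λ : ℝ} (hΛ : 0 ≤ Λ) {γ : Idx J → ℝ} {g₁ : ℝ} (hγ0 : ∀ a, 0 ≤ γ a)
    (hγ : ∀ a, γ a ≤ g₁) {σ : Fin J → ℝ} {a : Idx J} {t : ℝ} (ht : |sg σ a| ≤ t) :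
    |cf Λ γ σ a| ≤ g₁ * (t + Λ * t ^ 2) := by
  unfold cf
  have h1 : |sg σ a + Λ * sg σ a ^ 2| ≤ t + Λ * t ^ 2 := by
    refine (abs_add_le _ _).trans (add_le_add ht ?_)
    rw [abs_mul, abs_of_nonneg hΛ, abs_pow]
    exact mul_le_mul_of_nonneg_left (pow_le_pow_left₀ (abs_nonneg _) ht 2) hΛ
  rw [abs_mul, abs_neg, abs_of_nonneg (hγ0 a)]
  exact mul_le_mul (hγ a) h1 (abs_nonneg _) ((hγ0 a).trans (hγ a))

theorem sg_neg (σ : Fin J → ℝ) (a : Idx J) : sg (-σ) a = -sg σ a := by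
  rcases a with j | j <;> simp [sg]

/-- Constant such that `|cf| ≤ cfC / r` for the weights `wt`. -/
def cfC (k : Consts) (Λ lam : ℝ) : ℝ := k.g₁ * (lam / k.g₀ + Λ * (lam / k.g₀) ^ 2)

theorem abs_cf_wt_le {N : Network I J} (hN : N.IsTopology) {k : Consts} {r : ℕ} {γ : Idx J → ℝ}
    (h : Near N k r γ) {lam Λ : ℝ} (hlam : 0 ≤ lam) (hΛ : 0 ≤ Λ) (o : Option (Fin I)) (a : Idx J) :
    |cf Λ γ (wt N γ lam r o) a| ≤ cfC k Λ lam / r ∧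
      |cf Λ γ (-wt N γ lam r o) a| ≤ cfC k Λ lam / r := by
  have hr := h.r_pos
  have h1 := abs_sg_wt_le hN h hlam o a
  have h2 : k.g₁ * (lam / k.g₀ / r + Λ * (lam / k.g₀ / r) ^ 2) ≤ cfC k Λ lam / r := by
    unfold cfC
    rw [mul_div_assoc, add_div]
    refine mul_le_mul_of_nonneg_left (add_le_add le_rfl ?_) k.g₁_pos.le
    rw [mul_div_assoc]
    refine mul_le_mul_of_nonneg_left ?_ hΛ
    rw [div_pow]
    exact div_le_div_of_nonneg_left (by positivity) (by positivity) (by nlinarith)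
  exact ⟨(abs_cf_le hΛ (fun a => (h.γ_pos a).le) h.le_g₁ h1).trans h2,
    (abs_cf_le hΛ (fun a => (h.γ_pos a).le) h.le_g₁ (by rw [sg_neg, abs_neg]; exact h1)).trans h2⟩

/-- The logarithmic derivative is of order `1/r`. -/
theorem abs_rate_wt_le {N : Network I J} (hN : N.IsTopology) {k : Consts} {r : ℕ} {γ : Idx J → ℝ}
    (h : Near N k r γ) {lam Λ : ℝ} (hlam : 0 ≤ lam) (hΛ : 0 ≤ Λ) {hi : ℝ} {q ξ : Fin J → ℝ}
    (hξ : Rates N k hi q ξ) (E : Chi J) (o : Option (Fin I)) :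
    |rate (cf Λ γ (wt N γ lam r o)) (vel E ξ)| ≤
      Fintype.card (Idx J) * (cfC k Λ lam * k.smax) / r := by
  unfold rate
  rw [abs_neg]
  refine (Finset.abs_sum_le_sum_abs _ _).trans ?_
  have : ∀ a, |cf Λ γ (wt N γ lam r o) a * vel E ξ a| ≤ cfC k Λ lam * k.smax / r := fun a => by
    rw [abs_mul, abs_of_nonneg (vel_nonneg hξ E a), mul_div_right_comm]
    exact mul_le_mul (abs_cf_wt_le hN h hlam hΛ o a).1 (vel_le hξ E a) (vel_nonneg hξ E a)
      ((abs_nonneg _).trans (abs_cf_wt_le hN h hlam hΛ o a).1)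
  refine (Finset.sum_le_sum fun a _ => this a).trans_eq ?_
  simp [Finset.card_univ]; ring

/-- Drift of the workload of resource `i`, up to normalization. -/
def wdrift (N : Network I J) (γ v : Idx J → ℝ) (i : Fin I) : ℝ :=
  ∑ j, N.K i j * (γ (Sum.inl j) / γ (Sum.inr j) - v (Sum.inr j))

theorem rate_wt_some {N : Network I J} {γ : Idx J → ℝ} (hγ : ∀ a, 0 < γ a) (lam Λ : ℝ) (r : ℕ)
    (E : Chi J) (ξ : Fin J → ℝ) (i : Fin I) :
    rate (cf Λ γ (wt N γ lam r (some i))) (vel E ξ) = lam / r * wdrift N γ (vel E ξ) i +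
      Λ * ∑ j, wt N γ lam r (some i) j ^ 2 *
        (γ (Sum.inl j) + γ (Sum.inr j) * vel E ξ (Sum.inr j)) := by
  rw [rate_cf]
  have h1 : ∀ j, vel E ξ (Sum.inl j) = 1 := fun _ => rfl
  simp only [h1, mul_one]
  congr 1
  unfold wdrift
  rw [Finset.mul_sum]
  refine Finset.sum_congr rfl fun j _ => ?_
  have := hγ (Sum.inr j)
  simp only [wt]
  field_simp

theorem rate_neg_wt_some {N : Network I J} {γ : Idx J → ℝ} (hγ : ∀ a, 0 < γ a) (lam Λ : ℝ) (r : ℕ)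
    (E : Chi J) (ξ : Fin J → ℝ) (i : Fin I) :
    rate (cf Λ γ (-wt N γ lam r (some i))) (vel E ξ) = -(lam / r * wdrift N γ (vel E ξ) i) +
      Λ * ∑ j, wt N γ lam r (some i) j ^ 2 *
        (γ (Sum.inl j) + γ (Sum.inr j) * vel E ξ (Sum.inr j)) := by
  have h1 := rate_wt_some (N := N) hγ lam Λ r E ξ i
  have h2 : ∀ j, vel E ξ (Sum.inl j) = 1 := fun _ => rfl
  rw [rate_cf] at h1 ⊢
  simp only [h2, mul_one] at h1 ⊢
  simp only [Pi.neg_apply, neg_mul, Finset.sum_neg_distrib, neg_sq]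
  linarith

/-- The second order term is at most `λ² rateC / r²`. -/
def rateC (k : Consts) (Λ : ℝ) (J : ℕ) : ℝ := Λ * (J * (1 / k.g₀ ^ 2 * (2 * k.g₁ * k.smax)))

theorem sum_wt_sq_le {N : Network I J} (hN : N.IsTopology) {k : Consts} {r : ℕ} {γ : Idx J → ℝ}
    (h : Near N k r γ) {lam Λ : ℝ} (hlam : 0 ≤ lam) (hΛ : 0 ≤ Λ) {hi : ℝ} {q ξ : Fin J → ℝ}
    (hξ : Rates N k hi q ξ) (E : Chi J) (o : Option (Fin I)) :
    0 ≤ Λ * ∑ j, wt N γ lam r o j ^ 2 *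
        (γ (Sum.inl j) + γ (Sum.inr j) * vel E ξ (Sum.inr j)) ∧
    Λ * ∑ j, wt N γ lam r o j ^ 2 *
        (γ (Sum.inl j) + γ (Sum.inr j) * vel E ξ (Sum.inr j)) ≤
      lam ^ 2 * rateC k Λ J / r ^ 2 := by
  have hs := k.one_le_smax
  have hg1 := k.g₁_pos
  have h0 : ∀ j, 0 ≤ γ (Sum.inl j) + γ (Sum.inr j) * vel E ξ (Sum.inr j) := fun j =>
    add_nonneg (h.γ_pos _).le (mul_nonneg (h.γ_pos _).le (vel_nonneg hξ E _))
  refine ⟨mul_nonneg hΛ (Finset.sum_nonneg fun j _ => mul_nonneg (sq_nonneg _) (h0 j)), ?_⟩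
  have h1 : ∀ j, wt N γ lam r o j ^ 2 * (γ (Sum.inl j) + γ (Sum.inr j) * vel E ξ (Sum.inr j)) ≤
      (lam / k.g₀ / r) ^ 2 * (2 * k.g₁ * k.smax) := fun j => by
    refine mul_le_mul (pow_le_pow_left₀ (wt_nonneg hN h.γ_pos hlam r o j) (wt_le hN h hlam o j) 2)
      ?_ (h0 j) (sq_nonneg _)
    have h2 := h.le_g₁ (Sum.inl j)
    have h3 := mul_le_mul (h.le_g₁ (Sum.inr j)) (vel_le hξ E (Sum.inr j))
      (vel_nonneg hξ E _) hg1.le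
    nlinarith
  calc _ ≤ Λ * ∑ _j : Fin J, (lam / k.g₀ / r) ^ 2 * (2 * k.g₁ * k.smax) :=
        mul_le_mul_of_nonneg_left (Finset.sum_le_sum fun j _ => h1 j) hΛ
    _ = _ := by
        unfold rateC
        simp only [Finset.sum_const, Finset.card_univ, Fintype.card_fin, nsmul_eq_mul]
        field_simp

end Drift
end RSN
end

noncomputable section

namespace RSN

/-! ### Drift of the exponentials of workloads and residual times -/

section Sums

variable {I J : ℕ} (N : Network I J) (γ : Idx J → ℝ) (Λ lam y : ℝ) (r : ℕ)

/-- The exponential supermartingale with weights `wt`. -/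
def eK (o : Option (Fin I)) (x : Config J) : ℝ :=
  expo (wt N γ lam r o) (cf Λ γ (wt N γ lam r o)) x

/-- The exponentials that control residual times and workloads together. -/
def PP (x : Config J) : ℝ :=
  ∑ o : Option (Fin I), ∑ a : Idx J, eK N γ Λ lam r o x * Real.exp (y * x.2.1 a)

/-- The exponentials of the workloads. -/
def SS (x : Config J) : ℝ := ∑ i : Fin I, eK N γ Λ lam r (some i) x

/-- The part of `PP` that belongs to blocked jobs. -/
def PE (x : Config J) : ℝ :=
  ∑ o : Option (Fin I), ∑ j : Fin J, if x.2.2 j = true then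
    eK N γ Λ lam r o x * Real.exp (y * x.2.1 (Sum.inr j)) else 0

end Sums

section Drift

variable {I J : ℕ} {N : Network I J} {γ : Idx J → ℝ} {Λ lam y : ℝ} {r : ℕ} {k : Consts}

theorem eK_pos (o : Option (Fin I)) (x : Config J) : 0 < eK N γ Λ lam r o x := expo_pos _ _ _

theorem eK_none (x : Config J) : eK N γ Λ lam r none x = 1 := by
  have h3 : ∀ a, sg (0 : Fin J → ℝ) a = 0 := fun a => by rcases a with j | j <;> simp [sg]
  simp [eK, expo, wt, cf, h3]

theorem SS_nonneg (x : Config J) : 0 ≤ SS N γ Λ lam r x :=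
  Finset.sum_nonneg fun _ _ => (eK_pos _ _).le

theorem PE_term_nonneg (x : Config J) (o : Option (Fin I)) (j : Fin J) :
    0 ≤ if x.2.2 j = true then
      eK N γ Λ lam r o x * Real.exp (y * x.2.1 (Sum.inr j)) else 0 := by
  split_ifs
  exacts [(mul_pos (eK_pos _ _) (Real.exp_pos _)).le, le_rfl]

theorem PE_nonneg (x : Config J) : 0 ≤ PE N γ Λ lam y r x :=
  Finset.sum_nonneg fun _ _ => Finset.sum_nonneg fun _ _ => PE_term_nonneg _ _ _

theorem sum_eK (x : Config J) : ∑ o, eK N γ Λ lam r o x = 1 + SS N γ Λ lam r x := by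
  rw [Fintype.sum_option, eK_none, SS]

theorem le_PP (x : Config J) (o : Option (Fin I)) (a : Idx J) :
    eK N γ Λ lam r o x * Real.exp (y * x.2.1 a) ≤ PP N γ Λ lam y r x := by
  refine le_trans ?_ (Finset.single_le_sum (f := fun o => ∑ a : Idx J,
    eK N γ Λ lam r o x * Real.exp (y * x.2.1 a)) (fun o _ => Finset.sum_nonneg fun a _ =>
      (mul_pos (eK_pos _ _) (Real.exp_pos _)).le) (Finset.mem_univ o))
  exact Finset.single_le_sum (f := fun a => eK N γ Λ lam r o x * Real.exp (y * x.2.1 a))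
    (fun a _ => (mul_pos (eK_pos _ _) (Real.exp_pos _)).le) (Finset.mem_univ a)

theorem exp_le_PP (x : Config J) (a : Idx J) :
    Real.exp (y * x.2.1 a) ≤ PP N γ Λ lam y r x := by
  have := le_PP (N := N) (γ := γ) (Λ := Λ) (lam := lam) (y := y) (r := r) x none a
  rwa [eK_none, one_mul] at this

theorem PP_nonneg (x : Config J) : 0 ≤ PP N γ Λ lam y r x :=
  Finset.sum_nonneg fun _ _ => Finset.sum_nonneg fun _ _ =>
    (mul_pos (eK_pos _ _) (Real.exp_pos _)).le

theorem exp_half_le_sqrt_PP (x : Config J) (a : Idx J) :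
    Real.exp (y / 2 * x.2.1 a) ≤ √(PP N γ Λ lam y r x) := by
  refine Real.le_sqrt_of_sq_le ?_
  rw [← Real.exp_nat_mul]
  refine le_trans (le_of_eq ?_) (exp_le_PP x a)
  congr 1; push_cast; ring

theorem cfC_nonneg (k : Consts) {Λ lam : ℝ} (hΛ : 0 ≤ Λ) (hlam : 0 ≤ lam) : 0 ≤ cfC k Λ lam := by
  have := k.g₀_pos; have := k.g₁_pos
  unfold cfC; positivity

/-- Comparison of the sum of the residual times with the largest one. -/
theorem exists_max_residual [Nonempty (Idx J)] (hΛ : 0 ≤ Λ) (hlam : 0 ≤ lam)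
    (hr : 4 * Fintype.card (Idx J) * cfC k Λ lam ≤ y * r) (hr0 : 0 < r) {x : Config J}
    (hR : ∀ a, 0 ≤ x.2.1 a) :
    ∃ a₀, (∀ a, x.2.1 a ≤ x.2.1 a₀) ∧ ∑ a, x.2.1 a ≤ Fintype.card (Idx J) * x.2.1 a₀ ∧
      cfC k Λ lam / r * ∑ a, x.2.1 a ≤ y / 4 * x.2.1 a₀ := by
  obtain ⟨a₀, h⟩ := Finite.exists_max x.2.1
  have h1 : ∑ a, x.2.1 a ≤ Fintype.card (Idx J) * x.2.1 a₀ := by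
    refine (Finset.sum_le_sum fun a _ => h a).trans_eq ?_
    simp [Finset.card_univ]
  refine ⟨a₀, h, h1, ?_⟩
  have hr1 : (0 : ℝ) < r := by exact_mod_cast hr0
  have hc := cfC_nonneg k hΛ hlam
  refine (mul_le_mul_of_nonneg_left h1 (by positivity)).trans ?_
  rw [div_mul_eq_mul_div, div_le_iff₀ hr1]
  nlinarith [hR a₀]

theorem sum_cf_mul_le (hN : N.IsTopology) (h : Near N k r γ) (hlam : 0 ≤ lam) (hΛ : 0 ≤ Λ)
    {x : Config J} (hR : ∀ a, 0 ≤ x.2.1 a) (o : Option (Fin I)) :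
    |∑ a, cf Λ γ (wt N γ lam r o) a * x.2.1 a| ≤ cfC k Λ lam / r * ∑ a, x.2.1 a ∧
    |∑ a, cf Λ γ (-wt N γ lam r o) a * x.2.1 a| ≤ cfC k Λ lam / r * ∑ a, x.2.1 a := by
  constructor
  all_goals
    rw [Finset.mul_sum]
    refine (Finset.abs_sum_le_sum_abs _ _).trans (Finset.sum_le_sum fun a _ => ?_)
    rw [abs_mul, abs_of_nonneg (hR a)]
    refine mul_le_mul_of_nonneg_right ?_ (hR a)
  exacts [(abs_cf_wt_le hN h hlam hΛ o a).1, (abs_cf_wt_le hN h hlam hΛ o a).2]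

theorem sum_wt_nonneg (hN : N.IsTopology) (h : Near N k r γ) (hlam : 0 ≤ lam)
    {x : Config J} (hq : ∀ j, 0 ≤ x.1 j) (o : Option (Fin I)) :
    0 ≤ ∑ j, wt N γ lam r o j * x.1 j :=
  Finset.sum_nonneg fun j _ => mul_nonneg (wt_nonneg hN h.γ_pos hlam r o j) (hq j)

/-- The exponential of a resource only used by short queues is close to that with the opposite
weight. -/
theorem eK_sub_le (hN : N.IsTopology) (h : Near N k r γ) (hlam : 0 ≤ lam) (hΛ : 0 ≤ Λ)
    {x : Config J} (hR : ∀ a, 0 ≤ x.2.1 a) {hi : ℝ} {i : Fin I}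
    (hhi : 0 ≤ hi) (hhir : hi ≤ k.g₀ * r) (hsmall : ∀ j, N.K i j = 1 → x.1 j < hi) :
    eK N γ Λ lam r (some i) x - expo (-wt N γ lam r (some i))
        (cf Λ γ (-wt N γ lam r (some i))) x ≤
      (2 * (J * (lam / k.g₀ * hi)) / r + 2 * (cfC k Λ lam / r * ∑ a, x.2.1 a)) *
        (Real.exp (J * lam) * Real.exp (cfC k Λ lam / r * ∑ a, x.2.1 a)) := by
  have hr := h.r_pos
  have hg := k.g₀_pos
  obtain ⟨h1, h2⟩ := sum_cf_mul_le hN h hlam hΛ hR (some i)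
  have hs0 : 0 ≤ ∑ a, x.2.1 a := Finset.sum_nonneg fun a _ => hR a
  have hc := cfC_nonneg k hΛ hlam
  set T := cfC k Λ lam / r * ∑ a, x.2.1 a with hT
  have hq1 : ∑ j, wt N γ lam r (some i) j * x.1 j ≤ J * (lam / k.g₀ * hi) / r := by
    have : ∀ j, wt N γ lam r (some i) j * x.1 j ≤ lam / k.g₀ / r * hi := fun j => by
      rcases hN.zero_or_one i j with h0 | h0
      · simp only [wt, h0]; simp; positivity
      · exact (mul_le_mul_of_nonneg_left (hsmall j h0).le
          (wt_nonneg hN h.γ_pos hlam r _ j)).trans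
          (mul_le_mul_of_nonneg_right (wt_le hN h hlam _ j) hhi)
    refine (Finset.sum_le_sum fun j _ => this j).trans_eq ?_
    simp; ring
  have hq2 : J * (lam / k.g₀ * hi) / r ≤ J * lam := by
    rw [div_le_iff₀ (by linarith), mul_assoc]
    refine mul_le_mul_of_nonneg_left ?_ (Nat.cast_nonneg _)
    rw [div_mul_eq_mul_div, div_le_iff₀ hg]
    nlinarith
  unfold eK expo
  set u := ∑ j, wt N γ lam r (some i) j * x.1 j with hu
  have hu' : ∑ j, (-wt N γ lam r (some i)) j * x.1 j = -u := by
    rw [hu, ← Finset.sum_neg_distrib]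
    exact Finset.sum_congr rfl fun j _ => by rw [Pi.neg_apply, neg_mul]
  rw [hu']
  set A := ∑ a, cf Λ γ (wt N γ lam r (some i)) a * x.2.1 a with hA
  set B := ∑ a, cf Λ γ (-wt N γ lam r (some i)) a * x.2.1 a with hB
  have hexp : Real.exp (u + A) - Real.exp (-u + B) ≤
      (u + A - (-u + B)) * Real.exp (u + A) := by
    have := Real.add_one_le_exp (-u + B - (u + A))
    have h3 : Real.exp (-u + B) = Real.exp (u + A) * Real.exp (-u + B - (u + A)) := by
      rw [← Real.exp_add]; congr 1; ring
    rw [h3]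
    nlinarith [Real.exp_pos (u + A)]
  have h4 := abs_le.1 h1
  have h5 := abs_le.1 h2
  have h6 : Real.exp (u + A) ≤ Real.exp (J * lam) * Real.exp T := by
    rw [← Real.exp_add]; exact Real.exp_le_exp.2 (by linarith)
  have h7 : u + A - (-u + B) ≤ 2 * (J * (lam / k.g₀ * hi)) / r + 2 * T := by
    have : 2 * (J * (lam / k.g₀ * hi)) / r = 2 * (J * (lam / k.g₀ * hi) / r) := by ring
    rw [this]; linarith
  have h8 : 0 ≤ 2 * (J * (lam / k.g₀ * hi)) / r + 2 * T := by positivity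
  calc _ ≤ _ := hexp
    _ ≤ (2 * (J * (lam / k.g₀ * hi)) / r + 2 * T) * Real.exp (u + A) :=
        mul_le_mul_of_nonneg_right h7 (Real.exp_pos _).le
    _ ≤ _ := mul_le_mul_of_nonneg_left h6 h8

/-- Drift of `V₁`, including the discount at rate `λ² / r²`. -/
def dV₁ (N : Network I J) (γ : Idx J → ℝ) (Λ lam : ℝ) (r : ℕ) (δ : ℝ) (v : Idx J → ℝ)
    (x : Config J) : ℝ :=
  ∑ i : Fin I, (eK N γ Λ lam r (some i) x * (rate (cf Λ γ (wt N γ lam r (some i))) v + δ) +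
    expo (-wt N γ lam r (some i)) (cf Λ γ (-wt N γ lam r (some i))) x *
      (rate (cf Λ γ (-wt N γ lam r (some i))) v + δ))

theorem upperDeriv_V₁ (p : Policy J) (x : Config J) (δ : ℝ) :
    UpperDeriv (fun u => V₁ N γ Λ lam r (flow p N r x u))
      (dV₁ N γ Λ lam r δ (speed p N r x) x - δ * V₁ N γ Λ lam r x) := by
  have : dV₁ N γ Λ lam r δ (speed p N r x) x - δ * V₁ N γ Λ lam r x =
      ∑ i : Fin I, (eK N γ Λ lam r (some i) x *
        rate (cf Λ γ (wt N γ lam r (some i))) (speed p N r x) +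
      expo (-wt N γ lam r (some i)) (cf Λ γ (-wt N γ lam r (some i))) x *
        rate (cf Λ γ (-wt N γ lam r (some i))) (speed p N r x)) := by
    unfold dV₁ V₁
    rw [Finset.mul_sum, ← Finset.sum_sub_distrib]
    refine Finset.sum_congr rfl fun i _ => ?_
    unfold eK; ring
  rw [this]
  exact UpperDeriv.sum _ fun i _ => (upperDeriv_expo_flow p N r _ _ x).add
    (upperDeriv_expo_flow p N r _ _ x)

/-- Constant in the drift estimate of `V₁`. -/
def V₁C (k : Consts) (I J : ℕ) (Λ lam y : ℝ) : ℝ :=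
  I * (lam * (J * k.C₀ / k.g₀) + lam * k.smax * J + lam ^ 2 * (rateC k Λ J + 1) +
    lam * (J * k.smax) * Real.exp (J * lam) * (2 * (J * lam / k.g₀) +
      2 * (cfC k Λ lam * (Fintype.card (Idx J) * (4 / y)))))

set_option maxHeartbeats 1000000 in
/-- Drift estimate for `V₁`: the negative drift of the workloads makes it decrease in proportion to
`SS`. Capacity that is lost because job types are blocked, or because a resource has only short
queues, is accounted for by the error terms. -/
theorem dV₁_le [Nonempty (Idx J)] (hN : N.IsTopology) (h : Near N k r γ) (hlam : 0 < lam)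
    (hΛ : 0 ≤ Λ) (hy : 0 < y) (hlamc : lam * (rateC k Λ J + 1) ≤ k.c₀ / 2)
    (hr : 4 * Fintype.card (Idx J) * cfC k Λ lam ≤ y * r)
    {x : Config J} (hR : ∀ a, 0 ≤ x.2.1 a) (hq : ∀ j, 0 ≤ x.1 j)
    {hi : ℝ} (hhi : 1 ≤ hi) (hhir : hi ≤ k.g₀ * r) {ξ : Fin J → ℝ} (hξ : Rates N k hi x.1 ξ) :
    r ^ 2 * dV₁ N γ Λ lam r (lam ^ 2 / r ^ 2) (vel x.2.2 ξ) x ≤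
      -(k.c₀ * lam / 2) * SS N γ Λ lam r x + V₁C k I J Λ lam y * (r * PE N γ Λ lam y r x) +
        V₁C k I J Λ lam y * (hi * √(PP N γ Λ lam y r x)) := by
  have hr1 := h.r_pos
  have hr0 : (0 : ℝ) < r := by linarith
  have hg := k.g₀_pos
  have hg1 := k.g₁_pos
  have hC₀ := k.C₀_pos
  have hs := k.one_le_smax
  have hs0 : 0 < k.smax := by linarith
  have hrC : 0 ≤ rateC k Λ J := by unfold rateC; positivity
  have hcC := cfC_nonneg k hΛ hlam.le
  obtain ⟨a₀, ha1, ha2, ha3⟩ := exists_max_residual hΛ hlam.le hr (by exact_mod_cast hr0) hR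
  set P := PP N γ Λ lam y r x with hP
  set X := √P with hX
  have hX1 : Real.exp (y / 2 * x.2.1 a₀) ≤ X := exp_half_le_sqrt_PP x a₀
  set T := cfC k Λ lam / r * ∑ a, x.2.1 a with hT
  have hT0 : 0 ≤ T := mul_nonneg (by positivity) (Finset.sum_nonneg fun a _ => hR a)
  have hTX : Real.exp T ≤ X := (Real.exp_le_exp.2 (by nlinarith)).trans hX1
  set n : ℝ := (Fintype.card (Idx J) : ℝ) with hn
  have hSX : (∑ a, x.2.1 a) * Real.exp T ≤ n * (4 / y) * X := by
    have h1 : x.2.1 a₀ ≤ 4 / y * Real.exp (y / 4 * x.2.1 a₀) := by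
      have := Real.add_one_le_exp (y / 4 * x.2.1 a₀)
      have h2 : x.2.1 a₀ = 4 / y * (y / 4 * x.2.1 a₀) := by field_simp
      calc x.2.1 a₀ = 4 / y * (y / 4 * x.2.1 a₀) := h2
        _ ≤ _ := mul_le_mul_of_nonneg_left (by linarith) (by positivity)
    have h3 : Real.exp T ≤ Real.exp (y / 4 * x.2.1 a₀) := Real.exp_le_exp.2 ha3
    calc (∑ a, x.2.1 a) * Real.exp T
        ≤ (n * (4 / y * Real.exp (y / 4 * x.2.1 a₀))) * Real.exp (y / 4 * x.2.1 a₀) := by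
          refine mul_le_mul (ha2.trans (mul_le_mul_of_nonneg_left h1 (Nat.cast_nonneg _))) h3
            (Real.exp_pos _).le (by positivity)
      _ = n * (4 / y) * Real.exp (y / 2 * x.2.1 a₀) := by
          have : Real.exp (y / 2 * x.2.1 a₀) =
              Real.exp (y / 4 * x.2.1 a₀) * Real.exp (y / 4 * x.2.1 a₀) := by
            rw [← Real.exp_add]; congr 1; ring
          rw [this]; ring
      _ ≤ _ := mul_le_mul_of_nonneg_left hX1 (by positivity)
  -- estimate for a single resource
  set W := fun j => vel x.2.2 ξ (Sum.inr j) with hW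
  set D : ℝ := lam * (J * k.C₀ / k.g₀) + lam ^ 2 * (rateC k Λ J + 1) +
    lam * (J * k.smax) * Real.exp (J * lam) * (2 * (J * lam / k.g₀) +
      2 * (cfC k Λ lam * (n * (4 / y)))) with hD
  have key : ∀ i, r ^ 2 * (eK N γ Λ lam r (some i) x *
      (rate (cf Λ γ (wt N γ lam r (some i))) (vel x.2.2 ξ) + lam ^ 2 / r ^ 2) +
      expo (-wt N γ lam r (some i)) (cf Λ γ (-wt N γ lam r (some i))) x *
      (rate (cf Λ γ (-wt N γ lam r (some i))) (vel x.2.2 ξ) + lam ^ 2 / r ^ 2)) ≤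
      -(k.c₀ * lam / 2) * eK N γ Λ lam r (some i) x +
        lam * k.smax * (r * PE N γ Λ lam y r x) + D * (hi * X) := by
    intro i
    rw [rate_wt_some h.γ_pos, rate_neg_wt_some h.γ_pos]
    obtain ⟨hQ0, hQ⟩ := sum_wt_sq_le hN h hlam.le hΛ hξ x.2.2 (some i)
    set Q := Λ * ∑ j, wt N γ lam r (some i) j ^ 2 *
        (γ (Sum.inl j) + γ (Sum.inr j) * vel x.2.2 ξ (Sum.inr j)) with hQdef
    set ep := eK N γ Λ lam r (some i) x with hep
    set em := expo (-wt N γ lam r (some i)) (cf Λ γ (-wt N γ lam r (some i))) x with hem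
    have hep0 : 0 < ep := expo_pos _ _ _
    have hem0 : 0 < em := expo_pos _ _ _
    have hemX : em ≤ X := by
      refine le_trans ?_ hTX
      rw [hem]; unfold expo
      refine Real.exp_le_exp.2 ?_
      have h1 := (abs_le.1 (sum_cf_mul_le hN h hlam.le hΛ hR (some i)).2).2
      have h2 := sum_wt_nonneg hN h hlam.le hq (some i)
      have h3 : ∑ j, (-wt N γ lam r (some i)) j * x.1 j =
          -∑ j, wt N γ lam r (some i) j * x.1 j := by
        rw [← Finset.sum_neg_distrib]
        exact Finset.sum_congr rfl fun j _ => by rw [Pi.neg_apply, neg_mul]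
      rw [h3]; linarith
    -- decomposition of the drift of the workload
    set d1 := ∑ j, N.K i j * (γ (Sum.inl j) / γ (Sum.inr j) - N.ρ j) with hd1
    set d2 := ∑ j, N.K i j * (N.ρ j - ξ j) with hd2
    set d3 := ∑ j, N.K i j * (ξ j - W j) with hd3
    have hd : wdrift N γ (vel x.2.2 ξ) i = d1 + d2 + d3 := by
      rw [hd1, hd2, hd3, ← Finset.sum_add_distrib, ← Finset.sum_add_distrib]
      exact Finset.sum_congr rfl fun j _ => by simp only [hW]; ring
    have hd1u : r * d1 ≤ -k.c₀ := by
      have := h.drift i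
      rw [le_div_iff₀ hr0] at this
      linarith
    have hd1l : -(r * d1) ≤ J * k.C₀ / k.g₀ := by
      have h1 : -d1 ≤ ∑ _j : Fin J, k.C₀ / k.g₀ / r := by
        rw [hd1, ← Finset.sum_neg_distrib]
        refine Finset.sum_le_sum fun j _ => ?_
        have h2 := (abs_le.1 (h.dev j)).1
        have h3 := h.γ_pos (Sum.inr j)
        have h4 : N.ρ j - γ (Sum.inl j) / γ (Sum.inr j) ≤ k.C₀ / k.g₀ / r := by
          have h5 : N.ρ j - γ (Sum.inl j) / γ (Sum.inr j) =
              (γ (Sum.inr j) * N.ρ j - γ (Sum.inl j)) / γ (Sum.inr j) := by field_simp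
          rw [h5, div_le_iff₀ h3]
          have h6 : k.C₀ / k.g₀ / r * γ (Sum.inr j) ≥ k.C₀ / k.g₀ / r * k.g₀ :=
            mul_le_mul_of_nonneg_left (h.g₀_le _) (by positivity)
          have h7 : k.C₀ / k.g₀ / r * k.g₀ = k.C₀ / r := by field_simp
          linarith
        have h5 : 0 ≤ k.C₀ / k.g₀ / r := by positivity
        have := N.K_nonneg hN i j
        have := N.K_le_one hN i j
        nlinarith
      have h2 : ∑ _j : Fin J, k.C₀ / k.g₀ / r = J * k.C₀ / k.g₀ / r := by simp; ring
      rw [h2, le_div_iff₀ hr0] at h1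
      linarith
    have hd2n : 0 ≤ d2 := hξ.nonneg i
    have hd2u : d2 ≤ J * k.smax := by
      have : ∀ j, N.K i j * (N.ρ j - ξ j) ≤ k.smax := fun j => by
        have h1 := (abs_le.1 (hξ.abs_le j)).2
        have := N.K_nonneg hN i j
        have := N.K_le_one hN i j
        nlinarith
      refine (Finset.sum_le_sum fun j _ => this j).trans_eq ?_
      simp
    have hd3n : 0 ≤ d3 := by
      refine Finset.sum_nonneg fun j _ => mul_nonneg (N.K_nonneg hN i j) ?_
      simp only [hW, vel, Sum.elim_inr]
      split_ifs
      · linarith [hξ.lower j, k.smin_pos]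
      · linarith
    have hd3u : d3 * ep ≤ k.smax * PE N γ Λ lam y r x := by
      have h1 : d3 * ep ≤ k.smax * ∑ j, if x.2.2 j = true then
          ep * Real.exp (y * x.2.1 (Sum.inr j)) else 0 := by
        rw [hd3, Finset.sum_mul, Finset.mul_sum]
        refine Finset.sum_le_sum fun j _ => ?_
        simp only [hW, vel, Sum.elim_inr]
        split_ifs
        · have h2 : 1 ≤ Real.exp (y * x.2.1 (Sum.inr j)) :=
            Real.one_le_exp (mul_nonneg hy.le (hR _))
          have h3 : N.K i j * (ξ j - 0) ≤ k.smax := by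
            have := N.K_nonneg hN i j
            have := N.K_le_one hN i j
            have := hξ.upper j
            have := hξ.lower j
            have := k.smin_pos
            nlinarith
          calc N.K i j * (ξ j - 0) * ep ≤ k.smax * ep := mul_le_mul_of_nonneg_right h3 hep0.le
            _ ≤ _ := mul_le_mul_of_nonneg_left (le_mul_of_one_le_right hep0.le h2) hs0.le
        · simp
      refine h1.trans (mul_le_mul_of_nonneg_left ?_ hs0.le)
      exact Finset.single_le_sum (f := fun o => ∑ j, if x.2.2 j = true then
        eK N γ Λ lam r o x * Real.exp (y * x.2.1 (Sum.inr j)) else 0)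
        (fun o _ => Finset.sum_nonneg fun j _ => PE_term_nonneg x o j) (Finset.mem_univ (some i))
    have hd2e : r * (d2 * (ep - em)) ≤ (J * k.smax) * Real.exp (J * lam) *
        (2 * (J * lam / k.g₀) + 2 * (cfC k Λ lam * (n * (4 / y)))) * (hi * X) := by
      by_cases hA : ∃ j, N.K i j = 1 ∧ hi ≤ x.1 j
      · rw [hd2, hξ.full i hA]; simp only [zero_mul, mul_zero]
        positivity
      · push Not at hA
        have h1 := eK_sub_le hN h hlam.le hΛ hR (by linarith) hhir hA
        rw [← hT, ← hep, ← hem] at h1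
        set Z := (2 * (J * (lam / k.g₀ * hi)) / r + 2 * T) * (Real.exp (J * lam) * Real.exp T)
          with hZ
        have h2 : r * Z ≤ Real.exp (J * lam) *
            (2 * (J * lam / k.g₀) + 2 * (cfC k Λ lam * (n * (4 / y)))) * (hi * X) := by
          have h3 : r * Z = Real.exp (J * lam) * (2 * (J * lam / k.g₀) * (hi * Real.exp T) +
              2 * (cfC k Λ lam * ((∑ a, x.2.1 a) * Real.exp T))) := by
            rw [hZ]
            have : T * r = cfC k Λ lam * ∑ a, x.2.1 a := by rw [hT]; field_simp
            have h4 : r * ((2 * (J * (lam / k.g₀ * hi)) / r + 2 * T) *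
                (Real.exp (J * lam) * Real.exp T)) =
                (2 * (J * (lam / k.g₀ * hi)) + 2 * (T * r)) *
                (Real.exp (J * lam) * Real.exp T) := by field_simp
            rw [h4, this]; ring
          rw [h3, mul_assoc (Real.exp (J * lam))]
          refine mul_le_mul_of_nonneg_left ?_ (Real.exp_pos _).le
          have h5 : hi * Real.exp T ≤ hi * X := mul_le_mul_of_nonneg_left hTX (by linarith)
          have h6 : X ≤ hi * X := le_mul_of_one_le_left (by linarith) hhi
          have h7 : (∑ a, x.2.1 a) * Real.exp T ≤ n * (4 / y) * (hi * X) :=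
            hSX.trans (mul_le_mul_of_nonneg_left h6 (by positivity))
          have h8 := mul_le_mul_of_nonneg_left h5 (show 0 ≤ 2 * (J * lam / k.g₀) by positivity)
          have h9 := mul_le_mul_of_nonneg_left h7 hcC
          linarith
        calc r * (d2 * (ep - em)) ≤ r * (d2 * Z) := by gcongr
          _ ≤ r * ((J * k.smax) * Z) := by gcongr
          _ = (J * k.smax) * (r * Z) := by ring
          _ ≤ _ := by
            refine (mul_le_mul_of_nonneg_left h2 (by positivity)).trans_eq ?_
            ring
    -- collecting the terms
    have hQr : r ^ 2 * (Q + lam ^ 2 / r ^ 2) ≤ lam ^ 2 * (rateC k Λ J + 1) := by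
      have : r ^ 2 * (Q + lam ^ 2 / r ^ 2) = r ^ 2 * Q + lam ^ 2 := by field_simp
      rw [le_div_iff₀ (by positivity)] at hQ
      rw [this]; linarith
    have hall : r ^ 2 * (ep * (lam / r * wdrift N γ (vel x.2.2 ξ) i + Q + lam ^ 2 / r ^ 2) +
        em * (-(lam / r * wdrift N γ (vel x.2.2 ξ) i) + Q + lam ^ 2 / r ^ 2)) =
        lam * ((r * d1) * ep) + lam * (-(r * d1) * em) + lam * (r * (d2 * (ep - em))) +
        lam * (r * (d3 * ep)) - lam * (r * (d3 * em)) +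
        r ^ 2 * (Q + lam ^ 2 / r ^ 2) * (ep + em) := by
      rw [hd]; field_simp; ring
    rw [hall]
    have t1 : lam * ((r * d1) * ep) ≤ lam * (-k.c₀ * ep) :=
      mul_le_mul_of_nonneg_left (mul_le_mul_of_nonneg_right hd1u hep0.le) hlam.le
    have hXhi : X ≤ hi * X := le_mul_of_one_le_left (by linarith) hhi
    have t2 : lam * (-(r * d1) * em) ≤ lam * (J * k.C₀ / k.g₀) * (hi * X) := by
      calc lam * (-(r * d1) * em) ≤ lam * ((J * k.C₀ / k.g₀) * em) :=
            mul_le_mul_of_nonneg_left (mul_le_mul_of_nonneg_right hd1l hem0.le) hlam.le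
        _ = lam * (J * k.C₀ / k.g₀) * em := by ring
        _ ≤ _ := mul_le_mul_of_nonneg_left (hemX.trans hXhi) (by positivity)
    have t3 := mul_le_mul_of_nonneg_left hd2e hlam.le
    have t4 : lam * (r * (d3 * ep)) ≤ lam * k.smax * (r * PE N γ Λ lam y r x) := by
      calc lam * (r * (d3 * ep)) ≤ lam * (r * (k.smax * PE N γ Λ lam y r x)) := by gcongr
        _ = _ := by ring
    have t5 : 0 ≤ lam * (r * (d3 * em)) := by positivity
    have t6 : r ^ 2 * (Q + lam ^ 2 / r ^ 2) * (ep + em) ≤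
        lam * (k.c₀ / 2) * ep + lam ^ 2 * (rateC k Λ J + 1) * (hi * X) := by
      refine (mul_le_mul_of_nonneg_right hQr (by positivity)).trans ?_
      rw [mul_add]
      refine add_le_add ?_ (mul_le_mul_of_nonneg_left (hemX.trans hXhi) (by positivity))
      refine mul_le_mul_of_nonneg_right ?_ hep0.le
      calc lam ^ 2 * (rateC k Λ J + 1) = lam * (lam * (rateC k Λ J + 1)) := by ring
        _ ≤ _ := mul_le_mul_of_nonneg_left hlamc hlam.le
    rw [hD]
    linarith
  unfold dV₁
  rw [Finset.mul_sum]
  refine (Finset.sum_le_sum fun i _ => key i).trans ?_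
  rw [Finset.sum_add_distrib, Finset.sum_add_distrib, ← Finset.mul_sum]
  simp only [Finset.sum_const, Finset.card_univ, Fintype.card_fin, nsmul_eq_mul]
  have hPE := PE_nonneg (N := N) (γ := γ) (Λ := Λ) (lam := lam) (y := y) (r := r) x
  have hJ : (1 : ℝ) ≤ J := by
    have : 0 < J := by
      rcases a₀ with j | j
      exacts [j.pos, j.pos]
    exact_mod_cast this
  have hD0 : 0 ≤ D := by rw [hD]; positivity
  have e1 : V₁C k I J Λ lam y = I * (D + lam * k.smax * J) := by unfold V₁C; rw [hD]; ring
  rw [e1]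
  have e2 : I * (lam * k.smax * (r * PE N γ Λ lam y r x)) ≤
      I * (D + lam * k.smax * J) * (r * PE N γ Λ lam y r x) := by
    rw [← mul_assoc]
    refine mul_le_mul_of_nonneg_right (mul_le_mul_of_nonneg_left ?_ (Nat.cast_nonneg _))
      (by positivity)
    nlinarith [mul_pos hlam hs0]
  have e3 : I * (D * (hi * X)) ≤ I * (D + lam * k.smax * J) * (hi * X) := by
    rw [← mul_assoc]
    refine mul_le_mul_of_nonneg_right (mul_le_mul_of_nonneg_left ?_ (Nat.cast_nonneg _))
      (by positivity)
    have : 0 ≤ lam * k.smax * J := by positivity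
    linarith
  unfold SS
  linarith

/-- Drift of `V₃`. -/
def dV₃ (N : Network I J) (γ : Idx J → ℝ) (Λ lam y G : ℝ) (r : ℕ) (δ : ℝ) (v : Idx J → ℝ)
    (x : Config J) : ℝ :=
  ∑ o : Option (Fin I), ∑ a : Idx J,
    (eK N γ Λ lam r o x * Real.exp (y * x.2.1 a) *
        (rate (cf Λ γ (wt N γ lam r o)) v - y * v a + δ) +
      G * (eK N γ Λ lam r o x * Real.exp (-y * x.2.1 a) *
        (rate (cf Λ γ (wt N γ lam r o)) v + y * v a + δ)))

theorem upperDeriv_V₃ (p : Policy J) {G : ℝ} (hG : 0 ≤ G) (x : Config J) (δ : ℝ) :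
    UpperDeriv (fun u => V₃ N γ Λ lam y G r (flow p N r x u))
      (dV₃ N γ Λ lam y G r δ (speed p N r x) x - δ * V₃ N γ Λ lam y G r x) := by
  have : dV₃ N γ Λ lam y G r δ (speed p N r x) x - δ * V₃ N γ Λ lam y G r x =
      ∑ o : Option (Fin I), ∑ a : Idx J,
      (expo (wt N γ lam r o) (cf Λ γ (wt N γ lam r o) + Pi.single a y) x *
        rate (cf Λ γ (wt N γ lam r o) + Pi.single a y) (speed p N r x) +
      G * (expo (wt N γ lam r o) (cf Λ γ (wt N γ lam r o) - Pi.single a y) x *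
        rate (cf Λ γ (wt N γ lam r o) - Pi.single a y) (speed p N r x))) := by
    unfold dV₃ V₃
    rw [Finset.mul_sum, ← Finset.sum_sub_distrib]
    refine Finset.sum_congr rfl fun o _ => ?_
    rw [Finset.mul_sum, ← Finset.sum_sub_distrib]
    refine Finset.sum_congr rfl fun a _ => ?_
    rw [rate_add, rate_sub, rate_single, expo_add_single, expo_sub_single]
    unfold eK; ring
  rw [this]
  exact UpperDeriv.sum _ fun o _ => UpperDeriv.sum _ fun a _ =>
    (upperDeriv_expo_flow p N r _ _ x).add ((upperDeriv_expo_flow p N r _ _ x).const_mul hG)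

/-- Drift estimate for `V₃`: the residual times decrease, except those of the jobs of blocked types. -/
theorem dV₃_le (hN : N.IsTopology) (h : Near N k r γ) (hlam : 0 ≤ lam) (hΛ : 0 ≤ Λ) (hy : 0 < y)
    {G δ : ℝ} (hG : 0 ≤ G)
    (hr : Fintype.card (Idx J) * (cfC k Λ lam * k.smax) / r + δ ≤ y * k.smin / 2)
    {x : Config J} (hR : ∀ a, 0 ≤ x.2.1 a)
    {hi : ℝ} {ξ : Fin J → ℝ} (hξ : Rates N k hi x.1 ξ) :
    dV₃ N γ Λ lam y G r δ (vel x.2.2 ξ) x ≤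
      -(y * k.smin / 2) * PP N γ Λ lam y r x + y * k.smin * PE N γ Λ lam y r x +
        Fintype.card (Idx J) * (2 * G * y * k.smax) * (1 + SS N γ Λ lam r x) := by
  have hs := k.one_le_smax
  have hsm := k.smin_pos
  have hs1 := k.smin_le_one
  have key : ∀ o (a : Idx J), eK N γ Λ lam r o x * Real.exp (y * x.2.1 a) *
        (rate (cf Λ γ (wt N γ lam r o)) (vel x.2.2 ξ) - y * vel x.2.2 ξ a + δ) +
      G * (eK N γ Λ lam r o x * Real.exp (-y * x.2.1 a) *
        (rate (cf Λ γ (wt N γ lam r o)) (vel x.2.2 ξ) + y * vel x.2.2 ξ a + δ)) ≤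
      -(y * k.smin / 2) * (eK N γ Λ lam r o x * Real.exp (y * x.2.1 a)) +
      y * k.smin * (Sum.elim (fun _ => 0) (fun j => if x.2.2 j = true then
        eK N γ Λ lam r o x * Real.exp (y * x.2.1 (Sum.inr j)) else 0) a) +
      2 * G * y * k.smax * eK N γ Λ lam r o x := by
    intro o a
    have h1 := (abs_le.1 (abs_rate_wt_le hN h hlam hΛ hξ x.2.2 o)).2
    set ρ' := rate (cf Λ γ (wt N γ lam r o)) (vel x.2.2 ξ) with hρ'
    have he := eK_pos (N := N) (γ := γ) (Λ := Λ) (lam := lam) (r := r) o x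
    have hexp := Real.exp_pos (y * x.2.1 a)
    have hprod := mul_pos he hexp
    refine add_le_add ?_ ?_
    · have h2 : ρ' - y * vel x.2.2 ξ a + δ ≤ y * k.smin / 2 - y * vel x.2.2 ξ a := by linarith
      refine (mul_le_mul_of_nonneg_left h2 hprod.le).trans ?_
      rcases a with j | j
      · simp only [vel, Sum.elim_inl]
        have : y * k.smin ≤ y * 1 := mul_le_mul_of_nonneg_left hs1 hy.le
        nlinarith
      · simp only [vel, Sum.elim_inr]
        split_ifs
        · nlinarith
        · have := mul_le_mul_of_nonneg_left (hξ.lower j) hy.le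
          nlinarith
    · have h2 : ρ' + y * vel x.2.2 ξ a + δ ≤ 2 * (y * k.smax) := by
        have h3 := mul_le_mul_of_nonneg_left (vel_le hξ x.2.2 a) hy.le
        have h4 : y * k.smin ≤ y * k.smax := mul_le_mul_of_nonneg_left (by linarith) hy.le
        have h5 : 0 ≤ y * k.smax := by positivity
        nlinarith [mul_pos hy hsm]
      have h3 : Real.exp (-y * x.2.1 a) ≤ 1 :=
        Real.exp_le_one_iff.2 (by nlinarith [hR a])
      have h4 : eK N γ Λ lam r o x * Real.exp (-y * x.2.1 a) * (ρ' + y * vel x.2.2 ξ a + δ) ≤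
          eK N γ Λ lam r o x * (2 * (y * k.smax)) := by
        have h5 : 0 ≤ 2 * (y * k.smax) := by positivity
        calc _ ≤ eK N γ Λ lam r o x * Real.exp (-y * x.2.1 a) * (2 * (y * k.smax)) := by
              gcongr
          _ ≤ eK N γ Λ lam r o x * 1 * (2 * (y * k.smax)) := by gcongr
          _ = _ := by ring
      calc _ ≤ G * (eK N γ Λ lam r o x * (2 * (y * k.smax))) := mul_le_mul_of_nonneg_left h4 hG
        _ = _ := by ring
  unfold dV₃
  refine (Finset.sum_le_sum fun o _ => Finset.sum_le_sum fun a _ => key o a).trans_eq ?_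
  simp only [Finset.sum_add_distrib, ← Finset.mul_sum]
  have e1 : ∑ o : Option (Fin I), ∑ a : Idx J, (Sum.elim (fun _ => 0) (fun j =>
      if x.2.2 j = true then eK N γ Λ lam r o x * Real.exp (y * x.2.1 (Sum.inr j)) else 0) a : ℝ) =
      PE N γ Λ lam y r x := by
    unfold PE
    refine Finset.sum_congr rfl fun o _ => ?_
    rw [Fintype.sum_sum_type]
    simp
  have e2 : ∑ o : Option (Fin I), ∑ a : Idx J, eK N γ Λ lam r o x * Real.exp (y * x.2.1 a) =
    PP N γ Λ lam y r x := rfl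
  simp only [Finset.sum_const, Finset.card_univ, nsmul_eq_mul, ← Finset.mul_sum]
  simp only [Finset.mul_sum] at e1 e2 ⊢
  simp only [← Finset.mul_sum] at e1 e2 ⊢
  rw [e1, sum_eK]
  unfold PP
  simp only [← Finset.mul_sum]
  ring

end Drift
end RSN
end

noncomputable section

namespace RSN

/-! ### Drift of the penalty for blocked job types -/

section Drift

variable {I J : ℕ} {N : Network I J} {γ : Idx J → ℝ} {Λ lam y : ℝ} {r : ℕ} {k : Consts}

/-- Drift of `V₂`. -/
def dV₂ (N : Network I J) (γ : Idx J → ℝ) (Λ lam y θ b B₁ lo hi : ℝ) (r : ℕ) (δ : ℝ)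
    (v : Idx J → ℝ) (x : Config J) : ℝ :=
  ∑ o : Option (Fin I), ∑ j : Fin J,
    if x.2.2 j = true then Real.exp (hi * b⁻¹) * expoB N γ Λ lam y b r o j x *
      (rate (Function.update (cf Λ γ (wt N γ lam r o - Pi.single j b⁻¹)) (Sum.inr j) (2 * y)) v + δ)
    else B₁ * Real.exp (θ * lo) * expoU N γ Λ lam θ r o j x *
      (rate (cf Λ γ (wt N γ lam r o - Pi.single j θ)) v + δ)

theorem upperDeriv_V₂ (p : Policy J) {θ b B₁ lo hi : ℝ} (hB₁ : 0 ≤ B₁) (x : Config J) (δ : ℝ) :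
    UpperDeriv (fun u => V₂ N γ Λ lam y θ b B₁ lo hi r (flow p N r x u))
      (dV₂ N γ Λ lam y θ b B₁ lo hi r δ (speed p N r x) x -
        δ * V₂ N γ Λ lam y θ b B₁ lo hi r x) := by
  have : dV₂ N γ Λ lam y θ b B₁ lo hi r δ (speed p N r x) x -
        δ * V₂ N γ Λ lam y θ b B₁ lo hi r x =
      ∑ o : Option (Fin I), ∑ j : Fin J,
      if x.2.2 j = true then Real.exp (hi * b⁻¹) * (expoB N γ Λ lam y b r o j x *
        rate (Function.update (cf Λ γ (wt N γ lam r o - Pi.single j b⁻¹)) (Sum.inr j) (2 * y))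
          (speed p N r x))
      else B₁ * Real.exp (θ * lo) * (expoU N γ Λ lam θ r o j x *
        rate (cf Λ γ (wt N γ lam r o - Pi.single j θ)) (speed p N r x)) := by
    unfold dV₂ V₂
    rw [Finset.mul_sum, ← Finset.sum_sub_distrib]
    refine Finset.sum_congr rfl fun o _ => ?_
    rw [Finset.mul_sum, ← Finset.sum_sub_distrib]
    refine Finset.sum_congr rfl fun j _ => ?_
    split_ifs <;> ring
  rw [this]
  refine UpperDeriv.sum _ fun o _ => UpperDeriv.sum _ fun j _ => ?_
  by_cases hE : x.2.2 j = true
  · have h1 : ∀ u, (flow p N r x u).2.2 j = true := fun _ => hE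
    simp only [h1, hE, if_true]
    exact (upperDeriv_expo_flow p N r _ _ x).const_mul (Real.exp_pos _).le
  · have h1 : ∀ u, ¬ (flow p N r x u).2.2 j = true := fun _ => hE
    simp only [h1, hE]
    exact (upperDeriv_expo_flow p N r _ _ x).const_mul (mul_nonneg hB₁ (Real.exp_pos _).le)

theorem cf_sub_inl (σ : Fin J → ℝ) (j : Fin J) (t : ℝ) :
    cf Λ γ (σ - Pi.single j t) (Sum.inl j) - cf Λ γ σ (Sum.inl j) =
      γ (Sum.inl j) * (t * (1 - Λ * t + 2 * Λ * σ j)) := by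
  simp only [cf, sg, Sum.elim_inl, Pi.sub_apply, Pi.single_eq_same]; ring

theorem cf_sub_inr (σ : Fin J → ℝ) (j : Fin J) (t : ℝ) :
    cf Λ γ (σ - Pi.single j t) (Sum.inr j) - cf Λ γ σ (Sum.inr j) =
      -(γ (Sum.inr j) * (t * (1 + Λ * t - 2 * Λ * σ j))) := by
  simp only [cf, sg, Sum.elim_inr, Pi.sub_apply, Pi.single_eq_same]; ring

set_option maxHeartbeats 1000000 in
/-- Drift estimate for `V₂`: blocked job types contribute a decrease of order `1/b`, and those that
are served none, up to an error that is small because of the distance of the two thresholds. -/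
theorem dV₂_le (hN : N.IsTopology) (h : Near N k r γ) (hlam : 0 ≤ lam) (hΛ : 0 ≤ Λ)
    {θ b B₁ lo hi δ e₁ : ℝ} (hB₁ : 0 ≤ B₁) (hb : 0 < b) (hθ : 0 < θ)
    (hΛb : 4 * Λ ≤ b) (hΛθ : 2 * Λ * θ ≤ 1) (hΛs : 2 * Λ * (lam / k.g₀ / r) ≤ 1 / 2)
    (hθ2 : Λ * θ * (2 * k.g₁ * k.smax) ≤ k.g₀ * k.vmin / 4) (hθy : 2 * k.g₁ * θ ≤ y)
    (hcf : cfC k Λ lam / r ≤ y)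
    (hr1 : Fintype.card (Idx J) * (cfC k Λ lam * k.smax) / r + δ ≤ k.g₀ / (4 * b))
    (hr2 : Fintype.card (Idx J) * (cfC k Λ lam * k.smax) / r + δ ≤ θ * (k.g₀ * k.vmin / 4))
    (hr3 : k.C₀ / r ≤ k.g₀ * k.vmin / 2)
    (he₁ : B₁ * Real.exp (-(θ * (hi - lo))) * (θ * (k.g₀ * k.vmin) + 4 * θ * k.g₁ * k.smax) ≤ e₁)
    {x : Config J} (hx : Valid lo hi x) {ξ : Fin J → ℝ} (hξ : Rates N k hi x.1 ξ) :
    dV₂ N γ Λ lam y θ b B₁ lo hi r δ (vel x.2.2 ξ) x ≤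
      -(k.g₀ / (2 * b)) * PE N γ Λ lam y r x + e₁ * PP N γ Λ lam y r x := by
  have hg := k.g₀_pos
  have hg1 := k.g₁_pos
  have hs := k.one_le_smax
  have hvm := k.vmin_pos
  have he₁0 : 0 ≤ e₁ := le_trans (by positivity) he₁
  have hbinv : 0 < b⁻¹ := by positivity
  have key : ∀ (o : Option (Fin I)) (j : Fin J),
      (if x.2.2 j = true then Real.exp (hi * b⁻¹) * expoB N γ Λ lam y b r o j x *
      (rate (Function.update (cf Λ γ (wt N γ lam r o - Pi.single j b⁻¹)) (Sum.inr j) (2 * y))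
        (vel x.2.2 ξ) + δ)
    else B₁ * Real.exp (θ * lo) * expoU N γ Λ lam θ r o j x *
      (rate (cf Λ γ (wt N γ lam r o - Pi.single j θ)) (vel x.2.2 ξ) + δ)) ≤
      -(k.g₀ / (2 * b)) * (if x.2.2 j = true then
        eK N γ Λ lam r o x * Real.exp (y * x.2.1 (Sum.inr j)) else 0) +
      e₁ * (eK N γ Λ lam r o x * Real.exp (y * x.2.1 (Sum.inl j))) := by
    intro o j
    have hrt := (abs_le.1 (abs_rate_wt_le hN h hlam hΛ hξ x.2.2 o)).2
    set ρ' := rate (cf Λ γ (wt N γ lam r o)) (vel x.2.2 ξ) with hρ'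
    set C₁ := Fintype.card (Idx J) * (cfC k Λ lam * k.smax) / r with hC₁
    have hw0 := wt_nonneg hN h.γ_pos hlam r o j
    have hw1 : 2 * Λ * wt N γ lam r o j ≤ 1 / 2 :=
      (mul_le_mul_of_nonneg_left (wt_le hN h hlam o j) (by positivity)).trans hΛs
    have hw2 : 0 ≤ 2 * Λ * wt N γ lam r o j := by positivity
    have hcfa : ∀ a, |cf Λ γ (wt N γ lam r o) a| ≤ y := fun a =>
      (abs_cf_wt_le hN h hlam hΛ o a).1.trans hcf
    have he := eK_pos (N := N) (γ := γ) (Λ := Λ) (lam := lam) (r := r) o x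
    have hγl := h.γ_pos (Sum.inl j)
    have hγr := h.γ_pos (Sum.inr j)
    by_cases hE : x.2.2 j = true
    -- a blocked queue only grows, at a rate of at least `g₀`
    · simp only [hE, if_true]
      have hd := sum_mul_sub_sum_mul (R := vel x.2.2 ξ)
        (c := Function.update (cf Λ γ (wt N γ lam r o - Pi.single j b⁻¹)) (Sum.inr j) (2 * y))
        (c' := cf Λ γ (wt N γ lam r o)) j
        (fun a h1 h2 => by rw [Function.update_of_ne h2, cf_sub_single h1 h2])
      have hd' := sum_mul_sub_sum_mul (R := x.2.1)
        (c := Function.update (cf Λ γ (wt N γ lam r o - Pi.single j b⁻¹)) (Sum.inr j) (2 * y))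
        (c' := cf Λ γ (wt N γ lam r o)) j
        (fun a h1 h2 => by rw [Function.update_of_ne h2, cf_sub_single h1 h2])
      rw [Function.update_self, Function.update_of_ne (by simp), cf_sub_inl] at hd hd'
      have hvr : vel x.2.2 ξ (Sum.inr j) = 0 := by simp [vel, hE]
      have hvl : vel x.2.2 ξ (Sum.inl j) = 1 := rfl
      rw [hvr, hvl, mul_zero, mul_one, add_zero] at hd
      have hfac : 3 / 4 ≤ 1 - Λ * b⁻¹ + 2 * Λ * wt N γ lam r o j := by
        have : Λ * b⁻¹ ≤ 1 / 4 := by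
          rw [← div_eq_mul_inv, div_le_iff₀ hb]; linarith
        linarith
      have hrate : rate (Function.update (cf Λ γ (wt N γ lam r o - Pi.single j b⁻¹)) (Sum.inr j)
          (2 * y)) (vel x.2.2 ξ) + δ ≤ -(k.g₀ / (2 * b)) := by
        have h1 : k.g₀ * (b⁻¹ * (3 / 4)) ≤ γ (Sum.inl j) *
            (b⁻¹ * (1 - Λ * b⁻¹ + 2 * Λ * wt N γ lam r o j)) := by
          refine mul_le_mul (h.g₀_le _) (mul_le_mul_of_nonneg_left hfac hbinv.le) (by positivity)
            hγl.le
        have h2 : k.g₀ * (b⁻¹ * (3 / 4)) = k.g₀ / (2 * b) + k.g₀ / (4 * b) := by field_simp; ring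
        have h3 : rate (Function.update (cf Λ γ (wt N γ lam r o - Pi.single j b⁻¹)) (Sum.inr j)
            (2 * y)) (vel x.2.2 ξ) = ρ' - γ (Sum.inl j) *
            (b⁻¹ * (1 - Λ * b⁻¹ + 2 * Λ * wt N γ lam r o j)) := by
          rw [hρ']; unfold rate; linarith
        rw [h3]; linarith
      have hval : eK N γ Λ lam r o x * Real.exp (y * x.2.1 (Sum.inr j)) ≤
          Real.exp (hi * b⁻¹) * expoB N γ Λ lam y b r o j x := by
        unfold expoB eK expo
        rw [← Real.exp_add, ← Real.exp_add, sum_sub_single_mul]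
        refine Real.exp_le_exp.2 ?_
        have h1 := hx.lt_hi j hE
        have h2 : b⁻¹ * x.1 j ≤ hi * b⁻¹ := by nlinarith
        have h3 : 0 ≤ γ (Sum.inl j) * (b⁻¹ * (1 - Λ * b⁻¹ + 2 * Λ * wt N γ lam r o j)) *
            x.2.1 (Sum.inl j) := by
          have := hx.R_nonneg (Sum.inl j)
          have : 0 ≤ 1 - Λ * b⁻¹ + 2 * Λ * wt N γ lam r o j := by linarith
          positivity
        have h4 : y * x.2.1 (Sum.inr j) ≤
            (2 * y - cf Λ γ (wt N γ lam r o) (Sum.inr j)) * x.2.1 (Sum.inr j) :=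
          mul_le_mul_of_nonneg_right (by linarith [(abs_le.1 (hcfa (Sum.inr j))).2])
            (hx.R_nonneg _)
        linarith
      have hpos : 0 ≤ Real.exp (hi * b⁻¹) * expoB N γ Λ lam y b r o j x :=
        (mul_pos (Real.exp_pos _) (expo_pos _ _ _)).le
      have h1 := mul_le_mul_of_nonneg_left hrate hpos
      have h2 : 0 ≤ k.g₀ / (2 * b) := by positivity
      have h3 := mul_le_mul_of_nonneg_left hval h2
      have h4 : 0 ≤ e₁ * (eK N γ Λ lam r o x * Real.exp (y * x.2.1 (Sum.inl j))) :=
        mul_nonneg he₁0 (mul_pos he (Real.exp_pos _)).le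
      linarith
    · simp only [hE]
      have hd := sum_mul_sub_sum_mul (R := vel x.2.2 ξ)
        (c := cf Λ γ (wt N γ lam r o - Pi.single j θ)) (c' := cf Λ γ (wt N γ lam r o)) j
        (fun a h1 h2 => by rw [cf_sub_single h1 h2])
      have hd' := sum_mul_sub_sum_mul (R := x.2.1)
        (c := cf Λ γ (wt N γ lam r o - Pi.single j θ)) (c' := cf Λ γ (wt N γ lam r o)) j
        (fun a h1 h2 => by rw [cf_sub_single h1 h2])
      rw [cf_sub_inl, cf_sub_inr] at hd hd'
      have hvr : vel x.2.2 ξ (Sum.inr j) = ξ j := by simp [vel, hE]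
      have hvl : vel x.2.2 ξ (Sum.inl j) = 1 := rfl
      rw [hvr, hvl, mul_one] at hd
      have hξ0 : 0 ≤ ξ j := k.smin_pos.le.trans (hξ.lower j)
      have hsum : γ (Sum.inl j) + γ (Sum.inr j) * ξ j ≤ 2 * k.g₁ * k.smax := by
        have h1 := h.le_g₁ (Sum.inl j)
        have h2 := mul_le_mul (h.le_g₁ (Sum.inr j)) (hξ.upper j) hξ0 hg1.le
        nlinarith
      have hsum0 : 0 ≤ γ (Sum.inl j) + γ (Sum.inr j) * ξ j := by positivity
      have hrate : rate (cf Λ γ (wt N γ lam r o - Pi.single j θ)) (vel x.2.2 ξ) ≤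
          ρ' - θ * (γ (Sum.inl j) - γ (Sum.inr j) * ξ j) + θ * (k.g₀ * k.vmin / 4) := by
        have h3 : rate (cf Λ γ (wt N γ lam r o - Pi.single j θ)) (vel x.2.2 ξ) =
            ρ' - θ * (γ (Sum.inl j) - γ (Sum.inr j) * ξ j) +
            θ * ((Λ * θ - 2 * Λ * wt N γ lam r o j) * (γ (Sum.inl j) + γ (Sum.inr j) * ξ j)) := by
          rw [hρ']; unfold rate; linarith
        rw [h3]
        refine add_le_add le_rfl (mul_le_mul_of_nonneg_left ?_ hθ.le)
        have h4 : (Λ * θ - 2 * Λ * wt N γ lam r o j) * (γ (Sum.inl j) + γ (Sum.inr j) * ξ j) ≤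
            Λ * θ * (γ (Sum.inl j) + γ (Sum.inr j) * ξ j) :=
          mul_le_mul_of_nonneg_right (by linarith) hsum0
        have h5 := mul_le_mul_of_nonneg_left hsum (show 0 ≤ Λ * θ by positivity)
        linarith
      have hpos : 0 ≤ B₁ * Real.exp (θ * lo) * expoU N γ Λ lam θ r o j x :=
        mul_nonneg (mul_nonneg hB₁ (Real.exp_pos _).le) (expo_pos _ _ _).le
      have hPP : 0 < eK N γ Λ lam r o x * Real.exp (y * x.2.1 (Sum.inl j)) :=
        mul_pos he (Real.exp_pos _)
      simp only [Bool.false_eq_true, if_false, mul_zero, zero_add]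
      rcases lt_or_ge (x.1 j) hi with hq | hq
      -- short queues get less than their load, so that the exponential decreases
      · refine le_trans ?_ (mul_nonneg he₁0 hPP.le)
        refine mul_nonpos_of_nonneg_of_nonpos hpos ?_
        have h1 := (abs_le.1 (h.dev j)).1
        have h2 := mul_le_mul (h.g₀_le (Sum.inr j)) (hξ.small j hq) hvm.le hγr.le
        have h3 : k.g₀ * k.vmin / 2 ≤ γ (Sum.inl j) - γ (Sum.inr j) * ξ j := by linarith
        have h4 := mul_le_mul_of_nonneg_left h3 hθ.le
        linarith
      -- for long queues the exponential is small
      · have hval : Real.exp (θ * lo) * expoU N γ Λ lam θ r o j x ≤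
            Real.exp (-(θ * (hi - lo))) *
              (eK N γ Λ lam r o x * Real.exp (y * x.2.1 (Sum.inl j))) := by
          unfold expoU eK expo
          rw [← Real.exp_add, ← Real.exp_add, ← Real.exp_add, sum_sub_single_mul]
          refine Real.exp_le_exp.2 ?_
          have h2 : θ * hi ≤ θ * x.1 j := mul_le_mul_of_nonneg_left hq hθ.le
          have h3 : γ (Sum.inl j) * (θ * (1 - Λ * θ + 2 * Λ * wt N γ lam r o j)) *
              x.2.1 (Sum.inl j) ≤ y * x.2.1 (Sum.inl j) := by
            refine mul_le_mul_of_nonneg_right ?_ (hx.R_nonneg _)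
            have h4 : θ * (1 - Λ * θ + 2 * Λ * wt N γ lam r o j) ≤ θ * 2 := by
              refine mul_le_mul_of_nonneg_left ?_ hθ.le
              have : 0 ≤ Λ * θ := by positivity
              linarith
            have h5 : 0 ≤ θ * (1 - Λ * θ + 2 * Λ * wt N γ lam r o j) :=
              mul_nonneg hθ.le (by linarith)
            have h6 := mul_le_mul (h.le_g₁ (Sum.inl j)) h4 h5 hg1.le
            linarith
          have h4 : 0 ≤ γ (Sum.inr j) * (θ * (1 + Λ * θ - 2 * Λ * wt N γ lam r o j)) *
              x.2.1 (Sum.inr j) := by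
            have h5 : 0 ≤ 1 + Λ * θ - 2 * Λ * wt N γ lam r o j := by
              have : 0 ≤ Λ * θ := by positivity
              linarith
            have := hx.R_nonneg (Sum.inr j)
            positivity
          linarith
        have hr' : rate (cf Λ γ (wt N γ lam r o - Pi.single j θ)) (vel x.2.2 ξ) + δ ≤
            θ * (k.g₀ * k.vmin) + 4 * θ * k.g₁ * k.smax := by
          have h1 : -(γ (Sum.inl j) - γ (Sum.inr j) * ξ j) ≤ 2 * k.g₁ * k.smax := by linarith
          have h2 := mul_le_mul_of_nonneg_left h1 hθ.le
          have h3 : 0 ≤ θ * (k.g₀ * k.vmin) := by positivity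
          have h4 : 0 ≤ θ * k.g₁ * k.smax := by positivity
          linarith
        calc _ ≤ B₁ * Real.exp (θ * lo) * expoU N γ Λ lam θ r o j x *
              (θ * (k.g₀ * k.vmin) + 4 * θ * k.g₁ * k.smax) := mul_le_mul_of_nonneg_left hr' hpos
          _ = B₁ * (θ * (k.g₀ * k.vmin) + 4 * θ * k.g₁ * k.smax) *
              (Real.exp (θ * lo) * expoU N γ Λ lam θ r o j x) := by ring
          _ ≤ B₁ * (θ * (k.g₀ * k.vmin) + 4 * θ * k.g₁ * k.smax) * (Real.exp (-(θ * (hi - lo))) *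
              (eK N γ Λ lam r o x * Real.exp (y * x.2.1 (Sum.inl j)))) :=
              mul_le_mul_of_nonneg_left hval (by positivity)
          _ = B₁ * Real.exp (-(θ * (hi - lo))) * (θ * (k.g₀ * k.vmin) + 4 * θ * k.g₁ * k.smax) *
              (eK N γ Λ lam r o x * Real.exp (y * x.2.1 (Sum.inl j))) := by ring
          _ ≤ _ := mul_le_mul_of_nonneg_right he₁ hPP.le
  unfold dV₂
  refine (Finset.sum_le_sum fun o _ => Finset.sum_le_sum fun j _ => key o j).trans ?_
  simp only [Finset.sum_add_distrib]
  refine add_le_add (le_of_eq ?_) ?_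
  · unfold PE
    rw [Finset.mul_sum]
    exact Finset.sum_congr rfl fun o _ => by rw [Finset.mul_sum]
  · unfold PP
    rw [Finset.mul_sum]
    refine Finset.sum_le_sum fun o _ => ?_
    rw [← Finset.mul_sum, Fintype.sum_sum_type]
    refine mul_le_mul_of_nonneg_left (le_add_of_nonneg_right ?_) he₁0
    exact Finset.sum_nonneg fun j _ => (mul_pos (eK_pos _ _) (Real.exp_pos _)).le

/-! ### Bounds on queue lengths and residual times -/

/-- Queue lengths are bounded by the exponentials: by `PP` always, and by the exponential of a
resource up to a small multiple of `PP`. -/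
theorem exists_queue_le [Nonempty (Idx J)] (hN : N.IsTopology) (h : Near N k r γ) (hlam : 0 < lam)
    (hΛ : 0 ≤ Λ) (hy : 0 < y) (hr : 4 * Fintype.card (Idx J) * cfC k Λ lam ≤ y * r)
    {x : Config J} (hR : ∀ a, 0 ≤ x.2.1 a) (hq : ∀ j, 0 ≤ x.1 j) (j : Fin J) :
    ∃ i, x.1 j ≤ k.g₁ / lam * r * (eK N γ Λ lam r (some i) x *
        Real.exp (cfC k Λ lam / r * ∑ a, x.2.1 a)) ∧
      (x.1 j / r) ^ 2 ≤ 2 * (k.g₁ / lam) ^ 2 * PP N γ Λ lam y r x ∧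
      ∀ a, x.1 j ≤ k.g₁ / lam * r * (PP N γ Λ lam y r x * Real.exp (-(y / 2 * x.2.1 a))) := by
  obtain ⟨i, hi⟩ := hN.uses_resource j
  have hr1 := h.r_pos
  have hr0 : (0 : ℝ) < r := by linarith
  have hg1 := k.g₁_pos
  have hγ := h.γ_pos (Sum.inr j)
  obtain ⟨a₀, ha1, ha2, ha3⟩ := exists_max_residual hΛ hlam.le hr (by exact_mod_cast hr0) hR
  set T := cfC k Λ lam / r * ∑ a, x.2.1 a with hT
  set u := ∑ j, wt N γ lam r (some i) j * x.1 j with hu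
  have hu1 : lam / (r * k.g₁) * x.1 j ≤ u := by
    refine le_trans ?_ (Finset.single_le_sum (f := fun j => wt N γ lam r (some i) j * x.1 j)
      (fun j _ => mul_nonneg (wt_nonneg hN h.γ_pos hlam.le r _ j) (hq j)) (Finset.mem_univ j))
    refine mul_le_mul_of_nonneg_right ?_ (hq j)
    simp only [wt, hi, mul_one]
    exact div_le_div_of_nonneg_left hlam.le (by positivity)
      (mul_le_mul_of_nonneg_left (h.le_g₁ _) hr0.le)
  have hu0 : 0 ≤ u := le_trans (by have := hq j; positivity) hu1
  have hq1 : x.1 j ≤ k.g₁ / lam * r * u := by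
    have : x.1 j = k.g₁ / lam * r * (lam / (r * k.g₁) * x.1 j) := by field_simp
    rw [this]; exact mul_le_mul_of_nonneg_left hu1 (by positivity)
  have hue : Real.exp u ≤ eK N γ Λ lam r (some i) x * Real.exp T := by
    unfold eK expo
    rw [← Real.exp_add]
    refine Real.exp_le_exp.2 ?_
    have := (abs_le.1 (sum_cf_mul_le hN h hlam.le hΛ hR (some i)).1).1
    linarith
  have hule := Real.add_one_le_exp u
  have heP : ∀ a, Real.exp u ≤ PP N γ Λ lam y r x * Real.exp (-(y / 2 * x.2.1 a)) := by
    intro a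
    have h1 := le_PP (N := N) (γ := γ) (Λ := Λ) (lam := lam) (y := y) (r := r) x (some i) a₀
    have he := eK_pos (N := N) (γ := γ) (Λ := Λ) (lam := lam) (r := r) (some i) x
    have h2 : Real.exp T ≤ Real.exp (y * x.2.1 a₀) * Real.exp (-(y / 2 * x.2.1 a)) := by
      rw [← Real.exp_add]
      refine Real.exp_le_exp.2 ?_
      have h4 := mul_le_mul_of_nonneg_left (ha1 a) hy.le
      have := hR a₀
      nlinarith
    calc Real.exp u ≤ eK N γ Λ lam r (some i) x * Real.exp T := hue
      _ ≤ eK N γ Λ lam r (some i) x *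
          (Real.exp (y * x.2.1 a₀) * Real.exp (-(y / 2 * x.2.1 a))) :=
          mul_le_mul_of_nonneg_left h2 he.le
      _ = eK N γ Λ lam r (some i) x * Real.exp (y * x.2.1 a₀) *
          Real.exp (-(y / 2 * x.2.1 a)) := by ring
      _ ≤ _ := mul_le_mul_of_nonneg_right h1 (Real.exp_pos _).le
  refine ⟨i, hq1.trans (mul_le_mul_of_nonneg_left ((by linarith : u ≤ Real.exp u).trans hue)
    (by positivity)), ?_, fun a => hq1.trans (mul_le_mul_of_nonneg_left
    ((by linarith : u ≤ Real.exp u).trans (heP a)) (by positivity))⟩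
  have h1 : x.1 j / r ≤ k.g₁ / lam * u := by
    rw [div_le_iff₀ hr0]; linarith
  have h2 : (x.1 j / r) ^ 2 ≤ (k.g₁ / lam * u) ^ 2 :=
    pow_le_pow_left₀ (div_nonneg (hq j) hr0.le) h1 2
  have h3 : u ^ 2 ≤ 2 * Real.exp u := by
    have := Real.quadratic_le_exp_of_nonneg hu0
    nlinarith
  have h4 : Real.exp u ≤ PP N γ Λ lam y r x := (heP a₀).trans
    (mul_le_of_le_one_right (PP_nonneg x) (Real.exp_le_one_iff.2 (by
      have := hR a₀
      have : 0 ≤ y / 2 * x.2.1 a₀ := by positivity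
      linarith)))
  calc (x.1 j / r) ^ 2 ≤ (k.g₁ / lam) ^ 2 * u ^ 2 := by rw [← mul_pow]; exact h2
    _ ≤ (k.g₁ / lam) ^ 2 * (2 * PP N γ Λ lam y r x) :=
        mul_le_mul_of_nonneg_left (h3.trans (by linarith)) (sq_nonneg _)
    _ = _ := by ring

end Drift
end RSN
end

noncomputable section

namespace RSN

/-! ### Drift of the corrected cost gap -/

section GapDrift

variable {I J : ℕ} {N : Network I J} {γ : Idx J → ℝ} {Λ lam y : ℝ} {r : ℕ} {k : Consts}

/-- Drift of the corrected queue lengths. -/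
def qdrift (γ v : Idx J → ℝ) (j : Fin J) : ℝ :=
  γ (Sum.inl j) * v (Sum.inl j) - γ (Sum.inr j) * v (Sum.inr j)

theorem qt_flow (p : Policy J) (N : Network I J) (r : ℕ) (x : Config J) (u : ℝ) :
    qt γ (flow p N r x u) = qt γ x + u • qdrift γ (speed p N r x) := by
  ext j
  simp only [qt, flow, qdrift, Pi.add_apply, Pi.smul_apply, smul_eq_mul]
  ring

theorem gap_add_smul_le (hN : N.IsTopology) {Cp : ℝ} (hCp : 0 ≤ Cp) (q m : Fin J → ℝ) {u : ℝ}
    (hu : 0 ≤ u) :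
    N.gap Cp (q + u • m) ≤ N.gap Cp q + u * (N.h ⬝ᵥ m + Cp * ∑ i, |N.wl m i|) := by
  have h1 := N.hext_lipschitz hN hCp (N.wl q) (N.wl (q + u • m))
  have h2 : ∑ i, |N.wl q i - N.wl (q + u • m) i| = u * ∑ i, |N.wl m i| := by
    rw [Finset.mul_sum]
    refine Finset.sum_congr rfl fun i _ => ?_
    rw [N.wl_add, N.wl_smul, Pi.add_apply, Pi.smul_apply, smul_eq_mul, sub_add_cancel_left,
      abs_neg, abs_mul, abs_of_nonneg hu]
  rw [h2] at h1
  unfold Network.gap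
  rw [dotProduct_add, dotProduct_smul, smul_eq_mul]
  linarith

/-- Upper bound for the derivative of `Y` along the deterministic motion, for any bound `D` on the
increase of the gap. -/
theorem upperDeriv_Y (p : Policy J) {Cp Cφ Gχ ℓ D : ℝ} (hCφ : 0 ≤ Cφ) (hG : 0 ≤ Gχ)
    (hℓ : 0 < ℓ) (x : Config J)
    (hD : ∀ u, 0 ≤ u → N.gap Cp (qt γ x + u • qdrift γ (speed p N r x)) ≤
      N.gap Cp (qt γ x) + u * D) :
    UpperDeriv (fun u => Y N γ Cp Cφ Gχ ℓ y (flow p N r x u))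
      (D + Cφ * ∑ i, (N.wl (qt γ x) i / √(ℓ ^ 2 + N.wl (qt γ x) i ^ 2) - 1) *
        N.wl (qdrift γ (speed p N r x)) i +
        Gχ * ∑ a, Real.exp (-y * x.2.1 a) * (y * speed p N r x a)) := by
  unfold Y
  refine UpperDeriv.add (UpperDeriv.add ?_ ((UpperDeriv.sum _ fun i _ => ?_).const_mul hCφ))
    ((UpperDeriv.sum _ fun a _ => ?_).const_mul hG)
  · refine ⟨fun u => N.gap Cp (qt γ x) + u * D, ?_, by simp [qt_flow], fun u hu => ?_⟩
    · have := ((hasDerivAt_id' (0 : ℝ)).mul_const D).const_add (N.gap Cp (qt γ x))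
      simpa using this
    · simp only [qt_flow]; exact hD u hu
  · set w := N.wl (qt γ x) i with hw
    set d := N.wl (qdrift γ (speed p N r x)) i with hd
    refine ⟨fun u => phi ℓ w + (w / √(ℓ ^ 2 + w ^ 2) - 1) * d * u + d ^ 2 / (2 * ℓ) * u ^ 2, ?_,
      by simp [qt_flow, hw], fun u _ => ?_⟩
    · have h1 := ((hasDerivAt_id' (0 : ℝ)).const_mul ((w / √(ℓ ^ 2 + w ^ 2) - 1) * d)).const_add
        (phi ℓ w)
      have h2 := h1.fun_add ((hasDerivAt_pow 2 (0 : ℝ)).const_mul (d ^ 2 / (2 * ℓ)))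
      simpa using h2
    · simp only [qt_flow, N.wl_add, N.wl_smul, Pi.add_apply, Pi.smul_apply, smul_eq_mul]
      refine (phi_add_le hℓ w (u * d)).trans_eq ?_
      ring
  · have h1 : HasDerivAt (fun u : ℝ => -y * (x.2.1 a - u * speed p N r x a))
        (y * speed p N r x a) 0 := by
      have := (((hasDerivAt_id' (0 : ℝ)).mul_const (speed p N r x a)).const_sub
        (x.2.1 a)).const_mul (-y)
      simpa using this
    refine ⟨_, ?_, rfl, fun u _ => le_rfl⟩
    simpa [flow] using h1.exp

theorem qdrift_eq (E : Chi J) (ξ : Fin J → ℝ) (hE : ∀ j, E j = false) (j : Fin J) :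
    qdrift γ (vel E ξ) j = N.β j * (N.ρ j - ξ j) + ((γ (Sum.inl j) - γ (Sum.inr j) * N.ρ j) +
      (γ (Sum.inr j) - N.β j) * (N.ρ j - ξ j)) := by
  have h1 : vel E ξ (Sum.inl j) = 1 := rfl
  have h2 : vel E ξ (Sum.inr j) = ξ j := by simp [vel, hE j]
  rw [qdrift, h1, h2]; ring

theorem Near.dev_total (h : Near N k r γ) {hi : ℝ} {q ξ : Fin J → ℝ} (hξ : Rates N k hi q ξ)
    (j : Fin J) : |(γ (Sum.inl j) - γ (Sum.inr j) * N.ρ j) +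
      (γ (Sum.inr j) - N.β j) * (N.ρ j - ξ j)| ≤ k.C₀ * (1 + k.smax) / r := by
  refine (abs_add_le _ _).trans ?_
  rw [abs_mul]
  have h1 := h.dev j
  have h2 := mul_le_mul (h.devβ j) (hξ.abs_le j) (abs_nonneg _)
    ((abs_nonneg _).trans (h.devβ j))
  have h3 : k.C₀ * (1 + k.smax) / r = k.C₀ / r + k.C₀ / r * k.smax := by ring
  rw [h3]; linarith

theorem abs_qdrift_le (h : Near N k r γ) {hi : ℝ} {q ξ : Fin J → ℝ} (hξ : Rates N k hi q ξ)
    (E : Chi J) (j : Fin J) : |qdrift γ (vel E ξ) j| ≤ k.g₁ * (1 + k.smax) := by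
  have h1 : vel E ξ (Sum.inl j) = 1 := rfl
  have h2 := vel_le hξ E (Sum.inr j)
  have h3 := vel_nonneg hξ E (Sum.inr j)
  have h4 := mul_le_mul (h.le_g₁ (Sum.inr j)) h2 h3 k.g₁_pos.le
  have h5 := mul_nonneg (h.γ_pos (Sum.inr j)).le h3
  have h6 := h.γ_pos (Sum.inl j)
  have h7 := h.le_g₁ (Sum.inl j)
  rw [qdrift, h1, abs_le]
  constructor <;> nlinarith

theorem sum_exp_vel_le {hi : ℝ} {q ξ : Fin J → ℝ} (hξ : Rates N k hi q ξ) (hy : 0 ≤ y)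
    {x : Config J} (hR : ∀ a, 0 ≤ x.2.1 a) :
    ∑ a, Real.exp (-y * x.2.1 a) * (y * vel x.2.2 ξ a) ≤
      Fintype.card (Idx J) * (y * k.smax) := by
  have : ∀ a, Real.exp (-y * x.2.1 a) * (y * vel x.2.2 ξ a) ≤ y * k.smax := fun a => by
    have h1 : Real.exp (-y * x.2.1 a) ≤ 1 := Real.exp_le_one_iff.2 (by nlinarith [hR a])
    have h2 := vel_nonneg hξ x.2.2 a
    calc _ ≤ 1 * (y * vel x.2.2 ξ a) := mul_le_mul_of_nonneg_right h1 (by positivity)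
      _ ≤ _ := by rw [one_mul]; exact mul_le_mul_of_nonneg_left (vel_le hξ x.2.2 a) hy
  refine (Finset.sum_le_sum fun a _ => this a).trans_eq ?_
  simp [Finset.card_univ]

/-- Bound for the derivative of `Y`, valid in all states. -/
def YC (k : Consts) (I J : ℕ) (L Cb y : ℝ) : ℝ :=
  L * (J * (k.g₁ * (1 + k.smax))) +
    4 * k.Cp * (I * (2 * (Cb * (J * (k.g₁ * (1 + k.smax)))))) +
    Fintype.card (Idx J) * (y * k.smax)

theorem upperDeriv_Y_le (h : Near N k r γ) {L Cb : ℝ} (hg : GapBound N k.Cp L Cb)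
    (p : Policy J) {Gχ ℓ : ℝ} (hG : 0 ≤ Gχ) (hG1 : Gχ ≤ 1) (hℓ : 0 < ℓ) (hy : 0 ≤ y)
    {x : Config J} (hR : ∀ a, 0 ≤ x.2.1 a) {hi : ℝ} (hξ : Rates N k hi x.1 (p.x N r x.1)) :
    UpperDeriv (fun u => Y N γ k.Cp (4 * k.Cp) Gχ ℓ y (flow p N r x u)) (YC k I J L Cb y) := by
  have hCp := k.Cp_nonneg
  have hL := hg.L_nonneg
  have hCb := hg.Cb_nonneg
  have hm : ∑ j, |qdrift γ (speed p N r x) j| ≤ J * (k.g₁ * (1 + k.smax)) := by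
    refine (Finset.sum_le_sum fun j _ => abs_qdrift_le h hξ x.2.2 j).trans_eq ?_
    simp
  refine (upperDeriv_Y (N := N) (γ := γ) (r := r) (y := y) p (Cp := k.Cp)
    (D := L * (J * (k.g₁ * (1 + k.smax)))) (by positivity : 0 ≤ 4 * k.Cp) hG hℓ x
    fun u hu => ?_).mono ?_
  · refine (hg.lip _ (qt γ x)).trans (add_le_add le_rfl ?_)
    simp only [Pi.add_apply, add_sub_cancel_left, Pi.smul_apply, smul_eq_mul, abs_mul,
      abs_of_nonneg hu, ← Finset.mul_sum]
    rw [mul_left_comm]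
    exact mul_le_mul_of_nonneg_left (mul_le_mul_of_nonneg_left hm hL) hu
  · refine add_le_add (add_le_add le_rfl (mul_le_mul_of_nonneg_left ?_ (by positivity))) ?_
    · have h1 : ∀ i, (N.wl (qt γ x) i / √(ℓ ^ 2 + N.wl (qt γ x) i ^ 2) - 1) *
          N.wl (qdrift γ (speed p N r x)) i ≤ 2 * (Cb * (J * (k.g₁ * (1 + k.smax)))) := by
        intro i
        refine (le_abs_self _).trans ?_
        rw [abs_mul]
        have h2 := hg.wl_lip (qdrift γ (speed p N r x)) 0 i
        have h0 : N.wl (0 : Fin J → ℝ) i = 0 := by rw [Network.wl_apply]; simp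
        simp only [h0, Pi.zero_apply, sub_zero] at h2
        exact mul_le_mul (phi_slope_abs_le hℓ _)
          (h2.trans (mul_le_mul_of_nonneg_left hm hCb)) (abs_nonneg _) (by norm_num)
      refine (Finset.sum_le_sum fun i _ => h1 i).trans_eq ?_
      simp
    · have h1 := sum_exp_vel_le hξ hy hR
      have h2 : (0 : ℝ) ≤ Fintype.card (Idx J) * (y * k.smax) := by
        have := k.one_le_smax; positivity
      calc _ ≤ Gχ * (Fintype.card (Idx J) * (y * k.smax)) := mul_le_mul_of_nonneg_left h1 hG
        _ ≤ _ := mul_le_of_le_one_left h2 hG1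

/-- When the cost can be reduced, no job type is blocked and the residual times are not too large,
then `Y` decreases at a positive rate. The workload of resources that are used only by short queues
may grow; the effect of this on the extended cost is compensated by the terms with `phi`. -/
theorem upperDeriv_Y_le_neg (hN : N.IsTopology) (h : Near N k r γ) (p : Policy J) {Gχ ℓ b : ℝ}
    (hG : 0 ≤ Gχ) (hℓ : 0 < ℓ) (hy : 0 ≤ y)
    {x : Config J} (hR : ∀ a, 0 ≤ x.2.1 a) (hRb : ∀ a, x.2.1 a ≤ b)
    {hi : ℝ} (hhi : 0 ≤ hi) (hξ : Rates N k hi x.1 (p.x N r x.1)) (hE : ∀ j, x.2.2 j = false)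
    (hℓhi : J * ((hi + k.g₁ * b) / k.g₀) ≤ ℓ)
    (hcost : ∑ j, N.h j * N.β j * (N.ρ j - p.x N r x.1 j) ≤ -k.cM)
    (hsmall : (∑ j, N.h j) * (k.C₀ * (1 + k.smax) / r) +
      9 * k.Cp * (I * (J * (k.C₀ * (1 + k.smax) / r / k.g₀))) +
      Gχ * (Fintype.card (Idx J) * (y * k.smax)) ≤ k.cM / 2) (hNh : ∀ j, 0 < N.h j) :
    UpperDeriv (fun u => Y N γ k.Cp (4 * k.Cp) Gχ ℓ y (flow p N r x u)) (-(k.cM / 2)) := by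
  have hCp := k.Cp_nonneg
  have hg := k.g₀_pos
  have hg1 := k.g₁_pos
  have hC₀ := k.C₀_pos
  have hs := k.one_le_smax
  set m := qdrift γ (speed p N r x) with hm
  set ξ := p.x N r x.1 with hξd
  have hβ : ∀ j, 0 < N.β j := fun j => hg.trans_le (h.g₀_le_β j)
  set e : ℝ := k.C₀ * (1 + k.smax) / r with he
  have he0 : 0 ≤ e := by positivity
  set er : Fin J → ℝ := fun j => (γ (Sum.inl j) - γ (Sum.inr j) * N.ρ j) +
      (γ (Sum.inr j) - N.β j) * (N.ρ j - ξ j) with her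
  have herb : ∀ j, |er j| ≤ e := fun j => h.dev_total hξ j
  have hmj : ∀ j, m j = N.β j * (N.ρ j - ξ j) + er j := fun j => qdrift_eq x.2.2 ξ hE j
  have hhm : N.h ⬝ᵥ m ≤ -k.cM + (∑ j, N.h j) * e := by
    have h1 : N.h ⬝ᵥ m = ∑ j, N.h j * N.β j * (N.ρ j - ξ j) + ∑ j, N.h j * er j := by
      rw [← Finset.sum_add_distrib]
      exact Finset.sum_congr rfl fun j _ => by rw [hmj]; ring
    rw [h1, Finset.sum_mul]
    refine add_le_add hcost (Finset.sum_le_sum fun j _ => mul_le_mul_of_nonneg_left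
      ((le_abs_self _).trans (herb j)) (hNh j).le)
  set n : Fin I → ℝ := fun i => ∑ j, N.K i j * (N.ρ j - ξ j) with hn
  set f : Fin I → ℝ := fun i => ∑ j, N.K i j * (er j / N.β j) with hf
  have hwm : ∀ i, N.wl m i = n i + f i := fun i => by
    rw [Network.wl_apply, hn, hf, ← Finset.sum_add_distrib]
    refine Finset.sum_congr rfl fun j _ => ?_
    rw [hmj]
    have := (hβ j).ne'
    field_simp
  have hfb : ∀ i, |f i| ≤ J * (e / k.g₀) := fun i => by
    refine (Finset.abs_sum_le_sum_abs _ _).trans ?_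
    have : ∀ j, |N.K i j * (er j / N.β j)| ≤ e / k.g₀ := fun j => by
      rw [abs_mul, abs_of_nonneg (N.K_nonneg hN i j), abs_div, abs_of_pos (hβ j)]
      have h1 : |er j| / N.β j ≤ e / k.g₀ := div_le_div₀ he0 (herb j) hg (h.g₀_le_β j)
      calc _ ≤ 1 * (|er j| / N.β j) := mul_le_mul_of_nonneg_right (N.K_le_one hN i j)
            (div_nonneg (abs_nonneg _) (hβ j).le)
        _ ≤ _ := by rw [one_mul]; exact h1
    refine (Finset.sum_le_sum fun j _ => this j).trans_eq ?_
    simp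
  have hn0 : ∀ i, 0 ≤ n i := fun i => hξ.nonneg i
  -- in resources with growing workload the workload is at most `ℓ`
  have hslope : ∀ i, (N.wl (qt γ x) i / √(ℓ ^ 2 + N.wl (qt γ x) i ^ 2) - 1) * n i ≤
      -(1 / 4) * n i := by
    intro i
    by_cases hA : ∃ j, N.K i j = 1 ∧ hi ≤ x.1 j
    · have : n i = 0 := hξ.full i hA
      rw [this]; simp
    · push Not at hA
      refine mul_le_mul_of_nonneg_right (phi_slope_le hℓ (le_trans ?_ hℓhi)) (hn0 i)
      have : ∀ j, N.K i j * (qt γ x j / N.β j) ≤ (hi + k.g₁ * b) / k.g₀ := by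
        intro j
        have hb0 : 0 ≤ b := (hR (Sum.inl j)).trans (hRb (Sum.inl j))
        have h0 : 0 ≤ (hi + k.g₁ * b) / k.g₀ := by positivity
        rcases hN.zero_or_one i j with hK | hK
        · rw [hK, zero_mul]; exact h0
        · rw [hK, one_mul, div_le_div_iff₀ (hβ j) hg]
          have h1 := hA j hK
          have h2 : qt γ x j ≤ hi + k.g₁ * b := by
            unfold qt
            have h3 := mul_nonneg (h.γ_pos (Sum.inl j)).le (hR (Sum.inl j))
            have h4 := mul_le_mul (h.le_g₁ (Sum.inr j)) (hRb (Sum.inr j)) (hR _) hg1.le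
            linarith
          have h3 : 0 ≤ hi + k.g₁ * b := by positivity
          calc qt γ x j * k.g₀ ≤ (hi + k.g₁ * b) * k.g₀ := mul_le_mul_of_nonneg_right h2 hg.le
            _ ≤ _ := mul_le_mul_of_nonneg_left (h.g₀_le_β j) h3
      rw [Network.wl_apply]
      refine (Finset.sum_le_sum fun j _ => this j).trans_eq ?_
      simp
  refine (upperDeriv_Y (N := N) (γ := γ) (r := r) (y := y) p (Cp := k.Cp)
    (D := N.h ⬝ᵥ m + k.Cp * ∑ i, |N.wl m i|) (by positivity : 0 ≤ 4 * k.Cp) hG hℓ x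
    fun u hu => gap_add_smul_le hN hCp _ _ hu).mono ?_
  have h1 : ∑ i, |N.wl m i| + 4 * ∑ i, (N.wl (qt γ x) i / √(ℓ ^ 2 + N.wl (qt γ x) i ^ 2) - 1) *
      N.wl m i ≤ 9 * (I * (J * (e / k.g₀))) := by
    rw [Finset.mul_sum, ← Finset.sum_add_distrib]
    have : ∀ i, |N.wl m i| + 4 * ((N.wl (qt γ x) i / √(ℓ ^ 2 + N.wl (qt γ x) i ^ 2) - 1) *
        N.wl m i) ≤ 9 * (J * (e / k.g₀)) := by
      intro i
      rw [hwm i]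
      set s := N.wl (qt γ x) i / √(ℓ ^ 2 + N.wl (qt γ x) i ^ 2) - 1 with hs'
      have h2 : |n i + f i| ≤ n i + |f i| := by
        refine (abs_add_le _ _).trans_eq ?_
        rw [abs_of_nonneg (hn0 i)]
      have h3 : s * f i ≤ 2 * |f i| := by
        refine (le_abs_self _).trans ?_
        rw [abs_mul]
        exact mul_le_mul_of_nonneg_right (phi_slope_abs_le hℓ _) (abs_nonneg _)
      have h4 := hslope i
      have h5 := hfb i
      linarith
    refine (Finset.sum_le_sum fun i _ => this i).trans_eq ?_
    simp; ring
  have h2 := mul_le_mul_of_nonneg_left h1 hCp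
  have h3 := mul_le_mul_of_nonneg_left (sum_exp_vel_le hξ hy hR) hG
  have h4 : ∑ a, Real.exp (-y * x.2.1 a) * (y * speed p N r x a) =
    ∑ a, Real.exp (-y * x.2.1 a) * (y * vel x.2.2 ξ a) := rfl
  rw [h4, ← hm]
  linarith

/-- Weight of the residual times in the bound on `Y`. -/
def YR (k : Consts) (I : ℕ) (L Cb : ℝ) : ℝ := L * k.g₁ + 8 * k.Cp * I * Cb * k.g₁

theorem sum_abs_qt_sub_le (h : Near N k r γ) {x : Config J} (hR : ∀ a, 0 ≤ x.2.1 a) :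
    ∑ j, |qt γ x j - x.1 j| ≤ k.g₁ * ∑ a, x.2.1 a := by
  rw [Fintype.sum_sum_type, ← Finset.sum_add_distrib, Finset.mul_sum]
  refine Finset.sum_le_sum fun j _ => ?_
  have h1 := mul_le_mul_of_nonneg_right (h.le_g₁ (Sum.inl j)) (hR (Sum.inl j))
  have h2 := mul_le_mul_of_nonneg_right (h.le_g₁ (Sum.inr j)) (hR (Sum.inr j))
  have h3 := mul_nonneg (h.γ_pos (Sum.inl j)).le (hR (Sum.inl j))
  have h4 := mul_nonneg (h.γ_pos (Sum.inr j)).le (hR (Sum.inr j))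
  unfold qt
  rw [abs_le]; constructor <;> linarith

theorem gap_zero_le (hN : N.IsTopology) {Cp : ℝ} (hCp : 0 ≤ Cp) : N.gap Cp 0 ≤ 0 := by
  unfold Network.gap
  rw [dotProduct_zero]
  linarith [N.hext_nonneg hN hCp (N.wl 0)]

/-- `Y` is bounded by the gap of the queue lengths and the residual times. -/
theorem Y_le (hN : N.IsTopology) (h : Near N k r γ) {L Cb : ℝ} (hg : GapBound N k.Cp L Cb)
    {Gχ ℓ : ℝ} (hG : 0 ≤ Gχ) (hG1 : Gχ ≤ 1) (hℓ : 0 < ℓ) (hy : 0 ≤ y)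
    {x : Config J} (hR : ∀ a, 0 ≤ x.2.1 a) (hq : ∀ j, 0 ≤ x.1 j) :
    max (Y N γ k.Cp (4 * k.Cp) Gχ ℓ y x) 0 ≤ N.gap k.Cp x.1 + YR k I L Cb * ∑ a, x.2.1 a +
      (4 * k.Cp * I * ℓ + Fintype.card (Idx J)) := by
  have hCp := k.Cp_nonneg
  have hL := hg.L_nonneg
  have hCb := hg.Cb_nonneg
  have hβ : ∀ j, 0 < N.β j := fun j => k.g₀_pos.trans_le (h.g₀_le_β j)
  have hS : 0 ≤ ∑ a, x.2.1 a := Finset.sum_nonneg fun a _ => hR a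
  have hg1 := k.g₁_pos
  have hd := sum_abs_qt_sub_le h hR
  have h1 := (hg.lip (qt γ x) x.1).trans (add_le_add le_rfl (mul_le_mul_of_nonneg_left hd hL))
  have h2 : ∀ i, phi ℓ (N.wl (qt γ x) i) ≤ ℓ + 2 * (Cb * (k.g₁ * ∑ a, x.2.1 a)) := by
    intro i
    have h3 := phi_lipschitz ℓ (N.wl x.1 i) (N.wl (qt γ x) i - N.wl x.1 i)
    rw [add_sub_cancel] at h3
    have h4 := phi_le_of_nonneg hℓ.le (N.wl_nonneg hN hβ hq i)
    have h5 := (hg.wl_lip (qt γ x) x.1 i).trans (mul_le_mul_of_nonneg_left hd hCb)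
    linarith
  have h3 : ∑ i, phi ℓ (N.wl (qt γ x) i) ≤ I * (ℓ + 2 * (Cb * (k.g₁ * ∑ a, x.2.1 a))) := by
    refine (Finset.sum_le_sum fun i _ => h2 i).trans_eq ?_
    simp only [Finset.sum_const, Finset.card_univ, Fintype.card_fin, nsmul_eq_mul]
  have h4 : ∑ a, Real.exp (-y * x.2.1 a) ≤ Fintype.card (Idx J) := by
    have : ∀ a, Real.exp (-y * x.2.1 a) ≤ 1 := fun a =>
      Real.exp_le_one_iff.2 (by nlinarith [hR a])
    refine (Finset.sum_le_sum fun a _ => this a).trans_eq ?_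
    simp [Finset.card_univ]
  have h5 : Gχ * ∑ a, Real.exp (-y * x.2.1 a) ≤ Fintype.card (Idx J) :=
    (mul_le_mul_of_nonneg_left h4 hG).trans (mul_le_of_le_one_left (Nat.cast_nonneg _) hG1)
  have h6 := mul_le_mul_of_nonneg_left h3 (show 0 ≤ 4 * k.Cp by positivity)
  have h7 := N.gap_nonneg hN hCp hq
  have h8 : 0 ≤ YR k I L Cb := by unfold YR; positivity
  refine max_le ?_ (by positivity)
  unfold Y YR
  linarith

theorem gap_le_sum (hN : N.IsTopology) {Cp L Cb : ℝ} (hCp : 0 ≤ Cp) (hg : GapBound N Cp L Cb)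
    {q : Fin J → ℝ} (hq : ∀ j, 0 ≤ q j) : N.gap Cp q ≤ L * ∑ j, q j := by
  have h1 := hg.lip q 0
  have h2 := gap_zero_le (N := N) hN hCp
  have h3 : ∑ j, |q j - (0 : Fin J → ℝ) j| = ∑ j, q j :=
    Finset.sum_congr rfl fun j _ => by rw [Pi.zero_apply, sub_zero, abs_of_nonneg (hq j)]
  rw [h3] at h1
  linarith

theorem sum_residual_le_sqrt [Nonempty (Idx J)] (hy : 0 < y) {x : Config J} :
    ∑ a, x.2.1 a ≤ Fintype.card (Idx J) * (2 / y) * √(PP N γ Λ lam y r x) := by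
  have : ∀ a, x.2.1 a ≤ 2 / y * √(PP N γ Λ lam y r x) := fun a => by
    have h1 := exp_half_le_sqrt_PP (N := N) (γ := γ) (Λ := Λ) (lam := lam) (y := y) (r := r) x a
    have h2 := Real.add_one_le_exp (y / 2 * x.2.1 a)
    have h3 : x.2.1 a = 2 / y * (y / 2 * x.2.1 a) := by field_simp
    rw [h3]
    exact mul_le_mul_of_nonneg_left (by linarith) (by positivity)
  refine (Finset.sum_le_sum fun a _ => this a).trans_eq ?_
  simp [Finset.card_univ]; ring

/-- Bound on `Y` in the states where it may grow. -/
theorem Y_le_of_bad [Nonempty (Idx J)] (hN : N.IsTopology) (h : Near N k r γ) {L Cb : ℝ}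
    (hg : GapBound N k.Cp L Cb) (hlam : 0 < lam) (hΛ : 0 ≤ Λ) (hy : 0 < y)
    (hr : 4 * Fintype.card (Idx J) * cfC k Λ lam ≤ y * r)
    {Gχ ℓ b hi e₂ : ℝ} (hG : 0 ≤ Gχ) (hG1 : Gχ ≤ 1) (hℓ : 0 < ℓ) (hhi : 0 ≤ hi)
    (hbr : Fintype.card (Idx J) * cfC k Λ lam * b ≤ r)
    (he₂ : L * (J * (k.g₁ / lam * r * Real.exp (-(y / 2 * b)))) ≤ e₂)
    {x : Config J} (hR : ∀ a, 0 ≤ x.2.1 a) (hq : ∀ j, 0 ≤ x.1 j)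
    (hbad : N.gap k.Cp x.1 ≤ k.Cg * hi ∨ (∃ j, x.2.2 j = true) ∨ ∃ a, b < x.2.1 a) :
    max (Y N γ k.Cp (4 * k.Cp) Gχ ℓ y x) 0 ≤ k.Cg * hi +
      3 * L * J * (k.g₁ / lam) * (r * PE N γ Λ lam y r x) +
      e₂ * PP N γ Λ lam y r x +
      YR k I L Cb * (Fintype.card (Idx J) * (2 / y)) * √(PP N γ Λ lam y r x) +
      (4 * k.Cp * I * ℓ + Fintype.card (Idx J)) := by
  have hCp := k.Cp_nonneg
  have hL := hg.L_nonneg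
  have hCb := hg.Cb_nonneg
  have hg1 := k.g₁_pos
  have hCg := k.Cg_nonneg
  have hr1 := h.r_pos
  have h1 := Y_le hN h hg hG hG1 hℓ hy.le hR hq
  have hYR : 0 ≤ YR k I L Cb := by unfold YR; positivity
  have h2 := mul_le_mul_of_nonneg_left (sum_residual_le_sqrt (N := N) (γ := γ) (Λ := Λ)
    (lam := lam) (r := r) hy (x := x)) hYR
  have hPE := PE_nonneg (N := N) (γ := γ) (Λ := Λ) (lam := lam) (y := y) (r := r) x
  have hPP := PP_nonneg (N := N) (γ := γ) (Λ := Λ) (lam := lam) (y := y) (r := r) x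
  have he20 : 0 ≤ e₂ := le_trans (by positivity) he₂
  have t1 : 0 ≤ 3 * L * J * (k.g₁ / lam) * (r * PE N γ Λ lam y r x) := by positivity
  have t2 : 0 ≤ e₂ * PP N γ Λ lam y r x := by positivity
  have t3 : 0 ≤ k.Cg * hi := by positivity
  have hgap : N.gap k.Cp x.1 ≤ k.Cg * hi +
      3 * L * J * (k.g₁ / lam) * (r * PE N γ Λ lam y r x) + e₂ * PP N γ Λ lam y r x := by
    rcases hbad with hb | hb
    · linarith
    · have hgs := gap_le_sum hN hCp hg hq
      by_cases hRb : ∃ a, b < x.2.1 a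
      · obtain ⟨a, ha⟩ := hRb
        have h3 : ∀ j, x.1 j ≤ k.g₁ / lam * r *
            (PP N γ Λ lam y r x * Real.exp (-(y / 2 * b))) := fun j => by
          obtain ⟨i, -, -, h4⟩ := exists_queue_le hN h hlam hΛ hy hr hR hq j
          refine (h4 a).trans (mul_le_mul_of_nonneg_left (mul_le_mul_of_nonneg_left
            (Real.exp_le_exp.2 ?_) hPP) (by positivity))
          have := mul_le_mul_of_nonneg_left ha.le (show 0 ≤ y / 2 by positivity)
          linarith
        have h4 : ∑ j, x.1 j ≤ J * (k.g₁ / lam * r *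
            (PP N γ Λ lam y r x * Real.exp (-(y / 2 * b)))) := by
          refine (Finset.sum_le_sum fun j _ => h3 j).trans_eq ?_
          simp
        have h5 := mul_le_mul_of_nonneg_left h4 hL
        have h6 := mul_le_mul_of_nonneg_right he₂ hPP
        linarith
      · have hE : ∃ j, x.2.2 j = true := hb.resolve_right hRb
        push Not at hRb
        obtain ⟨j₀, hj₀⟩ := hE
        have hT : cfC k Λ lam / r * ∑ a, x.2.1 a ≤ 1 := by
          have h3 : ∑ a, x.2.1 a ≤ Fintype.card (Idx J) * b := by
            refine (Finset.sum_le_sum fun a _ => hRb a).trans_eq ?_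
            simp [Finset.card_univ]
          have hc := cfC_nonneg k hΛ hlam.le
          rw [div_mul_eq_mul_div, div_le_one (by linarith)]
          have := mul_le_mul_of_nonneg_left h3 hc
          linarith
        have h3 : ∀ j, x.1 j ≤ k.g₁ / lam * r * (PE N γ Λ lam y r x * 3) := fun j => by
          obtain ⟨i, h4, -, -⟩ := exists_queue_le hN h hlam hΛ hy hr hR hq j
          refine h4.trans (mul_le_mul_of_nonneg_left ?_ (by positivity))
          have he := eK_pos (N := N) (γ := γ) (Λ := Λ) (lam := lam) (r := r) (some i) x
          have h5 : eK N γ Λ lam r (some i) x ≤ PE N γ Λ lam y r x := by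
            refine le_trans ?_ (Finset.single_le_sum (f := fun o => ∑ j, if x.2.2 j = true then
              eK N γ Λ lam r o x * Real.exp (y * x.2.1 (Sum.inr j)) else 0)
              (fun o _ => Finset.sum_nonneg fun j _ => PE_term_nonneg x o j)
              (Finset.mem_univ (some i)))
            refine le_trans ?_ (Finset.single_le_sum (f := fun j => if x.2.2 j = true then
              eK N γ Λ lam r (some i) x * Real.exp (y * x.2.1 (Sum.inr j)) else 0)
              (fun j _ => PE_term_nonneg x (some i) j) (Finset.mem_univ j₀))
            simp only [hj₀, if_true]
            exact le_mul_of_one_le_right he.le (Real.one_le_exp (mul_nonneg hy.le (hR _)))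
          have h6 : Real.exp (cfC k Λ lam / r * ∑ a, x.2.1 a) ≤ 3 := by
            refine (Real.exp_le_exp.2 hT).trans ?_
            have := Real.exp_one_lt_d9
            linarith
          exact mul_le_mul h5 h6 (Real.exp_pos _).le hPE
        have h4 : ∑ j, x.1 j ≤ J * (k.g₁ / lam * r * (PE N γ Λ lam y r x * 3)) := by
          refine (Finset.sum_le_sum fun j _ => h3 j).trans_eq ?_
          simp
        have h5 := mul_le_mul_of_nonneg_left h4 hL
        linarith
  linarith

/-- The square of the positive part of `Y` is of order `r² PP`. -/
def YsqC (k : Consts) (I J : ℕ) (L Cb lam y : ℝ) : ℝ :=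
  6 * L ^ 2 * J ^ 2 * (k.g₁ / lam) ^ 2 +
    3 * (YR k I L Cb) ^ 2 * (Fintype.card (Idx J) * (2 / y)) ^ 2

theorem Y_sq_le [Nonempty (Idx J)] (hN : N.IsTopology) (h : Near N k r γ) {L Cb : ℝ}
    (hg : GapBound N k.Cp L Cb) (hlam : 0 < lam) (hΛ : 0 ≤ Λ) (hy : 0 < y)
    (hr : 4 * Fintype.card (Idx J) * cfC k Λ lam ≤ y * r)
    {Gχ ℓ : ℝ} (hG : 0 ≤ Gχ) (hG1 : Gχ ≤ 1) (hℓ : 0 < ℓ)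
    {x : Config J} (hR : ∀ a, 0 ≤ x.2.1 a) (hq : ∀ j, 0 ≤ x.1 j) :
    max (Y N γ k.Cp (4 * k.Cp) Gχ ℓ y x) 0 ^ 2 / r ^ 2 ≤
      YsqC k I J L Cb lam y * PP N γ Λ lam y r x +
      3 * (4 * k.Cp * I * ℓ + Fintype.card (Idx J)) ^ 2 := by
  have hCp := k.Cp_nonneg
  have hL := hg.L_nonneg
  have hCb := hg.Cb_nonneg
  have hg1 := k.g₁_pos
  have hr1 := h.r_pos
  have hYR : 0 ≤ YR k I L Cb := by unfold YR; positivity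
  have hPP := PP_nonneg (N := N) (γ := γ) (Λ := Λ) (lam := lam) (y := y) (r := r) x
  have h1 := Y_le hN h hg hG hG1 hℓ hy.le hR hq
  have h2 := mul_le_mul_of_nonneg_left (sum_residual_le_sqrt (N := N) (γ := γ) (Λ := Λ)
    (lam := lam) (r := r) hy (x := x)) hYR
  have hgs := gap_le_sum hN hCp hg hq
  set n : ℝ := (Fintype.card (Idx J) : ℝ) with hn
  set X := √(PP N γ Λ lam y r x) with hX
  have hX2 : X ^ 2 = PP N γ Λ lam y r x := Real.sq_sqrt hPP
  set a := L * ∑ j, x.1 j with ha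
  set b := YR k I L Cb * (n * (2 / y) * X) with hb
  set c := 4 * k.Cp * I * ℓ + n with hc
  have hYle : max (Y N γ k.Cp (4 * k.Cp) Gχ ℓ y x) 0 ≤ a + b + c := by linarith
  have hsq : max (Y N γ k.Cp (4 * k.Cp) Gχ ℓ y x) 0 ^ 2 ≤ 3 * a ^ 2 + 3 * b ^ 2 + 3 * c ^ 2 := by
    refine (pow_le_pow_left₀ (le_max_right _ _) hYle 2).trans ?_
    nlinarith [sq_nonneg (a - b), sq_nonneg (b - c), sq_nonneg (a - c)]
  have hr2 : (1 : ℝ) ≤ (r : ℝ) ^ 2 := one_le_pow₀ hr1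
  rw [div_le_iff₀ (by positivity)]
  have ha2 : a ^ 2 ≤ 2 * L ^ 2 * J ^ 2 * (k.g₁ / lam) ^ 2 * PP N γ Λ lam y r x * r ^ 2 := by
    have h3 : ∀ j, x.1 j ^ 2 ≤ 2 * (k.g₁ / lam) ^ 2 * PP N γ Λ lam y r x * r ^ 2 := fun j => by
      obtain ⟨i, -, h4, -⟩ := exists_queue_le hN h hlam hΛ hy hr hR hq j
      rwa [div_pow, div_le_iff₀ (by positivity)] at h4
    have h4 : (∑ j, x.1 j) ^ 2 ≤ J * ∑ j, x.1 j ^ 2 := by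
      have := sq_sum_le_card_mul_sum_sq (s := Finset.univ) (f := x.1)
      simpa using this
    have h5 : ∑ j, x.1 j ^ 2 ≤ J * (2 * (k.g₁ / lam) ^ 2 * PP N γ Λ lam y r x * r ^ 2) := by
      refine (Finset.sum_le_sum fun j _ => h3 j).trans_eq ?_
      simp
    have h6 : (∑ j, x.1 j) ^ 2 ≤
        J * (J * (2 * (k.g₁ / lam) ^ 2 * PP N γ Λ lam y r x * r ^ 2)) :=
      h4.trans (mul_le_mul_of_nonneg_left h5 (Nat.cast_nonneg _))
    rw [ha, mul_pow]
    refine (mul_le_mul_of_nonneg_left h6 (sq_nonneg L)).trans_eq ?_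
    ring
  have hb2 : b ^ 2 = (YR k I L Cb) ^ 2 * (n * (2 / y)) ^ 2 * PP N γ Λ lam y r x := by
    rw [hb, ← hX2]; ring
  have hb3 : b ^ 2 ≤ b ^ 2 * r ^ 2 := le_mul_of_one_le_right (sq_nonneg _) hr2
  rw [hb2] at hb3
  unfold YsqC
  rw [← hn]
  nlinarith

end GapDrift
end RSN
end

noncomputable section

namespace RSN

/-! ### The Lyapunov function and its constants -/

/-- Constants of the Lyapunov function: `Λ`, `lam`, `y`, `θ` enter the exponents, `G` and `B₁` balance
the two kinds of exponentials in `V₃` and `V₂`, the parts `V₁`, `V₂`, `V₃` have the weights `A`, `B`,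
`A₃`, and the smoothing scale of `phi`, the weight of its curvature correction and the thresholds
are `Cl`, `Cχ`, `c₁`, `c₂` up to powers of `r ^ κ`. -/
structure LyapC where
  Λ : ℝ
  lam : ℝ
  y : ℝ
  θ : ℝ
  G : ℝ
  B₁ : ℝ
  A : ℝ
  B : ℝ
  A₃ : ℝ
  Cl : ℝ
  Cχ : ℝ
  c₁ : ℝ
  c₂ : ℝ
  κ : ℝ

section Total

variable {I J : ℕ}

/-- The length scale `r ^ κ` of the thresholds. -/
def LyapC.b (w : LyapC) (r : ℕ) : ℝ := (r : ℝ) ^ w.κ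

/-- The corrected cost gap with the scales belonging to `r`. -/
def LyapC.gapY (w : LyapC) (N : Network I J) (Cp : ℝ) (r : ℕ) (γ : Idx J → ℝ) (x : Config J) : ℝ :=
  Y N γ Cp (4 * Cp) (w.Cχ / w.b r) (w.Cl * w.b r) w.y x

/-- The Lyapunov function: weighted exponentials of the workloads (`V₁`), of the residual times (`V₃`)
and of the penalty for blocked job types (`V₂`), and the square of the positive part of the
corrected cost gap. -/
def LyapC.W (w : LyapC) (N : Network I J) (Cp : ℝ) (r : ℕ) (γ : Idx J → ℝ) (x : Config J) : ℝ :=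
  w.A * r ^ 2 * V₁ N γ w.Λ w.lam r x + w.A₃ * V₃ N γ w.Λ w.lam w.y w.G r x +
    w.B * r * w.b r * V₂ N γ w.Λ w.lam w.y w.θ (w.b r) w.B₁ (w.c₁ * w.b r) (w.c₂ * w.b r) r x +
    max (w.gapY N Cp r γ x) 0 ^ 2

/-- The rate at which the Lyapunov function decreases. It dominates the unscaled cost gap. -/
def LyapC.f (w : LyapC) (N : Network I J) (k : Consts) (r : ℕ) (γ : Idx J → ℝ) (x : Config J) : ℝ :=
  k.cM * max (w.gapY N k.Cp r γ x) 0 + PP N γ w.Λ w.lam w.y r x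

/-- The signs of the constants. -/
structure LyapC.Pos (w : LyapC) : Prop where
  Λ_nonneg : 0 ≤ w.Λ
  lam_pos : 0 < w.lam
  y_pos : 0 < w.y
  θ_pos : 0 < w.θ
  G_nonneg : 0 ≤ w.G
  B₁_nonneg : 0 ≤ w.B₁
  A_nonneg : 0 ≤ w.A
  B_nonneg : 0 ≤ w.B
  A₃_nonneg : 0 ≤ w.A₃
  Cl_pos : 0 < w.Cl
  Cχ_nonneg : 0 ≤ w.Cχ
  c₁_pos : 0 < w.c₁
  c₁_lt_c₂ : w.c₁ < w.c₂
  κ_pos : 0 < w.κ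
  κ_lt : w.κ < 1 / 4

theorem LyapC.tendsto_b {w : LyapC} (h : w.Pos) : Tendsto (fun r : ℕ => w.b r) atTop atTop :=
  (tendsto_rpow_atTop h.κ_pos).comp tendsto_natCast_atTop_atTop

theorem LyapC.tendsto_b_pow_div {w : LyapC} (h : w.Pos) {n : ℕ} (hn : n ≤ 2) :
    Tendsto (fun r : ℕ => w.b r ^ n / r) atTop (𝓝 0) := by
  have hn' : (n : ℝ) ≤ 2 := by exact_mod_cast hn
  have h0 : 0 < 1 - w.κ * n := by nlinarith [h.κ_lt, h.κ_pos]
  refine ((tendsto_rpow_neg_atTop h0).comp tendsto_natCast_atTop_atTop).congr' ?_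
  filter_upwards [eventually_gt_atTop 0] with r hr
  have hr0 : (0 : ℝ) < r := by exact_mod_cast hr
  simp only [Function.comp, LyapC.b]
  rw [neg_sub, Real.rpow_sub hr0, Real.rpow_one, Real.rpow_mul hr0.le, Real.rpow_natCast]

/-- Exponentials of the length scale dominate powers of `r`. -/
theorem LyapC.tendsto_mul_exp {w : LyapC} (h : w.Pos) {c : ℝ} (hc : 0 < c) :
    Tendsto (fun r : ℕ => r * w.b r * Real.exp (-(c * w.b r))) atTop (𝓝 0) := by
  have h1 := (tendsto_rpow_mul_exp_neg_mul_atTop_nhds_zero (w.κ⁻¹ + 1) c hc).comp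
    (LyapC.tendsto_b h)
  refine h1.congr' ?_
  filter_upwards [eventually_gt_atTop 0] with r hr
  have hr0 : (0 : ℝ) < r := by exact_mod_cast hr
  have hb : 0 < w.b r := Real.rpow_pos_of_pos hr0 _
  simp only [Function.comp]
  rw [Real.rpow_add hb, Real.rpow_one]
  have : w.b r ^ w.κ⁻¹ = r := by
    unfold LyapC.b
    rw [← Real.rpow_mul hr0.le, mul_inv_cancel₀ h.κ_pos.ne', Real.rpow_one]
  rw [this, neg_mul]

/-- How the drifts of the parts of the Lyapunov function add up. -/
theorem drift_sum_le {A A₃ B C₁ C₃ D Q₀ Q₁ Q₂ Q₃ Cδ cS cP g₀ r b hi e₁ e₂ S PE P X Yp cM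
    d₁ d₂ d₃ dY : ℝ} (hX : X ^ 2 = P) (hr : 1 ≤ r) (hb : 0 < b) (hA : 0 ≤ A) (hA₃ : 0 ≤ A₃)
    (hB : 0 ≤ B) (hS : 0 ≤ S) (hPE : 0 ≤ PE) (hcP : 0 ≤ cP)
    (h₁ : d₁ ≤ -cS * S + C₁ * (r * PE) + C₁ * (hi * X))
    (h₃ : d₃ ≤ -(cP / 2) * P + cP * PE + C₃ * (1 + S))
    (h₂ : d₂ ≤ -(g₀ / (2 * b)) * PE + e₁ * P)
    (hY : dY ≤ -cM * Yp + D * (Q₀ + Q₁ * (r * PE) + e₂ * P + Q₂ * X) + (Cδ * P + Q₃))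
    (c1 : Cδ + 4 ≤ A₃ * (cP / 2)) (c2 : A₃ * C₃ ≤ A * cS) (c3 : A * C₁ + A₃ * cP + D * Q₁ ≤ B * g₀ / 2)
    (he₁ : B * r * b * e₁ ≤ 1) (he₂ : D * e₂ ≤ 1) :
    A * d₁ + A₃ * d₃ + B * r * b * d₂ + dY ≤ -cM * Yp - P +
      ((A * C₁ * hi) ^ 2 / 2 + (D * Q₂) ^ 2 / 2 + A₃ * C₃ + D * Q₀ + Q₃) := by
  have hP : 0 ≤ P := hX ▸ sq_nonneg X
  have hrb : 0 ≤ B * r * b := by positivity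
  have t1 := mul_le_mul_of_nonneg_left h₁ hA
  have t3 := mul_le_mul_of_nonneg_left h₃ hA₃
  have t2 := mul_le_mul_of_nonneg_left h₂ hrb
  have s2 : B * r * b * (-(g₀ / (2 * b)) * PE + e₁ * P) =
      -(B * g₀ / 2) * (r * PE) + B * r * b * e₁ * P := by field_simp
  rw [s2] at t2
  have u1 := mul_le_mul_of_nonneg_right he₁ hP
  have u2 := mul_le_mul_of_nonneg_right he₂ hP
  have hrPE : 0 ≤ r * PE := by positivity
  have u3 := mul_le_mul_of_nonneg_right c3 hrPE
  have u4 := mul_le_mul_of_nonneg_right c2 hS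
  have u5 := mul_le_mul_of_nonneg_right c1 hP
  have u6 : PE ≤ r * PE := le_mul_of_one_le_left hPE hr
  have u7 := mul_le_mul_of_nonneg_left u6 (mul_nonneg hA₃ hcP)
  have u8 : A * C₁ * hi * X ≤ (A * C₁ * hi) ^ 2 / 2 + P / 2 := by
    rw [← hX]; nlinarith [sq_nonneg (A * C₁ * hi - X)]
  have u9 : D * Q₂ * X ≤ (D * Q₂) ^ 2 / 2 + P / 2 := by
    rw [← hX]; nlinarith [sq_nonneg (D * Q₂ - X)]
  linarith

/-- Relations between the constants of the Lyapunov function. -/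
structure LyapC.Good (w : LyapC) (k : Consts) (I J : ℕ) (L Cb s₀ s₁ K η : ℝ) : Prop
    extends w.Pos where
  s₀_pos : 0 < s₀
  s₁_pos : 0 < s₁
  K_nonneg : 0 ≤ K
  η_pos : 0 < η
  Λs₀ : 2 * w.Λ * s₀ ≤ 1
  lam_le : w.lam * (rateC k w.Λ J + 1) ≤ k.c₀ / 2
  Λθ : 2 * w.Λ * w.θ ≤ 1
  θ_le : w.Λ * w.θ * (2 * k.g₁ * k.smax) ≤ k.g₀ * k.vmin / 4
  θ_le_y : 2 * k.g₁ * w.θ ≤ w.y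
  θ_le_s₀ : w.θ ≤ s₀ / 2
  G_eq : w.G = K / η
  B₁_eq : w.B₁ = K * Real.exp (w.θ + w.c₂)
  Cl_ge : J * ((w.c₂ + k.g₁) / k.g₀) ≤ w.Cl
  Cχ_ge : 4 * k.Cp * I * Cb ^ 2 * Fintype.card (Idx J) * K ≤ 2 * w.Cl * (η * w.Cχ)
  A₃_ge_jump : 2 * (L + 2 * (4 * k.Cp) * I * Cb) ^ 2 * Fintype.card (Idx J) * K +
    2 * Fintype.card (Idx J) ≤ w.A₃
  A₃_ge : w.lam ^ 2 * YsqC k I J L Cb w.lam w.y + 4 ≤ w.A₃ * (w.y * k.smin / 2)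
  A_ge : w.A₃ * (Fintype.card (Idx J) * (2 * w.G * w.y * k.smax)) ≤ w.A * (k.c₀ * w.lam / 2)
  B_ge : w.A * V₁C k I J w.Λ w.lam w.y + w.A₃ * (w.y * k.smin) +
    (2 * YC k I J L Cb w.y + k.cM) * (3 * L * J * (k.g₁ / w.lam)) ≤ w.B * k.g₀ / 2

/-- The constants can be chosen: first the small ones, then `A₃`, `A` and `B` one after the other. -/
theorem exists_lyapC [Nonempty (Idx J)] (k : Consts) (I : ℕ)
    {L Cb Λ s₀ s₁ y K η c₁ c₂ κ : ℝ} (hL : 0 ≤ L)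
    (hCb : 0 ≤ Cb) (hΛ : 0 ≤ Λ) (hs₀ : 0 < s₀) (hs₁ : 0 < s₁) (hy : 0 < y) (hK : 0 ≤ K) (hη : 0 < η)
    (hΛs : 2 * Λ * s₀ ≤ 1) (hc₁ : 0 < c₁) (hc : c₁ < c₂) (hκ : 0 < κ) (hκ4 : κ < 1 / 4) :
    ∃ w : LyapC, w.Good k I J L Cb s₀ s₁ K η ∧ w.Λ = Λ ∧ w.y = y ∧ w.c₁ = c₁ ∧ w.c₂ = c₂ ∧
      w.κ = κ := by
  have hg0 := k.g₀_pos
  have hg1 := k.g₁_pos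
  have hc0 := k.c₀_pos
  have hsm := k.smin_pos
  have hsx := k.one_le_smax
  have hvm := k.vmin_pos
  have hCp := k.Cp_nonneg
  have hrC : 0 ≤ rateC k Λ J := by unfold rateC; positivity
  obtain ⟨lam, hlam0, hlam⟩ : ∃ lam : ℝ, 0 < lam ∧ lam * (rateC k Λ J + 1) ≤ k.c₀ / 2 :=
    ⟨k.c₀ / 2 / (rateC k Λ J + 1), by positivity, le_of_eq (by field_simp)⟩
  obtain ⟨θ, hθ0, hθ1, hθ2, hθ3, hθ4⟩ : ∃ θ : ℝ, 0 < θ ∧ 2 * Λ * θ ≤ 1 ∧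
      Λ * θ * (2 * k.g₁ * k.smax) ≤ k.g₀ * k.vmin / 4 ∧ 2 * k.g₁ * θ ≤ y ∧ θ ≤ s₀ / 2 := by
    have h : ∀ c : ℝ, ∀ d > 0, ∀ᶠ θ in 𝓝[>] (0 : ℝ), c * θ ≤ d := fun c d hd => by
      have h1 : Tendsto (fun θ : ℝ => c * θ) (𝓝 0) (𝓝 (c * 0)) := tendsto_id.const_mul c
      rw [mul_zero] at h1
      exact (h1.mono_left nhdsWithin_le_nhds).eventually_le_const hd
    obtain ⟨θ, h5, h6, h7, h8, h9⟩ := (eventually_mem_nhdsWithin.and ((h (2 * Λ) 1 one_pos).and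
      ((h (Λ * (2 * k.g₁ * k.smax)) (k.g₀ * k.vmin / 4) (by positivity)).and
      ((h (2 * k.g₁) y hy).and (h 1 (s₀ / 2) (by positivity)))))).exists
    exact ⟨θ, h5, h6, by linarith, h8, by linarith⟩
  set Cl : ℝ := J * ((c₂ + k.g₁) / k.g₀) + 1 with hCl
  have hc₂ : 0 < c₂ := hc₁.trans hc
  have hClp : 0 < Cl := by rw [hCl]; positivity
  set n : ℝ := (Fintype.card (Idx J) : ℝ) with hn
  set Cχ : ℝ := 4 * k.Cp * I * Cb ^ 2 * n * K / (2 * Cl * η) with hCχ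
  set G := K / η with hG
  have hG0 : 0 ≤ G := by positivity
  set A₃ : ℝ := (2 * (L + 2 * (4 * k.Cp) * I * Cb) ^ 2 * n * K + 2 * n) +
    (lam ^ 2 * YsqC k I J L Cb lam y + 4) / (y * k.smin / 2) with hA₃
  have hYsq : 0 ≤ YsqC k I J L Cb lam y := by unfold YsqC; positivity
  have hA₃0 : 0 ≤ A₃ := by rw [hA₃]; positivity
  set A : ℝ := A₃ * (n * (2 * G * y * k.smax)) / (k.c₀ * lam / 2) with hA
  have hA0 : 0 ≤ A := by rw [hA]; positivity
  have hYC : 0 ≤ YC k I J L Cb y := by unfold YC; positivity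
  have hcfC := cfC_nonneg k hΛ hlam0.le
  have hC0 := k.C₀_pos
  have hV₁C : 0 ≤ V₁C k I J Λ lam y := by unfold V₁C; positivity
  have hcM := k.cM_pos
  set B : ℝ := (A * V₁C k I J Λ lam y + A₃ * (y * k.smin) +
    (2 * YC k I J L Cb y + k.cM) * (3 * L * J * (k.g₁ / lam))) * 2 / k.g₀ with hB
  refine ⟨⟨Λ, lam, y, θ, G, K * Real.exp (θ + c₂), A, B, A₃, Cl, Cχ, c₁, c₂, κ⟩, ?_, rfl, rfl, rfl,
    rfl, rfl⟩
  exact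
    { Λ_nonneg := hΛ
      lam_pos := hlam0
      y_pos := hy
      θ_pos := hθ0
      G_nonneg := hG0
      B₁_nonneg := by positivity
      A_nonneg := hA0
      B_nonneg := by positivity
      A₃_nonneg := hA₃0
      Cl_pos := hClp
      Cχ_nonneg := by positivity
      c₁_pos := hc₁
      c₁_lt_c₂ := hc
      κ_pos := hκ
      κ_lt := hκ4
      s₀_pos := hs₀
      s₁_pos := hs₁
      K_nonneg := hK
      η_pos := hη
      Λs₀ := hΛs
      lam_le := hlam
      Λθ := hθ1
      θ_le := hθ2
      θ_le_y := hθ3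
      θ_le_s₀ := hθ4
      G_eq := rfl
      B₁_eq := rfl
      Cl_ge := by simp only [hCl]; linarith
      Cχ_ge := le_of_eq (by simp only [hCχ]; field_simp; rw [hn]; ring)
      A₃_ge_jump := by
        simp only [hA₃, ← hn]
        exact le_add_of_nonneg_right (by positivity)
      A₃_ge := by
        have h1 : 0 < y * k.smin / 2 := by positivity
        have h2 : (lam ^ 2 * YsqC k I J L Cb lam y + 4) / (y * k.smin / 2) ≤ A₃ := by
          rw [hA₃]; exact le_add_of_nonneg_left (by positivity)
        exact (div_le_iff₀ h1).1 h2
      A_ge := le_of_eq (by simp only [hA, ← hn]; field_simp)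
      B_ge := le_of_eq (by simp only [hB]; field_simp) }

end Total
end RSN
end

noncomputable section

namespace RSN

/-! ### The drift and jump inequalities of the Lyapunov function -/

section Eventual

variable {I J : ℕ}

/-- The conditions on `r` under which the Lyapunov function has the desired properties. -/
structure LyapC.Large (w : LyapC) (N : Network I J) (k : Consts) (L Cb s₀ s₁ : ℝ) (r : ℕ) :
    Prop where
  one_le_b : 1 ≤ w.b r
  one_le_hi : 1 ≤ w.c₂ * w.b r
  residual : 4 * Fintype.card (Idx J) * cfC k w.Λ w.lam ≤ w.y * r
  hi_le : w.c₂ * w.b r ≤ k.g₀ * r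
  rate₁ : Fintype.card (Idx J) * (cfC k w.Λ w.lam * k.smax) / r + w.lam ^ 2 / r ^ 2 ≤
    w.y * k.smin / 2
  rate₂ : Fintype.card (Idx J) * (cfC k w.Λ w.lam * k.smax) / r + w.lam ^ 2 / r ^ 2 ≤
    k.g₀ / (4 * w.b r)
  rate₃ : Fintype.card (Idx J) * (cfC k w.Λ w.lam * k.smax) / r + w.lam ^ 2 / r ^ 2 ≤
    w.θ * (k.g₀ * k.vmin / 4)
  Λ_le : 4 * w.Λ ≤ w.b r
  lam_le : 2 * w.Λ * (w.lam / k.g₀ / r) ≤ 1 / 2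
  cf_le : cfC k w.Λ w.lam / r ≤ w.y
  dev_le : k.C₀ / r ≤ k.g₀ * k.vmin / 2
  exp_le₁ : w.B * (w.B₁ * (w.θ * (k.g₀ * k.vmin) + 4 * w.θ * k.g₁ * k.smax)) *
    (r * w.b r * Real.exp (-(w.θ * (w.c₂ - w.c₁) * w.b r))) ≤ 1
  exp_le₂ : (2 * YC k I J L Cb w.y + k.cM) * (L * (J * (k.g₁ / w.lam))) *
    (r * w.b r * Real.exp (-(w.y / 2 * w.b r))) ≤ 1
  b_le : Fintype.card (Idx J) * cfC k w.Λ w.lam * w.b r ≤ r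
  small : (∑ j, N.h j) * (k.C₀ * (1 + k.smax) / r) +
      9 * k.Cp * (I * (J * (k.C₀ * (1 + k.smax) / r / k.g₀))) +
      w.Cχ / w.b r * (Fintype.card (Idx J) * (w.y * k.smax)) ≤ k.cM / 2
  Cχ_le : w.Cχ ≤ w.b r
  lam_s₀ : w.lam / k.g₀ / r ≤ s₀ / 2
  lam_s₁ : w.lam / k.g₀ / r ≤ s₁
  lam_θ : w.lam / k.g₀ / r ≤ w.θ
  b_inv_θ : (w.b r)⁻¹ ≤ w.θ
  B₁_le : w.B₁ ≤ Real.exp (w.θ * (w.c₂ - w.c₁) * w.b r - w.θ)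

theorem LyapC.eventually_large (w : LyapC) (N : Network I J) (k : Consts) {L Cb s₀ s₁ K η : ℝ}
    (hw : w.Good k I J L Cb s₀ s₁ K η) : ∀ᶠ r : ℕ in atTop, w.Large N k L Cb s₀ s₁ r := by
  have hp := hw.toPos
  have hg0 := k.g₀_pos
  have hr := tendsto_natCast_atTop_atTop (R := ℝ)
  have hb := LyapC.tendsto_b hp
  have hbr := LyapC.tendsto_b_pow_div hp one_le_two
  simp only [pow_one] at hbr
  have hinv : ∀ c : ℝ, Tendsto (fun r : ℕ => c / (r : ℝ)) atTop (𝓝 0) := fun c =>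
    hr.const_div_atTop c
  have hbinv : ∀ c : ℝ, Tendsto (fun r : ℕ => c / w.b r) atTop (𝓝 0) := fun c =>
    hb.const_div_atTop c
  have hθc : 0 < w.θ * (w.c₂ - w.c₁) := mul_pos hp.θ_pos (sub_pos.2 hp.c₁_lt_c₂)
  have hrate : Tendsto (fun r : ℕ => Fintype.card (Idx J) * (cfC k w.Λ w.lam * k.smax) / (r : ℝ) +
      w.lam ^ 2 / (r : ℝ) ^ 2) atTop (𝓝 0) := by
    have h1 := (hinv (Fintype.card (Idx J) * (cfC k w.Λ w.lam * k.smax))).add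
      ((hinv w.lam).pow 2)
    simpa [div_pow] using h1
  have hrateb : Tendsto (fun r : ℕ => w.b r * (Fintype.card (Idx J) *
      (cfC k w.Λ w.lam * k.smax) / (r : ℝ) + w.lam ^ 2 / (r : ℝ) ^ 2)) atTop (𝓝 0) := by
    have h1 := (hbr.mul_const (Fintype.card (Idx J) * (cfC k w.Λ w.lam * k.smax))).add
      ((hbr.mul (hinv (w.lam ^ 2))))
    simp only [zero_mul, add_zero, mul_zero] at h1
    refine h1.congr fun r => ?_
    ring
  have hsm := k.smin_pos
  have hvm := k.vmin_pos
  have hy := hp.y_pos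
  have hθ := hp.θ_pos
  have hs0 := hw.s₀_pos
  have hs1 := hw.s₁_pos
  have hcM := k.cM_pos
  have hc2 : 0 < w.c₂ := hp.c₁_pos.trans hp.c₁_lt_c₂
  have e1 := hb.eventually_ge_atTop 1
  have e2 := (hb.const_mul_atTop hc2).eventually_ge_atTop 1
  have e3 := (hr.const_mul_atTop hy).eventually_ge_atTop (4 * Fintype.card (Idx J) * cfC k w.Λ w.lam)
  have e4 : ∀ᶠ r : ℕ in atTop, w.c₂ * w.b r ≤ k.g₀ * r := by
    have h1 := hbr.const_mul w.c₂
    rw [mul_zero] at h1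
    filter_upwards [h1.eventually_le_const hg0, eventually_gt_atTop 0] with r h2 h3
    have h4 : (0 : ℝ) < r := by exact_mod_cast h3
    rwa [← mul_div_assoc, div_le_iff₀ h4] at h2
  have e5 := hrate.eventually_le_const (show 0 < w.y * k.smin / 2 by positivity)
  have e6 : ∀ᶠ r : ℕ in atTop, Fintype.card (Idx J) * (cfC k w.Λ w.lam * k.smax) / (r : ℝ) +
      w.lam ^ 2 / (r : ℝ) ^ 2 ≤ k.g₀ / (4 * w.b r) := by
    filter_upwards [hrateb.eventually_le_const (show 0 < k.g₀ / 4 by positivity), e1] with r h1 h2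
    rw [le_div_iff₀ (by positivity)]
    linarith
  have e7 := hrate.eventually_le_const (show 0 < w.θ * (k.g₀ * k.vmin / 4) by positivity)
  have e8 := hb.eventually_ge_atTop (4 * w.Λ)
  have e9 : ∀ᶠ r : ℕ in atTop, 2 * w.Λ * (w.lam / k.g₀ / r) ≤ 1 / 2 := by
    have h1 := (hinv (w.lam / k.g₀)).const_mul (2 * w.Λ)
    rw [mul_zero] at h1
    exact h1.eventually_le_const (by norm_num)
  have e10 := (hinv (cfC k w.Λ w.lam)).eventually_le_const hy
  have e11 := (hinv k.C₀).eventually_le_const (show 0 < k.g₀ * k.vmin / 2 by positivity)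
  have e12 := ((LyapC.tendsto_mul_exp hp hθc).const_mul
    (w.B * (w.B₁ * (w.θ * (k.g₀ * k.vmin) + 4 * w.θ * k.g₁ * k.smax))))
  rw [mul_zero] at e12
  have e13 := ((LyapC.tendsto_mul_exp hp (half_pos hy)).const_mul
    ((2 * YC k I J L Cb w.y + k.cM) * (L * (J * (k.g₁ / w.lam)))))
  rw [mul_zero] at e13
  have e14 : ∀ᶠ r : ℕ in atTop, Fintype.card (Idx J) * cfC k w.Λ w.lam * w.b r ≤ r := by
    have h1 := hbr.const_mul (Fintype.card (Idx J) * cfC k w.Λ w.lam)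
    rw [mul_zero] at h1
    filter_upwards [h1.eventually_le_const one_pos, eventually_gt_atTop 0] with r h2 h3
    have h4 : (0 : ℝ) < r := by exact_mod_cast h3
    rwa [← mul_div_assoc, div_le_iff₀ h4, one_mul] at h2
  have e15 : Tendsto (fun r : ℕ => (∑ j, N.h j) * (k.C₀ * (1 + k.smax) / r) +
      9 * k.Cp * (I * (J * (k.C₀ * (1 + k.smax) / r / k.g₀))) +
      w.Cχ / w.b r * (Fintype.card (Idx J) * (w.y * k.smax))) atTop (𝓝 0) := by
    have h1 := hinv (k.C₀ * (1 + k.smax))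
    have h2 := ((h1.const_mul (∑ j, N.h j)).add
      ((((h1.div_const k.g₀).const_mul (J : ℝ)).const_mul (I : ℝ)).const_mul (9 * k.Cp))).add
      ((hbinv w.Cχ).mul_const (Fintype.card (Idx J) * (w.y * k.smax)))
    simpa using h2
  have e16 := hb.eventually_ge_atTop w.Cχ
  have e17 := (hinv (w.lam / k.g₀)).eventually_le_const (show 0 < s₀ / 2 by positivity)
  have e18 := (hinv (w.lam / k.g₀)).eventually_le_const hs1
  have e19 := (hinv (w.lam / k.g₀)).eventually_le_const hθ
  have e20 := (tendsto_inv_atTop_zero.comp hb).eventually_le_const hθ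
  have e21 : ∀ᶠ r : ℕ in atTop, w.B₁ ≤ Real.exp (w.θ * (w.c₂ - w.c₁) * w.b r - w.θ) := by
    have h1 : Tendsto (fun r : ℕ => w.θ * (w.c₂ - w.c₁) * w.b r - w.θ) atTop atTop :=
      tendsto_atTop_add_const_right _ _ (hb.const_mul_atTop hθc)
    exact (Real.tendsto_exp_atTop.comp h1).eventually_ge_atTop w.B₁
  filter_upwards [e1, e2, e3, e4, e5, e6, e7, e8, e9, e10, e11, e12.eventually_le_const one_pos,
    e13.eventually_le_const one_pos, e14, e15.eventually_le_const (half_pos hcM), e16, e17, e18,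
    e19, e20, e21] with r f1 f2 f3 f4 f5 f6 f7 f8 f9 f10 f11 f12 f13 f14 f15 f16 f17 f18 f19 f20 f21
  exact ⟨f1, f2, f3, f4, f5, f6, f7, f8, f9, f10, f11, f12, f13, f14, f15, f16, f17, f18, f19,
    f20, f21⟩

/-- Constant in the drift inequality. -/
def LyapC.driftC (w : LyapC) (k : Consts) (I J : ℕ) (L Cb : ℝ) : ℝ :=
  (w.A * V₁C k I J w.Λ w.lam w.y * w.c₂) ^ 2 / 2 +
  ((2 * YC k I J L Cb w.y + k.cM) *
    (YR k I L Cb * (Fintype.card (Idx J) * (2 / w.y)))) ^ 2 / 2 +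
  w.A₃ * (Fintype.card (Idx J) * (2 * w.G * w.y * k.smax)) +
  (2 * YC k I J L Cb w.y + k.cM) * (k.Cg * w.c₂ +
    (4 * k.Cp * I * w.Cl + Fintype.card (Idx J))) +
  w.lam ^ 2 * (3 * (4 * k.Cp * I * w.Cl + Fintype.card (Idx J)) ^ 2)

set_option maxHeartbeats 1000000 in
/-- **Drift inequality**: along the deterministic motion the Lyapunov function decreases at rate `f`,
up to an error of order `r ^ (2 κ)`, even with a discount at rate `λ² / r²`. -/
theorem LyapC.upperDeriv_W [Nonempty (Idx J)] {N : Network I J} (hN : N.IsTopology) {k : Consts}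
    {w : LyapC} {L Cb s₀ s₁ K η : ℝ} (hw : w.Good k I J L Cb s₀ s₁ K η)
    (hg : GapBound N k.Cp L Cb) {r : ℕ} (hr : w.Large N k L Cb s₀ s₁ r) {γ : Idx J → ℝ}
    (hγ : Near N k r γ) (p : Policy J) {x : Config J} (hx : Valid (w.c₁ * w.b r) (w.c₂ * w.b r) x)
    (hξ : Rates N k (w.c₂ * w.b r) x.1 (p.x N r x.1)) :
    UpperDeriv (fun u => w.W N k.Cp r γ (flow p N r x u))
      (-w.f N k r γ x + w.driftC k I J L Cb * w.b r ^ 2 -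
        w.lam ^ 2 / r ^ 2 * w.W N k.Cp r γ x) := by
  have hp := hw.toPos
  have hr1 := hγ.r_pos
  have hb1 := hr.one_le_b
  have hb0 : 0 < w.b r := by linarith
  have hlam := hp.lam_pos
  have hΛ := hp.Λ_nonneg
  have hy := hp.y_pos
  have hθ := hp.θ_pos
  have hG := hp.G_nonneg
  have hA := hp.A_nonneg
  have hB := hp.B_nonneg
  have hA₃ := hp.A₃_nonneg
  have hCl := hp.Cl_pos
  have hCχ := hp.Cχ_nonneg
  have hc2 : 0 < w.c₂ := hp.c₁_pos.trans hp.c₁_lt_c₂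
  have hL := hg.L_nonneg
  have hCb := hg.Cb_nonneg
  have hCp := k.Cp_nonneg
  have hCg := k.Cg_nonneg
  have hcM := k.cM_pos
  have hg1 := k.g₁_pos
  have hsx := k.one_le_smax
  have hR := hx.R_nonneg
  have hq := hx.q_nonneg
  have hGχ0 : 0 ≤ w.Cχ / w.b r := by positivity
  have hGχ1 : w.Cχ / w.b r ≤ 1 := (div_le_one hb0).2 hr.Cχ_le
  have hℓ : 0 < w.Cl * w.b r := by positivity
  have hhi : 0 ≤ w.c₂ * w.b r := by positivity
  have hYC : 0 ≤ YC k I J L Cb w.y := by unfold YC; positivity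
  have hYR : 0 ≤ YR k I L Cb := by unfold YR; positivity
  have hsp : speed p N r x = vel x.2.2 (p.x N r x.1) := rfl
  set δ : ℝ := w.lam ^ 2 / r ^ 2 with hδ
  set Yp := max (w.gapY N k.Cp r γ x) 0 with hYp
  set P := PP N γ w.Λ w.lam w.y r x with hP
  have hP0 : 0 ≤ P := PP_nonneg x
  set E₁ : ℝ := w.B₁ * Real.exp (-(w.θ * (w.c₂ * w.b r - w.c₁ * w.b r))) *
    (w.θ * (k.g₀ * k.vmin) + 4 * w.θ * k.g₁ * k.smax) with hE₁
  set E₂ : ℝ := L * (J * (k.g₁ / w.lam * r * Real.exp (-(w.y / 2 * w.b r)))) with hE₂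
  set D : ℝ := 2 * YC k I J L Cb w.y + k.cM with hD
  have hD0 : 0 ≤ D := by positivity
  set n : ℝ := (Fintype.card (Idx J) : ℝ) with hn
  have hn0 : 0 ≤ n := Nat.cast_nonneg _
  set Q₀ : ℝ := k.Cg * (w.c₂ * w.b r) + (4 * k.Cp * I * (w.Cl * w.b r) + n) with hQ₀
  have hPE := PE_nonneg (N := N) (γ := γ) (Λ := w.Λ) (lam := w.lam) (y := w.y) (r := r) x
  set X := √P with hX
  set bad : ℝ := Q₀ + 3 * L * J * (k.g₁ / w.lam) * (r * PE N γ w.Λ w.lam w.y r x) + E₂ * P +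
    YR k I L Cb * (n * (2 / w.y)) * X with hbad
  have hbad0 : 0 ≤ bad := by positivity
  -- the gap part
  obtain ⟨μ, hμ, hμb⟩ : ∃ μ, UpperDeriv (fun u => w.gapY N k.Cp r γ (flow p N r x u)) μ ∧
      2 * Yp * μ ≤ -k.cM * Yp + D * bad := by
    by_cases hc : N.gap k.Cp x.1 ≤ k.Cg * (w.c₂ * w.b r) ∨ (∃ j, x.2.2 j = true) ∨
        ∃ a, w.b r < x.2.1 a
    -- the gap may grow, but then it is bounded by `bad`
    · refine ⟨_, upperDeriv_Y_le hγ hg p hGχ0 hGχ1 hℓ hy.le hR hξ, ?_⟩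
      have h1 := Y_le_of_bad hN hγ hg hlam hΛ hy hr.residual hGχ0 hGχ1 hℓ hhi hr.b_le
        (le_refl E₂) hR hq hc
      have h2 : Yp ≤ bad := by
        rw [hbad, hQ₀]
        refine h1.trans_eq ?_
        ring
      have h3 := mul_le_mul_of_nonneg_left h2 hD0
      rw [hD] at h3 ⊢
      linarith
    · push Not at hc
      obtain ⟨hc1, hc2', hc3⟩ := hc
      refine ⟨_, upperDeriv_Y_le_neg hN hγ p hGχ0 hℓ hy.le hR hc3 hhi hξ
        (fun j => by simpa using hc2' j) ?_ (hξ.cost.resolve_right (not_le.2 hc1)) hr.small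
        hN.h_pos, ?_⟩
      · have h1 := mul_le_mul_of_nonneg_right hw.Cl_ge hb0.le
        refine le_trans (le_of_eq ?_) h1
        ring
      · have := mul_nonneg hD0 hbad0
        linarith
  have hW := (((upperDeriv_V₁ (N := N) (γ := γ) (Λ := w.Λ) (lam := w.lam) (r := r) p x δ).const_mul
    (show 0 ≤ w.A * r ^ 2 by positivity)).add ((upperDeriv_V₃ (N := N) (γ := γ) (Λ := w.Λ)
    (lam := w.lam) (y := w.y) (r := r) p hG x δ).const_mul hA₃)).add
    ((upperDeriv_V₂ (N := N) (γ := γ) (Λ := w.Λ) (lam := w.lam) (y := w.y) (r := r) p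
    (θ := w.θ) (b := w.b r) (lo := w.c₁ * w.b r) (hi := w.c₂ * w.b r) hp.B₁_nonneg x δ).const_mul
    (show 0 ≤ w.B * r * w.b r by positivity)) |>.add (upperDeriv_sq_posPart hμ)
  have hflow0 : flow p N r x 0 = x := by
    unfold flow; simp
  refine UpperDeriv.mono hW ?_
  rw [hflow0, ← hYp]
  -- the exponentials
  have b1 := dV₁_le hN hγ hlam hΛ hy hw.lam_le hr.residual hR hq hr.one_le_hi hr.hi_le hξ
  have b3 := dV₃_le hN hγ hlam.le hΛ hy hG hr.rate₁ hR hξ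
  have b2 := dV₂_le hN hγ hlam.le hΛ hp.B₁_nonneg hb0 hθ hr.Λ_le hw.Λθ hr.lam_le hw.θ_le
    hw.θ_le_y hr.cf_le hr.rate₂ hr.rate₃ hr.dev_le (le_refl E₁) hx hξ
  have bY := Y_sq_le hN hγ hg hlam hΛ hy hr.residual hGχ0 hGχ1 hℓ hR hq
  rw [← hsp, ← hδ] at b1 b2 b3
  have bY' : 2 * Yp * μ + δ * Yp ^ 2 ≤ -k.cM * Yp + D * (Q₀ + 3 * L * J * (k.g₁ / w.lam) *
      (r * PE N γ w.Λ w.lam w.y r x) + E₂ * P + YR k I L Cb * (n * (2 / w.y)) * X) +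
      (w.lam ^ 2 * YsqC k I J L Cb w.lam w.y * P +
        w.lam ^ 2 * (3 * (4 * k.Cp * I * (w.Cl * w.b r) + n) ^ 2)) := by
    have h1 : δ * Yp ^ 2 = w.lam ^ 2 * (Yp ^ 2 / r ^ 2) := by rw [hδ]; ring
    have h2 := mul_le_mul_of_nonneg_left bY (sq_nonneg w.lam)
    rw [h1]
    have h3 : Yp ^ 2 / (r : ℝ) ^ 2 = max (Y N γ k.Cp (4 * k.Cp) (w.Cχ / w.b r) (w.Cl * w.b r) w.y x)
      0 ^ 2 / r ^ 2 := rfl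
    rw [h3]
    linarith
  have hE₁' : w.B * r * w.b r * E₁ ≤ 1 := by
    refine le_trans (le_of_eq ?_) hr.exp_le₁
    rw [hE₁]
    have : w.θ * (w.c₂ * w.b r - w.c₁ * w.b r) = w.θ * (w.c₂ - w.c₁) * w.b r := by ring
    rw [this]; ring
  have hE₂' : D * E₂ ≤ 1 := by
    refine le_trans ?_ hr.exp_le₂
    rw [hE₂]
    have h1 : D * (L * (J * (k.g₁ / w.lam * r * Real.exp (-(w.y / 2 * w.b r))))) =
        D * (L * (J * (k.g₁ / w.lam))) * (r * 1 * Real.exp (-(w.y / 2 * w.b r))) := by ring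
    rw [h1]
    gcongr
  have key := drift_sum_le (A := w.A) (A₃ := w.A₃) (B := w.B) (D := D) (Q₀ := Q₀)
    (cM := k.cM) (r := r) (b := w.b r) (hi := w.c₂ * w.b r) (X := X) (P := P) (Yp := Yp)
    (S := SS N γ w.Λ w.lam r x) (cP := w.y * k.smin) (C₁ := V₁C k I J w.Λ w.lam w.y)
    (Real.sq_sqrt hP0) hr1 hb0 hA hA₃ hB (SS_nonneg x) hPE
    (mul_nonneg hy.le k.smin_pos.le) b1 b3 b2 bY' hw.A₃_ge hw.A_ge hw.B_ge hE₁' hE₂'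
  -- all errors are of order `b²`
  have hconst : (w.A * V₁C k I J w.Λ w.lam w.y * (w.c₂ * w.b r)) ^ 2 / 2 +
      (D * (YR k I L Cb * (n * (2 / w.y)))) ^ 2 / 2 + w.A₃ * (n * (2 * w.G * w.y * k.smax)) +
      D * Q₀ + w.lam ^ 2 * (3 * (4 * k.Cp * I * (w.Cl * w.b r) + n) ^ 2) ≤
      w.driftC k I J L Cb * w.b r ^ 2 := by
    have hbb : (1 : ℝ) ≤ w.b r ^ 2 := one_le_pow₀ hb1
    have hbb2 : w.b r ≤ w.b r ^ 2 := by nlinarith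
    unfold LyapC.driftC
    rw [← hn, ← hD]
    simp only [add_mul]
    refine add_le_add (add_le_add (add_le_add (add_le_add (le_of_eq (by ring)) ?_) ?_) ?_) ?_
    · exact le_mul_of_one_le_right (by positivity) hbb
    · exact le_mul_of_one_le_right (by positivity) hbb
    · rw [mul_assoc]
      refine mul_le_mul_of_nonneg_left ?_ hD0
      rw [hQ₀]
      have h1 : k.Cg * (w.c₂ * w.b r) = k.Cg * w.c₂ * w.b r := by ring
      have h2 : 4 * k.Cp * I * (w.Cl * w.b r) = 4 * k.Cp * I * w.Cl * w.b r := by ring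
      rw [h1, h2, add_mul, add_mul]
      have h3 := mul_le_mul_of_nonneg_left hbb2 (show 0 ≤ k.Cg * w.c₂ by positivity)
      have h4 := mul_le_mul_of_nonneg_left hbb2 (show 0 ≤ 4 * k.Cp * I * w.Cl by positivity)
      exact add_le_add h3 (add_le_add h4 (le_mul_of_one_le_right hn0 hbb))
    · rw [show w.lam ^ 2 * (3 * (4 * k.Cp * I * w.Cl + n) ^ 2) * w.b r ^ 2 =
        w.lam ^ 2 * (3 * ((4 * k.Cp * I * w.Cl + n) * w.b r) ^ 2) by ring]
      refine mul_le_mul_of_nonneg_left ?_ (sq_nonneg _)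
      refine mul_le_mul_of_nonneg_left ?_ zero_le_three
      refine pow_le_pow_left₀ (by positivity) ?_ 2
      rw [add_mul]
      exact add_le_add (le_of_eq (by ring)) (le_mul_of_one_le_right hn0 hb1)
  unfold LyapC.f LyapC.W
  rw [← hYp, ← hP]
  linarith

/-- The mean of the Lyapunov function does not increase at jumps. -/
theorem LyapC.W_jump [Nonempty (Idx J)] {N : Network I J} (hN : N.IsTopology) {k : Consts}
    {w : LyapC} {L Cb s₀ s₁ K η : ℝ} (hw : w.Good k I J L Cb s₀ s₁ K η)
    (hg : GapBound N k.Cp L Cb) {r : ℕ} (hr : w.Large N k L Cb s₀ s₁ r) {γ : Idx J → ℝ}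
    (hγ : Near N k r γ) {m : Idx J → Measure ℝ} (hm : JumpLaw γ w.Λ s₀ s₁ w.y K η m)
    {x : Config J} (hx : Valid (w.c₁ * w.b r) (w.c₂ * w.b r) x) :
    Integrable (fun z => w.W N k.Cp r γ (jump (w.c₁ * w.b r) (w.c₂ * w.b r) x z))
      (Measure.pi m) ∧
    ∫ z, w.W N k.Cp r γ (jump (w.c₁ * w.b r) (w.c₂ * w.b r) x z) ∂Measure.pi m ≤
      w.W N k.Cp r γ x := by
  have := hm.prob
  have hp := hw.toPos
  have hb1 := hr.one_le_b
  have hb0 : 0 < w.b r := by linarith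
  have hlam := hp.lam_pos
  have hΛ := hp.Λ_nonneg
  have hy := hp.y_pos
  have hθ := hp.θ_pos
  have hg1 := k.g₁_pos
  have hs0 := hw.s₀_pos
  have hR := hx.R_nonneg
  set lo := w.c₁ * w.b r with hlo
  set hi := w.c₂ * w.b r with hhi
  have hwt : ∀ o a, |sg (wt N γ w.lam r o) a| ≤ w.lam / k.g₀ / r := fun o a =>
    abs_sg_wt_le hN hγ hlam.le o a
  have hcf : ∀ o a, |cf w.Λ γ (wt N γ w.lam r o) a| ≤ w.y ∧
      |cf w.Λ γ (-wt N γ w.lam r o) a| ≤ w.y := fun o a =>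
    ⟨(abs_cf_wt_le hN hγ hlam.le hΛ o a).1.trans hr.cf_le,
      (abs_cf_wt_le hN hγ hlam.le hΛ o a).2.trans hr.cf_le⟩
  have hsub : ∀ t, 0 ≤ t → ∀ o j a, |sg (wt N γ w.lam r o - Pi.single j t) a| ≤
      w.lam / k.g₀ / r + t := by
    intro t ht o j a
    rw [sg_sub]
    refine (abs_sub _ _).trans (add_le_add (hwt o a) ?_)
    rcases a with i | i
    · simp only [sg, Sum.elim_inl, Pi.single_apply]
      split_ifs
      exacts [(abs_of_nonneg ht).le, by simpa using ht]
    · simp only [sg, Sum.elim_inr, Pi.single_apply, abs_neg]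
      split_ifs
      exacts [(abs_of_nonneg ht).le, by simpa using ht]
  have hbi : (0 : ℝ) ≤ (w.b r)⁻¹ := by positivity
  have hcf2 : ∀ t, 0 ≤ t → t ≤ w.θ → ∀ o j a,
      |cf w.Λ γ (wt N γ w.lam r o - Pi.single j t) a| ≤ 2 * w.y := by
    intro t ht htθ o j a
    have h1 : |sg (wt N γ w.lam r o - Pi.single j t) a| ≤ 2 * w.θ :=
      (hsub t ht o j a).trans (by linarith [hr.lam_θ])
    refine (abs_cf_le hΛ (fun a => (hγ.γ_pos a).le) hγ.le_g₁ h1).trans ?_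
    have h2 := hw.Λθ
    have h3 := hw.θ_le_y
    have h4 : 2 * w.θ + w.Λ * (2 * w.θ) ^ 2 ≤ 2 * w.θ * 2 := by nlinarith
    have h5 := mul_le_mul_of_nonneg_left h4 hg1.le
    linarith
  have j1 := V₁_jump (N := N) hm hy.le (fun o a => (hwt o a).trans (by linarith [hr.lam_s₀])) hcf
    lo hi hR (lam := w.lam) (r := r)
  have j3 := V₃_jump (N := N) hm hy.le hw.η_pos
    (fun o a => (hwt o a).trans (by linarith [hr.lam_s₀]))
    (fun o a => (hwt o a).trans hr.lam_s₁) (fun o a => (hcf o a).1) lo hi hR hw.K_nonneg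
    (lam := w.lam) (r := r)
  rw [← hw.G_eq] at j3
  have hhib : hi * (w.b r)⁻¹ = w.c₂ := by rw [hhi]; field_simp
  have j2 := V₂_jump (N := N) hm (lam := w.lam) (θ := w.θ) (b := w.b r) (B₁ := w.B₁) (r := r)
    hγ.γ_pos hΛ hw.Λs₀ hy.le hb0 hr.b_inv_θ (by rw [hlo]; have := hp.c₁_pos; positivity)
    (fun o j a => (hsub _ hbi o j a).trans (by linarith [hr.lam_s₀, hr.b_inv_θ, hw.θ_le_s₀]))
    (fun o j a => (hsub _ hθ.le o j a).trans (by linarith [hr.lam_s₀, hw.θ_le_s₀]))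
    (hcf2 _ hbi hr.b_inv_θ) (hcf2 _ hθ.le le_rfl) (by rw [hhib, hw.B₁_eq])
    (by
      have : w.θ * (hi - lo) = w.θ * (w.c₂ - w.c₁) * w.b r := by rw [hhi, hlo]; ring
      rw [this]; exact hr.B₁_le) hx
  have hℓ : 0 < w.Cl * w.b r := mul_pos hp.Cl_pos hb0
  have jY := Y_sq_jump hm hg (Cφ := 4 * k.Cp) (Gχ := w.Cχ / w.b r) (ℓ := w.Cl * w.b r)
    (by have := k.Cp_nonneg; positivity) (div_nonneg hp.Cχ_nonneg hb0.le)
    ((div_le_one hb0).2 hr.Cχ_le) hℓ hy.le hw.s₁_pos.le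
    (hw.Cχ_ge.trans_eq (by field_simp)) lo hi hR
  have hA := hp.A_nonneg
  have hB := hp.B_nonneg
  have hA₃ := hp.A₃_nonneg
  have i1 := j1.1.const_mul (w.A * r ^ 2)
  have i3 := j3.1.const_mul w.A₃
  have i2 := j2.1.const_mul (w.B * r * w.b r)
  have i13 : Integrable (fun z => w.A * r ^ 2 * V₁ N γ w.Λ w.lam r (jump lo hi x z) +
      w.A₃ * V₃ N γ w.Λ w.lam w.y w.G r (jump lo hi x z)) (Measure.pi m) := i1.add i3
  have i132 : Integrable (fun z => w.A * r ^ 2 * V₁ N γ w.Λ w.lam r (jump lo hi x z) +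
      w.A₃ * V₃ N γ w.Λ w.lam w.y w.G r (jump lo hi x z) + w.B * r * w.b r *
      V₂ N γ w.Λ w.lam w.y w.θ (w.b r) w.B₁ lo hi r (jump lo hi x z)) (Measure.pi m) := i13.add i2
  refine ⟨i132.add jY.1, ?_⟩
  unfold LyapC.W LyapC.gapY
  rw [integral_add i132 jY.1, integral_add i13 i2, integral_add i1 i3, integral_const_mul,
    integral_const_mul, integral_const_mul]
  have t1 := mul_le_mul_of_nonneg_left j1.2 (show 0 ≤ w.A * r ^ 2 by positivity)
  have t3 := mul_le_mul_of_nonneg_left j3.2 hA₃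
  have t2 := mul_le_mul_of_nonneg_left j2.2 (show 0 ≤ w.B * r * w.b r by positivity)
  have t4 := mul_le_mul_of_nonneg_right hw.A₃_ge_jump (numFire_nonneg x)
  linarith [jY.2]

end Eventual
end RSN
end

noncomputable section

namespace RSN

/-! ### The Lyapunov function along the deterministic motion -/

section Continuity

variable {I J : ℕ}

theorem continuous_expo (σ : Fin J → ℝ) (c : Idx J → ℝ) : Continuous (expo σ c) := by
  unfold expo; fun_prop

theorem continuous_ite_blocked {f g : Config J → ℝ} (hf : Continuous f) (hg : Continuous g)
    (j : Fin J) : Continuous fun x : Config J => if x.2.2 j = true then f x else g x := by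
  refine hf.if (fun x hx => ?_) hg
  have h : IsClopen {x : Config J | x.2.2 j = true} :=
    (isClopen_discrete ({true} : Set Bool)).preimage (f := fun x : Config J => x.2.2 j) (by fun_prop)
  rw [h.frontier_eq] at hx
  exact hx.elim

theorem continuous_PP (N : Network I J) (γ : Idx J → ℝ) (Λ lam y : ℝ) (r : ℕ) :
    Continuous (PP N γ Λ lam y r) := by
  unfold PP eK
  exact continuous_finsetSum _ fun o _ => continuous_finsetSum _ fun a _ =>
    (continuous_expo _ _).mul (by fun_prop)

theorem LyapC.continuous_gapY (w : LyapC) {N : Network I J} {Cp L Cb : ℝ} (hg : GapBound N Cp L Cb)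
    (r : ℕ) (γ : Idx J → ℝ) : Continuous (w.gapY N Cp r γ) := by
  have h1 : Continuous (qt γ) := by unfold qt; fun_prop
  have h2 := (continuous_wl N).comp h1
  have h3 := hg.continuous_gap.comp h1
  have h4 := continuous_phi (w.Cl * w.b r)
  unfold LyapC.gapY Y
  refine (h3.add (continuous_const.mul (continuous_finsetSum _ fun i _ =>
    h4.comp ((continuous_apply i).comp h2)))).add (by fun_prop)

theorem LyapC.continuous_f (w : LyapC) {N : Network I J} {k : Consts} {L Cb : ℝ}
    (hg : GapBound N k.Cp L Cb) (r : ℕ) (γ : Idx J → ℝ) : Continuous (w.f N k r γ) := by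
  have h1 := w.continuous_gapY hg r γ
  have h2 := continuous_PP N γ w.Λ w.lam w.y r
  unfold LyapC.f
  fun_prop

theorem LyapC.continuous_W (w : LyapC) {N : Network I J} {Cp L Cb : ℝ}
    (hg : GapBound N Cp L Cb) (r : ℕ) (γ : Idx J → ℝ) : Continuous (w.W N Cp r γ) := by
  have h1 := w.continuous_gapY hg r γ
  have h2 : Continuous (V₁ N γ w.Λ w.lam r) := by
    unfold V₁
    exact continuous_finsetSum _ fun i _ => (continuous_expo _ _).add (continuous_expo _ _)
  have h3 : Continuous (V₃ N γ w.Λ w.lam w.y w.G r) := by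
    unfold V₃
    exact continuous_finsetSum _ fun i _ => continuous_finsetSum _ fun a _ =>
      (continuous_expo _ _).add (continuous_const.mul (continuous_expo _ _))
  have h4 : Continuous (V₂ N γ w.Λ w.lam w.y w.θ (w.b r) w.B₁ (w.c₁ * w.b r) (w.c₂ * w.b r) r) := by
    unfold V₂ expoB expoU
    exact continuous_finsetSum _ fun i _ => continuous_finsetSum _ fun a _ =>
      continuous_ite_blocked (continuous_const.mul (continuous_expo _ _))
        (continuous_const.mul (continuous_expo _ _)) a
  unfold LyapC.W
  fun_prop

theorem LyapC.f_nonneg (w : LyapC) (N : Network I J) (k : Consts) (r : ℕ) (γ : Idx J → ℝ)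
    (x : Config J) : 0 ≤ w.f N k r γ x :=
  add_nonneg (mul_nonneg k.cM_pos.le (le_max_right _ _)) (PP_nonneg x)

theorem LyapC.W_nonneg {w : LyapC} (hw : w.Pos) (N : Network I J) (Cp : ℝ) (r : ℕ) (γ : Idx J → ℝ)
    (x : Config J) : 0 ≤ w.W N Cp r γ x := by
  have hb : 0 ≤ w.b r := Real.rpow_nonneg (Nat.cast_nonneg r) _
  have h1 : 0 ≤ V₁ N γ w.Λ w.lam r x :=
    Finset.sum_nonneg fun i _ => add_nonneg (expo_pos _ _ _).le (expo_pos _ _ _).le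
  have h3 : 0 ≤ V₃ N γ w.Λ w.lam w.y w.G r x :=
    Finset.sum_nonneg fun i _ => Finset.sum_nonneg fun a _ =>
      add_nonneg (expo_pos _ _ _).le (mul_nonneg hw.G_nonneg (expo_pos _ _ _).le)
  have h2 : 0 ≤ V₂ N γ w.Λ w.lam w.y w.θ (w.b r) w.B₁ (w.c₁ * w.b r) (w.c₂ * w.b r) r x := by
    refine Finset.sum_nonneg fun i _ => Finset.sum_nonneg fun a _ => ?_
    split_ifs
    · exact mul_nonneg (Real.exp_pos _).le (expo_pos _ _ _).le
    · exact mul_nonneg (mul_nonneg hw.B₁_nonneg (Real.exp_pos _).le) (expo_pos _ _ _).le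
  have := hw.A_nonneg
  have := hw.A₃_nonneg
  have := hw.B_nonneg
  unfold LyapC.W
  positivity

end Continuity

section Motion

theorem _root_.HasDerivAt.upperDeriv {g : ℝ → ℝ} {d : ℝ} (h : HasDerivAt g d 0) : UpperDeriv g d :=
  ⟨g, h, rfl, fun _ _ => le_rfl⟩

/-- A continuous function whose right derivative is nowhere positive does not increase. -/
theorem le_of_upperDeriv {F : ℝ → ℝ} {h : ℝ} (hh : 0 ≤ h) (hF : ContinuousOn F (Set.Icc 0 h))
    (hd : ∀ s ∈ Set.Ico 0 h, UpperDeriv (fun u => F (s + u)) 0) : F h ≤ F 0 := by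
  refine image_le_of_liminf_slope_right_le_deriv_boundary (B := fun _ => F 0) (B' := fun _ => 0)
    hF le_rfl continuousOn_const (fun x _ => hasDerivWithinAt_const _ _ _) (fun s hs ρ hρ => ?_)
    ⟨hh, le_rfl⟩
  obtain ⟨g, h1, h2, h3⟩ := hd s hs
  have h4 := (hasDerivAt_iff_tendsto_slope.1 h1).mono_left
    (nhdsWithin_mono 0 (s := Set.Ioi 0) (fun x (hx : (0 : ℝ) < x) => hx.ne'))
  have h5 : Tendsto (fun z => z - s) (𝓝[>] s) (𝓝[>] 0) := by
    refine tendsto_nhdsWithin_of_tendsto_nhds_of_eventually_within _ ?_ ?_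
    · have : Tendsto (fun z => z - s) (𝓝 s) (𝓝 (s - s)) := (continuous_id.sub continuous_const).tendsto s
      rw [sub_self] at this
      exact this.mono_left nhdsWithin_le_nhds
    · filter_upwards [self_mem_nhdsWithin] with z hz using Set.mem_Ioi.2 (sub_pos.2 (Set.mem_Ioi.1 hz))
  refine Eventually.frequently ?_
  filter_upwards [(h4.comp h5).eventually_lt_const hρ, self_mem_nhdsWithin] with z hz hz'
  refine lt_of_le_of_lt ?_ hz
  have hz0 : 0 < z - s := sub_pos.2 hz'
  have h6 := h3 (z - s) hz0.le
  simp only [Function.comp, slope_def_field, sub_zero, h2, add_zero]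
  simp only [add_sub_cancel] at h6
  gcongr

/-- Weights that grow at rate `c` up to time `t₀` and then decay at rate `d`. The growth before `t₀`
is made up for by the discount in the drift inequality and keeps the integral of the weights bounded
in `t₀`. -/
def wgt (c d t₀ s : ℝ) : ℝ := Real.exp (c * min (s - t₀) 0 - d * max (s - t₀) 0)

theorem wgt_pos (c d t₀ s : ℝ) : 0 < wgt c d t₀ s := Real.exp_pos _

theorem continuous_wgt (c d t₀ : ℝ) : Continuous (wgt c d t₀) := by unfold wgt; fun_prop

theorem wgt_add_le {c d : ℝ} (hc : 0 ≤ c) (hd : 0 ≤ d) (t₀ s : ℝ) {u : ℝ} (hu : 0 ≤ u) :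
    wgt c d t₀ (s + u) ≤ wgt c d t₀ s * Real.exp (c * u) := by
  unfold wgt
  rw [← Real.exp_add, Real.exp_le_exp]
  have h1 : min (s + u - t₀) 0 ≤ min (s - t₀) 0 + u := by
    rw [← min_add_add_right]; exact min_le_min (by linarith) (by linarith)
  have h2 : max (s - t₀) 0 ≤ max (s + u - t₀) 0 := max_le_max_right 0 (by linarith)
  nlinarith [mul_le_mul_of_nonneg_left h1 hc, mul_le_mul_of_nonneg_left h2 hd]

variable {I J : ℕ} {p : Policy J} {N : Network I J} {r : ℕ}

theorem flow_flow (x : Config J) (s u : ℝ) :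
    flow p N r (flow p N r x s) u = flow p N r x (s + u) := by
  unfold flow
  refine Prod.ext rfl (Prod.ext (funext fun a => ?_) rfl)
  change x.2.1 a - s * speed p N r x a - u * speed p N r x a = x.2.1 a - (s + u) * speed p N r x a
  ring

theorem flow_zero (x : Config J) : flow p N r x 0 = x := by
  unfold flow
  simp

theorem continuous_flow (x : Config J) : Continuous (flow p N r x) := by
  unfold flow; fun_prop

theorem Valid.flow {lo hi : ℝ} {x : Config J} (hx : Valid lo hi x) {s : ℝ}
    (hs : ∀ a, s * speed p N r x a ≤ x.2.1 a) : Valid lo hi (flow p N r x s) where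
  q_nonneg := hx.q_nonneg
  R_nonneg a := sub_nonneg.2 (hs a)
  lo_le := hx.lo_le
  lt_hi := hx.lt_hi
  R_pos j hj := by
    have h1 : speed p N r x (Sum.inr j) = 0 := by
      have : x.2.2 j = true := hj
      simp [speed, this]
    simp only [RSN.flow, h1, mul_zero, sub_zero]
    exact hx.R_pos j hj

/-- Integrated form of the drift inequality, with a weight. -/
theorem flow_le {W f : Config J → ℝ} (hW : Continuous W) (hf : Continuous f)
    {lo hi c d g t₀ : ℝ} (hc : 0 ≤ c) (hd : 0 ≤ d) (hW0 : ∀ x, 0 ≤ W x)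
    (hdrift : ∀ x, Valid lo hi x → UpperDeriv (fun u => W (flow p N r x u)) (-f x + g - c * W x))
    {x : Config J} (hx : Valid lo hi x) {h : ℝ} (hh : 0 ≤ h) (h0 : ∀ a, 0 ≤ speed p N r x a)
    (hR : ∀ a, h * speed p N r x a ≤ x.2.1 a) (t : ℝ) :
    wgt c d t₀ (t + h) * W (flow p N r x h) +
        ∫ u in (0 : ℝ)..h, wgt c d t₀ (t + u) * f (flow p N r x u) ≤
      wgt c d t₀ t * W x + g * ∫ u in (0 : ℝ)..h, wgt c d t₀ (t + u) := by
  have hG : Continuous fun u => wgt c d t₀ (t + u) :=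
    (continuous_wgt c d t₀).comp (continuous_const.add continuous_id)
  have hWf : Continuous fun u => W (flow p N r x u) := hW.comp (continuous_flow x)
  have hff : Continuous fun u => f (flow p N r x u) := hf.comp (continuous_flow x)
  set e : ℝ → ℝ := fun u => wgt c d t₀ (t + u) * f (flow p N r x u) - g * wgt c d t₀ (t + u)
    with he_def
  have he : Continuous e := (hG.mul hff).sub (continuous_const.mul hG)
  have hI : ∀ s, HasDerivAt (fun s => ∫ u in (0 : ℝ)..s, e u) (e s) s := fun s =>
    intervalIntegral.integral_hasDerivAt_right (he.intervalIntegrable _ _)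
      he.aestronglyMeasurable.stronglyMeasurableAtFilter he.continuousAt
  have key := le_of_upperDeriv (F := fun s => wgt c d t₀ (t + s) * W (flow p N r x s) +
    ∫ u in (0 : ℝ)..s, e u) hh
    ((hG.mul hWf).add (continuous_iff_continuousAt.2 fun s => (hI s).continuousAt)).continuousOn
    fun s hs => ?_
  · simp only [add_zero, intervalIntegral.integral_same, flow_zero] at key
    have h1 : ∫ u in (0 : ℝ)..h, e u = (∫ u in (0 : ℝ)..h, wgt c d t₀ (t + u) * f (flow p N r x u)) -
        g * ∫ u in (0 : ℝ)..h, wgt c d t₀ (t + u) := by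
      rw [← intervalIntegral.integral_const_mul, ← intervalIntegral.integral_sub
        ((hG.fun_mul hff).intervalIntegrable _ _)
        ((continuous_const.fun_mul hG).intervalIntegrable _ _)]
    rw [h1] at key
    linarith
  · have hv : Valid lo hi (flow p N r x s) := hx.flow fun a =>
      (mul_le_mul_of_nonneg_right hs.2.le (h0 a)).trans (hR a)
    obtain ⟨φ, a, b, e'⟩ := hdrift _ hv
    simp only [flow_flow, add_zero] at b e'
    have h1 : UpperDeriv (fun u => wgt c d t₀ (t + (s + u)) * W (flow p N r x (s + u)))
        (wgt c d t₀ (t + s) * (-f (flow p N r x s) + g)) := by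
      refine ⟨fun u => wgt c d t₀ (t + s) * (Real.exp (c * u) * φ u), ?_, by simp [b], fun u hu => ?_⟩
      · have h2 : HasDerivAt (fun u : ℝ => c * u) c 0 := by
          simpa using (hasDerivAt_id' (0 : ℝ)).const_mul c
        have h3 := (h2.exp.fun_mul a).const_mul (wgt c d t₀ (t + s))
        refine h3.congr_deriv ?_
        rw [b, mul_zero, Real.exp_zero]; ring
      · beta_reduce
        rw [← add_assoc, ← mul_assoc]
        exact mul_le_mul (wgt_add_le hc hd t₀ (t + s) hu) (e' u hu) (hW0 _)
          (mul_pos (wgt_pos _ _ _ _) (Real.exp_pos _)).le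
    have h2 : UpperDeriv (fun u => ∫ v in (0 : ℝ)..(s + u), e v) (e s) := by
      refine HasDerivAt.upperDeriv ?_
      have h3 := HasDerivAt.comp_const_add s 0 (by simpa using hI s)
      exact h3
    refine (h1.add h2).mono (le_of_eq ?_)
    simp only [he_def]; ring

end Motion
end RSN
end

noncomputable section

namespace RSN

/-! ### The embedded chain -/

section Chain

variable {I J : ℕ}

/-- Time, number of renewal intervals used so far of each renewal process, and configuration. -/
abbrev Stage (J : ℕ) : Type := ℝ × (Idx J → ℕ) × Config J

/-- Time until the renewal process `a` has its next event. The value for the services of a blocked job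
type, which are suspended, is that of the arrivals, so that it does not affect the minimum. -/
def fireTime (p : Policy J) (N : Network I J) (r : ℕ) (x : Config J) : Idx J → ℝ :=
  Sum.elim (fun j => x.2.1 (Sum.inl j))
    (fun j => if x.2.2 j = true then x.2.1 (Sum.inl j) else x.2.1 (Sum.inr j) / p.x N r x.1 j)

/-- Time until the next event. -/
def hold (p : Policy J) (N : Network I J) (r : ℕ) (x : Config J) : ℝ := ⨅ a, fireTime p N r x a

/-- The state at time `hold` after the current one, when the processes that fire get the residual
times `z`. -/
def step (p : Policy J) (N : Network I J) (r : ℕ) (lo hi : ℝ) (S : Stage J) (z : Idx J → ℝ) :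
    Stage J :=
  (S.1 + hold p N r S.2.2,
    fun a => S.2.1 a + if (flow p N r S.2.2 (hold p N r S.2.2)).2.1 a ≤ 0 then 1 else 0,
    jump lo hi (flow p N r S.2.2 (hold p N r S.2.2)) z)

/-- The configuration at time `0` for the initial state `x`: processes without residual time begin
with a full renewal interval. -/
def start (lo hi : ℝ) (x : Config J) (z : Idx J → ℝ) : Config J :=
  (x.1, fun a => if x.2.1 a ≤ 0 then z a else x.2.1 a, fun j => updE lo hi (x.2.2 j) (x.1 j))

/-- The states at the event times, driven by the renewal intervals `ξ`. -/
def chain (p : Policy J) (N : Network I J) (r : ℕ) (lo hi : ℝ) (x : Config J)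
    (ξ : Idx J → ℕ → ℝ) : ℕ → Stage J
  | 0 => (0, fun a => if x.2.1 a ≤ 0 then 1 else 0, start lo hi x fun a => ξ a 0)
  | n + 1 => step p N r lo hi (chain p N r lo hi x ξ n)
      fun a => ξ a ((chain p N r lo hi x ξ n).2.1 a)

variable {p : Policy J} {N : Network I J} {r : ℕ} {lo hi : ℝ}

theorem speed_nonneg (hpos : ∀ q j, 0 < p.x N r q j) (x : Config J) (a : Idx J) :
    0 ≤ speed p N r x a := by
  rcases a with j | j
  · exact zero_le_one
  · simp only [speed, Sum.elim_inr]; split_ifs; exacts [le_rfl, (hpos _ _).le]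

theorem fireTime_nonneg (hpos : ∀ q j, 0 < p.x N r q j) {x : Config J} (hx : ∀ a, 0 ≤ x.2.1 a)
    (a : Idx J) : 0 ≤ fireTime p N r x a := by
  rcases a with j | j
  · exact hx _
  · simp only [fireTime, Sum.elim_inr]; split_ifs; exacts [hx _, div_nonneg (hx _) (hpos _ _).le]

theorem hold_nonneg (hpos : ∀ q j, 0 < p.x N r q j) {x : Config J} (hx : ∀ a, 0 ≤ x.2.1 a) :
    0 ≤ hold p N r x :=
  Real.iInf_nonneg (fireTime_nonneg hpos hx)

theorem hold_mul_speed_le (hpos : ∀ q j, 0 < p.x N r q j) {x : Config J} (hx : ∀ a, 0 ≤ x.2.1 a)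
    (a : Idx J) : hold p N r x * speed p N r x a ≤ x.2.1 a := by
  have h : hold p N r x ≤ fireTime p N r x a := ciInf_le (Set.finite_range _).bddBelow a
  rcases a with j | j
  · simpa [speed, fireTime] using h
  · by_cases hE : x.2.2 j = true
    · simpa [speed, hE] using hx _
    · simp only [speed, fireTime, Sum.elim_inr, if_neg hE] at h ⊢
      rwa [le_div_iff₀ (hpos _ _)] at h

/-- At the end of the holding time some process fires. -/
theorem exists_fire [Nonempty (Idx J)] (hpos : ∀ q j, 0 < p.x N r q j) (x : Config J) :
    ∃ a, (flow p N r x (hold p N r x)).2.1 a = 0 := by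
  obtain ⟨a, ha⟩ := exists_eq_ciInf_of_finite (f := fireTime p N r x)
  rcases a with j | j
  · exact ⟨Sum.inl j, by simp only [flow, hold, ← ha]; simp [fireTime, speed]⟩
  · by_cases hE : x.2.2 j = true
    · exact ⟨Sum.inl j, by simp only [flow, hold, ← ha]; simp [fireTime, speed, hE]⟩
    · refine ⟨Sum.inr j, ?_⟩
      simp only [flow, hold, ← ha]
      simp [fireTime, speed, hE, (hpos x.1 j).ne']

theorem updE_lo {e : Bool} {q : ℝ} (hlohi : lo ≤ hi) (h : updE lo hi e q = false) : lo ≤ q := by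
  unfold updE at h
  split_ifs at h
  · exact hlohi.trans (not_lt.1 (of_decide_eq_false h))
  · exact not_lt.1 (of_decide_eq_false h)

theorem updE_hi {e : Bool} {q : ℝ} (hlohi : lo ≤ hi) (h : updE lo hi e q = true) : q < hi := by
  unfold updE at h
  split_ifs at h
  · exact of_decide_eq_true h
  · exact (of_decide_eq_true h).trans_le hlohi

/-- Jumps lead to valid states: a service can only be completed if the job type is not blocked, and
then there are jobs, as the threshold is at least `1`. -/
theorem Valid.jump (hlo : 1 ≤ lo) (hlohi : lo ≤ hi) {x : Config J} (hx : Valid lo hi x)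
    {z : Idx J → ℝ} (hz : ∀ a, 0 < z a) : Valid lo hi (jump lo hi x z) ∧
      ∀ a, 0 < (jump lo hi x z).2.1 a := by
  have hR : ∀ a, 0 < (RSN.jump lo hi x z).2.1 a := fun a => by
    simp only [RSN.jump]; split_ifs with h
    exacts [hz a, not_le.1 h]
  refine ⟨⟨fun j => ?_, fun a => (hR a).le, fun j hj => updE_lo hlohi hj,
    fun j hj => updE_hi hlohi hj, fun j _ => hR _⟩, hR⟩
  simp only [RSN.jump, jumpQ]
  by_cases hE : x.2.2 j = true
  · rw [if_neg (not_le.2 (hx.R_pos j hE))]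
    have := hx.q_nonneg j
    split_ifs <;> linarith
  · have := hx.lo_le j (by simpa using hE)
    split_ifs <;> linarith

theorem Valid.start (hlohi : lo ≤ hi) {x : Config J} (hq : ∀ j, 0 ≤ x.1 j)
    {z : Idx J → ℝ} (hz : ∀ a, 0 < z a) : Valid lo hi (start lo hi x z) ∧
      ∀ a, 0 < (start lo hi x z).2.1 a := by
  have hR : ∀ a, 0 < (RSN.start lo hi x z).2.1 a := fun a => by
    simp only [RSN.start]; split_ifs with h
    exacts [hz a, not_le.1 h]
  exact ⟨⟨hq, fun a => (hR a).le, fun j hj => updE_lo hlohi hj, fun j hj => updE_hi hlohi hj,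
    fun j _ => hR _⟩, hR⟩

theorem valid_chain (hpos : ∀ q j, 0 < p.x N r q j) (hlo : 1 ≤ lo) (hlohi : lo ≤ hi) {x : Config J}
    (hq : ∀ j, 0 ≤ x.1 j) {ξ : Idx J → ℕ → ℝ} (hξ : ∀ a l, 0 < ξ a l) (n : ℕ) :
    Valid lo hi (chain p N r lo hi x ξ n).2.2 ∧ ∀ a, 0 < (chain p N r lo hi x ξ n).2.2.2.1 a := by
  induction n with
  | zero => exact Valid.start hlohi hq fun a => hξ a 0
  | succ n ih =>
    exact Valid.jump hlo hlohi (ih.1.flow (hold_mul_speed_le hpos ih.1.R_nonneg)) fun a => hξ a _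

section Measurability

theorem measurable_updE {α : Type*} [MeasurableSpace α] (lo hi : ℝ) {e : α → Bool} {q : α → ℝ}
    (he : Measurable e) (hq : Measurable q) : Measurable fun x => updE lo hi (e x) (q x) := by
  have h1 : ∀ c : ℝ, Measurable fun x => decide (q x < c) := fun c => by
    have : (fun x => decide (q x < c)) = fun x => if q x < c then true else false := by
      ext x; simp
    rw [this]
    exact Measurable.ite (measurableSet_lt hq measurable_const) measurable_const measurable_const
  unfold updE
  exact Measurable.ite (he (measurableSet_singleton true)) (h1 hi) (h1 lo)

theorem measurable_policy (p : Policy J) (N : Network I J) (r : ℕ) (j : Fin J) :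
    Measurable fun q => p.x N r q j := by
  have h1 : Measurable (p.Z N r) := by
    refine measurable_pi_iff.2 fun i => ?_
    unfold Policy.Z
    have : (fun q : Fin J → ℝ => @decide (q i < N.βmin * p.c₂ * (r : ℝ) ^ p.κ)
        (Classical.propDecidable _)) =
        fun q => if q i < N.βmin * p.c₂ * (r : ℝ) ^ p.κ then true else false := by
      ext q; by_cases h : q i < N.βmin * p.c₂ * (r : ℝ) ^ p.κ <;> simp [h]
    rw [this]
    exact Measurable.ite (measurableSet_lt (measurable_pi_apply i) measurable_const)
      measurable_const measurable_const
  classical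
  have h2 : Measurable fun z : Chi J =>
    N.ρ j - (if z ∈ N.calM p.dir then p.vc z j else 0) - p.vb z j := measurable_of_finite _
  have h3 := h2.comp h1
  unfold Policy.x
  convert h3 using 1
  ext q
  simp only [Function.comp]

theorem measurableSet_blocked (j : Fin J) : MeasurableSet {x : Config J | x.2.2 j = true} := by
  have h : Measurable fun x : Config J => x.2.2 j := (measurable_pi_apply j).comp measurable_snd.snd
  exact h (measurableSet_singleton true)

theorem measurable_speed (p : Policy J) (N : Network I J) (r : ℕ) (a : Idx J) :
    Measurable fun x => speed p N r x a := by
  rcases a with j | j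
  · exact measurable_const
  · simp only [speed, Sum.elim_inr]
    exact Measurable.ite
      (measurableSet_blocked j)
      measurable_const ((measurable_policy p N r j).comp measurable_fst)

theorem measurable_hold (p : Policy J) (N : Network I J) (r : ℕ) : Measurable (hold p N r) := by
  have h0 : ∀ a, Measurable fun x : Config J => x.2.1 a := fun a =>
    (measurable_pi_apply a).comp measurable_snd.fst
  refine Measurable.iInf fun a => ?_
  rcases a with j | j
  · exact h0 _
  · simp only [fireTime, Sum.elim_inr]
    exact Measurable.ite
      (measurableSet_blocked j)
      (h0 _) ((h0 _).div ((measurable_policy p N r j).comp measurable_fst))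

theorem measurable_flow (p : Policy J) (N : Network I J) (r : ℕ) :
    Measurable fun y : Config J × ℝ => flow p N r y.1 y.2 := by
  unfold flow
  refine measurable_fst.fst.prodMk (Measurable.prodMk (measurable_pi_iff.2 fun a => ?_)
    measurable_fst.snd.snd)
  exact ((measurable_pi_apply a).comp measurable_fst.snd.fst).sub
    (measurable_snd.mul ((measurable_speed p N r a).comp measurable_fst))

theorem measurable_jump (lo hi : ℝ) :
    Measurable fun y : Config J × (Idx J → ℝ) => jump lo hi y.1 y.2 := by
  have h0 : ∀ a, Measurable fun y : Config J × (Idx J → ℝ) => y.1.2.1 a := fun a =>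
    (measurable_pi_apply a).comp measurable_fst.snd.fst
  have hset : ∀ a, MeasurableSet {y : Config J × (Idx J → ℝ) | y.1.2.1 a ≤ 0} := fun a =>
    measurableSet_le (h0 a) measurable_const
  have hQ : ∀ j, Measurable fun y : Config J × (Idx J → ℝ) => jumpQ y.1 j := fun j => by
    unfold jumpQ
    exact (((measurable_pi_apply j).comp measurable_fst.fst).add
      (Measurable.ite (hset _) measurable_const measurable_const)).sub
      (Measurable.ite (hset _) measurable_const measurable_const)
  unfold jump
  refine (measurable_pi_iff.2 hQ).prodMk (Measurable.prodMk (measurable_pi_iff.2 fun a => ?_)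
    (measurable_pi_iff.2 fun j => ?_))
  · exact Measurable.ite (hset a) ((measurable_pi_apply a).comp measurable_snd) (h0 a)
  · exact measurable_updE lo hi ((measurable_pi_apply j).comp measurable_fst.snd.snd) (hQ j)

theorem measurable_start (lo hi : ℝ) (x : Config J) : Measurable (start lo hi x) := by
  unfold start
  refine measurable_const.prodMk (Measurable.prodMk (measurable_pi_iff.2 fun a => ?_)
    measurable_const)
  split_ifs
  exacts [measurable_pi_apply a, measurable_const]

/-- The configuration just before the next event is a measurable function of the present one. -/
theorem measurable_flow_hold (p : Policy J) (N : Network I J) (r : ℕ) :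
    Measurable fun x => flow p N r x (hold p N r x) :=
  (measurable_flow p N r).comp (measurable_id.prodMk (measurable_hold p N r))

theorem measurable_fresh {α : Type*} [MeasurableSpace α] {ξ : α → Idx J → ℕ → ℝ} (hξ : Measurable ξ)
    {k : α → Idx J → ℕ} (hk : Measurable k) : Measurable fun x => fun a => ξ x a (k x a) := by
  refine measurable_pi_iff.2 fun a => ?_
  have h1 : Measurable fun y : (ℕ → ℝ) × ℕ => y.1 y.2 :=
    measurable_from_prod_countable_left fun n => measurable_pi_apply n
  exact h1.comp (((measurable_pi_apply a).comp hξ).prodMk ((measurable_pi_apply a).comp hk))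

theorem measurable_step (p : Policy J) (N : Network I J) (r : ℕ) (lo hi : ℝ) :
    Measurable fun y : Stage J × (Idx J → ℝ) => step p N r lo hi y.1 y.2 := by
  have h1 : Measurable fun y : Stage J × (Idx J → ℝ) => y.1.2.2 := measurable_fst.snd.snd
  have h2 := (measurable_flow_hold p N r).comp h1
  unfold step
  refine (measurable_fst.fst.add ((measurable_hold p N r).comp h1)).prodMk
    ((measurable_pi_iff.2 fun a => ?_).prodMk ((measurable_jump lo hi).comp
      (h2.prodMk measurable_snd)))
  exact ((measurable_pi_apply a).comp measurable_fst.snd.fst).add (Measurable.ite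
    (measurableSet_le ((measurable_pi_apply a).comp h2.snd.fst) measurable_const)
      measurable_const measurable_const)

theorem measurable_chain (p : Policy J) (N : Network I J) (r : ℕ) (lo hi : ℝ) (x : Config J)
    (n : ℕ) : Measurable fun ξ : Idx J → ℕ → ℝ => chain p N r lo hi x ξ n := by
  induction n with
  | zero =>
    exact measurable_const.prodMk (measurable_const.prodMk
      ((measurable_start lo hi x).comp (measurable_pi_iff.2 fun a =>
        (measurable_pi_apply 0).comp (measurable_pi_apply a))))
  | succ n ih =>
    exact (measurable_step p N r lo hi).comp (ih.prodMk (measurable_fresh measurable_id ih.snd.fst))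

end Measurability

/-- The first `n` transitions only depend on the renewal intervals that they use. -/
theorem chain_congr {x : Config J} {ξ ξ' : Idx J → ℕ → ℝ} {n : ℕ} {k : Idx J → ℕ}
    (hk : ∀ a, (chain p N r lo hi x ξ n).2.1 a ≤ k a) (h : ∀ a l, l < k a → ξ a l = ξ' a l) :
    chain p N r lo hi x ξ n = chain p N r lo hi x ξ' n := by
  induction n with
  | zero =>
    simp only [chain, start] at hk ⊢
    congr! 5 with a
    split_ifs with ha
    · refine h a 0 ?_
      have := hk a
      rw [if_pos ha] at this
      omega
    · rfl
  | succ n ih =>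
    have h1 := ih fun a => (Nat.le_add_right _ _).trans (hk a)
    have h2 : ∀ a, (flow p N r (chain p N r lo hi x ξ n).2.2
        (hold p N r (chain p N r lo hi x ξ n).2.2)).2.1 a ≤ 0 →
        (chain p N r lo hi x ξ n).2.1 a < k a := fun a ha => by
      have := hk a
      simp only [chain, step, if_pos ha] at this
      omega
    simp only [chain, step, jump, ← h1]
    congr! 5 with a
    split_ifs with ha
    exacts [h a _ (h2 a ha), rfl]

end Chain

section Fresh

variable {I J : ℕ} {Ω : Type*} [MeasurableSpace Ω] {P : Measure Ω} [IsProbabilityMeasure P]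
  {ξ : Idx J → ℕ → Ω → ℝ} {m : Idx J → Measure ℝ}

/-- The joint law of one renewal interval from each process. -/
theorem map_fresh (hξ : ∀ a l, Measurable (ξ a l))
    (hind : iIndepFun (fun i : Idx J × ℕ => ξ i.1 i.2) P) (hm : ∀ a l, P.map (ξ a l) = m a)
    (k : Idx J → ℕ) : P.map (fun ω a => ξ a (k a) ω) = Measure.pi m := by
  have h1 := hind.precomp (g := fun a : Idx J => (a, k a)) fun a b h => (Prod.mk.inj h).1
  have h2 := (iIndepFun_iff_map_fun_eq_pi_map fun a => (hξ a (k a)).aemeasurable).1 h1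
  simp only [hm] at h2
  exact h2

/-- The renewal intervals that come next are independent of the past of the embedded chain. -/
theorem lintegral_fresh (hξ : ∀ a l, Measurable (ξ a l))
    (hind : iIndepFun (fun i : Idx J × ℕ => ξ i.1 i.2) P) (hm : ∀ a l, P.map (ξ a l) = m a)
    (p : Policy J) (N : Network I J) (r : ℕ) (lo hi : ℝ) (x : Config J) (n : ℕ)
    {F : Stage J × (Idx J → ℝ) → ℝ≥0∞} (hF : Measurable F) :
    ∫⁻ ω, F (chain p N r lo hi x (fun a l => ξ a l ω) n,
        fun a => ξ a ((chain p N r lo hi x (fun a l => ξ a l ω) n).2.1 a) ω) ∂P =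
      ∫⁻ ω, ∫⁻ z, F (chain p N r lo hi x (fun a l => ξ a l ω) n, z) ∂Measure.pi m ∂P := by
  have hmp : ∀ a, IsProbabilityMeasure (m a) := fun a => by
    rw [← hm a 0]; exact Measure.isProbabilityMeasure_map (hξ a 0).aemeasurable
  set S : Ω → Stage J := fun ω => chain p N r lo hi x (fun a l => ξ a l ω) n with hS
  have hξm : Measurable fun ω => fun a l => ξ a l ω :=
    measurable_pi_iff.2 fun a => measurable_pi_iff.2 fun l => hξ a l
  have hSm : Measurable S := (measurable_chain p N r lo hi x n).comp hξm
  have hset : ∀ k, MeasurableSet {ω | (S ω).2.1 = k} := fun k =>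
    hSm.snd.fst (measurableSet_singleton k)
  have hG : Measurable fun s : Stage J => ∫⁻ z, F (s, z) ∂Measure.pi m :=
    hF.lintegral_prod_right'
  -- split according to the numbers `k` of intervals used
  have hsplit : ∀ f : Ω → ℝ≥0∞, ∫⁻ ω, f ω ∂P = ∑' k, ∫⁻ ω in {ω | (S ω).2.1 = k}, f ω ∂P :=
    fun f => by
      rw [← lintegral_iUnion hset (fun k k' hkk' => Set.disjoint_left.2 fun ω h h' =>
        hkk' (h.symm.trans h')), Set.iUnion_eq_univ_iff.2 fun ω => ⟨(S ω).2.1, rfl⟩,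
        Measure.restrict_univ]
  rw [hsplit, hsplit]
  refine tsum_congr fun k => ?_
  -- on this event the chain is a function of the first `k` intervals
  set A : Finset (Idx J × ℕ) := Finset.univ.sigma (fun a => Finset.range (k a)) |>.map
    (Equiv.sigmaEquivProd _ _).toEmbedding with hA
  set T : Finset (Idx J × ℕ) := Finset.univ.image fun a => (a, k a) with hT
  have hmemA : ∀ a l, (a, l) ∈ A ↔ l < k a := fun a l => by
    simp only [hA, Finset.mem_map, Finset.mem_sigma, Finset.mem_univ, true_and, Finset.mem_range]
    constructor
    · rintro ⟨⟨a', l'⟩, h1, h2⟩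
      simp only [Equiv.coe_toEmbedding, Equiv.sigmaEquivProd_apply, Prod.mk.injEq] at h2
      obtain ⟨rfl, rfl⟩ := h2; exact h1
    · exact fun h => ⟨⟨a, l⟩, h, rfl⟩
  have hAT : Disjoint A T := by
    refine Finset.disjoint_left.2 fun ⟨a, l⟩ h1 h2 => ?_
    rw [hmemA] at h1
    simp only [hT, Finset.mem_image, Finset.mem_univ, true_and, Prod.mk.injEq] at h2
    obtain ⟨a', rfl, rfl⟩ := h2
    exact lt_irrefl _ h1
  have hmemT : ∀ a, (a, k a) ∈ T := fun a => Finset.mem_image_of_mem _ (Finset.mem_univ a)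
  have hindep := hind.indepFun_finset A T hAT fun i => hξ i.1 i.2
  let ext : (A → ℝ) → Idx J → ℕ → ℝ := fun s a l => if h : (a, l) ∈ A then s ⟨(a, l), h⟩ else 0
  have hext : Measurable ext := measurable_pi_iff.2 fun a => measurable_pi_iff.2 fun l => by
    by_cases h : (a, l) ∈ A
    · simp only [ext, dif_pos h]; exact measurable_pi_apply _
    · simp only [ext, dif_neg h]; exact measurable_const
  set S' : Ω → Stage J := fun ω =>
    chain p N r lo hi x (ext fun i => ξ i.1.1 i.1.2 ω) n with hS'
  have hagree : ∀ ω a l, l < k a → ξ a l ω = ext (fun i => ξ i.1.1 i.1.2 ω) a l :=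
    fun ω a l h => by simp only [ext, dif_pos ((hmemA a l).2 h)]
  have h1 : ∀ ω, (S ω).2.1 = k → S ω = S' ω := fun ω h =>
    chain_congr (fun a => (congrFun h a).le) (hagree ω)
  have h2 : ∀ ω, (S' ω).2.1 = k → S ω = S' ω := fun ω h =>
    (chain_congr (fun a => (congrFun h a).le) fun a l hl => (hagree ω a l hl).symm).symm
  have hiff : {ω | (S ω).2.1 = k} = {ω | (S' ω).2.1 = k} := by
    ext ω
    exact ⟨fun h => by change (S' ω).2.1 = k; rw [← h1 ω h]; exact h,
      fun h => by change (S ω).2.1 = k; rw [h2 ω h]; exact h⟩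
  have hS'm : Measurable S' := (measurable_chain p N r lo hi x n).comp
    (hext.comp (measurable_pi_iff.2 fun i => hξ i.1.1 i.1.2))
  set z : Ω → Idx J → ℝ := fun ω a => ξ a (k a) ω with hz
  have hzm : Measurable z := measurable_pi_iff.2 fun a => hξ a (k a)
  have hSz : IndepFun S' z P := hindep.comp
    (φ := fun s => chain p N r lo hi x (ext s) n) (ψ := fun (t : T → ℝ) (a : Idx J) => t ⟨(a, k a), hmemT a⟩)
    ((measurable_chain p N r lo hi x n).comp hext)
    (measurable_pi_iff.2 fun a => measurable_pi_apply _)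
  have hmap : P.map (fun ω => (S' ω, z ω)) = (P.map S').prod (Measure.pi m) := by
    rw [(indepFun_iff_map_prod_eq_prod_map_map hS'm.aemeasurable hzm.aemeasurable).1 hSz,
      map_fresh hξ hind hm k]
  have : IsProbabilityMeasure (P.map S') := Measure.isProbabilityMeasure_map hS'm.aemeasurable
  set H : Stage J × (Idx J → ℝ) → ℝ≥0∞ := Set.indicator {y | y.1.2.1 = k} F with hH
  have hHset : MeasurableSet {y : Stage J × (Idx J → ℝ) | y.1.2.1 = k} :=
    measurable_fst.snd.fst (measurableSet_singleton k)
  have hHm : Measurable H := hF.indicator hHset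
  have e1 : ∫⁻ ω in {ω | (S ω).2.1 = k}, F (S ω, fun a => ξ a ((S ω).2.1 a) ω) ∂P =
      ∫⁻ ω, H (S' ω, z ω) ∂P := by
    rw [← lintegral_indicator (hset k)]
    refine lintegral_congr fun ω => ?_
    by_cases h : (S ω).2.1 = k
    · have h' : (S' ω).2.1 = k := by rw [← h1 ω h]; exact h
      rw [Set.indicator_of_mem (by exact h), hH, Set.indicator_of_mem (by exact h'), ← h1 ω h, h]
    · have h' : ¬ (S' ω).2.1 = k := fun h3 => h (by rw [h2 ω h3]; exact h3)
      rw [Set.indicator_of_notMem (by exact h), hH, Set.indicator_of_notMem (by exact h')]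
  have e2 : ∫⁻ ω in {ω | (S ω).2.1 = k}, ∫⁻ y, F (S ω, y) ∂Measure.pi m ∂P =
      ∫⁻ ω, ∫⁻ y, H (S' ω, y) ∂Measure.pi m ∂P := by
    rw [← lintegral_indicator (hset k)]
    refine lintegral_congr fun ω => ?_
    by_cases h : (S ω).2.1 = k
    · have h' : (S' ω).2.1 = k := by rw [← h1 ω h]; exact h
      rw [Set.indicator_of_mem (by exact h), h1 ω h]
      refine lintegral_congr fun y => ?_
      rw [hH, Set.indicator_of_mem (by exact h')]
    · have h' : ¬ (S' ω).2.1 = k := fun h3 => h (by rw [h2 ω h3]; exact h3)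
      rw [Set.indicator_of_notMem (by exact h)]
      have h3 : ∀ y, H (S' ω, y) = 0 := fun y => Set.indicator_of_notMem (by exact h') _
      simp [h3]
  rw [e1, e2, ← lintegral_map (f := H) (g := fun ω => (S' ω, z ω)) hHm (hS'm.prodMk hzm), hmap,
    lintegral_prod _ hHm.aemeasurable, lintegral_map hHm.lintegral_prod_right' hS'm]

end Fresh
end RSN
end

noncomputable section

namespace RSN

/-! ### The integrated drift inequality -/

section Dynkin

variable {I J : ℕ} {p : Policy J} {N : Network I J} {r : ℕ} {lo hi : ℝ}

/-- Integral of `φ` along the path from an event to the next one. -/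
def seg (p : Policy J) (N : Network I J) (r : ℕ) (φ : ℝ × Config J → ℝ≥0∞) (S : Stage J) : ℝ≥0∞ :=
  ∫⁻ s in Set.Ico S.1 (S.1 + hold p N r S.2.2), φ (s, flow p N r S.2.2 (s - S.1))

theorem measurable_seg {φ : ℝ × Config J → ℝ≥0∞} (hφ : Measurable φ) :
    Measurable (seg p N r φ) := by
  have h1 : Measurable fun y : Stage J × ℝ => φ (y.2, flow p N r y.1.2.2 (y.2 - y.1.1)) :=
    hφ.comp (measurable_snd.prodMk ((measurable_flow p N r).comp
      (measurable_fst.snd.snd.prodMk (measurable_snd.sub measurable_fst.fst))))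
  have h2 : MeasurableSet {y : Stage J × ℝ | y.2 ∈ Set.Ico y.1.1 (y.1.1 + hold p N r y.1.2.2)} :=
    (measurableSet_le measurable_fst.fst measurable_snd).inter
      (measurableSet_lt measurable_snd (measurable_fst.fst.add
        ((measurable_hold p N r).comp measurable_fst.snd.snd)))
  have h3 := (h1.indicator h2).lintegral_prod_right' (ν := (volume : Measure ℝ))
  convert h3 using 1
  ext S
  rw [seg, ← lintegral_indicator measurableSet_Ico]
  rfl

theorem ofReal_integral_shift {φ : ℝ → ℝ} (hφ : Continuous φ) (h0 : ∀ s, 0 ≤ φ s) (t : ℝ) {h : ℝ}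
    (hh : 0 ≤ h) : ENNReal.ofReal (∫ u in (0 : ℝ)..h, φ (t + u)) =
      ∫⁻ s in Set.Ico t (t + h), ENNReal.ofReal (φ s) := by
  rw [intervalIntegral.integral_comp_add_left, add_zero,
    intervalIntegral.integral_of_le (by linarith), ← integral_Ico_eq_integral_Ioc]
  exact ofReal_integral_eq_lintegral_ofReal
    ((hφ.integrableOn_Icc (a := t) (b := t + h)).mono_set Set.Ico_subset_Icc_self)
    (Eventually.of_forall h0)

variable {W f : Config J → ℝ} {c d g t₀ : ℝ}

/-- The drift inequality, integrated between two events. -/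
theorem seg_le (hW : Continuous W) (hf : Continuous f) (hc : 0 ≤ c) (hd : 0 ≤ d) (hg : 0 ≤ g)
    (hW0 : ∀ x, 0 ≤ W x) (hf0 : ∀ x, 0 ≤ f x)
    (hdrift : ∀ x, Valid lo hi x → UpperDeriv (fun u => W (flow p N r x u)) (-f x + g - c * W x))
    (hpos : ∀ q j, 0 < p.x N r q j) {S : Stage J} (hS : Valid lo hi S.2.2) :
    ENNReal.ofReal (wgt c d t₀ (S.1 + hold p N r S.2.2) *
          W (flow p N r S.2.2 (hold p N r S.2.2))) +
        seg p N r (fun y => ENNReal.ofReal (wgt c d t₀ y.1 * f y.2)) S ≤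
      ENNReal.ofReal (wgt c d t₀ S.1 * W S.2.2) +
        ENNReal.ofReal g * seg p N r (fun y => ENNReal.ofReal (wgt c d t₀ y.1)) S := by
  have hh := hold_nonneg hpos hS.R_nonneg
  have h1 := flow_le (t₀ := t₀) hW hf hc hd hW0 hdrift hS hh (speed_nonneg hpos _)
    (hold_mul_speed_le hpos hS.R_nonneg) S.1
  have hG := continuous_wgt c d t₀
  have h2 : Continuous fun s => wgt c d t₀ s * f (flow p N r S.2.2 (s - S.1)) :=
    hG.mul (hf.comp ((continuous_flow _).comp (continuous_id.sub continuous_const)))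
  have e1 := ofReal_integral_shift h2 (fun s => mul_nonneg (wgt_pos _ _ _ _).le (hf0 _)) S.1 hh
  have e2 := ofReal_integral_shift hG (fun s => (wgt_pos _ _ _ _).le) S.1 hh
  simp only [add_sub_cancel_left] at e1
  unfold seg
  dsimp only
  rw [← e1, ← e2, ← ENNReal.ofReal_mul hg, ← ENNReal.ofReal_add, ← ENNReal.ofReal_add]
  · exact ENNReal.ofReal_le_ofReal h1
  · exact mul_nonneg (wgt_pos _ _ _ _).le (hW0 _)
  · exact mul_nonneg hg (intervalIntegral.integral_nonneg hh fun u _ => (wgt_pos _ _ _ _).le)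
  · exact mul_nonneg (wgt_pos _ _ _ _).le (hW0 _)
  · exact intervalIntegral.integral_nonneg hh fun u _ => mul_nonneg (wgt_pos _ _ _ _).le (hf0 _)

theorem monotone_chain_time (hpos : ∀ q j, 0 < p.x N r q j) (hlo : 1 ≤ lo) (hlohi : lo ≤ hi)
    {x : Config J} (hq : ∀ j, 0 ≤ x.1 j) {ξ : Idx J → ℕ → ℝ} (hξ : ∀ a l, 0 < ξ a l) :
    Monotone fun n => (chain p N r lo hi x ξ n).1 :=
  monotone_nat_of_le_succ fun n => le_add_of_nonneg_right
    (hold_nonneg hpos (valid_chain hpos hlo hlohi hq hξ n).1.R_nonneg)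

/-- The segments of a path do not overlap. -/
theorem tsum_seg (hpos : ∀ q j, 0 < p.x N r q j) (hlo : 1 ≤ lo) (hlohi : lo ≤ hi)
    {x : Config J} (hq : ∀ j, 0 ≤ x.1 j) {ξ : Idx J → ℕ → ℝ} (hξ : ∀ a l, 0 < ξ a l)
    {φ : ℝ × Config J → ℝ≥0∞} {ψ : ℝ → ℝ≥0∞}
    (h : ∀ n, ∀ s ∈ Set.Ico (chain p N r lo hi x ξ n).1 (chain p N r lo hi x ξ (n + 1)).1,
      φ (s, flow p N r (chain p N r lo hi x ξ n).2.2 (s - (chain p N r lo hi x ξ n).1)) = ψ s) :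
    ∑' n, seg p N r φ (chain p N r lo hi x ξ n) = ∫⁻ s in ⋃ n,
      Set.Ico (chain p N r lo hi x ξ n).1 (chain p N r lo hi x ξ (n + 1)).1, ψ s := by
  have hdisj : Pairwise (Function.onFun Disjoint fun n =>
      Set.Ico (chain p N r lo hi x ξ n).1 (chain p N r lo hi x ξ (n + 1)).1) :=
    (monotone_chain_time (p := p) (N := N) (r := r) hpos hlo hlohi hq
      hξ).pairwise_disjoint_on_Ico_succ
  rw [lintegral_iUnion (fun n => measurableSet_Ico) hdisj]
  exact tsum_congr fun n => setLIntegral_congr_fun measurableSet_Ico (h n)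

variable {Ω : Type*} [MeasurableSpace Ω] {P : Measure Ω} [IsProbabilityMeasure P]
  {ξ : Idx J → ℕ → Ω → ℝ} {m : Idx J → Measure ℝ}

/-- **Dynkin's inequality**: the expected integral of `f` along the path is bounded by the initial
value of the Lyapunov function and the error term of the drift inequality. -/
theorem lintegral_tsum_seg_le (hW : Continuous W) (hf : Continuous f) (hc : 0 ≤ c) (hd : 0 ≤ d)
    (hg : 0 ≤ g) (hW0 : ∀ x, 0 ≤ W x) (hf0 : ∀ x, 0 ≤ f x)
    (hdrift : ∀ x, Valid lo hi x → UpperDeriv (fun u => W (flow p N r x u)) (-f x + g - c * W x))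
    (hjump : ∀ x, Valid lo hi x →
      ∫⁻ z, ENNReal.ofReal (W (jump lo hi x z)) ∂Measure.pi m ≤ ENNReal.ofReal (W x))
    (hpos : ∀ q j, 0 < p.x N r q j) (hlo : 1 ≤ lo) (hlohi : lo ≤ hi)
    (hξ : ∀ a l, Measurable (ξ a l)) (hind : iIndepFun (fun i : Idx J × ℕ => ξ i.1 i.2) P)
    (hm : ∀ a l, P.map (ξ a l) = m a) (hξ0 : ∀ᵐ ω ∂P, ∀ a l, 0 < ξ a l ω)
    {x : Config J} (hq : ∀ j, 0 ≤ x.1 j) :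
    ∫⁻ ω, ∑' n, seg p N r (fun y => ENNReal.ofReal (wgt c d t₀ y.1 * f y.2))
        (chain p N r lo hi x (fun a l => ξ a l ω) n) ∂P ≤
      ∫⁻ ω, ENNReal.ofReal (wgt c d t₀ 0 * W (start lo hi x fun a => ξ a 0 ω)) ∂P +
        ENNReal.ofReal g * ∫⁻ s in Set.Ici 0, ENNReal.ofReal (wgt c d t₀ s) := by
  have hmp : ∀ a, IsProbabilityMeasure (m a) := fun a => by
    rw [← hm a 0]; exact Measure.isProbabilityMeasure_map (hξ a 0).aemeasurable
  set S : ℕ → Ω → Stage J := fun n ω => chain p N r lo hi x (fun a l => ξ a l ω) n with hS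
  have hξm : Measurable fun ω => fun a l => ξ a l ω :=
    measurable_pi_iff.2 fun a => measurable_pi_iff.2 fun l => hξ a l
  have hSm : ∀ n, Measurable (S n) := fun n => (measurable_chain p N r lo hi x n).comp hξm
  have hGm := (continuous_wgt c d t₀).measurable
  have hWm := hW.measurable
  set φ : ℝ × Config J → ℝ≥0∞ := fun y => ENNReal.ofReal (wgt c d t₀ y.1 * f y.2) with hφ
  set ψ : ℝ × Config J → ℝ≥0∞ := fun y => ENNReal.ofReal (wgt c d t₀ y.1) with hψ
  have hφm : Measurable φ :=
    ((hGm.comp measurable_fst).mul (hf.measurable.comp measurable_snd)).ennreal_ofReal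
  have hψm : Measurable ψ := (hGm.comp measurable_fst).ennreal_ofReal
  have hIm : ∀ n, Measurable fun ω => seg p N r φ (S n ω) := fun n => (measurable_seg hφm).comp (hSm n)
  have hJm : ∀ n, Measurable fun ω => seg p N r ψ (S n ω) := fun n => (measurable_seg hψm).comp (hSm n)
  set a : ℕ → ℝ≥0∞ := fun n => ∫⁻ ω, ENNReal.ofReal (wgt c d t₀ (S n ω).1 * W (S n ω).2.2) ∂P
    with ha
  have ham : ∀ n, Measurable fun ω => ENNReal.ofReal (wgt c d t₀ (S n ω).1 * W (S n ω).2.2) :=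
    fun n => ((hGm.comp (hSm n).fst).mul (hWm.comp (hSm n).snd.snd)).ennreal_ofReal
  have hstep : ∀ n, a (n + 1) + ∫⁻ ω, seg p N r φ (S n ω) ∂P ≤
      a n + ENNReal.ofReal g * ∫⁻ ω, seg p N r ψ (S n ω) ∂P := fun n => by
    -- the jump at the end of the segment
    have h1 : a (n + 1) ≤ ∫⁻ ω, ENNReal.ofReal (wgt c d t₀ ((S n ω).1 + hold p N r (S n ω).2.2) *
        W (flow p N r (S n ω).2.2 (hold p N r (S n ω).2.2))) ∂P := by
      have hF : Measurable fun y : Stage J × (Idx J → ℝ) =>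
          ENNReal.ofReal (wgt c d t₀ (step p N r lo hi y.1 y.2).1 *
            W (step p N r lo hi y.1 y.2).2.2) :=
        ((hGm.comp (measurable_step p N r lo hi).fst).mul
          (hWm.comp (measurable_step p N r lo hi).snd.snd)).ennreal_ofReal
      have h2 : a (n + 1) = _ := lintegral_fresh hξ hind hm p N r lo hi x n hF
      rw [h2]
      refine lintegral_mono_ae ?_
      filter_upwards [hξ0] with ω hω
      have hv := (valid_chain hpos hlo hlohi hq hω n).1
      simp only [step]
      simp_rw [ENNReal.ofReal_mul (wgt_pos c d t₀ _).le]
      rw [lintegral_const_mul' _ _ ENNReal.ofReal_ne_top]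
      gcongr
      exact hjump _ (hv.flow (hold_mul_speed_le hpos hv.R_nonneg))
    refine (add_le_add_left h1 _).trans ?_
    rw [← lintegral_add_right _ (hIm n), ← lintegral_const_mul _ (hJm n),
      ← lintegral_add_left (ham n)]
    refine lintegral_mono_ae ?_
    filter_upwards [hξ0] with ω hω
    exact seg_le hW hf hc hd hg hW0 hf0 hdrift hpos (valid_chain hpos hlo hlohi hq hω n).1
  have hsum : ∀ n, a n + ∑ i ∈ Finset.range n, ∫⁻ ω, seg p N r φ (S i ω) ∂P ≤
      a 0 + ENNReal.ofReal g * ∑ i ∈ Finset.range n, ∫⁻ ω, seg p N r ψ (S i ω) ∂P := fun n => by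
    induction n with
    | zero => simp
    | succ n ih =>
      rw [Finset.sum_range_succ, Finset.sum_range_succ, mul_add]
      calc _ = (a (n + 1) + ∫⁻ ω, seg p N r φ (S n ω) ∂P) +
            ∑ i ∈ Finset.range n, ∫⁻ ω, seg p N r φ (S i ω) ∂P := by ring
        _ ≤ (a n + ENNReal.ofReal g * ∫⁻ ω, seg p N r ψ (S n ω) ∂P) +
            ∑ i ∈ Finset.range n, ∫⁻ ω, seg p N r φ (S i ω) ∂P := add_le_add (hstep n) le_rfl
        _ = (a n + ∑ i ∈ Finset.range n, ∫⁻ ω, seg p N r φ (S i ω) ∂P) +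
            ENNReal.ofReal g * ∫⁻ ω, seg p N r ψ (S n ω) ∂P := by ring
        _ ≤ _ := by rw [← add_assoc]; gcongr
  have htime : ∑' n, ∫⁻ ω, seg p N r ψ (S n ω) ∂P ≤
      ∫⁻ s in Set.Ici 0, ENNReal.ofReal (wgt c d t₀ s) := by
    rw [← lintegral_tsum fun n => (hJm n).aemeasurable]
    calc _ ≤ ∫⁻ _, (∫⁻ s in Set.Ici 0, ENNReal.ofReal (wgt c d t₀ s)) ∂P := by
          refine lintegral_mono_ae ?_
          filter_upwards [hξ0] with ω hω
          have hmono := monotone_chain_time hpos hlo hlohi hq hω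
          rw [tsum_seg hpos hlo hlohi hq hω (ψ := fun s => ENNReal.ofReal (wgt c d t₀ s))
            fun n s _ => rfl]
          exact lintegral_mono_set (Set.iUnion_subset fun n s hs => (hmono (Nat.zero_le n)).trans hs.1)
      _ = _ := by simp
  rw [lintegral_tsum fun n => (hIm n).aemeasurable]
  refine ENNReal.tsum_le_of_sum_range_le fun n => ?_
  refine (le_add_self.trans (hsum n)).trans ?_
  exact add_le_add le_rfl (mul_le_mul_right ((ENNReal.sum_le_tsum _).trans htime) _)

end Dynkin
end RSN
end

noncomputable section

namespace RSN

/-! ### The controlled queue lengths follow the embedded chain -/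

section Counting

theorem renewalCount_eq {ξ : ℕ → ℝ} (hξ : ∀ l, 0 < ξ l) {n : ℕ} {s : ℝ}
    (h1 : ∑ l ∈ Finset.range n, ξ l ≤ s) (h2 : s < ∑ l ∈ Finset.range (n + 1), ξ l) :
    renewalCount ξ s = n := by
  refine IsGreatest.csSup_eq ⟨h1, fun m hm => ?_⟩
  by_contra hmn
  have h3 : ∑ l ∈ Finset.range (n + 1), ξ l ≤ ∑ l ∈ Finset.range m, ξ l :=
    Finset.sum_le_sum_of_subset_of_nonneg (Finset.range_subset_range.2 (by omega))
      fun l _ _ => (hξ l).le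
  have h4 : ∑ l ∈ Finset.range m, ξ l ≤ s := hm
  linarith

/-- Number of events by time `c` of a delayed renewal process. -/
def evCount (Υ : ℝ) (ξ : ℕ → ℝ) (c : ℝ) : ℝ :=
  renewalCount ξ (max (c - Υ) 0) + if Υ ≤ c ∧ 0 < Υ then 1 else 0

theorem queueLength_eq (q₀ a s : ℝ) (u v : ℕ → ℝ) (t b : ℝ) :
    queueLength q₀ a s u v t b = q₀ + evCount a u t - evCount s v b := by
  unfold queueLength evCount; ring

theorem evCount_eq {ξ : ℕ → ℝ} (hξ : ∀ l, 0 < ξ l) {Υ c : ℝ} (hΥ : 0 ≤ Υ) (hc : 0 ≤ c) {k : ℕ}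
    (hk : (if Υ ≤ 0 then 1 else 0) ≤ k)
    (h1 : k = (if Υ ≤ 0 then 1 else 0) ∨ Υ + ∑ l ∈ Finset.range (k - 1), ξ l ≤ c)
    (h2 : c < Υ + ∑ l ∈ Finset.range k, ξ l) :
    evCount Υ ξ c = (k : ℝ) - ((if Υ ≤ 0 then 1 else 0 : ℕ) : ℝ) := by
  unfold evCount
  by_cases h0 : Υ ≤ 0
  · have hΥ0 : Υ = 0 := le_antisymm h0 hΥ
    subst hΥ0
    simp only [le_refl, if_true, zero_add, lt_irrefl, and_false, if_false, sub_zero, add_zero,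
      Nat.cast_one] at *
    obtain ⟨n, rfl⟩ : ∃ n, k = n + 1 := ⟨k - 1, by omega⟩
    rw [max_eq_left hc, renewalCount_eq hξ (n := n) ?_ h2]
    · push_cast; ring
    · rcases h1 with h1 | h1
      · have : n = 0 := by omega
        simpa [this] using hc
      · simpa using h1
  · simp only [if_neg h0, Nat.cast_zero, sub_zero] at *
    have hp : 0 < Υ := not_le.1 h0
    rcases Nat.eq_zero_or_pos k with rfl | hk0
    · have h3 : c < Υ := by simpa using h2
      rw [max_eq_right (by linarith), renewalCount_eq hξ (n := 0) (by simp) (by simpa using hξ 0),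
        if_neg fun h => absurd h.1 (not_le.2 h3)]
      simp
    · obtain ⟨n, rfl⟩ : ∃ n, k = n + 1 := ⟨k - 1, by omega⟩
      have h3 : Υ + ∑ l ∈ Finset.range n, ξ l ≤ c := by
        rcases h1 with h1 | h1
        · omega
        · simpa using h1
      have h4 : 0 ≤ ∑ l ∈ Finset.range n, ξ l := Finset.sum_nonneg fun l _ => (hξ l).le
      rw [max_eq_left (by linarith), renewalCount_eq hξ (n := n) (by linarith) (by linarith),
        if_pos ⟨by linarith, hp⟩]
      push_cast; ring

end Counting

section Hysteresis

variable {lo hi : ℝ} {e : Bool} {q : ℝ → ℝ}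

/-- The times at which the hysteresis rule leaves the `k`-th phase. -/
def exitSet (lo hi : ℝ) (q : ℝ → ℝ) (k : ℕ) : Set ℝ := {t | if Odd k then hi ≤ q t else q t < lo}

theorem switchTime_succ {k : ℕ} (hk : k = 0 → e = false) :
    switchTime lo hi e q (k + 1) = firstTime (switchTime lo hi e q k) (exitSet lo hi q k) := by
  rcases k with _ | n
  · rw [switchTime, switchTime, if_neg (by rw [hk rfl]; decide)]
    congr 1
  · rw [switchTime]
    by_cases h : Even n
    · rw [if_pos h]; congr 1; ext t
      simp only [exitSet, Set.mem_ofPred_eq, if_pos h.add_one]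
    · rw [if_neg h]; congr 1; ext t
      simp only [exitSet, Set.mem_ofPred_eq,
        if_neg (Nat.not_odd_iff_even.2 (Nat.not_even_iff_odd.1 h).add_one)]

theorem le_firstTime (s : ℝ≥0∞) (S : Set ℝ) : s ≤ firstTime s S :=
  le_iInf₂ fun _ ht => ht.2.1

theorem switchTime_mono : Monotone (switchTime lo hi e q) := by
  refine monotone_nat_of_le_succ fun k => ?_
  rcases k with _ | n
  · exact zero_le
  · rw [switchTime_succ (k := n + 1) (by omega)]; exact le_firstTime _ _

/-- At time `t` the hysteresis rule is in a phase of type `b` (`true` if blocked), which it does not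
leave at any time in `A`. -/
def Phase (lo hi : ℝ) (e : Bool) (q : ℝ → ℝ) (b : Bool) (t : ℝ) (A : Set ℝ) : Prop :=
  ∃ k : ℕ, (k = 0 → e = false) ∧ (Odd k ↔ b = true) ∧ switchTime lo hi e q k ≤ ENNReal.ofReal t ∧
    ∀ s ∈ A, 0 ≤ s → switchTime lo hi e q k ≤ ENNReal.ofReal s → s ∉ exitSet lo hi q k

theorem phase_zero : Phase lo hi e q e 0 (Set.Iio 0) := by
  refine ⟨if e = true then 1 else 0, fun h => ?_, ?_, ?_, fun s hs h0 => absurd h0 (not_le.2 hs)⟩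
  · by_contra h1; simp [h1] at h
  · cases e <;> simp
  · cases e <;> simp [switchTime]

theorem Phase.update (hlohi : lo ≤ hi) {b : Bool} {t₀ t : ℝ} (h : Phase lo hi e q b t₀ (Set.Iio t))
    (ht₀ : t₀ ≤ t) (ht : 0 ≤ t) : Phase lo hi e q (updE lo hi b (q t)) t (Set.Iic t) := by
  obtain ⟨k, h1, h2, h3, h4⟩ := h
  have h3' := h3.trans (ENNReal.ofReal_le_ofReal ht₀)
  have hmem : t ∈ exitSet lo hi q k ↔ if b = true then hi ≤ q t else q t < lo := by
    simp only [exitSet, Set.mem_ofPred_eq, h2]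
  by_cases hex : t ∈ exitSet lo hi q k
  · have h5 : switchTime lo hi e q (k + 1) = ENNReal.ofReal t := by
      rw [switchTime_succ h1]
      refine le_antisymm (iInf₂_le t ⟨ht, h3', hex⟩) (le_iInf₂ fun s hs => ?_)
      by_contra hlt
      exact h4 s (lt_of_not_ge fun hts => hlt (ENNReal.ofReal_le_ofReal hts)) hs.1 hs.2.1 hs.2.2
    refine ⟨k + 1, by omega, ?_, h5.le, fun s hs hs0 hs1 => ?_⟩
    · rw [Nat.odd_add_one, h2]
      rw [hmem] at hex
      cases b
      · simp only [Bool.false_eq_true, if_false] at hex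
        simp [updE, hex]
      · simp only [if_true] at hex
        simp [updE, hex]
    · have hst : s = t := le_antisymm hs (by
        rw [h5] at hs1
        exact (ENNReal.ofReal_le_ofReal_iff hs0).1 hs1)
      rw [hst]
      rw [hmem] at hex
      simp only [exitSet, Set.mem_ofPred_eq, Nat.odd_add_one, h2]
      cases b
      · simp only [Bool.false_eq_true, if_false] at hex
        simp only [Bool.false_eq_true, not_false_eq_true, if_true, not_le]; linarith
      · simp only [if_true] at hex
        simp only [not_true_eq_false, if_false, not_lt]; linarith
  · refine ⟨k, h1, ?_, h3', fun s hs hs0 hs1 => ?_⟩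
    · rw [h2]
      rw [hmem] at hex
      cases b
      · simp only [Bool.false_eq_true, if_false] at hex
        simp [updE, hex]
      · simp only [if_true] at hex
        simpa [updE] using hex
    · rcases lt_or_eq_of_le (Set.mem_Iic.1 hs) with h6 | h6
      · exact h4 s h6 hs0 hs1
      · rw [h6]; exact hex

/-- A phase lasts as long as the queue length does not change. -/
theorem Phase.extend {b : Bool} {t T : ℝ} (ht : 0 ≤ t) (h : Phase lo hi e q b t (Set.Iic t))
    (hq : ∀ s ∈ Set.Ico t T, q s = q t) : Phase lo hi e q b t (Set.Iio T) := by
  obtain ⟨k, h1, h2, h3, h4⟩ := h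
  refine ⟨k, h1, h2, h3, fun s hs hs0 hs1 => ?_⟩
  rcases le_total s t with h5 | h5
  · exact h4 s h5 hs0 hs1
  · have h6 := h4 t (Set.mem_Iic.2 le_rfl) ht h3
    simpa only [exitSet, Set.mem_ofPred_eq, hq s ⟨h5, hs⟩] using h6

theorem Phase.blocked_iff {b : Bool} {t T : ℝ} (h : Phase lo hi e q b t (Set.Iio T)) {s : ℝ}
    (hs0 : 0 ≤ s) (hs : s ∈ Set.Ico t T) : blocked lo hi e q s ↔ b = true := by
  obtain ⟨k, h1, h2, h3, h4⟩ := h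
  have h5 : switchTime lo hi e q k ≤ ENNReal.ofReal s := h3.trans (ENNReal.ofReal_le_ofReal hs.1)
  have h6 : ENNReal.ofReal s < switchTime lo hi e q (k + 1) := by
    refine lt_of_lt_of_le ((ENNReal.ofReal_lt_ofReal_iff (hs0.trans_lt hs.2)).2 hs.2) ?_
    rw [switchTime_succ h1]
    refine le_iInf₂ fun u hu => ?_
    by_contra hlt
    exact h4 u (lt_of_not_ge fun hts => hlt (ENNReal.ofReal_le_ofReal hts)) hu.1 hu.2.1 hu.2.2
  rw [← h2]
  constructor
  · rintro ⟨l, h7, h8⟩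
    have h9 : 2 * l + 1 < k + 1 := switchTime_mono.reflect_lt (h7.trans_lt h6)
    have h10 : k < 2 * l + 2 := switchTime_mono.reflect_lt (h5.trans_lt h8)
    exact ⟨l, by omega⟩
  · rintro ⟨l, rfl⟩
    exact ⟨l, h5, h6⟩

end Hysteresis

section Path

variable {I J : ℕ}

/-- Lower threshold of the policy. -/
def Policy.lo (p : Policy J) (N : Network I J) (r : ℕ) : ℝ := N.βmin * p.c₁ * (r : ℝ) ^ p.κ

/-- Upper threshold of the policy. -/
def Policy.hi (p : Policy J) (N : Network I J) (r : ℕ) : ℝ := N.βmin * p.c₂ * (r : ℝ) ^ p.κ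

/-- The queue lengths for the initial state `x`, renewal intervals `ξ` and capacities `B`. -/
def qpath (x : Config J) (ξ : Idx J → ℕ → ℝ) (B : ℝ → Fin J → ℝ) (t : ℝ) (j : Fin J) : ℝ :=
  queueLength (x.1 j) (x.2.1 (Sum.inl j)) (x.2.1 (Sum.inr j)) (ξ (Sum.inl j)) (ξ (Sum.inr j)) t (B t j)

/-- Operating times of the renewal processes. -/
def clk (B : ℝ → Fin J → ℝ) (t : ℝ) : Idx J → ℝ := Sum.elim (fun _ => t) (B t)

/-- A realization of the controlled system, with an upper bound `sx` of the allocation rates. -/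
structure IsPath (p : Policy J) (N : Network I J) (r : ℕ) (sx : ℝ) (x : Config J)
    (ξ : Idx J → ℕ → ℝ) (B : ℝ → Fin J → ℝ) : Prop where
  pos : ∀ q j, 0 < p.x N r q j
  le : ∀ q j, p.x N r q j ≤ sx
  one_le_sx : 1 ≤ sx
  one_le_lo : 1 ≤ p.lo N r
  lo_le_hi : p.lo N r ≤ p.hi N r
  q_nonneg : ∀ j, 0 ≤ x.1 j
  R_nonneg : ∀ a, 0 ≤ x.2.1 a
  ξ_pos : ∀ a l, 0 < ξ a l
  integrable : ∀ t ≥ 0, ∀ j,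
    IntervalIntegrable (fun s => p.rate N r x.2.2 (qpath x ξ B) s j) volume 0 t
  eq_integral : ∀ t ≥ 0, ∀ j, B t j = ∫ s in (0 : ℝ)..t, p.rate N r x.2.2 (qpath x ξ B) s j

variable {p : Policy J} {N : Network I J} {r : ℕ} {sx : ℝ} {x : Config J} {ξ : Idx J → ℕ → ℝ}
  {B : ℝ → Fin J → ℝ}

/-- The states of the embedded chain of a path. -/
abbrev IsPath.S (_ : IsPath p N r sx x ξ B) (n : ℕ) : Stage J :=
  chain p N r (p.lo N r) (p.hi N r) x ξ n

theorem IsPath.clk_sub (h : IsPath p N r sx x ξ B) {s t : ℝ} (hs : 0 ≤ s) (hst : s ≤ t) (a : Idx J) :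
    clk B s a ≤ clk B t a ∧ clk B t a ≤ clk B s a + sx * (t - s) := by
  have hsx := h.one_le_sx
  rcases a with j | j
  · exact ⟨hst, by simp only [clk, Sum.elim_inl]; nlinarith⟩
  · have h1 := h.integrable s hs j
    have h2 := h.integrable t (hs.trans hst) j
    have h3 : B t j - B s j = ∫ u in s..t, p.rate N r x.2.2 (qpath x ξ B) u j := by
      rw [h.eq_integral t (hs.trans hst), h.eq_integral s hs,
        intervalIntegral.integral_interval_sub_left h2 h1]
    have hr0 : ∀ u, 0 ≤ p.rate N r x.2.2 (qpath x ξ B) u j ∧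
        p.rate N r x.2.2 (qpath x ξ B) u j ≤ sx := fun u => by
      unfold Policy.rate
      split_ifs
      exacts [⟨le_rfl, by linarith⟩, ⟨(h.pos _ _).le, h.le _ _⟩]
    have h4 : 0 ≤ ∫ u in s..t, p.rate N r x.2.2 (qpath x ξ B) u j :=
      intervalIntegral.integral_nonneg hst fun u _ => (hr0 u).1
    have h5 : ∫ u in s..t, p.rate N r x.2.2 (qpath x ξ B) u j ≤ ∫ u in s..t, sx :=
      intervalIntegral.integral_mono hst (h1.symm.trans h2) intervalIntegrable_const fun u => (hr0 u).2
    rw [intervalIntegral.integral_const, smul_eq_mul] at h5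
    simp only [clk, Sum.elim_inr]
    constructor <;> linarith

/-- Number of the first renewal interval that begins after time `0`. -/
abbrev cnt₀ (x : Config J) (a : Idx J) : ℕ := if x.2.1 a ≤ 0 then 1 else 0

/-- How the embedded chain and the path are related at an event. -/
structure IsPath.Inv (h : IsPath p N r sx x ξ B) (n : ℕ) : Prop where
  time : 0 ≤ (h.S n).1
  R : ∀ a, (h.S n).2.2.2.1 a =
    x.2.1 a + ∑ l ∈ Finset.range ((h.S n).2.1 a), ξ a l - clk B (h.S n).1 a
  le_cnt : ∀ a, cnt₀ x a ≤ (h.S n).2.1 a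
  cnt : ∀ a, (h.S n).2.1 a = cnt₀ x a ∨
    x.2.1 a + ∑ l ∈ Finset.range ((h.S n).2.1 a - 1), ξ a l ≤ clk B (h.S n).1 a
  q : ∀ j, (h.S n).2.2.1 j = x.1 j +
    (((h.S n).2.1 (Sum.inl j) : ℝ) - (cnt₀ x (Sum.inl j) : ℝ)) -
    (((h.S n).2.1 (Sum.inr j) : ℝ) - (cnt₀ x (Sum.inr j) : ℝ))
  phase : ∀ j, Phase (p.lo N r) (p.hi N r) (x.2.2 j) (fun s => qpath x ξ B s j)
    ((h.S n).2.2.2.2 j) (h.S n).1 (Set.Iic (h.S n).1)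

theorem IsPath.clk_zero (h : IsPath p N r sx x ξ B) (a : Idx J) : clk B 0 a = 0 := by
  rcases a with j | j
  · rfl
  · simp [clk, h.eq_integral 0 le_rfl]

/-- The queue lengths in terms of the numbers of renewal intervals that have begun. -/
theorem IsPath.qpath_eq (h : IsPath p N r sx x ξ B) {t : ℝ} (ht : 0 ≤ t) {k : Idx J → ℕ}
    (hk : ∀ a, cnt₀ x a ≤ k a)
    (h1 : ∀ a, k a = cnt₀ x a ∨ x.2.1 a + ∑ l ∈ Finset.range (k a - 1), ξ a l ≤ clk B t a)
    (h2 : ∀ a, clk B t a < x.2.1 a + ∑ l ∈ Finset.range (k a), ξ a l) (j : Fin J) :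
    qpath x ξ B t j = x.1 j + ((k (Sum.inl j) : ℝ) - (cnt₀ x (Sum.inl j) : ℝ)) -
      ((k (Sum.inr j) : ℝ) - (cnt₀ x (Sum.inr j) : ℝ)) := by
  have hc : ∀ a, 0 ≤ clk B t a := fun a => by
    rw [← h.clk_zero a]; exact (h.clk_sub le_rfl ht a).1
  have e : ∀ a, evCount (x.2.1 a) (ξ a) (clk B t a) = (k a : ℝ) - (cnt₀ x a : ℝ) := fun a =>
    evCount_eq (h.ξ_pos a) (h.R_nonneg a) (hc a) (hk a) (h1 a) (h2 a)
  have e1 := e (Sum.inl j)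
  have e2 := e (Sum.inr j)
  rw [← e1, ← e2]
  exact queueLength_eq _ _ _ _ _ _ _

theorem IsPath.valid (h : IsPath p N r sx x ξ B) (n : ℕ) :
    Valid (p.lo N r) (p.hi N r) (h.S n).2.2 ∧ ∀ a, 0 < (h.S n).2.2.2.1 a :=
  valid_chain h.pos h.one_le_lo h.lo_le_hi h.q_nonneg h.ξ_pos n

theorem IsPath.inv_zero (h : IsPath p N r sx x ξ B) : h.Inv 0 := by
  have hq : ∀ j, qpath x ξ B 0 j = x.1 j := fun j => by
    rw [h.qpath_eq le_rfl (k := cnt₀ x) (fun a => le_rfl) (fun a => Or.inl rfl) fun a => ?_]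
    · ring
    · rw [h.clk_zero]
      have := h.R_nonneg a
      unfold cnt₀
      split_ifs with h0
      · simpa using (by linarith [h.ξ_pos a 0] : 0 < x.2.1 a + ξ a 0)
      · simpa using not_le.1 h0
  refine ⟨le_rfl, fun a => ?_, fun a => le_rfl, fun a => Or.inl rfl, fun j => ?_, fun j => ?_⟩
  · simp only [chain, start, h.clk_zero, sub_zero]
    split_ifs with h0
    · have : x.2.1 a = 0 := le_antisymm h0 (h.R_nonneg a)
      simp [this]
    · simp
  · simp [chain, start]
  · have h1 := Phase.update h.lo_le_hi (phase_zero (e := x.2.2 j) (q := fun s => qpath x ξ B s j))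
      le_rfl le_rfl
    simp only [hq] at h1
    exact h1

theorem IsPath.Inv.qpath_eq {h : IsPath p N r sx x ξ B} {n : ℕ} (hi : h.Inv n) {t : ℝ}
    (ht : (h.S n).1 ≤ t)
    (h2 : ∀ a, clk B t a < x.2.1 a + ∑ l ∈ Finset.range ((h.S n).2.1 a), ξ a l) :
    qpath x ξ B t = (h.S n).2.2.1 := by
  funext j
  rw [hi.q, h.qpath_eq (hi.time.trans ht) hi.le_cnt (fun a => ?_) h2]
  exact (hi.cnt a).imp_right fun h3 => h3.trans (h.clk_sub hi.time ht a).1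

/-- As long as the queue lengths do not change, capacity is allocated at constant rates. -/
theorem IsPath.Inv.clk_eq {h : IsPath p N r sx x ξ B} {n : ℕ} (hi : h.Inv n) {T : ℝ}
    (hq : ∀ s ∈ Set.Ico (h.S n).1 T, qpath x ξ B s = (h.S n).2.2.1)
    (hq0 : qpath x ξ B (h.S n).1 = (h.S n).2.2.1) {t : ℝ} (ht : t ∈ Set.Icc (h.S n).1 T) (a : Idx J) :
    clk B t a = clk B (h.S n).1 a + (t - (h.S n).1) * speed p N r (h.S n).2.2 a := by
  rcases a with j | j
  · simp [clk, speed]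
  · have ht0 := hi.time.trans ht.1
    have h3 : B t j - B (h.S n).1 j =
        ∫ u in (h.S n).1..t, p.rate N r x.2.2 (qpath x ξ B) u j := by
      rw [h.eq_integral t ht0, h.eq_integral _ hi.time,
        intervalIntegral.integral_interval_sub_left (h.integrable t ht0 j)
          (h.integrable _ hi.time j)]
    have hph := (hi.phase j).extend hi.time (T := T) fun s hs => by rw [hq s hs, hq0]
    have h4 : ∫ u in (h.S n).1..t, p.rate N r x.2.2 (qpath x ξ B) u j =
        ∫ _ in (h.S n).1..t, speed p N r (h.S n).2.2 (Sum.inr j) := by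
      refine intervalIntegral.integral_congr_Ioo_of_le ht.1 fun u hu => ?_
      have hu' : u ∈ Set.Ico (h.S n).1 T := ⟨hu.1.le, hu.2.trans_le ht.2⟩
      have hb := hph.blocked_iff (hi.time.trans hu'.1) hu'
      simp only [Policy.rate, speed, Sum.elim_inr]
      rw [hq u hu']
      by_cases hE : (h.S n).2.2.2.2 j = true
      · rw [if_pos hE]; exact if_pos (hb.2 hE)
      · rw [if_neg hE]; exact if_neg fun h5 => hE (hb.1 h5)
    rw [intervalIntegral.integral_const, smul_eq_mul] at h4
    simp only [clk, Sum.elim_inr]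
    linarith

/-- The queue lengths are constant between events. -/
theorem IsPath.Inv.qpath_eq_of_lt [Nonempty (Idx J)] {h : IsPath p N r sx x ξ B} {n : ℕ}
    (hi : h.Inv n) : ∀ s ∈ Set.Ico (h.S n).1 (h.S (n + 1)).1, qpath x ξ B s = (h.S n).2.2.1 := by
  have hv := h.valid n
  set t₀ := (h.S n).1 with ht₀
  set H := hold p N r (h.S n).2.2 with hH
  have hH0 : 0 ≤ H := hold_nonneg h.pos hv.1.R_nonneg
  have hsx : 0 < sx := by linarith [h.one_le_sx]
  have hq0 : qpath x ξ B t₀ = (h.S n).2.2.1 := hi.qpath_eq le_rfl fun a => by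
    have := hi.R a
    have := hv.2 a
    linarith
  set A : Set ℝ := {T | T ∈ Set.Icc t₀ (t₀ + H) ∧
    ∀ s ∈ Set.Ico t₀ T, qpath x ξ B s = (h.S n).2.2.1} with hA
  have hAne : A.Nonempty := ⟨t₀, ⟨le_rfl, by linarith⟩, fun s hs => absurd hs.1 (not_le.2 hs.2)⟩
  have hAbdd : BddAbove A := ⟨t₀ + H, fun T hT => hT.1.2⟩
  have hsup : sSup A ∈ A := by
    refine ⟨⟨le_csSup hAbdd ⟨⟨le_rfl, by linarith⟩, fun s hs => absurd hs.1 (not_le.2 hs.2)⟩,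
      csSup_le hAne fun T hT => hT.1.2⟩, fun s hs => ?_⟩
    obtain ⟨T, hT, hsT⟩ := exists_lt_of_lt_csSup hAne hs.2
    exact hT.2 s ⟨hs.1, hsT⟩
  set σ := sSup A with hσ
  rcases lt_or_eq_of_le hsup.1.2 with hlt | heq
  · exfalso
    -- all residual times are still positive at time `σ`
    set ρ : Idx J → ℝ := fun a => (h.S n).2.2.2.1 a - (σ - t₀) * speed p N r (h.S n).2.2 a with hρ
    have hρ0 : ∀ a, 0 < ρ a := fun a => by
      have h1 := hold_mul_speed_le h.pos hv.1.R_nonneg a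
      have h2 := hv.2 a
      rcases (speed_nonneg h.pos (h.S n).2.2 a).eq_or_lt with h3 | h3
      · simp only [hρ]; rw [← h3]; linarith
      · have : (σ - t₀) * speed p N r (h.S n).2.2 a < H * speed p N r (h.S n).2.2 a :=
          mul_lt_mul_of_pos_right (by linarith) h3
        simp only [hρ]; linarith
    obtain ⟨a₀, ha₀⟩ := Finite.exists_min ρ
    have hδ : 0 < ρ a₀ / sx := div_pos (hρ0 a₀) hsx
    have hmem : min (σ + ρ a₀ / sx) (t₀ + H) ∈ A := by
      refine ⟨⟨le_min (by linarith [hsup.1.1]) (by linarith), min_le_right _ _⟩, fun s hs => ?_⟩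
      rcases lt_or_ge s σ with h1 | h1
      · exact hsup.2 s ⟨hs.1, h1⟩
      · refine hi.qpath_eq hs.1 fun a => ?_
        have h2 := (h.clk_sub (hi.time.trans hsup.1.1) h1 a).2
        have h3 := hi.clk_eq hsup.2 hq0 ⟨hsup.1.1, le_rfl⟩ a
        have h4 := hi.R a
        have h5 : sx * (s - σ) < ρ a := by
          have : s - σ < ρ a₀ / sx := by linarith [hs.2.trans_le (min_le_left _ _)]
          rw [lt_div_iff₀ hsx] at this
          linarith [ha₀ a]
        simp only [hρ] at h5
        linarith
    have := le_csSup hAbdd hmem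
    rw [← hσ] at this
    rcases min_le_iff.1 this with h1 | h1 <;> linarith
  · intro s hs
    exact hsup.2 s ⟨hs.1, by rw [heq]; exact hs.2⟩

/-- Between two events the queue lengths, hence the allocation rates, are constant; at the event the
processes whose residual time expires are those whose renewal interval ends. -/
theorem IsPath.Inv.succ [Nonempty (Idx J)] {h : IsPath p N r sx x ξ B} {n : ℕ} (hi : h.Inv n) :
    h.Inv (n + 1) := by
  have hv := h.valid n
  have hq := hi.qpath_eq_of_lt
  have hH0 : 0 ≤ hold p N r (h.S n).2.2 := hold_nonneg h.pos hv.1.R_nonneg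
  have hq0 : qpath x ξ B (h.S n).1 = (h.S n).2.2.1 := hi.qpath_eq le_rfl fun a => by
    have := hi.R a
    have := hv.2 a
    linarith
  have ht1 : (h.S (n + 1)).1 = (h.S n).1 + hold p N r (h.S n).2.2 := rfl
  have hle : (h.S n).1 ≤ (h.S (n + 1)).1 := by rw [ht1]; linarith
  have hclk := fun a => hi.clk_eq hq hq0 ⟨hle, le_rfl⟩ a
  rw [ht1] at hclk
  simp only [add_sub_cancel_left] at hclk
  have htime : 0 ≤ (h.S (n + 1)).1 := hi.time.trans hle
  have hfl : ∀ a, (flow p N r (h.S n).2.2 (hold p N r (h.S n).2.2)).2.1 a =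
      (h.S n).2.2.2.1 a - hold p N r (h.S n).2.2 * speed p N r (h.S n).2.2 a := fun a => rfl
  have hfl0 : ∀ a, 0 ≤ (flow p N r (h.S n).2.2 (hold p N r (h.S n).2.2)).2.1 a := fun a =>
    sub_nonneg.2 (hold_mul_speed_le h.pos hv.1.R_nonneg a)
  have hcnt : ∀ a, (h.S (n + 1)).2.1 a = (h.S n).2.1 a +
    if (flow p N r (h.S n).2.2 (hold p N r (h.S n).2.2)).2.1 a ≤ 0 then 1 else 0 := fun a => rfl
  have hR : ∀ a, (h.S (n + 1)).2.2.2.1 a = x.2.1 a +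
      ∑ l ∈ Finset.range ((h.S (n + 1)).2.1 a), ξ a l - clk B (h.S (n + 1)).1 a := fun a => by
    have h1 := hi.R a
    have h2 := hclk a
    have h3 := hfl a
    have h4 := hfl0 a
    rw [hcnt, ht1]
    have h5 : (h.S (n + 1)).2.2.2.1 a =
      if (flow p N r (h.S n).2.2 (hold p N r (h.S n).2.2)).2.1 a ≤ 0 then ξ a ((h.S n).2.1 a)
      else (flow p N r (h.S n).2.2 (hold p N r (h.S n).2.2)).2.1 a := rfl
    rw [h5]
    split_ifs with h0
    · rw [Finset.sum_range_succ]; linarith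
    · rw [add_zero]; linarith
  have hle_cnt : ∀ a, cnt₀ x a ≤ (h.S (n + 1)).2.1 a := fun a =>
    (hi.le_cnt a).trans (Nat.le_add_right _ _)
  have hcnt' : ∀ a, (h.S (n + 1)).2.1 a = cnt₀ x a ∨
      x.2.1 a + ∑ l ∈ Finset.range ((h.S (n + 1)).2.1 a - 1), ξ a l ≤ clk B (h.S (n + 1)).1 a :=
    fun a => by
      have h1 := hi.R a
      have h2 := hclk a
      have h3 := hfl a
      rw [hcnt, ht1]
      split_ifs with h0
      · right
        rw [Nat.add_sub_cancel]
        linarith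
      · rw [add_zero]
        refine (hi.cnt a).imp_right fun h4 => h4.trans ?_
        exact (h.clk_sub hi.time hle a).1
  have hqq : ∀ j, (h.S (n + 1)).2.2.1 j = x.1 j +
      (((h.S (n + 1)).2.1 (Sum.inl j) : ℝ) - (cnt₀ x (Sum.inl j) : ℝ)) -
      (((h.S (n + 1)).2.1 (Sum.inr j) : ℝ) - (cnt₀ x (Sum.inr j) : ℝ)) := fun j => by
    have h1 := hi.q j
    have h2 : (h.S (n + 1)).2.2.1 j =
      jumpQ (flow p N r (h.S n).2.2 (hold p N r (h.S n).2.2)) j := rfl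
    have h3 : (flow p N r (h.S n).2.2 (hold p N r (h.S n).2.2)).1 j = (h.S n).2.2.1 j := rfl
    rw [h2, hcnt, hcnt, jumpQ, h3, h1]
    push_cast
    ring
  have hq1 : qpath x ξ B (h.S (n + 1)).1 = (h.S (n + 1)).2.2.1 := by
    funext j
    rw [hqq, h.qpath_eq htime hle_cnt hcnt' fun a => ?_]
    have := hR a
    have := (h.valid (n + 1)).2 a
    linarith
  refine ⟨htime, hR, hle_cnt, hcnt', hqq, fun j => ?_⟩
  have h1 := ((hi.phase j).extend hi.time (T := (h.S (n + 1)).1) fun s hs => by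
    rw [hq s hs, hq0]).update h.lo_le_hi hle htime
  rw [hq1] at h1
  exact h1

theorem IsPath.inv [Nonempty (Idx J)] (h : IsPath p N r sx x ξ B) (n : ℕ) : h.Inv n := by
  induction n with
  | zero => exact h.inv_zero
  | succ n ih => exact ih.succ

/-- There are finitely many events in bounded time. -/
theorem IsPath.exists_lt_time [Nonempty (Idx J)] (h : IsPath p N r sx x ξ B)
    (hdiv : ∀ a, Tendsto (fun m => ∑ l ∈ Finset.range m, ξ a l) atTop atTop) (C : ℝ) :
    ∃ n, C < (h.S n).1 := by
  by_contra! hC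
  -- only `m + 1` renewal intervals of each process can begin by time `C`, but each event uses one
  obtain ⟨m, hm⟩ : ∃ m : ℕ, ∀ a, sx * C < ∑ l ∈ Finset.range m, ξ a l :=
    (eventually_all.2 fun a => (hdiv a).eventually_gt_atTop (sx * C)).exists
  have h1 : ∀ n a, (h.S n).2.1 a ≤ m + 1 := fun n a => by
    by_contra! hlt
    have hi := h.inv n
    rcases hi.cnt a with h2 | h2
    · rw [h2, cnt₀] at hlt; split_ifs at hlt <;> omega
    · have h3 : ∑ l ∈ Finset.range m, ξ a l ≤ ∑ l ∈ Finset.range ((h.S n).2.1 a - 1), ξ a l :=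
        Finset.sum_le_sum_of_subset_of_nonneg (Finset.range_subset_range.2 (by omega))
          fun l _ _ => (h.ξ_pos a l).le
      have h4 := (h.clk_sub le_rfl hi.time a).2
      rw [h.clk_zero, sub_zero, zero_add] at h4
      have h5 : sx * (h.S n).1 ≤ sx * C :=
        mul_le_mul_of_nonneg_left (hC n) (by linarith [h.one_le_sx])
      linarith [hm a, h.R_nonneg a]
  have h2 : ∀ n, n ≤ ∑ a, (h.S n).2.1 a := fun n => by
    induction n with
    | zero => exact Nat.zero_le _
    | succ n ih =>
      obtain ⟨a, ha⟩ := exists_fire h.pos (h.S n).2.2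
      refine Nat.succ_le_of_lt (lt_of_le_of_lt ih (Finset.sum_lt_sum
        (fun b _ => Nat.le_add_right _ _) ⟨a, Finset.mem_univ a, ?_⟩))
      change _ < (h.S n).2.1 a + if _ then 1 else 0
      rw [if_pos ha.le]
      exact Nat.lt_succ_self _
  have h3 := (h2 (Fintype.card (Idx J) * (m + 1) + 1)).trans
    (Finset.sum_le_sum fun a _ => h1 _ a)
  rw [Finset.sum_const, Finset.card_univ, smul_eq_mul] at h3
  omega

/-- Functionals of the queue lengths are integrals along the segments of the embedded chain. -/
theorem IsPath.lintegral_le [Nonempty (Idx J)] (h : IsPath p N r sx x ξ B)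
    (hdiv : ∀ a, Tendsto (fun m => ∑ l ∈ Finset.range m, ξ a l) atTop atTop)
    {φ : ℝ × Config J → ℝ≥0∞} {ψ : ℝ → (Fin J → ℝ) → ℝ≥0∞}
    (hφ : ∀ s y, Valid (p.lo N r) (p.hi N r) y → ψ s y.1 ≤ φ (s, y)) :
    ∫⁻ s in Set.Ici 0, ψ s (qpath x ξ B s) ≤ ∑' n, seg p N r φ (h.S n) := by
  have hmono : Monotone fun n => (h.S n).1 :=
    monotone_chain_time h.pos h.one_le_lo h.lo_le_hi h.q_nonneg h.ξ_pos
  have hcov : Set.Ici (0 : ℝ) ⊆ ⋃ n, Set.Ico (h.S n).1 (h.S (n + 1)).1 := fun s hs => by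
    have hex := h.exists_lt_time hdiv s
    have h1 := Nat.find_spec hex
    obtain ⟨n, hn⟩ : ∃ n, Nat.find hex = n + 1 := Nat.exists_eq_succ_of_ne_zero fun h0 => by
      rw [h0] at h1
      exact absurd (Set.mem_Ici.1 hs) (not_le.2 h1)
    rw [hn] at h1
    exact Set.mem_iUnion.2 ⟨n, not_lt.1 (Nat.find_min hex (by omega)), h1⟩
  refine (lintegral_mono_set hcov).trans ((lintegral_iUnion_le _ _).trans
    (ENNReal.tsum_le_tsum fun n => ?_))
  refine setLIntegral_mono' measurableSet_Ico fun s hs => ?_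
  rw [(h.inv n).qpath_eq_of_lt s hs]
  refine hφ s (flow p N r (h.S n).2.2 (s - (h.S n).1)) ((h.valid n).1.flow fun a => ?_)
  have hs2 : s < (h.S n).1 + hold p N r (h.S n).2.2 := hs.2
  exact (mul_le_mul_of_nonneg_right (by linarith) (speed_nonneg h.pos _ a)).trans
    (hold_mul_speed_le h.pos (h.valid n).1.R_nonneg a)

end Path
end RSN
end

noncomputable section

namespace RSN

/-! ### The constants of the network and the policy -/

section Constants

variable {I J : ℕ}

theorem iInf_pos_of_pos [Nonempty (Fin J)] {f : Fin J → ℝ} (hf : ∀ j, 0 < f j) : 0 < ⨅ j, f j := by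
  obtain ⟨j, hj⟩ := exists_eq_ciInf_of_finite (f := f)
  rw [← hj]; exact hf j

/-- Finitely many positive numbers have a positive lower bound. -/
theorem exists_pos_le {ι : Type*} [Finite ι] {P : ι → Prop} {f : ι → ℝ} (hf : ∀ i, P i → 0 < f i) :
    ∃ c : ℝ, 0 < c ∧ ∀ i, P i → c ≤ f i := by
  have h : ∀ᶠ c in 𝓝[>] (0 : ℝ), ∀ i, P i → c ≤ f i := eventually_all.2 fun i => by
    by_cases hi : P i
    · filter_upwards [Ioo_mem_nhdsGT (hf i hi)] with c hc _ using hc.2.le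
    · exact Eventually.of_forall fun c h => absurd h hi
  obtain ⟨c, h1, h2⟩ := (eventually_mem_nhdsWithin.and h).exists
  exact ⟨c, h1, h2⟩

theorem abs_le_enorm2 (v : Fin J → ℝ) (j : Fin J) : |v j| ≤ enorm2 v :=
  Real.abs_le_sqrt (Finset.single_le_sum (f := fun j => v j ^ 2) (fun _ _ => sq_nonneg _)
    (Finset.mem_univ j))

theorem enorm2_nonneg (v : Fin J → ℝ) : 0 ≤ enorm2 v := Real.sqrt_nonneg _

theorem hβ_dotProduct_le (N : Network I J) (v : Fin J → ℝ) :
    N.hβ ⬝ᵥ v ≤ enorm2 N.β * enorm2 N.h * enorm2 v := by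
  have h1 : ∑ j, |N.β j| * |v j| ≤ enorm2 N.β * enorm2 v := by
    have := Real.sum_mul_le_sqrt_mul_sqrt Finset.univ (fun j => |N.β j|) (fun j => |v j|)
    simpa [enorm2] using this
  calc N.hβ ⬝ᵥ v ≤ ∑ j, enorm2 N.h * (|N.β j| * |v j|) := by
        refine Finset.sum_le_sum fun j _ => (le_abs_self _).trans ?_
        rw [Network.hβ, abs_mul, abs_mul, mul_assoc]
        exact mul_le_mul_of_nonneg_right (abs_le_enorm2 _ _) (by positivity)
    _ ≤ enorm2 N.h * (enorm2 N.β * enorm2 v) := by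
        rw [← Finset.mul_sum]; exact mul_le_mul_of_nonneg_left h1 (enorm2_nonneg _)
    _ = _ := by ring

section Policy

variable {N : Network I J} {p : Policy J}

theorem Policy.IsPolicy.vc_cost_neg (hp : p.IsPolicy N) {z : Chi J} (hz : z ∈ N.calM p.dir) :
    N.hβ ⬝ᵥ p.vc z < 0 := by
  have hu := hp.isCostDirection hz.1
  rw [N.hβ_dotProduct_eq hu (hp.vc_ker z hz)]
  exact mul_neg_of_pos_of_neg (hp.vc_dir z hz) hu.2.2.2

/-- On `ℳ` the rate adjustments of the policy reduce the cost: that by `v^b` is at most a quarter of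
that by `v^c`. -/
theorem Policy.IsPolicy.cost_neg (hp : p.IsPolicy N) {z : Chi J} (hz : z ∈ N.calM p.dir) :
    N.hβ ⬝ᵥ p.vc z + N.hβ ⬝ᵥ p.vb z < 0 := by
  have hfin : ((fun z => N.hβ ⬝ᵥ p.vc z) '' N.calM p.dir).Finite := (Set.toFinite _).image _
  have h1 : N.hβ ⬝ᵥ p.vc z ≤ p.lamTilde N := le_csSup hfin.bddAbove ⟨z, hz, rfl⟩
  have h2 : p.lamTilde N < 0 := by
    obtain ⟨z', hz', h⟩ := Set.Nonempty.csSup_mem (Set.Nonempty.image _ ⟨z, hz⟩) hfin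
    rw [Policy.lamTilde, ← h]
    exact hp.vc_cost_neg hz'
  have h3 := hβ_dotProduct_le N (p.vb z)
  have h4 := hp.vb_le_lamTilde ⟨z, hz⟩ z
  have hc : 0 ≤ enorm2 N.β * enorm2 N.h := mul_nonneg (enorm2_nonneg _) (enorm2_nonneg _)
  have h5 : enorm2 N.β * enorm2 N.h * (|p.lamTilde N| / (4 * enorm2 N.β * enorm2 N.h)) ≤
      |p.lamTilde N| / 4 := by
    rcases hc.eq_or_lt with h0 | h0
    · rw [← h0, zero_mul]; positivity
    · rw [mul_assoc 4, ← div_div, mul_div_cancel₀ _ h0.ne']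
  have h6 := mul_le_mul_of_nonneg_left h4 hc
  rw [abs_of_neg h2] at h5 h6
  linarith

open Classical in
/-- The total adjustment `ρ - x` of the allocation rates. -/
theorem Policy.ρ_sub_x (p : Policy J) (N : Network I J) (r : ℕ) (q : Fin J → ℝ) (j : Fin J) :
    N.ρ j - p.x N r q j =
      (if p.Z N r q ∈ N.calM p.dir then p.vc (p.Z N r q) j else 0) + p.vb (p.Z N r q) j := by
  unfold Policy.x
  ring

theorem Policy.Z_eq_true (p : Policy J) (N : Network I J) (r : ℕ) (q : Fin J → ℝ) (j : Fin J) :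
    p.Z N r q j = true ↔ q j < p.hi N r := by
  simp [Policy.Z, Policy.hi]

theorem Policy.IsPolicy.x_ge [Nonempty (Fin J)] (hp : p.IsPolicy N) (hρ : ∀ j, 0 < N.ρ j) (r : ℕ)
    (q : Fin J → ℝ) (j : Fin J) : N.ρmin / 4 ≤ p.x N r q j := by
  have h1 : N.ρmin ≤ N.ρ j := ciInf_le (Set.finite_range _).bddBelow j
  have h0 : 0 < N.ρmin := iInf_pos_of_pos hρ
  have h2 := (le_abs_self _).trans ((abs_le_enorm2 _ j).trans (hp.vb_le (p.Z N r q)))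
  unfold Policy.x
  split_ifs with hz
  · have := hp.vc_lt _ hz j
    linarith
  · linarith

end Policy

variable {N : Network I J} {p : Policy J}

theorem exists_gapBound (hN : N.IsTopology) (hβ : ∀ j, 0 < N.β j) {Cp : ℝ} (hCp : 0 ≤ Cp) :
    ∃ L Cb : ℝ, GapBound N Cp L Cb := by
  obtain ⟨L, hL0, hL⟩ := Network.exists_gap_lipschitz hN hβ hCp
  have hβ0 : ∀ j, 0 ≤ (N.β j)⁻¹ := fun j => (inv_pos.2 (hβ j)).le
  refine ⟨L, ∑ j, (N.β j)⁻¹, hL0, Finset.sum_nonneg fun j _ => hβ0 j,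
    Network.gap_concave hN hCp, hL, fun q q' i => ?_⟩
  refine (Network.abs_wl_sub_le hN hβ q q' i).trans ?_
  rw [Finset.mul_sum]
  refine Finset.sum_le_sum fun j _ => ?_
  rw [div_eq_mul_inv, mul_comm]
  exact mul_le_mul_of_nonneg_right
    (Finset.single_le_sum (f := fun j => (N.β j)⁻¹) (fun j _ => hβ0 j) (Finset.mem_univ j))
    (abs_nonneg _)

/-- The properties of the policy that matter, with constants independent of `r`. -/
theorem exists_rates [Nonempty (Fin J)] (hN : N.IsTopology) (hβ : ∀ j, 0 < N.β j)
    (hρ : ∀ j, 0 < N.ρ j) (hp : p.IsPolicy N) {Cp : ℝ}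
    (hCp : ∀ w : Fin I → ℝ, (∀ i, 0 ≤ w i) → N.hhat w = N.hext Cp w) :
    ∃ smin smax vmin cM Cg : ℝ, 0 < smin ∧ smin ≤ 1 ∧ 1 ≤ smax ∧ 0 < vmin ∧ 0 < cM ∧ 0 ≤ Cg ∧
      (∀ r q j, p.x N r q j ≤ smax) ∧
      ∀ k : Consts, k.smin = smin → k.smax = smax → k.vmin = vmin → k.cM = cM → k.Cg = Cg →
        k.Cp = Cp → ∀ r q, (∀ j, 0 ≤ q j) → Rates N k (p.hi N r) q (p.x N r q) := by
  classical
  have hρmin : 0 < N.ρmin := iInf_pos_of_pos hρ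
  obtain ⟨vmin, hvmin, hv⟩ := exists_pos_le (P := fun i : Chi J × Fin J => i.1 i.2 = true)
    (f := fun i => p.vb i.1 i.2) fun i hi => hp.vb_pos i.1 i.2 hi
  obtain ⟨cM, hcM, hc⟩ := exists_pos_le (P := fun z : Chi J => z ∈ N.calM p.dir)
    (f := fun z => -(N.hβ ⬝ᵥ p.vc z + N.hβ ⬝ᵥ p.vb z)) fun z hz => neg_pos.2 (hp.cost_neg hz)
  obtain ⟨Cg, hCg0, hCg⟩ := Network.exists_gap_le_of_notMem hN hβ hp.isCostDirection hCp
  set D : Chi J × Fin J → ℝ := fun i => |p.vc i.1 i.2| + |p.vb i.1 i.2| with hD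
  have hD0 : ∀ i, 0 ≤ D i := fun i => by positivity
  set smax : ℝ := 1 + ∑ j, N.ρ j + ∑ i, D i with hsmax
  have hsρ : 0 ≤ ∑ j, N.ρ j := Finset.sum_nonneg fun j _ => (hρ j).le
  have hsD : 0 ≤ ∑ i, D i := Finset.sum_nonneg fun i _ => hD0 i
  have habs : ∀ r q j, |N.ρ j - p.x N r q j| ≤ ∑ i, D i := fun r q j => by
    rw [p.ρ_sub_x]
    refine le_trans ((abs_add_le _ _).trans (add_le_add ?_ le_rfl))
      (Finset.single_le_sum (f := D) (fun i _ => hD0 i) (Finset.mem_univ (p.Z N r q, j)))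
    split_ifs
    exacts [le_rfl, by simp]
  have hupper : ∀ r q j, p.x N r q j ≤ smax := fun r q j => by
    have h1 := (abs_le.1 (habs r q j)).1
    have h2 := Finset.single_le_sum (f := N.ρ) (fun j _ => (hρ j).le) (Finset.mem_univ j)
    rw [hsmax]; linarith
  refine ⟨min 1 (N.ρmin / 4), smax, vmin, cM, Cg, lt_min one_pos (by linarith), min_le_left _ _,
    by linarith, hvmin, hcM, hCg0, hupper, ?_⟩
  intro k e1 e2 e3 e4 e5 e6 r q hq
  set z := p.Z N r q with hz
  have hK : ∀ i, ∑ j, N.K i j * (N.ρ j - p.x N r q j) = (N.K *ᵥ p.vb z) i := fun i => by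
    simp only [p.ρ_sub_x, mul_add, Finset.sum_add_distrib]
    rw [← hz]
    have : ∑ j, N.K i j * (if z ∈ N.calM p.dir then p.vc z j else 0) = 0 := by
      by_cases hm : z ∈ N.calM p.dir
      · simp only [if_pos hm]
        exact congrFun (hp.vc_ker z hm) i
      · simp [hm]
    rw [this, zero_add]; rfl
  have hhi : 0 ≤ p.hi N r := by
    have := iInf_pos_of_pos hβ
    have := hp.c₁_pos.trans hp.c₁_lt_c₂
    unfold Policy.hi; positivity
  refine ⟨fun j => ?_, fun j => ?_, fun j => ?_, fun i => ?_, fun i => ?_, fun j hj => ?_, ?_⟩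
  · rw [e1]; exact (min_le_right _ _).trans (hp.x_ge hρ r q j)
  · rw [e2]; exact hupper r q j
  · rw [e2]; exact (habs r q j).trans (by rw [hsmax]; linarith)
  · rw [hK]
    by_cases hi : i ∈ N.calA z
    · exact (hp.vb_full z i hi).ge
    · change 0 ≤ ∑ j, N.K i j * p.vb z j
      refine Finset.sum_nonneg fun j _ => ?_
      rcases hN.zero_or_one i j with h0 | h1
      · rw [h0, zero_mul]
      · rw [h1, one_mul]
        refine (hp.vb_pos z j ?_).le
        by_contra hzj
        exact hi ⟨j, h1, by simpa using hzj⟩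
  · rintro ⟨j, h1, h2⟩
    rw [hK]
    refine hp.vb_full z i ⟨j, h1, ?_⟩
    have := (p.Z_eq_true N r q j).not.2 (not_lt.2 h2)
    simpa using this
  · have hzj : z j = true := (p.Z_eq_true N r q j).2 hj
    rw [e3, p.ρ_sub_x, ← hz]
    have h1 := hv (z, j) hzj
    split_ifs with hm
    · have := hp.vc_nonneg z hm j hzj
      linarith
    · linarith
  · rw [e4, e5, e6]
    by_cases hm : z ∈ N.calM p.dir
    · left
      have h1 := hc z hm
      have h2 : ∑ j, N.h j * N.β j * (N.ρ j - p.x N r q j) = N.hβ ⬝ᵥ p.vc z + N.hβ ⬝ᵥ p.vb z := by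
        rw [← dotProduct_add]
        refine Finset.sum_congr rfl fun j _ => ?_
        rw [p.ρ_sub_x, ← hz, if_pos hm]; rfl
      rw [h2]; linarith
    · exact Or.inr (hCg z hm q hq _ hhi fun j hj => ((p.Z_eq_true N r q j).1 hj).le)

variable {Ω : Type*} [MeasurableSpace Ω] {X : Primitives J Ω} {P : Measure Ω}

theorem tendsto_of_tendsto_mul_sub {u : ℕ → ℝ} {a b : ℝ}
    (h : Tendsto (fun r : ℕ => (r : ℝ) * (u r - a)) atTop (𝓝 b)) : Tendsto u atTop (𝓝 a) := by
  have h1 := h.mul tendsto_inv_atTop_nhds_zero_nat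
  rw [mul_zero] at h1
  have h2 : Tendsto (fun r => u r - a) atTop (𝓝 0) := by
    refine h1.congr' ?_
    filter_upwards [eventually_gt_atTop 0] with r hr
    have : (r : ℝ) ≠ 0 := by exact_mod_cast hr.ne'
    field_simp
  simpa using h2.add_const a

/-- Arrival and service rates of the `r`-th system. -/
def rates (X : Primitives J Ω) (P : Measure Ω) (r : ℕ) : Idx J → ℝ :=
  Sum.elim (X.αr P r) (X.βr P r)

/-- The heavy traffic condition in terms of constants independent of `r`. -/
theorem exists_near (hH : X.HeavyTraffic P N) :
    ∃ g₀ g₁ c₀ C₀ : ℝ, 0 < g₀ ∧ 0 < g₁ ∧ 0 < c₀ ∧ 0 < C₀ ∧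
      ∀ k : Consts, k.g₀ = g₀ → k.g₁ = g₁ → k.c₀ = c₀ → k.C₀ = C₀ →
        ∀ᶠ r in atTop, Near N k r (rates X P r) := by
  have tα := fun j => tendsto_of_tendsto_mul_sub (hH.lim_α j)
  have tβ := fun j => tendsto_of_tendsto_mul_sub (hH.lim_β j)
  set lim : Idx J → ℝ := Sum.elim N.α N.β with hlim
  have hlim0 : ∀ a, 0 < lim a := fun a => by
    rcases a with j | j
    exacts [hH.α_pos j, hH.β_pos j]
  have tlim : ∀ a, Tendsto (fun r => rates X P r a) atTop (𝓝 (lim a)) := fun a => by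
    rcases a with j | j
    exacts [tα j, tβ j]
  obtain ⟨g, hg0, hg⟩ := exists_pos_le (P := fun _ : Idx J => True) fun a _ => hlim0 a
  obtain ⟨c, hc0, hc⟩ := exists_pos_le (P := fun _ : Fin I => True) (f := fun i => -N.θ i)
    fun i _ => neg_pos.2 (hH.θ_neg i)
  set D : Fin J → ℝ := fun j => N.αbar j - N.βbar j * N.ρ j with hD
  have tD : ∀ j, Tendsto (fun r : ℕ => (r : ℝ) * (X.αr P r j - X.βr P r j * N.ρ j)) atTop
      (𝓝 (D j)) := fun j => by
    refine ((hH.lim_α j).sub ((hH.lim_β j).mul_const (N.ρ j))).congr fun r => ?_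
    have : N.α j = N.β j * N.ρ j := by
      rw [Network.ρ, mul_div_cancel₀ _ (hH.β_pos j).ne']
    rw [this]; ring
  have hbd : ∀ {u : ℕ → ℝ} {b : ℝ}, Tendsto u atTop (𝓝 b) → ∀ C, |b| < C → ∀ᶠ r in atTop, |u r| ≤ C :=
    fun h C hC => (h.abs).eventually_le_const hC
  set g₁ : ℝ := 1 + ∑ a, lim a with hg₁
  have hlg : ∀ a, lim a < g₁ := fun a => by
    have := Finset.single_le_sum (f := lim) (fun a _ => (hlim0 a).le) (Finset.mem_univ a)
    rw [hg₁]; linarith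
  set C₀ : ℝ := 1 + ∑ j, (|D j| + |N.βbar j|) with hC₀
  have hC : ∀ j, |D j| + |N.βbar j| < C₀ := fun j => by
    have := Finset.single_le_sum (f := fun j => |D j| + |N.βbar j|)
      (fun j _ => by positivity) (Finset.mem_univ j)
    rw [hC₀]; linarith
  have hθ : ∀ i, Tendsto (fun r : ℕ => ∑ j, N.K i j *
      ((r : ℝ) * (X.αr P r j - X.βr P r j * N.ρ j) / X.βr P r j)) atTop (𝓝 (N.θ i)) := fun i => by
    have : N.θ i = ∑ j, N.K i j * (D j / N.β j) := by
      change ∑ j, N.K i j * N.η j = _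
      refine Finset.sum_congr rfl fun j _ => ?_
      have := (hH.β_pos j).ne'
      simp only [Network.η, hD, Network.ρ]
      field_simp
    rw [this]
    exact tendsto_finsetSum _ fun j _ => ((tD j).div (tβ j) (hH.β_pos j).ne').const_mul _
  have hg1 : 0 < g₁ := by
    have := Finset.sum_nonneg fun a (_ : a ∈ Finset.univ) => (hlim0 a).le
    rw [hg₁]; linarith
  have hC1 : 0 < C₀ := by rw [hC₀]; positivity
  refine ⟨g / 2, g₁, c / 2, C₀, by positivity, hg1, by positivity, hC1, ?_⟩
  intro k e1 e2 e3 e4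
  have a1 : ∀ᶠ r in atTop, ∀ a, g / 2 ≤ rates X P r a := eventually_all.2 fun a =>
    (tlim a).eventually_const_le (by linarith [hg a trivial])
  have a2 : ∀ᶠ r in atTop, ∀ a, rates X P r a ≤ g₁ := eventually_all.2 fun a =>
    (tlim a).eventually_le_const (hlg a)
  have a3 : ∀ᶠ r : ℕ in atTop, ∀ j, |(r : ℝ) * (X.αr P r j - X.βr P r j * N.ρ j)| ≤ C₀ :=
    eventually_all.2 fun j => hbd (tD j) _ (by linarith [hC j, abs_nonneg (N.βbar j)])
  have a4 : ∀ᶠ r : ℕ in atTop, ∀ j, |(r : ℝ) * (X.βr P r j - N.β j)| ≤ C₀ :=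
    eventually_all.2 fun j => hbd (hH.lim_β j) _ (by linarith [hC j, abs_nonneg (D j)])
  have a5 : ∀ᶠ r : ℕ in atTop, ∀ i, ∑ j, N.K i j *
      ((r : ℝ) * (X.αr P r j - X.βr P r j * N.ρ j) / X.βr P r j) ≤ -(c / 2) :=
    eventually_all.2 fun i => (hθ i).eventually_le_const (by linarith [hc i trivial])
  filter_upwards [a1, a2, a3, a4, a5, eventually_ge_atTop 1] with r b1 b2 b3 b4 b5 b6
  have hr : (0 : ℝ) < r := by exact_mod_cast b6
  refine ⟨b6, by rw [e1]; exact b1, by rw [e2]; exact b2, fun j => ?_, fun j => ?_, fun j => ?_,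
    fun i => ?_⟩
  · rw [e1]; have : g ≤ N.β j := hg (Sum.inr j) trivial
    linarith
  · rw [e4, le_div_iff₀ hr, mul_comm]
    have := b3 j
    rwa [abs_mul, abs_of_pos hr] at this
  · rw [e4, le_div_iff₀ hr, mul_comm]
    have := b4 j
    rwa [abs_mul, abs_of_pos hr] at this
  · rw [e3, le_div_iff₀ hr, Finset.sum_mul]
    refine le_trans (le_of_eq (Finset.sum_congr rfl fun j _ => ?_)) (b5 i)
    have : X.βr P r j ≠ 0 := by
      have : g / 2 ≤ X.βr P r j := b1 (Sum.inr j)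
      linarith
    simp only [rates, Sum.elim_inl, Sum.elim_inr]
    field_simp

end Constants
end RSN
end

noncomputable section

namespace RSN

/-! ### The laws of the primitives -/

section Laws

variable {J : ℕ} {Ω : Type*} [MeasurableSpace Ω] {X : Primitives J Ω} {P : Measure Ω}

/-- The interarrival times and job sizes as one family. -/
def noise (X : Primitives J Ω) (r : ℕ) : Idx J → ℕ → Ω → ℝ := Sum.elim (X.u r) (X.v r)

theorem measurable_noise (hX : X.IsPrimitives P) {r : ℕ} (hr : 1 ≤ r) (a : Idx J) (l : ℕ) :
    Measurable (noise X r a l) := by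
  rcases a with j | j
  exacts [hX.meas_u r hr j l, hX.meas_v r hr j l]

theorem noise_identDistrib (hX : X.IsPrimitives P) {r : ℕ} (hr : 1 ≤ r) (a : Idx J) (l : ℕ) :
    IdentDistrib (noise X r a l) (noise X r a 0) P P := by
  rcases a with j | j
  exacts [hX.ident_u r hr j l, hX.ident_v r hr j l]

theorem iIndepFun_noise (hX : X.IsPrimitives P) {r : ℕ} (hr : 1 ≤ r) :
    iIndepFun (fun i : Idx J × ℕ => noise X r i.1 i.2) P := by
  have h := (hX.indep r hr).precomp (g := fun i : Idx J × ℕ =>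
    Sum.elim (fun j => Sum.inl (j, i.2)) (fun j => Sum.inr (j, i.2)) i.1) (by
      rintro ⟨j | j, l⟩ ⟨j' | j', l'⟩ h <;> simp_all)
  convert h using 1
  funext i
  rcases i with ⟨j | j, l⟩ <;> rfl

theorem noise_pos (hX : X.IsPrimitives P) {r : ℕ} (hr : 1 ≤ r) :
    ∀ᵐ ω ∂P, ∀ a l, 0 < noise X r a l ω := by
  refine ae_all_iff.2 fun a => ae_all_iff.2 fun l => ?_
  have h0 : ∀ᵐ ω ∂P, 0 < noise X r a 0 ω := by
    rcases a with j | j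
    exacts [hX.pos_u r hr j, hX.pos_v r hr j]
  exact (noise_identDistrib hX hr a l).symm.ae_snd (p := fun u => 0 < u) measurableSet_Ioi h0

theorem memLp_noise (hX : X.IsPrimitives P) {r : ℕ} (hr : 1 ≤ r) (a : Idx J) :
    MemLp (noise X r a 0) 2 P := by
  rcases a with j | j
  exacts [hX.sq_u r hr j, hX.sq_v r hr j]

/-- Partial sums of the renewal intervals diverge. -/
theorem tendsto_sum_noise [IsProbabilityMeasure P] (hX : X.IsPrimitives P) {r : ℕ} (hr : 1 ≤ r) :
    ∀ᵐ ω ∂P, ∀ a, Tendsto (fun n => ∑ l ∈ Finset.range n, noise X r a l ω) atTop atTop := by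
  refine ae_all_iff.2 fun a => ?_
  have hint := (memLp_noise hX hr a).integrable one_le_two
  have h1 := strong_law_ae_real (fun l => noise X r a l) hint
    (fun i j hij => (iIndepFun_noise hX hr).indepFun (i := (a, i)) (j := (a, j)) (by simpa using hij))
    (noise_identDistrib hX hr a)
  have hpos : 0 < ∫ ω, noise X r a 0 ω ∂P := by
    have h0 : ∀ᵐ ω ∂P, 0 < noise X r a 0 ω := by
      filter_upwards [noise_pos hX hr] with ω hω using hω a 0
    have h0' : 0 ≤ᵐ[P] noise X r a 0 := h0.mono fun ω h => h.le
    refine lt_of_le_of_ne (integral_nonneg_of_ae h0') fun h2 => ?_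
    replace h2 := (integral_eq_zero_iff_of_nonneg_ae h0' hint).1 h2.symm
    have h3 : ∀ᵐ ω ∂P, False := by
      filter_upwards [h0, h2] with ω h3 h4
      exact h3.ne' h4
    simp only [eventually_false_iff_eq_bot, ae_eq_bot] at h3
    exact IsProbabilityMeasure.ne_zero P h3
  filter_upwards [h1] with ω hω
  have h2 := hω.pos_mul_atTop hpos tendsto_natCast_atTop_atTop
  refine h2.congr' ?_
  filter_upwards [eventually_gt_atTop 0] with n hn
  exact div_mul_cancel₀ _ (by exact_mod_cast hn.ne')

/-- Exponential moments bounded uniformly in `r`. -/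
theorem exists_mgfBound [IsProbabilityMeasure P] (hX : X.IsPrimitives P) :
    ∃ δ K : ℝ, 0 < δ ∧ 0 ≤ K ∧ ∀ r ≥ 1, ∀ a,
      MgfBound δ K (rates X P r a) (P.map (noise X r a 0)) := by
  obtain ⟨δ, hδ, h⟩ := hX.mgf
  have h' : ∀ a : Idx J, ∃ c : ℝ, ∀ r ≥ 1,
      ∫⁻ ω, ENNReal.ofReal (Real.exp (δ / 2 * noise X r a 0 ω)) ∂P ≤ ENNReal.ofReal c := fun a => by
    rcases a with j | j
    exacts [(h (δ / 2) (by linarith) j).2, (h (δ / 2) (by linarith) j).1]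
  choose c hc using h'
  refine ⟨δ / 2, ∑ a, |c a|, by positivity, by positivity, fun r hr a => ?_⟩
  have hm := measurable_noise hX hr a 0
  have hexp : Measurable fun u : ℝ => Real.exp (δ / 2 * u) := by fun_prop
  have hlint : ∫⁻ u, ENNReal.ofReal (Real.exp (δ / 2 * u)) ∂(P.map (noise X r a 0)) ≤
      ENNReal.ofReal (c a) := by
    rw [lintegral_map hexp.ennreal_ofReal hm]; exact hc a r hr
  have hint : Integrable (fun u : ℝ => Real.exp (δ / 2 * u)) (P.map (noise X r a 0)) := by
    refine ⟨hexp.aestronglyMeasurable, ?_⟩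
    rw [hasFiniteIntegral_iff_ofReal (Eventually.of_forall fun u => (Real.exp_pos _).le)]
    exact hlint.trans_lt ENNReal.ofReal_lt_top
  refine ⟨Measure.isProbabilityMeasure_map hm.aemeasurable, ?_, ?_, ?_, hint, ?_⟩
  · rw [ae_map_iff hm.aemeasurable measurableSet_Ioi]
    filter_upwards [noise_pos hX hr] with ω hω using hω a 0
  · exact (integrable_map_measure (by fun_prop) hm.aemeasurable).2
      ((memLp_noise hX hr a).integrable one_le_two)
  · rw [integral_map hm.aemeasurable (by fun_prop)]
    rcases a with j | j
    exacts [(inv_inv _).symm, (inv_inv _).symm]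
  · rw [integral_eq_lintegral_of_nonneg_ae (Eventually.of_forall fun u => (Real.exp_pos _).le)
      hexp.aestronglyMeasurable]
    refine (ENNReal.toReal_mono ENNReal.ofReal_ne_top (hlint.trans
      (ENNReal.ofReal_le_ofReal ?_))).trans_eq (ENNReal.toReal_ofReal (by positivity))
    exact (le_abs_self _).trans (Finset.single_le_sum (f := fun a => |c a|)
      (fun _ _ => abs_nonneg _) (Finset.mem_univ a))

/-- The laws of the primitives satisfy the jump inequalities with constants independent of `r`. -/
theorem exists_jumpLaw [IsProbabilityMeasure P] (hX : X.IsPrimitives P) {g₁ : ℝ} (hg : 0 < g₁) :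
    ∃ Λ s₀ s₁ y K η : ℝ, 0 ≤ Λ ∧ 0 < s₀ ∧ 0 < s₁ ∧ 0 < y ∧ 0 ≤ K ∧ 0 < η ∧ 2 * Λ * s₀ ≤ 1 ∧
      ∀ r ≥ 1, (∀ a, 0 < rates X P r a ∧ rates X P r a ≤ g₁) →
        JumpLaw (rates X P r) Λ s₀ s₁ y K η fun a => P.map (noise X r a 0) := by
  obtain ⟨δ, K, hδ, hK, hM⟩ := exists_mgfBound hX
  -- `Λ` dominates the second order term of the moment generating functions; `s₀`, `y` and `s₁` keep
  -- all exponents below `δ`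
  set Λ : ℝ := 32 / δ ^ 2 * K * g₁ ^ 2 with hΛ
  have hΛ0 : 0 ≤ Λ := by positivity
  set s₀ : ℝ := min (1 / (2 * Λ + 1)) (δ / (4 * g₁)) with hs₀
  set y : ℝ := min (δ / 4) (1 / (64 / δ ^ 2 * K * g₁ + 1)) with hy
  set s₁ : ℝ := min s₀ (y / (2 * g₁)) with hs₁
  have hs₀p : 0 < s₀ := lt_min (by positivity) (by positivity)
  have hyp : 0 < y := lt_min (by positivity) (by positivity)
  have hs₁p : 0 < s₁ := lt_min hs₀p (by positivity)
  have h1 : 2 * Λ * s₀ ≤ 1 := by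
    have := min_le_left (1 / (2 * Λ + 1)) (δ / (4 * g₁))
    rw [← hs₀, le_div_iff₀ (by positivity)] at this
    nlinarith
  have h2 : 4 * g₁ * s₀ ≤ δ := by
    have := min_le_right (1 / (2 * Λ + 1)) (δ / (4 * g₁))
    rw [← hs₀, le_div_iff₀ (by positivity)] at this
    linarith
  have h3 : 4 * y ≤ δ := by linarith [min_le_left (δ / 4) (1 / (64 / δ ^ 2 * K * g₁ + 1))]
  have h4 : 64 / δ ^ 2 * K * g₁ * y ≤ 1 := by
    have := min_le_right (δ / 4) (1 / (64 / δ ^ 2 * K * g₁ + 1))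
    rw [← hy, le_div_iff₀ (by positivity)] at this
    linarith
  have h5 : 2 * g₁ * s₁ ≤ y := by
    have := min_le_right s₀ (y / (2 * g₁))
    rw [← hs₁, le_div_iff₀ (by positivity)] at this
    linarith
  have hη : 0 < 1 - Real.exp (-(y / (2 * g₁))) := by
    rw [sub_pos, Real.exp_lt_one_iff]
    have : 0 < y / (2 * g₁) := by positivity
    linarith
  set K' : ℝ := Real.exp s₀ * K + (2 + 2 * g₁ ^ 2 * (2 / δ ^ 2 * K)) with hK'
  have hb : ∀ s, |s| ≤ s₀ → Λ * |s| ≤ 1 := fun s hs => by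
    have := mul_le_mul_of_nonneg_left hs hΛ0
    nlinarith
  refine ⟨Λ, s₀, s₁, y, K', 1 - Real.exp (-(y / (2 * g₁))), hΛ0, hs₀p, hs₁p, hyp, by positivity, hη,
    h1, fun r hr hγ => ?_⟩
  have M := hM r hr
  refine ⟨fun a => (M a).prob, fun a => (M a).pos, fun a => (M a).int_id,
    fun a => (M a).integrable_sq hδ, fun a => ?_, fun a => ?_,
    fun a c hc => (M a).integrable_exp (hc.trans h3), fun a s hs => ?_, fun a s hs c hc => ?_,
    fun a s hs => ?_⟩
  · have := (M a).prob
    rw [integral_sub (integrable_const _) ((M a).int_id.const_mul _), integral_const_mul,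
      (M a).mean, mul_inv_cancel₀ (hγ a).1.ne']
    simp
  · have := (M a).prob
    have hsq := (M a).integrable_sq hδ
    have e1 : ∫ u, (1 - rates X P r a * u) ^ 2 ∂(P.map (noise X r a 0)) ≤
        ∫ u, (2 + 2 * g₁ ^ 2 * u ^ 2) ∂(P.map (noise X r a 0)) := by
      refine integral_mono_of_nonneg (Eventually.of_forall fun u => sq_nonneg _)
        ((integrable_const _).add (hsq.const_mul _)) (Eventually.of_forall fun u => ?_)
      have : rates X P r a ^ 2 * u ^ 2 ≤ g₁ ^ 2 * u ^ 2 :=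
        mul_le_mul_of_nonneg_right (pow_le_pow_left₀ (hγ a).1.le (hγ a).2 2) (sq_nonneg u)
      dsimp only
      nlinarith [sq_nonneg (1 + rates X P r a * u)]
    rw [integral_add (integrable_const _) (hsq.const_mul _), integral_const_mul, integral_const,
      probReal_univ, one_smul] at e1
    have e2 := mul_le_mul_of_nonneg_left ((M a).integral_sq_le hδ)
      (show 0 ≤ 2 * g₁ ^ 2 by positivity)
    have e3 : 0 ≤ Real.exp s₀ * K := by positivity
    rw [hK']; linarith
  · exact (M a).exp_mul_integral_le_one hδ (hγ a).1 (hγ a).2 le_rfl (hb s hs)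
      ((mul_le_mul_of_nonneg_left hs (by positivity)).trans h2)
  · have e1 : Real.exp s ≤ Real.exp s₀ := Real.exp_le_exp.2 ((le_abs_self s).trans hs)
    have e2 := mul_le_mul e1 ((M a).integral_exp_le (hc.trans h3))
      (integral_nonneg fun u => (Real.exp_pos _).le) (Real.exp_pos _).le
    refine e2.trans ?_
    rw [hK']
    exact le_add_of_nonneg_right (by positivity)
  · rw [sub_sub_cancel]
    exact (M a).exp_mul_integral_le_exp_neg hδ (hγ a).1 (hγ a).2 hΛ0 hyp
      (hb s (hs.trans (min_le_left _ _)))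
      ((mul_le_mul_of_nonneg_left hs (by positivity)).trans h5) h3 h4

end Laws

/-! ### Means of the initial exponentials -/

section Initial

variable {I J : ℕ}

/-- `f` is integrable with mean at most `C`. -/
def MeanLe {α : Type*} [MeasurableSpace α] (μ : Measure α) (f : α → ℝ) (C : ℝ) : Prop :=
  Integrable f μ ∧ ∫ x, f x ∂μ ≤ C

theorem MeanLe.add {α : Type*} [MeasurableSpace α] {μ : Measure α} {f g : α → ℝ} {C D : ℝ}
    (hf : MeanLe μ f C) (hg : MeanLe μ g D) : MeanLe μ (fun x => f x + g x) (C + D) :=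
  ⟨hf.1.add hg.1, by rw [integral_add hf.1 hg.1]; exact add_le_add hf.2 hg.2⟩

theorem MeanLe.const_mul {α : Type*} [MeasurableSpace α] {μ : Measure α} {f : α → ℝ} {C c : ℝ}
    (hf : MeanLe μ f C) (hc : 0 ≤ c) : MeanLe μ (fun x => c * f x) (c * C) :=
  ⟨hf.1.const_mul c, by rw [integral_const_mul]; exact mul_le_mul_of_nonneg_left hf.2 hc⟩

theorem MeanLe.sum {α ι : Type*} [MeasurableSpace α] {μ : Measure α} {s : Finset ι}
    {f : ι → α → ℝ} {C : ℝ} (hf : ∀ i, MeanLe μ (f i) C) :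
    MeanLe μ (fun x => ∑ i ∈ s, f i x) (s.card * C) :=
  ⟨integrable_finsetSum _ fun i _ => (hf i).1, by
    rw [integral_finsetSum _ fun i _ => (hf i).1, ← nsmul_eq_mul]
    exact Finset.sum_le_card_nsmul _ _ _ fun i _ => (hf i).2⟩

theorem MeanLe.mono {α : Type*} [MeasurableSpace α] {μ : Measure α} {f : α → ℝ} {C D : ℝ}
    (hf : MeanLe μ f C) (h : C ≤ D) : MeanLe μ f D := ⟨hf.1, hf.2.trans h⟩

variable {N : Network I J} {γ : Idx J → ℝ} {Λ s₀ s₁ y K η : ℝ} {m : Idx J → Measure ℝ}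

/-- Exponentials of the initial configuration, when the initial residual times are at most `M`. -/
theorem meanLe_expo_start (hm : JumpLaw γ Λ s₀ s₁ y K η m) (hs₀ : 0 ≤ s₀) (hy : 0 ≤ y) (lo hi : ℝ)
    {x : Config J} {M : ℝ} (hx0 : ∀ a, 0 ≤ x.2.1 a) (hxM : ∀ a, x.2.1 a ≤ M)
    {σ : Fin J → ℝ} {c : Idx J → ℝ} (hc : ∀ a, c a ≤ 4 * y) {s : ℝ} (hs : ∑ j, σ j * x.1 j ≤ s) :
    MeanLe (Measure.pi m) (fun z => expo σ c (start lo hi x z))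
      (Real.exp s * (max K (Real.exp (4 * y * M))) ^ Fintype.card (Idx J)) := by
  have := hm.prob
  have e : ∀ z, expo σ c (start lo hi x z) = Real.exp (∑ j, σ j * x.1 j) *
      ∏ a, (fun a u => if x.2.1 a ≤ 0 then Real.exp (c a * u) else Real.exp (c a * x.2.1 a)) a (z a) :=
    fun z => by
      rw [expo_eq_prod]
      congr 1
      refine Finset.prod_congr rfl fun a _ => ?_
      simp only [start]
      split_ifs <;> rfl
  have hint : ∀ a, Integrable (fun u => if x.2.1 a ≤ 0 then Real.exp (c a * u) else
      Real.exp (c a * x.2.1 a)) (m a) := fun a => by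
    by_cases h : x.2.1 a ≤ 0
    · simp only [h, if_true]; exact hm.int_exp a _ (hc a)
    · simp only [h, if_false]; exact integrable_const _
  simp only [e]
  refine ⟨(Integrable.fintype_prod hint).const_mul _, ?_⟩
  rw [integral_const_mul, integral_fintype_prod_eq_prod (f := fun a u =>
    if x.2.1 a ≤ 0 then Real.exp (c a * u) else Real.exp (c a * x.2.1 a))]
  refine mul_le_mul (Real.exp_le_exp.2 hs) ?_ (Finset.prod_nonneg fun a _ =>
    integral_nonneg fun u => by dsimp only; split_ifs <;> positivity) (Real.exp_pos _).le
  rw [← Finset.card_univ, ← Finset.prod_const]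
  refine Finset.prod_le_prod (fun a _ => integral_nonneg fun u => by
    dsimp only; split_ifs <;> positivity) fun a _ => ?_
  by_cases h : x.2.1 a ≤ 0
  · simp only [h, if_true]
    have := hm.up a 0 (by simpa using hs₀) (c a) (hc a)
    rw [Real.exp_zero, one_mul] at this
    exact this.trans (le_max_left _ _)
  · simp only [h, if_false]
    rw [integral_const, probReal_univ, one_smul]
    refine le_trans (Real.exp_le_exp.2 ?_) (le_max_right _ _)
    exact mul_le_mul (hc a) (hxM a) (hx0 a) (by linarith)

/-- Bound for the exponentials of the initial configuration. -/
def expoC (k : Consts) (J : ℕ) (lam y K M : ℝ) : ℝ :=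
  Real.exp (J * (lam / k.g₀ * M)) * (max K (Real.exp (4 * y * M))) ^ Fintype.card (Idx J)

/-- Bound for the initial value of the Lyapunov function. -/
def startC (w : LyapC) (k : Consts) (I J : ℕ) (L Cb K M : ℝ) : ℝ :=
  w.A * (I * (2 * expoC k J w.lam w.y K M)) +
  w.A₃ * ((I + 1) * (Fintype.card (Idx J) * ((1 + w.G) * expoC k J w.lam w.y K M))) +
  w.B * ((I + 1) * (J * ((Real.exp w.c₂ + w.B₁) * expoC k J w.lam w.y K M))) +
  YsqC k I J L Cb w.lam w.y * ((I + 1) * (Fintype.card (Idx J) * expoC k J w.lam w.y K M)) +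
  3 * (4 * k.Cp * I * w.Cl + Fintype.card (Idx J)) ^ 2

end Initial
end RSN
end

noncomputable section

namespace RSN

/-! ### Bound for the initial value -/

section InitialBound

variable {I J : ℕ}

theorem card_option_fin : ((Finset.univ : Finset (Option (Fin I))).card : ℝ) = I + 1 := by
  simp [Finset.card_univ]

theorem sum_le_sq_mul_sum {r b X₁ X₂ X₃ X₄ c c' : ℝ} (hr : 1 ≤ r) (hb : 1 ≤ b) (h₁ : 0 ≤ X₁)
    (h₂ : 0 ≤ X₂) (h₃ : 0 ≤ X₃) (h₄ : 0 ≤ X₄) (hc : c ≤ (r * b) ^ 2 * c') :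
    r ^ 2 * X₁ + X₃ + r * b * X₂ + r ^ 2 * X₄ + c ≤ (r * b) ^ 2 * (X₁ + X₃ + X₂ + X₄ + c') := by
  have hrb : 1 ≤ r * b := one_le_mul_of_one_le_of_one_le hr hb
  have h5 : r ^ 2 ≤ (r * b) ^ 2 := by
    rw [mul_pow]; exact le_mul_of_one_le_right (by positivity) (one_le_pow₀ hb)
  have h6 : r * b ≤ (r * b) ^ 2 := by nlinarith
  have q1 := mul_le_mul_of_nonneg_right h5 h₁
  have q4 := mul_le_mul_of_nonneg_right h5 h₄
  have q2 := mul_le_mul_of_nonneg_right h6 h₂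
  have q3 := mul_le_mul_of_nonneg_right (hrb.trans h6) h₃
  linarith

set_option maxHeartbeats 1000000 in
/-- The initial value of the Lyapunov function is of order `r² b²`. -/
theorem LyapC.lintegral_start_le [Nonempty (Idx J)] {N : Network I J} (hN : N.IsTopology)
    {k : Consts} {w : LyapC} {L Cb s₀ s₁ K η : ℝ} (hw : w.Good k I J L Cb s₀ s₁ K η)
    (hg : GapBound N k.Cp L Cb) {r : ℕ} (hr : w.Large N k L Cb s₀ s₁ r) {γ : Idx J → ℝ}
    (hγ : Near N k r γ) {m : Idx J → Measure ℝ} (hm : JumpLaw γ w.Λ s₀ s₁ w.y K η m)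
    (hz : ∀ᵐ z ∂Measure.pi m, ∀ a, 0 < z a) {x : Config J} {M : ℝ} (hM : 0 ≤ M)
    (hq : ∀ j, 0 ≤ x.1 j) (hqM : ∀ j, x.1 j ≤ r * M) (hx0 : ∀ a, 0 ≤ x.2.1 a)
    (hxM : ∀ a, x.2.1 a ≤ M) :
    ∫⁻ z, ENNReal.ofReal (w.W N k.Cp r γ (start (w.c₁ * w.b r) (w.c₂ * w.b r) x z)) ∂Measure.pi m ≤
      ENNReal.ofReal (startC w k I J L Cb K M * (r * w.b r) ^ 2) := by
  have hp := hw.toPos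
  have hr1 := hγ.r_pos
  have hb1 := hr.one_le_b
  have hb0 : 0 < w.b r := by linarith
  have hlam := hp.lam_pos
  have hΛ := hp.Λ_nonneg
  have hy := hp.y_pos
  have hθ := hp.θ_pos
  have hG := hp.G_nonneg
  have hA := hp.A_nonneg
  have hB := hp.B_nonneg
  have hA₃ := hp.A₃_nonneg
  have hB₁ := hp.B₁_nonneg
  have hCl := hp.Cl_pos
  have hCχ := hp.Cχ_nonneg
  have hK := hw.K_nonneg
  have hg0 := k.g₀_pos
  have hg1 := k.g₁_pos
  have hCp := k.Cp_nonneg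
  set lo := w.c₁ * w.b r with hlo
  set hi := w.c₂ * w.b r with hhi
  set E := expoC k J w.lam w.y K M with hE
  have hlohi : lo ≤ hi := mul_le_mul_of_nonneg_right hp.c₁_lt_c₂.le hb0.le
  have hE0 : 0 ≤ E := by rw [hE, expoC]; positivity
  set σ : Option (Fin I) → Fin J → ℝ := wt N γ w.lam r with hσ
  have hσ0 : ∀ o j, 0 ≤ σ o j := fun o j => wt_nonneg hN hγ.γ_pos hlam.le r o j
  have hσq0 : ∀ o, 0 ≤ ∑ j, σ o j * x.1 j := fun o =>
    Finset.sum_nonneg fun j _ => mul_nonneg (hσ0 o j) (hq j)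
  have hσq : ∀ o, ∑ j, σ o j * x.1 j ≤ J * (w.lam / k.g₀ * M) := fun o => by
    have : ∀ j, σ o j * x.1 j ≤ w.lam / k.g₀ * M := fun j => by
      have h1 := mul_le_mul (wt_le hN hγ hlam.le o j) (hqM j) (hq j) (by positivity)
      refine h1.trans_eq ?_
      field_simp
    refine (Finset.sum_le_sum fun j _ => this j).trans_eq ?_
    simp
  have hcf : ∀ o a, |cf w.Λ γ (σ o) a| ≤ w.y ∧ |cf w.Λ γ (-σ o) a| ≤ w.y := fun o a =>
    ⟨(abs_cf_wt_le hN hγ hlam.le hΛ o a).1.trans hr.cf_le,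
      (abs_cf_wt_le hN hγ hlam.le hΛ o a).2.trans hr.cf_le⟩
  have hcf' : ∀ t, 0 ≤ t → t ≤ w.θ → ∀ o j a, cf w.Λ γ (σ o - Pi.single j t) a ≤ 2 * w.y :=
    fun t ht0 ht o j a => by
      have h1 : |sg (σ o - Pi.single j t) a| ≤ 2 * w.θ := by
        rw [sg_sub]
        have h2 := (abs_sg_wt_le hN hγ hlam.le o a).trans hr.lam_θ
        have h3 : |sg (Pi.single j t : Fin J → ℝ) a| ≤ t := by
          rcases a with i | i <;> by_cases hij : i = j
          · subst hij; simp [sg, abs_of_nonneg ht0]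
          · simpa [sg, hij] using ht0
          · subst hij; simp [sg, abs_of_nonneg ht0]
          · simpa [sg, hij] using ht0
        exact (abs_sub _ _).trans (by linarith)
      have h4 := abs_cf_le hΛ (fun a => (hγ.γ_pos a).le) hγ.le_g₁ h1
      have h5 : k.g₁ * (2 * w.θ + w.Λ * (2 * w.θ) ^ 2) ≤ 2 * w.y := by
        have e1 := mul_le_mul_of_nonneg_left hw.Λθ (show 0 ≤ 2 * k.g₁ * w.θ by positivity)
        nlinarith [hw.θ_le_y]
      exact (le_abs_self _).trans (h4.trans h5)
  -- means of the exponentials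
  have key : ∀ (τ : Fin J → ℝ) (c : Idx J → ℝ) (e : ℝ), (∀ a, c a ≤ 4 * w.y) →
      ∑ j, τ j * x.1 j ≤ J * (w.lam / k.g₀ * M) + e →
      MeanLe (Measure.pi m) (fun z => expo τ c (start lo hi x z)) (Real.exp e * E) :=
    fun τ c e hc hs => by
      have h1 := meanLe_expo_start hm hw.s₀_pos.le hy.le lo hi hx0 hxM hc hs
      rw [Real.exp_add] at h1
      exact h1.mono (le_of_eq (by rw [hE, expoC]; ring))
  have key0 : ∀ (τ : Fin J → ℝ) (c : Idx J → ℝ), (∀ a, c a ≤ 4 * w.y) →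
      ∑ j, τ j * x.1 j ≤ J * (w.lam / k.g₀ * M) →
      MeanLe (Measure.pi m) (fun z => expo τ c (start lo hi x z)) E := fun τ c hc hs => by
    simpa using key τ c 0 hc (by simpa using hs)
  have hneg : ∀ o, ∑ j, (-σ o) j * x.1 j ≤ J * (w.lam / k.g₀ * M) := fun o => by
    have : ∑ j, (-σ o) j * x.1 j = -∑ j, σ o j * x.1 j := by simp
    rw [this]
    have : (0 : ℝ) ≤ J * (w.lam / k.g₀ * M) := by positivity
    linarith [hσq0 o]
  have hle : ∀ {t : ℝ}, |t| ≤ w.y → t ≤ w.y := fun h => (le_abs_self _).trans h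
  have m1 : MeanLe (Measure.pi m) (fun z => V₁ N γ w.Λ w.lam r (start lo hi x z)) (I * (2 * E)) := by
    have h1 : ∀ i : Fin I, MeanLe (Measure.pi m) (fun z =>
        expo (σ (some i)) (cf w.Λ γ (σ (some i))) (start lo hi x z) +
        expo (-σ (some i)) (cf w.Λ γ (-σ (some i))) (start lo hi x z)) (2 * E) := fun i =>
      ((key0 _ _ (fun a => by linarith [hle (hcf (some i) a).1]) (hσq _)).add
        (key0 _ _ (fun a => by linarith [hle (hcf (some i) a).2]) (hneg _))).mono (by linarith)
    have h2 := MeanLe.sum (s := Finset.univ) h1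
    rw [Finset.card_univ, Fintype.card_fin] at h2
    exact h2
  have hsing : ∀ (a b : Idx J) (t : ℝ), t ≤ w.y → 0 ≤ w.y → (Pi.single a t : Idx J → ℝ) b ≤ w.y :=
    fun a b t ht h0 => by
      by_cases hab : b = a
      · subst hab; simpa using ht
      · simpa [hab] using h0
  have m3 : MeanLe (Measure.pi m) (fun z => V₃ N γ w.Λ w.lam w.y w.G r (start lo hi x z))
      ((I + 1) * (Fintype.card (Idx J) * ((1 + w.G) * E))) := by
    have h1 : ∀ (o : Option (Fin I)) (a : Idx J), MeanLe (Measure.pi m) (fun z =>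
        expo (σ o) (cf w.Λ γ (σ o) + Pi.single a w.y) (start lo hi x z) +
        w.G * expo (σ o) (cf w.Λ γ (σ o) - Pi.single a w.y) (start lo hi x z)) ((1 + w.G) * E) :=
      fun o a => ((key0 _ _ (fun b => by
        have := hsing a b w.y le_rfl hy.le
        have := hle (hcf o b).1
        simp only [Pi.add_apply]; linarith) (hσq _)).add
        ((key0 _ _ (fun b => by
          have := hsing a b (-w.y) (by linarith) hy.le
          have := hle (hcf o b).1
          rw [sub_eq_add_neg, ← Pi.single_neg]
          simp only [Pi.add_apply]; linarith) (hσq _)).const_mul hG)).mono (by linarith)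
    have h2 := MeanLe.sum (s := Finset.univ) fun o => MeanLe.sum (s := Finset.univ) (h1 o)
    rw [card_option_fin, Finset.card_univ] at h2
    exact h2
  have m2 : MeanLe (Measure.pi m) (fun z => V₂ N γ w.Λ w.lam w.y w.θ (w.b r) w.B₁ lo hi r
      (start lo hi x z)) ((I + 1) * (J * ((Real.exp w.c₂ + w.B₁) * E))) := by
    have hsub : ∀ o j t, ∑ i, (σ o - Pi.single j t : Fin J → ℝ) i * x.1 i ≤
        J * (w.lam / k.g₀ * M) + -(t * x.1 j) := fun o j t => by
      rw [sum_sub_single_mul]; linarith [hσq o]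
    have h1 : ∀ (o : Option (Fin I)) (j : Fin J), MeanLe (Measure.pi m) (fun z =>
        if (start lo hi x z).2.2 j = true then
          Real.exp (hi * (w.b r)⁻¹) * expoB N γ w.Λ w.lam w.y (w.b r) r o j (start lo hi x z)
        else w.B₁ * Real.exp (w.θ * lo) * expoU N γ w.Λ w.lam w.θ r o j (start lo hi x z))
        ((Real.exp w.c₂ + w.B₁) * E) := fun o j => by
      by_cases hEj : updE lo hi (x.2.2 j) (x.1 j) = true
      · have h2 : ∀ z, (start lo hi x z).2.2 j = true := fun _ => hEj
        simp only [h2, if_true]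
        have hbi : 0 ≤ (w.b r)⁻¹ := by positivity
        have h3 : hi * (w.b r)⁻¹ = w.c₂ := by rw [hhi]; field_simp
        rw [h3]
        refine ((key0 _ _ (fun a => ?_) ((hsub o j (w.b r)⁻¹).trans ?_)).const_mul
          (Real.exp_pos _).le).mono ?_
        · by_cases ha : a = Sum.inr j
          · subst ha; rw [Function.update_self]; linarith
          · rw [Function.update_of_ne ha]
            have := hcf' (w.b r)⁻¹ hbi hr.b_inv_θ o j a
            linarith
        · linarith [mul_nonneg hbi (hq j)]
        · rw [add_mul]; linarith [mul_nonneg hB₁ hE0]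
      · have h2 : ∀ z, ¬ (start lo hi x z).2.2 j = true := fun _ => hEj
        simp only [h2]
        have hqlo : lo ≤ x.1 j := updE_lo hlohi (by simpa using hEj)
        refine ((key _ _ (-(w.θ * lo)) (fun a => ?_) ((hsub o j w.θ).trans ?_)).const_mul
          (by positivity)).mono ?_
        · have := hcf' w.θ hθ.le le_rfl o j a
          linarith
        · have := mul_le_mul_of_nonneg_left hqlo hθ.le
          linarith
        · have h3 : w.B₁ * Real.exp (w.θ * lo) * (Real.exp (-(w.θ * lo)) * E) = w.B₁ * E := by
            rw [Real.exp_neg]; field_simp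
          rw [h3, add_mul]
          linarith [mul_nonneg (Real.exp_pos w.c₂).le hE0]
    have h2 := MeanLe.sum (s := Finset.univ) fun o => MeanLe.sum (s := Finset.univ) (h1 o)
    rw [card_option_fin, Finset.card_univ, Fintype.card_fin] at h2
    exact h2
  have m4 : MeanLe (Measure.pi m) (fun z => PP N γ w.Λ w.lam w.y r (start lo hi x z))
      ((I + 1) * (Fintype.card (Idx J) * E)) := by
    have h1 : ∀ (o : Option (Fin I)) (a : Idx J), MeanLe (Measure.pi m) (fun z =>
        eK N γ w.Λ w.lam r o (start lo hi x z) * Real.exp (w.y * (start lo hi x z).2.1 a)) E :=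
      fun o a => by
        simp only [eK, ← expo_add_single]
        exact key0 _ _ (fun b => by
          have := hsing a b w.y le_rfl hy.le
          have := hle (hcf o b).1
          simp only [Pi.add_apply]; linarith) (hσq _)
    have h2 := MeanLe.sum (s := Finset.univ) fun o => MeanLe.sum (s := Finset.univ) (h1 o)
    rw [card_option_fin, Finset.card_univ] at h2
    exact h2
  have hYsq : 0 ≤ YsqC k I J L Cb w.lam w.y := by unfold YsqC; positivity
  set U : (Idx J → ℝ) → ℝ := fun z => w.A * r ^ 2 * V₁ N γ w.Λ w.lam r (start lo hi x z) +
    w.A₃ * V₃ N γ w.Λ w.lam w.y w.G r (start lo hi x z) +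
    w.B * r * w.b r * V₂ N γ w.Λ w.lam w.y w.θ (w.b r) w.B₁ lo hi r (start lo hi x z) +
    r ^ 2 * YsqC k I J L Cb w.lam w.y * PP N γ w.Λ w.lam w.y r (start lo hi x z) with hU
  have mU := (((m1.const_mul (show 0 ≤ w.A * r ^ 2 by positivity)).add (m3.const_mul hA₃)).add
    (m2.const_mul (show 0 ≤ w.B * r * w.b r by positivity))).add
    (m4.const_mul (show 0 ≤ r ^ 2 * YsqC k I J L Cb w.lam w.y by positivity))
  set c : ℝ := r ^ 2 * (3 * (4 * k.Cp * I * (w.Cl * w.b r) + Fintype.card (Idx J)) ^ 2) with hc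
  have := hm.prob
  have mUc : MeanLe (Measure.pi m) (fun z => U z + c) (_ + c) :=
    mU.add ⟨integrable_const c, by simp⟩
  -- the squared gap is of order `r²` times the exponentials, up to the constant `c`
  have hWU : ∀ᵐ z ∂Measure.pi m, w.W N k.Cp r γ (start lo hi x z) ≤ U z + c := by
    filter_upwards [hz] with z hz
    have hv := (Valid.start hlohi hq hz).1
    have hYs := Y_sq_le hN hγ hg hlam hΛ hy hr.residual (Gχ := w.Cχ / w.b r) (by positivity)
      ((div_le_one hb0).2 hr.Cχ_le) (ℓ := w.Cl * w.b r) (by positivity) hv.R_nonneg hv.q_nonneg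
    rw [div_le_iff₀ (by positivity)] at hYs
    simp only [LyapC.W, LyapC.gapY, hU, hc]
    linarith
  have hW0 := fun z => w.W_nonneg hp N k.Cp r γ (start lo hi x z)
  have h1 : ∫⁻ z, ENNReal.ofReal (w.W N k.Cp r γ (start lo hi x z)) ∂Measure.pi m ≤
      ENNReal.ofReal (∫ z, (U z + c) ∂Measure.pi m) := by
    rw [ofReal_integral_eq_lintegral_ofReal mUc.1 (hWU.mono fun z hz => (hW0 z).trans hz)]
    exact lintegral_mono_ae (hWU.mono fun z hz => ENNReal.ofReal_le_ofReal hz)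
  refine h1.trans (ENNReal.ofReal_le_ofReal (mUc.2.trans ?_))
  have q5 : c ≤ (r * w.b r) ^ 2 * (3 * (4 * k.Cp * I * w.Cl + Fintype.card (Idx J)) ^ 2) := by
    rw [hc, mul_pow, mul_assoc ((r : ℝ) ^ 2), mul_left_comm (w.b r ^ 2), ← mul_pow]
    have h2 : (0 : ℝ) ≤ 4 * k.Cp * I * w.Cl := by positivity
    have h3 : 4 * k.Cp * I * (w.Cl * w.b r) + Fintype.card (Idx J) ≤
        w.b r * (4 * k.Cp * I * w.Cl + Fintype.card (Idx J)) := by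
      linarith [mul_nonneg (sub_nonneg.2 hb1) (Nat.cast_nonneg' (α := ℝ) (Fintype.card (Idx J)))]
    gcongr
  have key := sum_le_sq_mul_sum hr1 hb1 (X₁ := w.A * (I * (2 * E)))
    (X₃ := w.A₃ * ((I + 1) * (Fintype.card (Idx J) * ((1 + w.G) * E))))
    (X₂ := w.B * ((I + 1) * (J * ((Real.exp w.c₂ + w.B₁) * E))))
    (X₄ := YsqC k I J L Cb w.lam w.y * ((I + 1) * (Fintype.card (Idx J) * E)))
    (by positivity) (by positivity) (by positivity) (by positivity) q5
  rw [startC, ← hE, mul_comm _ ((r * w.b r) ^ 2)]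
  refine le_trans (le_of_eq ?_) key
  ring

end InitialBound

/-! ### The cost gap -/

section CostGap

variable {I J : ℕ}

/-- Constant in the bound of the cost gap by the rate of decrease of the Lyapunov function. -/
def gapC (w : LyapC) (N : Network I J) (k : Consts) (L : ℝ) : ℝ :=
  1 / k.cM + L * (k.g₁ * (Fintype.card (Idx J) / w.y)) +
    (L + ∑ j, N.h j) * (k.C₀ / k.g₀ * (J * (1 + 2 * (k.g₁ / w.lam) ^ 2)))

theorem one_le_PP [Nonempty (Idx J)] {N : Network I J} {γ : Idx J → ℝ} {Λ lam y : ℝ} {r : ℕ}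
    (hy : 0 ≤ y) {x : Config J} (hR : ∀ a, 0 ≤ x.2.1 a) : 1 ≤ PP N γ Λ lam y r x :=
  (Real.one_le_exp (mul_nonneg hy (hR (Classical.arbitrary _)))).trans (exp_le_PP x _)

/-- The diffusion-scaled cost gap is at most of the order of the rate of decrease of the Lyapunov
function, divided by `r`. -/
theorem LyapC.abs_gap_le [Nonempty (Idx J)] {N : Network I J} (hN : N.IsTopology)
    (hβ : ∀ j, 0 < N.β j) {k : Consts} {w : LyapC} {L Cb : ℝ} (hp : w.Pos)
    (hg : GapBound N k.Cp L Cb)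
    (hCp : ∀ v : Fin I → ℝ, (∀ i, 0 ≤ v i) → N.hhat v = N.hext k.Cp v) {r : ℕ}
    (hr : 4 * Fintype.card (Idx J) * cfC k w.Λ w.lam ≤ w.y * r) {γ : Idx J → ℝ} (hγ : Near N k r γ)
    {x : Config J} (hq : ∀ j, 0 ≤ x.1 j) (hR : ∀ a, 0 ≤ x.2.1 a) (hχ : 0 ≤ w.b r) :
    |(N.h ⬝ᵥ fun j => x.1 j / r) - N.hhat (N.K *ᵥ fun j => x.1 j / r / γ (Sum.inr j))| ≤
      gapC w N k L / r * w.f N k r γ x := by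
  have hr1 := hγ.r_pos
  have hr0 : (0 : ℝ) < r := by linarith
  have hg0 := k.g₀_pos
  have hg1 := k.g₁_pos
  have hcM := k.cM_pos
  have hC0 := k.C₀_pos
  have hy := hp.y_pos
  have hlam := hp.lam_pos
  have hL := hg.L_nonneg
  have hh : 0 ≤ ∑ j, N.h j := Finset.sum_nonneg fun j _ => (hN.h_pos j).le
  set Pv := PP N γ w.Λ w.lam w.y r x with hPv
  set Yp := max (w.gapY N k.Cp r γ x) 0 with hYp
  have hP1 : 1 ≤ Pv := one_le_PP hy.le hR
  have hY0 : 0 ≤ Yp := le_max_right _ _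
  set qs : Fin J → ℝ := fun j => x.1 j / r with hqs
  set q' : Fin J → ℝ := fun j => x.1 j / r / γ (Sum.inr j) * N.β j with hq'
  have hwl : (N.K *ᵥ fun j => x.1 j / r / γ (Sum.inr j)) = N.wl q' := by
    unfold Network.wl
    congr 1
    funext j
    rw [hq']; exact (mul_div_cancel_right₀ _ (hβ j).ne').symm
  have hq'0 : ∀ j, 0 ≤ q' j := fun j =>
    mul_nonneg (div_nonneg (div_nonneg (hq j) hr0.le) (hγ.γ_pos _).le) (hβ j).le
  have e1 : (N.h ⬝ᵥ qs) - N.hhat (N.K *ᵥ fun j => x.1 j / r / γ (Sum.inr j)) =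
      N.gap k.Cp q' + (N.h ⬝ᵥ qs - N.h ⬝ᵥ q') := by
    rw [hwl, hCp _ (Network.wl_nonneg hN hβ hq'0), Network.gap]; ring
  have hgap0 := Network.gap_nonneg hN k.Cp_nonneg hq'0
  -- replacing `β^r` by `β`
  set D := ∑ j, |q' j - qs j| with hD
  have hDh : |N.h ⬝ᵥ qs - N.h ⬝ᵥ q'| ≤ (∑ j, N.h j) * D := by
    rw [← dotProduct_sub, Finset.sum_mul]
    refine (Finset.abs_sum_le_sum_abs _ _).trans (Finset.sum_le_sum fun j _ => ?_)
    rw [abs_mul, abs_of_pos (hN.h_pos j), Pi.sub_apply, abs_sub_comm]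
    exact mul_le_mul_of_nonneg_left (Finset.single_le_sum (f := fun j => |q' j - qs j|)
      (fun _ _ => abs_nonneg _) (Finset.mem_univ j)) (hN.h_pos j).le
  have hDle : D ≤ k.C₀ / k.g₀ * (J * (1 + 2 * (k.g₁ / w.lam) ^ 2)) / r * Pv := by
    have : ∀ j, |q' j - qs j| ≤ k.C₀ / k.g₀ * (1 + 2 * (k.g₁ / w.lam) ^ 2) / r * Pv := fun j => by
      obtain ⟨-, -, h2, -⟩ := exists_queue_le hN hγ hlam hp.Λ_nonneg hy hr hR hq j
      have hγj := hγ.γ_pos (Sum.inr j)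
      have h3 : x.1 j / r ≤ (1 + 2 * (k.g₁ / w.lam) ^ 2) * Pv := by nlinarith [sq_nonneg (x.1 j / r - 1)]
      have h4 : q' j - qs j = x.1 j / r * ((N.β j - γ (Sum.inr j)) / γ (Sum.inr j)) := by
        simp only [hq', hqs]; field_simp
      have h5 : |(N.β j - γ (Sum.inr j)) / γ (Sum.inr j)| ≤ k.C₀ / r / k.g₀ := by
        rw [abs_div, abs_of_pos hγj, abs_sub_comm]
        exact div_le_div₀ (by positivity) (hγ.devβ j) hg0 (hγ.g₀_le _)
      rw [h4, abs_mul, abs_of_nonneg (div_nonneg (hq j) hr0.le)]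
      refine (mul_le_mul h3 h5 (abs_nonneg _) (by positivity)).trans_eq ?_
      field_simp
    refine (Finset.sum_le_sum fun j _ => this j).trans_eq ?_
    simp only [Finset.sum_const, Finset.card_univ, Fintype.card_fin, nsmul_eq_mul]
    ring
  have h1 := hg.lip q' qs
  -- the gap of the scaled queue lengths
  have h2 : N.gap k.Cp qs ≤ 1 / r * N.gap k.Cp x.1 := by
    have : qs = (1 / (r : ℝ)) • x.1 := by
      funext j; simp only [hqs, Pi.smul_apply, smul_eq_mul]; ring
    rw [this]; exact Network.gap_smul_le hN k.Cp_nonneg _ (by positivity)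
  have h3 := hg.lip x.1 (qt γ x)
  have h4 := sum_abs_qt_sub_le hγ hR
  have h5 : ∑ a, x.2.1 a ≤ Fintype.card (Idx J) / w.y * Pv := by
    have : ∀ a, x.2.1 a ≤ 1 / w.y * Pv := fun a => by
      have e2 := (Real.add_one_le_exp (w.y * x.2.1 a)).trans
        (exp_le_PP (N := N) (γ := γ) (Λ := w.Λ) (lam := w.lam) (r := r) x a)
      rw [← hPv] at e2
      rw [div_mul_eq_mul_div, one_mul, le_div_iff₀ hy]; linarith
    refine (Finset.sum_le_sum fun a _ => this a).trans_eq ?_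
    simp only [Finset.sum_const, Finset.card_univ, nsmul_eq_mul]; ring
  have h6 : N.gap k.Cp (qt γ x) ≤ Yp := by
    refine le_trans ?_ (le_max_left _ _)
    have e2 : 0 ≤ ∑ i, phi (w.Cl * w.b r) (N.wl (qt γ x) i) :=
      Finset.sum_nonneg fun i _ => phi_nonneg _ _
    have e3 : 0 ≤ ∑ a, Real.exp (-w.y * x.2.1 a) := Finset.sum_nonneg fun a _ => (Real.exp_pos _).le
    have e4 := mul_nonneg (mul_nonneg zero_le_four k.Cp_nonneg) e2
    have e5 := mul_nonneg (div_nonneg hp.Cχ_nonneg hχ) e3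
    unfold LyapC.gapY Y
    linarith
  have h7 : N.gap k.Cp x.1 ≤ Yp + L * (k.g₁ * (Fintype.card (Idx J) / w.y)) * Pv := by
    have e2 : ∑ j, |x.1 j - qt γ x j| ≤ k.g₁ * (Fintype.card (Idx J) / w.y * Pv) := by
      simp only [abs_sub_comm (x.1 _)]
      exact h4.trans (mul_le_mul_of_nonneg_left h5 hg1.le)
    have e3 := mul_le_mul_of_nonneg_left e2 hL
    linarith
  have h8 : N.gap k.Cp qs ≤ (1 / k.cM + L * (k.g₁ * (Fintype.card (Idx J) / w.y))) / r *
      (k.cM * Yp + Pv) := by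
    refine h2.trans ((mul_le_mul_of_nonneg_left h7 (by positivity)).trans ?_)
    rw [div_mul_eq_mul_div, div_mul_eq_mul_div, one_mul]
    refine div_le_div_of_nonneg_right ?_ hr0.le
    have e2 : 1 / k.cM * (k.cM * Yp + Pv) = Yp + 1 / k.cM * Pv := by field_simp
    have e3 : 0 ≤ 1 / k.cM * Pv := by positivity
    have e4 : 0 ≤ L * (k.g₁ * (Fintype.card (Idx J) / w.y)) * (k.cM * Yp) := by positivity
    rw [add_mul, e2]; linarith
  set Cd := k.C₀ / k.g₀ * (J * (1 + 2 * (k.g₁ / w.lam) ^ 2)) with hCd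
  have h9 : (L + ∑ j, N.h j) * D ≤ (L + ∑ j, N.h j) * Cd / r * (k.cM * Yp + Pv) := by
    refine (mul_le_mul_of_nonneg_left hDle (by positivity)).trans ?_
    rw [← mul_assoc, ← mul_div_assoc]
    exact mul_le_mul_of_nonneg_left (by linarith [mul_nonneg hcM.le hY0]) (by positivity)
  rw [e1]
  refine (abs_add_le _ _).trans ?_
  rw [abs_of_nonneg hgap0]
  have hfe : w.f N k r γ x = k.cM * Yp + Pv := rfl
  have hsplit : gapC w N k L / r * w.f N k r γ x =
      (1 / k.cM + L * (k.g₁ * (Fintype.card (Idx J) / w.y))) / r * (k.cM * Yp + Pv) +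
      (L + ∑ j, N.h j) * Cd / r * (k.cM * Yp + Pv) := by
    rw [hfe, gapC, ← hCd]; ring
  rw [hsplit]
  linarith

end CostGap
end RSN
end

noncomputable section

namespace RSN

/-! ### Discounted and averaged cost gaps -/

section Calculus

theorem wgt_le_one {c d t₀ : ℝ} (hc : 0 ≤ c) (hd : 0 ≤ d) (s : ℝ) : wgt c d t₀ s ≤ 1 := by
  refine Real.exp_le_one_iff.2 ?_
  have h1 := mul_nonpos_of_nonneg_of_nonpos hc (min_le_right (s - t₀) 0)
  have h2 := mul_nonneg hd (le_max_right (s - t₀) 0)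
  linarith

theorem lintegral_wgt_le {c d : ℝ} (hc : 0 < c) (hd : 0 < d) (t₀ : ℝ) (A : Set ℝ) :
    ∫⁻ s in A, ENNReal.ofReal (wgt c d t₀ s) ≤ ENNReal.ofReal (1 / c + 1 / d) := by
  have e1 : ∀ s ∈ Set.Iic t₀, wgt c d t₀ s = Real.exp (-(c * t₀)) * Real.exp (c * s) :=
    fun s hs => by
      have hs : s ≤ t₀ := hs
      rw [wgt, min_eq_left (by linarith), max_eq_right (by linarith), ← Real.exp_add]
      ring_nf
  have e2 : ∀ s ∈ Set.Ioi t₀, wgt c d t₀ s = Real.exp (d * t₀) * Real.exp (-d * s) :=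
    fun s hs => by
      have hs : t₀ < s := hs
      rw [wgt, min_eq_right (by linarith), max_eq_left (by linarith), ← Real.exp_add]
      ring_nf
  have h1 : ∫⁻ s in Set.Iic t₀, ENNReal.ofReal (wgt c d t₀ s) = ENNReal.ofReal (1 / c) := by
    rw [setLIntegral_congr_fun measurableSet_Iic fun s hs => by rw [e1 s hs],
      ← ofReal_integral_eq_lintegral_ofReal ((integrableOn_exp_mul_Iic hc t₀).const_mul _)
        (ae_of_all _ fun s => by positivity), integral_const_mul, integral_exp_mul_Iic hc,
      ← mul_div_assoc, ← Real.exp_add]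
    simp
  have h2 : ∫⁻ s in Set.Ioi t₀, ENNReal.ofReal (wgt c d t₀ s) = ENNReal.ofReal (1 / d) := by
    rw [setLIntegral_congr_fun measurableSet_Ioi fun s hs => by rw [e2 s hs],
      ← ofReal_integral_eq_lintegral_ofReal
        ((integrableOn_exp_mul_Ioi (neg_lt_zero.2 hd) t₀).const_mul _)
        (ae_of_all _ fun s => by positivity), integral_const_mul,
      integral_exp_mul_Ioi (neg_lt_zero.2 hd), neg_div_neg_eq, ← mul_div_assoc, ← Real.exp_add]
    simp
  rw [ENNReal.ofReal_add (by positivity) (by positivity), ← h1, ← h2]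
  refine le_trans ?_ (lintegral_union_le _ _ _)
  rw [Set.Iic_union_Ioi]
  exact lintegral_mono_set (Set.subset_univ _)

/-- Affine change of the time scale; no measurability of `F` is needed. -/
theorem setLIntegral_comp_affine_le {a t : ℝ} (ha : 0 < a) {A : Set ℝ} (hA : MeasurableSet A)
    (h : ∀ s ∈ A, 0 ≤ a * (t + s)) (F : ℝ → ℝ≥0∞) :
    ∫⁻ s in A, F (a * (t + s)) ≤ ENNReal.ofReal a⁻¹ * ∫⁻ s in Set.Ici 0, F s := by
  have he : MeasurableEmbedding fun s : ℝ => a * (t + s) :=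
    ((Homeomorph.addLeft t).trans (Homeomorph.mulLeft₀ a ha.ne')).measurableEmbedding
  have hmap : Measure.map (fun s : ℝ => a * (t + s)) volume = ENNReal.ofReal a⁻¹ • volume := by
    have h1 := Real.map_volume_mul_left ha.ne'
    rw [abs_of_pos (inv_pos.2 ha)] at h1
    have h2 := Measure.map_map (μ := (volume : Measure ℝ)) (g := fun s => a * s)
      (f := fun s => t + s) (by fun_prop) (by fun_prop)
    rw [map_add_left_eq_self] at h2
    exact h2.symm.trans h1
  calc ∫⁻ s in A, F (a * (t + s)) ≤
      ∫⁻ s in A, (Set.Ici (0 : ℝ)).indicator F (a * (t + s)) :=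
        setLIntegral_mono' hA fun s hs => by
          rw [Set.indicator_of_mem (show a * (t + s) ∈ Set.Ici (0 : ℝ) from h s hs)]
    _ ≤ ∫⁻ s, (Set.Ici (0 : ℝ)).indicator F (a * (t + s)) := setLIntegral_le_lintegral _ _
    _ = _ := by
        rw [← he.lintegral_map (μ := volume), hmap, lintegral_smul_measure,
          lintegral_indicator measurableSet_Ici, smul_eq_mul]

end Calculus

section Cost

variable {I J : ℕ} {Ω : Type*} [MeasurableSpace Ω] {P : Measure Ω} [IsProbabilityMeasure P]
  {N : Network I J} {p : Policy J} {X : Primitives J Ω}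

/-- The unscaled initial configuration of a state. -/
def initConfig (r : ℕ) (y : State J) : Config J :=
  (fun j => r * y.qhat j, Sum.elim (fun j => r * y.ΥA j) fun j => r * y.ΥS j, y.E)

theorem seg_const_mul {r : ℕ} {φ : ℝ × Config J → ℝ≥0∞} {c : ℝ≥0∞} (hc : c ≠ ⊤) (S : Stage J) :
    seg p N r (fun y => c * φ y) S = c * seg p N r φ S :=
  lintegral_const_mul' c _ hc

/-- The weighted integral of the cost gap along the controlled path, in unscaled time. -/
theorem LyapC.lintegral_gap_le [Nonempty (Idx J)] (hN : N.IsTopology) (hβ : ∀ j, 0 < N.β j)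
    {k : Consts} {w : LyapC} {L Cb s₀ s₁ K η : ℝ} (hw : w.Good k I J L Cb s₀ s₁ K η)
    (hg : GapBound N k.Cp L Cb)
    (hCp : ∀ v : Fin I → ℝ, (∀ i, 0 ≤ v i) → N.hhat v = N.hext k.Cp v) {r : ℕ}
    (hr : w.Large N k L Cb s₀ s₁ r) (hγ : Near N k r (rates X P r)) (hX : X.IsPrimitives P)
    (hm : JumpLaw (rates X P r) w.Λ s₀ s₁ w.y K η fun a => P.map (noise X r a 0))
    (hlo : p.lo N r = w.c₁ * w.b r) (hhi : p.hi N r = w.c₂ * w.b r) (hlo1 : 1 ≤ p.lo N r)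
    (hpos : ∀ q j, 0 < p.x N r q j) {sx : ℝ} (hle : ∀ q j, p.x N r q j ≤ sx)
    (hrates : ∀ q, (∀ j, 0 ≤ q j) → Rates N k (p.hi N r) q (p.x N r q))
    {M : ℝ} (hM : 0 ≤ M) {y : State J} (hy : y ∈ stateSpace J r) (hyq : ∀ j, y.qhat j ≤ M)
    (hyA : ∀ j, r * y.ΥA j ≤ M) (hyS : ∀ j, r * y.ΥS j ≤ M) {B : ℝ → Ω → Fin J → ℝ}
    (hB : p.IsControl N X P r y B) {d t₀ : ℝ} (hd : 0 < d) :
    ∫⁻ ω, (∫⁻ s in Set.Ici 0, ENNReal.ofReal (wgt (w.lam ^ 2 / r ^ 2) d t₀ s) *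
        ENNReal.ofReal |(N.h ⬝ᵥ fun j => Q X r y B ω s j / r) -
          N.hhat (N.K *ᵥ fun j => Q X r y B ω s j / r / X.βr P r j)|) ∂P ≤
      ENNReal.ofReal (|gapC w N k L| / r) *
        (ENNReal.ofReal (|startC w k I J L Cb K M| * (r * w.b r) ^ 2) +
          ENNReal.ofReal (|w.driftC k I J L Cb| * w.b r ^ 2) *
            ENNReal.ofReal (r ^ 2 / w.lam ^ 2 + 1 / d)) := by
  have hp := hw.toPos
  have hr1 := hγ.r_pos
  have hr0 : (0 : ℝ) < r := by linarith
  have hb1 := hr.one_le_b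
  have hb0 : 0 < w.b r := by linarith
  have hlam := hp.lam_pos
  have hc0 : 0 < w.lam ^ 2 / (r : ℝ) ^ 2 := by positivity
  set c := w.lam ^ 2 / (r : ℝ) ^ 2 with hc
  set γ := rates X P r with hγdef
  set x := initConfig r y with hx
  have hlohi : p.lo N r ≤ p.hi N r := by
    rw [hlo, hhi]; exact mul_le_mul_of_nonneg_right hp.c₁_lt_c₂.le hb0.le
  have hq0 : ∀ j, 0 ≤ x.1 j := fun j => by
    obtain ⟨n, hn⟩ := hy.1 j
    simp only [hx, initConfig, hn]; positivity
  have hR0 : ∀ a, 0 ≤ x.2.1 a := by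
    rintro (j | j)
    exacts [mul_nonneg hr0.le (hy.2.1 j), mul_nonneg hr0.le (hy.2.2 j)]
  have hRM : ∀ a, x.2.1 a ≤ M := by
    rintro (j | j)
    exacts [hyA j, hyS j]
  have hqM : ∀ j, x.1 j ≤ r * M := fun j => mul_le_mul_of_nonneg_left (hyq j) hr0.le
  have hmeas := measurable_noise hX hγ.one_le
  have hind := iIndepFun_noise hX hγ.one_le
  have hlaw : ∀ a l, P.map (noise X r a l) = P.map (noise X r a 0) := fun a l =>
    (noise_identDistrib hX hγ.one_le a l).map_eq
  have hξ0 := noise_pos hX hγ.one_le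
  set m : Idx J → Measure ℝ := fun a => P.map (noise X r a 0) with hmdef
  set φ : ℝ × Config J → ℝ≥0∞ := fun z => ENNReal.ofReal (wgt c d t₀ z.1 * w.f N k r γ z.2) with hφ
  -- the cost gap is dominated by the rate of decrease of the Lyapunov function
  have hpath : ∀ᵐ ω ∂P, ∫⁻ s in Set.Ici 0, ENNReal.ofReal (wgt c d t₀ s) *
        ENNReal.ofReal |(N.h ⬝ᵥ fun j => Q X r y B ω s j / r) -
          N.hhat (N.K *ᵥ fun j => Q X r y B ω s j / r / X.βr P r j)| ≤
      ENNReal.ofReal (|gapC w N k L| / r) *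
        ∑' n, seg p N r φ (chain p N r (p.lo N r) (p.hi N r) x (fun a l => noise X r a l ω) n) := by
    filter_upwards [hξ0, tendsto_sum_noise hX hγ.one_le, hB.integrable, hB.eq_integral] with
      ω h1 h2 h3 h4
    have h : IsPath p N r (max sx 1) x (fun a l => noise X r a l ω) (fun t => B t ω) :=
      ⟨hpos, fun q j => (hle q j).trans (le_max_left _ _), le_max_right _ _, hlo1, hlohi, hq0, hR0,
        h1, h3, h4⟩
    have h5 := h.lintegral_le h2
      (φ := fun z => ENNReal.ofReal (|gapC w N k L| / r) * φ z)
      (ψ := fun s q => ENNReal.ofReal (wgt c d t₀ s) *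
        ENNReal.ofReal |(N.h ⬝ᵥ fun j => q j / r) - N.hhat (N.K *ᵥ fun j => q j / r / X.βr P r j)|)
      fun s z hz => by
        simp only [hφ]
        rw [← ENNReal.ofReal_mul (wgt_pos c d t₀ s).le, ← ENNReal.ofReal_mul (by positivity)]
        refine ENNReal.ofReal_le_ofReal ?_
        rw [mul_left_comm]
        refine mul_le_mul_of_nonneg_left ?_ (wgt_pos c d t₀ s).le
        refine (LyapC.abs_gap_le hN hβ hp hg hCp hr.residual hγ hz.q_nonneg hz.R_nonneg
          hb0.le).trans ?_
        exact mul_le_mul_of_nonneg_right (div_le_div_of_nonneg_right (le_abs_self _) hr0.le)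
          (w.f_nonneg N k r γ z)
    refine h5.trans_eq ?_
    simp only [seg_const_mul ENNReal.ofReal_ne_top]
    exact ENNReal.tsum_mul_left
  refine (lintegral_mono_ae hpath).trans ?_
  rw [lintegral_const_mul' _ _ ENNReal.ofReal_ne_top]
  refine mul_le_mul_right ?_ _
  refine (lintegral_tsum_seg_le (p := p) (N := N) (r := r) (m := m) (w.continuous_W hg r γ)
    (w.continuous_f hg r γ) hc0.le hd.le (g := |w.driftC k I J L Cb| * w.b r ^ 2) (by positivity)
    (w.W_nonneg hp N k.Cp r γ) (w.f_nonneg N k r γ) (fun z hz => ?_) (fun z hz => ?_) hpos hlo1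
    hlohi hmeas hind hlaw hξ0 hq0).trans (add_le_add ?_ ?_)
  · rw [hlo, hhi] at hz
    have h1 := hrates z.1 hz.q_nonneg
    rw [hhi] at h1
    refine (LyapC.upperDeriv_W hN hw hg hr hγ p hz h1).mono ?_
    have := mul_le_mul_of_nonneg_right (le_abs_self (w.driftC k I J L Cb)) (sq_nonneg (w.b r))
    linarith
  · rw [hlo, hhi] at hz ⊢
    obtain ⟨h1, h2⟩ := LyapC.W_jump hN hw hg hr hγ hm hz
    rw [← ofReal_integral_eq_lintegral_ofReal h1 (ae_of_all _ fun _ => w.W_nonneg hp N k.Cp r γ _)]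
    exact ENNReal.ofReal_le_ofReal h2
  · have hz : ∀ᵐ z ∂Measure.pi m, ∀ a, 0 < z a :=
      ae_all_iff.2 fun a => Measure.tendsto_eval_ae_ae.eventually (hm.pos a)
    have h1 := LyapC.lintegral_start_le hN hw hg hr hγ hm hz hM hq0 hqM hR0 hRM
    have hS : Measurable fun z : Idx J → ℝ =>
        w.W N k.Cp r γ (start (w.c₁ * w.b r) (w.c₂ * w.b r) x z) :=
      (w.continuous_W hg r γ).measurable.comp (measurable_start _ _ _)
    have hfr := map_fresh hmeas hind hlaw fun _ => 0
    rw [← hfr, lintegral_map hS.ennreal_ofReal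
      (measurable_pi_iff.2 fun a => hmeas a 0)] at h1
    rw [hlo, hhi]
    refine (lintegral_mono fun ω => ENNReal.ofReal_le_ofReal ?_).trans (h1.trans
      (ENNReal.ofReal_le_ofReal (mul_le_mul_of_nonneg_right (le_abs_self _) (sq_nonneg _))))
    exact mul_le_of_le_one_left (w.W_nonneg hp N k.Cp r γ _) (wgt_le_one hc0.le hd.le 0)
  · refine mul_le_mul_right ((lintegral_wgt_le hc0 hd t₀ _).trans_eq ?_) _
    rw [hc, one_div_div]

/-- The expected discounted cost gap tends to `0` uniformly over the time shift, the initial states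
and the controls; the dependence on the discount rate `d` is explicit. -/
theorem exists_discounted_gap_le [Nonempty (Fin J)] (hN : N.IsTopology) (hX : X.IsPrimitives P)
    (hH : X.HeavyTraffic P N) (hp : p.IsPolicy N) {M : ℝ} (hM : 0 ≤ M) :
    ∃ D : ℕ → ℝ, Tendsto D atTop (𝓝 0) ∧ ∀ᶠ r in atTop, 0 ≤ D r ∧ ∀ d > 0, ∀ t ≥ 0,
      ∀ y ∈ stateSpace J r, (∀ j, y.qhat j ≤ M) → (∀ j, r * y.ΥA j ≤ M) →
      (∀ j, r * y.ΥS j ≤ M) → ∀ B : ℝ → Ω → Fin J → ℝ, p.IsControl N X P r y B →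
      ∫⁻ ω, (∫⁻ s in Set.Ici (0 : ℝ), ENNReal.ofReal (Real.exp (-d * s)) *
        ENNReal.ofReal (costGap N X P r y B ω (t + s))) ∂P ≤
        ENNReal.ofReal (D r * (1 + 1 / d)) := by
  have hβ := hH.β_pos
  have hρ : ∀ j, 0 < N.ρ j := fun j => div_pos (hH.α_pos j) (hβ j)
  have : Nonempty (Idx J) := ⟨Sum.inl (Classical.arbitrary _)⟩
  obtain ⟨Cp, hCp0, hCp⟩ := Network.exists_hhat_eq_hext hN hβ
  obtain ⟨L, Cb, hg⟩ := exists_gapBound hN hβ hCp0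
  obtain ⟨smin, smax, vmin, cM, Cg, h1, h2, h3, h4, h5, h6, hle, hrates⟩ :=
    exists_rates hN hβ hρ hp hCp
  obtain ⟨g₀, g₁, c₀, C₀, h7, h8, h9, h10, hnear⟩ := exists_near hH
  set k : Consts := ⟨g₀, g₁, c₀, C₀, smin, smax, vmin, cM, Cp, Cg, h7, h8, h9, h10, h1, h2, h3, h4,
    h5, hCp0, h6⟩ with hk
  obtain ⟨Λ, s₀, s₁, y, K, η, h11, h12, h13, h14, h15, h16, h17, hjl⟩ := exists_jumpLaw hX h8
  have hβmin : 0 < N.βmin := iInf_pos_of_pos hβ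
  obtain ⟨w, hw, rfl, rfl, hw1, hw2, hw3⟩ := exists_lyapC (J := J) k I hg.L_nonneg hg.Cb_nonneg h11 h12 h13
    h14 h15 h16 h17 (mul_pos hβmin hp.c₁_pos) (mul_lt_mul_of_pos_left hp.c₁_lt_c₂ hβmin) hp.κ_pos
    hp.κ_lt
  have hwp := hw.toPos
  have hlo : ∀ r, p.lo N r = w.c₁ * w.b r := fun r => by rw [hw1, LyapC.b, hw3]; rfl
  have hhi : ∀ r, p.hi N r = w.c₂ * w.b r := fun r => by rw [hw2, LyapC.b, hw3]; rfl
  have hc₁ : 0 < w.c₁ := by rw [hw1]; exact mul_pos hβmin hp.c₁_pos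
  have hpos : ∀ r q j, 0 < p.x N r q j := fun r q j =>
    lt_of_lt_of_le (by have : 0 < N.ρmin := iInf_pos_of_pos hρ; positivity) (hp.x_ge hρ r q j)
  set G := |gapC w N k L| with hG
  set S := |startC w k I J L Cb K M| with hS
  set F := |w.driftC k I J L Cb| with hF
  refine ⟨fun r => G * (S + F / w.lam ^ 2 + F) * (w.b r ^ 2 / r), ?_, ?_⟩
  · simpa using (LyapC.tendsto_b_pow_div hwp le_rfl).const_mul (G * (S + F / w.lam ^ 2 + F))
  filter_upwards [hnear k rfl rfl rfl rfl, w.eventually_large N k hw,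
    ((LyapC.tendsto_b hwp).const_mul_atTop hc₁).eventually_ge_atTop 1] with r hγ hr hlo1
  have hr1 := hγ.r_pos
  refine ⟨by positivity, fun d hd t ht y hy hyq hyA hyS B hB => ?_⟩
  have core := LyapC.lintegral_gap_le hN hβ hw hg hCp hr hγ hX
    (hjl r hγ.one_le fun a => ⟨hγ.γ_pos a, hγ.le_g₁ a⟩) (hlo r) (hhi r) (by rw [hlo]; exact hlo1)
    (hpos r) (hle r) (hrates k rfl rfl rfl rfl rfl rfl r) hM hy hyq hyA hyS hB
    (d := d / r ^ 2) (t₀ := r ^ 2 * t) (by positivity)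
  have hr2 : (0 : ℝ) < r ^ 2 := by positivity
  have hstep : ∀ ω, ∫⁻ s in Set.Ici (0 : ℝ), ENNReal.ofReal (Real.exp (-d * s)) *
      ENNReal.ofReal (costGap N X P r y B ω (t + s)) ≤
      ENNReal.ofReal ((r : ℝ) ^ 2)⁻¹ * ∫⁻ s in Set.Ici 0,
        ENNReal.ofReal (wgt (w.lam ^ 2 / r ^ 2) (d / r ^ 2) (r ^ 2 * t) s) *
        ENNReal.ofReal |(N.h ⬝ᵥ fun j => Q X r y B ω s j / r) -
          N.hhat (N.K *ᵥ fun j => Q X r y B ω s j / r / X.βr P r j)| := fun ω => by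
    refine le_trans (le_of_eq ?_) (setLIntegral_comp_affine_le hr2 (t := t) measurableSet_Ici
      (fun s hs => mul_nonneg hr2.le (add_nonneg ht hs)) _)
    refine setLIntegral_congr_fun measurableSet_Ici fun s hs => ?_
    have hs : 0 ≤ s := hs
    have h18 : wgt (w.lam ^ 2 / r ^ 2) (d / r ^ 2) (r ^ 2 * t) (r ^ 2 * (t + s)) =
        Real.exp (-d * s) := by
      have h19 : (r : ℝ) ^ 2 * (t + s) - r ^ 2 * t = r ^ 2 * s := by ring
      rw [wgt, h19, min_eq_right (by positivity), max_eq_left (by positivity)]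
      congr 1
      field_simp
      ring
    simp only [h18]
    rfl
  refine (lintegral_mono hstep).trans ?_
  rw [lintegral_const_mul' _ _ ENNReal.ofReal_ne_top]
  refine (mul_le_mul_right core _).trans ?_
  rw [← ENNReal.ofReal_mul (by positivity), ← ENNReal.ofReal_add (by positivity) (by positivity),
    ← ENNReal.ofReal_mul (by positivity), ← ENNReal.ofReal_mul (by positivity)]
  refine ENNReal.ofReal_le_ofReal ?_
  have e : ((r : ℝ) ^ 2)⁻¹ * (G / r * (S * (r * w.b r) ^ 2 + F * w.b r ^ 2 *
      (r ^ 2 / w.lam ^ 2 + 1 / (d / r ^ 2)))) =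
      (G * (w.b r ^ 2 / r)) * (S + F / w.lam ^ 2 + F * (1 / d)) := by
    field_simp
    ring
  rw [e, show G * (S + F / w.lam ^ 2 + F) * (w.b r ^ 2 / r) * (1 + 1 / d) =
    (G * (w.b r ^ 2 / r)) * ((S + F / w.lam ^ 2 + F) * (1 + 1 / d)) by ring]
  refine mul_le_mul_of_nonneg_left ?_ (by positivity)
  have : 0 ≤ F + (S + F / w.lam ^ 2) * (1 / d) := by positivity
  linarith

/-- An average over `[0, T]` is at most `e / T` times the integral discounted at rate `1 / T`. -/
theorem average_le_discounted {g : ℝ → ℝ} {T : ℝ} (hT : 0 < T) :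
    ENNReal.ofReal (1 / T) * ∫⁻ s in Set.Icc (0 : ℝ) T, ENNReal.ofReal (g s) ≤
      ENNReal.ofReal (1 / T * Real.exp 1) * ∫⁻ s in Set.Ici (0 : ℝ),
        ENNReal.ofReal (Real.exp (-(1 / T) * s)) * ENNReal.ofReal (g s) := by
  rw [ENNReal.ofReal_mul (by positivity), mul_assoc]
  refine mul_le_mul_right ?_ _
  rw [← lintegral_const_mul' _ _ ENNReal.ofReal_ne_top]
  refine (setLIntegral_mono' measurableSet_Icc fun s hs => ?_).trans
    (lintegral_mono_set Set.Icc_subset_Ici_self)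
  rw [← mul_assoc, ← ENNReal.ofReal_mul (by positivity), ← Real.exp_add]
  refine le_mul_of_one_le_left' ?_
  rw [← ENNReal.ofReal_one]
  refine ENNReal.ofReal_le_ofReal (Real.one_le_exp (?_ : (0 : ℝ) ≤ 1 + -(1 / T) * s))
  have : 1 / T * s ≤ 1 := by rw [one_div_mul_eq_div]; exact (div_le_one hT).2 hs.2
  linarith

theorem Network.hhat_of_isEmpty [IsEmpty (Fin J)] (N : Network I J) (v : Fin I → ℝ) :
    N.hhat v = 0 := by
  have : (fun q => N.h ⬝ᵥ q) '' N.Lam v ⊆ {0} := by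
    rintro _ ⟨q, -, rfl⟩
    simp [dotProduct]
  rw [Network.hhat]
  rcases Set.subset_singleton_iff_eq.1 this with h | h
  · rw [h, Real.sInf_empty]
  · rw [h, csInf_singleton]

end Cost
end RSN
end

theorem proposition3p5 {I J : ℕ} {Ω : Type*} [MeasurableSpace Ω]
    (P : Measure Ω) [IsProbabilityMeasure P]
    (N : RSN.Network I J) (hN : N.IsTopology)
    (X : RSN.Primitives J Ω) (hX : X.IsPrimitives P) (hHT : X.HeavyTraffic P N)
    (p : RSN.Policy J) (hp : p.IsPolicy N)
    (ς : ℝ) (hς : 0 < ς) (ε : ℝ) (hε : ε ∈ Set.Ioo (0 : ℝ) 1) (M : ℝ) :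
    ∃ Tstar R : ℝ, 0 < Tstar ∧ 0 < R ∧
      ∀ r : ℕ, R ≤ (r : ℝ) → ∀ T : ℝ, Tstar ≤ T → ∀ t : ℝ, 0 ≤ t →
      ∀ y ∈ RSN.stateSpace J r, (∀ j, y.qhat j ≤ M) →
        (∀ j, (r : ℝ) * y.ΥA j ≤ M) → (∀ j, (r : ℝ) * y.ΥS j ≤ M) →
      ∀ B : ℝ → Ω → Fin J → ℝ, p.IsControl N X P r y B →
        (∫⁻ ω, ENNReal.ofReal (1 / T) * (∫⁻ s in Set.Icc (0 : ℝ) T,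
            ENNReal.ofReal (RSN.costGap N X P r y B ω (t + s))) ∂P ≤ ENNReal.ofReal ε) ∧
        (∫⁻ ω, (∫⁻ s in Set.Ici (0 : ℝ),
            ENNReal.ofReal (Real.exp (-ς * s) * RSN.costGap N X P r y B ω (t + s))) ∂P
          ≤ ENNReal.ofReal ε) := by
  obtain ⟨hε0, -⟩ := hε
  rcases isEmpty_or_nonempty (Fin J) with hJ | hJ
  · refine ⟨1, 1, one_pos, one_pos, fun r _ T _ t _ y _ _ _ _ B _ => ?_⟩
    have h0 : ∀ ω s, RSN.costGap N X P r y B ω s = 0 := fun ω s => by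
      simp [RSN.costGap, RSN.Network.hhat_of_isEmpty, dotProduct]
    simp [h0]
  obtain ⟨D, hD, hev⟩ := RSN.exists_discounted_gap_le (P := P) hN hX hHT hp (le_max_right M 0)
  have hsmall : ∀ c : ℝ, ∀ᶠ r in atTop, D r * c < ε := fun c =>
    (hD.mul_const c).eventually_lt_const (by simpa using hε0)
  obtain ⟨R, hR⟩ := eventually_atTop.1 (hev.and ((hsmall (Real.exp 1 * 2)).and
    (hsmall (1 + 1 / ς))))
  refine ⟨1, R + 1, one_pos, by positivity, fun r hr T hT t ht y hy hyq hyA hyS B hB => ?_⟩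
  have hrR : R ≤ r := by
    have : (R : ℝ) ≤ r := by linarith
    exact_mod_cast this
  obtain ⟨⟨hD0, hgap⟩, h1, h2⟩ := hR r hrR
  have key := fun d (hd : 0 < d) => hgap d hd t ht y hy (fun j => (hyq j).trans (le_max_left _ _))
    (fun j => (hyA j).trans (le_max_left _ _)) (fun j => (hyS j).trans (le_max_left _ _)) B hB
  have hT0 : 0 < T := by linarith
  constructor
  · refine (lintegral_mono fun ω => RSN.average_le_discounted hT0).trans ?_
    rw [lintegral_const_mul' _ _ ENNReal.ofReal_ne_top]
    refine (mul_le_mul_right (key (1 / T) (by positivity)) _).trans ?_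
    rw [← ENNReal.ofReal_mul (by positivity)]
    refine ENNReal.ofReal_le_ofReal (le_trans ?_ h1.le)
    rw [one_div_one_div, show 1 / T * Real.exp 1 * (D r * (1 + T)) =
      D r * (Real.exp 1 * ((1 + T) / T)) by ring]
    have h3 : (1 + T) / T ≤ 2 := by rw [div_le_iff₀ hT0]; linarith
    gcongr
  · refine le_trans (le_of_eq ?_) ((key ς hς).trans (ENNReal.ofReal_le_ofReal h2.le))
    simp only [ENNReal.ofReal_mul (Real.exp_pos _).le]
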